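/- Let $0<q<1$, $0\le s\le 1$, and let $N\in\frac12\mathbb Z$, $N\neq 0$. Write $[x]=(q^x-q^{-x})/(q-q^{-1})$. **Algebras.** $\mathcal A(S^2_{qs})$ is the $*$-algebra generated by $A=A^*,B,B^*$ with relations $AB=q^2BA$, $BB^*+(A+s^2)(A-1)=0$, $B^*B+(q^2A+s^2)(q^2A-1)=0$. $U_q(su(2))$ is the Hopf $*$-algebra generated by $K=K^*,K^{-1},E,F=E^*$ with $KEK^{-1}=qE$, $[E,F]=\frac{K^2-K^{-2}}{q-q^{-1}}$ (and adjoint relations), $\Delta K=K\otimes K$, $\Delta E=E\otimes K+K^{-1}\otimes E$, $\epsilon(K)=1$, $\epsilon(E)=0$, $S(K)=K^{-1}$, $S(E)=-qE$ (whence $\Delta F=F\otimes K+K^{-1}\otimes F$, $\epsilon(F)=0$, $S(F)=-q^{-1}F$). It acts on $\mathcal A(S^2_{qs})$ from the left, with $h\triangleright(ab)=(h_{(1)}\triangleright a)(h_{(2)}\triangleright b)$, by $K\triangleright A=A$, $K\triangleright B=qB$, $K\triangleright B^*=q^{-1}B^*$; $E\triangleright A=-q^{-1/2}B$, $E\triangleright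 B=0$, $E\triangleright B^*=q^{1/2}(1+q^2)A-q^{1/2}(1-s^2)$; $F\triangleright A=q^{-3/2}B^*$, $F\triangleright B=-q^{-1/2}(1+q^2)A+q^{-1/2}(1-s^2)$, $F\triangleright B^*=0$. **Hilbert space and operators.** $\mathcal H=\mathcal H_{-N}\oplus\mathcal H_N$ has orthonormal basis $|l,m;\pm N\rangle$ with $l-|N|,\,l-|m|\in\mathbb N=\{0,1,\dots\}$, and $\mathcal M$ is the linear span of the basis. Set $\gamma=1\oplus-1$, and let $D$ be the self-adjoint operator with $$D|l,m;\pm N\rangle=(l-|N|+1)\,|l,m;\mp N\rangle ,\qquad |D|\,|l,m;\pm N\rangle=(l-|N|+1)\,|l,m;\pm N\rangle ,$$ $$J|l,m;\pm N\rangle=(-1)^{m+N}|l,-m;\mp N\rangle ,\qquad T|l,m;\pm N\rangle=(-q)^{m+N}|l,-m;\mp N\rangle ,$$ with $J$ (on $\mathcal H$) and $T$ (on $\mathcal M$) antilinear. $U_q(su(2))$ acts on $\mathcal M$ by $K|l,m;\pm N\rangle=q^m|l,m;\pm N\rangle$, $E|l,m;\pm N\rangle=\sqrt{[l-m][l+m+1]}\,|l,m+1;\pm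 N\rangle$, $F|l,m;\pm N\rangle=\sqrt{[l+m][l-m+1]}\,|l,m-1;\pm N\rangle$. There is a unique $*$-representation of $\mathcal A(S^2_{qs})$ by bounded operators on $\mathcal H$ such that $x_1=(q[2])^{1/2}B$ and $x_0=-q[2]A+(1-s^2)$ act, for $M\in\{N,-N\}$, by $$x_1|l,m;M\rangle=B^+_{l,m}|l+1,m+1;M\rangle+B^0_{l,m}|l,m+1;M\rangle+B^-_{l,m}|l-1,m+1;M\rangle,$$ $$x_0|l,m;M\rangle=A^+_{l,m}|l+1,m;M\rangle+A^0_{l,m}|l,m;M\rangle+A^+_{l-1,m}|l-1,m;M\rangle,$$ where vectors with inadmissible labels are $0$ and $$A^+_{l,m}=q^m\sqrt{[2][l-m+1][l+m+1]}\,\alpha_{l+1},\quad A^0_{l,m}=\bigl([2l]-q^{l+m+1}[2][l-m]\bigr)\beta_l,$$ $$B^+_{l,m}=q^{-l+m}\sqrt{[l+m+1][l+m+2]}\,\alpha_{l+1},\quad B^0_{l,m}=-q^{m+2}\sqrt{[2][l-m][l+m+1]}\,\beta_l,\quad B^-_{l,m}=-q^{l+m+1}\sqrt{[l-m][l-m-1]}\,\alpha_l,$$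 $$\alpha_l=\frac1{[2l]}\sqrt{\frac{[2][l+M][l-M]}{[2l-1][2l+1]}}\sqrt{(q^{l+M}+q^{-(l+M)}s^2)(q^{l-M}s^2+q^{-(l-M)})}\quad(\alpha_{|M|}=0),$$ $$\beta_l=\frac{\bigl([2l]-q^{l+M+1}[2][l-M]\bigr)(1-s^2)+q[2][2M]s^2}{q^2[2l][2l+2]} .$$ We write $a$ also for the operator representing $a\in\mathcal A(S^2_{qs})$. **Notions.** With $\delta=[|D|,\cdot\,]$, $\mathrm{OP}^0=\bigcap_j\mathrm{Dom}(\delta^j)$ is a set of bounded operators, and $\mathrm{OP}^{-\infty}$ is the set of bounded $X$ with $|D|^kX\in\mathrm{OP}^0$ for all $k\in\mathbb N$. An even equivariant spectral triple over a Hopf $*$-algebra $\mathcal U$ consists of a $\mathcal U$-module $*$-algebra $\mathcal A$ (that is, $h\triangleright(ab)=(h_{(1)}\triangleright a)(h_{(2)}\triangleright b)$, $h\triangleright 1=\epsilon(h)1$, $h\triangleright a^*=(S(h)^*\triangleright a)^*$), a dense subspace $\mathcal M\subset\mathcal H$ carrying a $*$-representation of $\mathcal A\rtimes\mathcal U$ (so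 $h\,a=(h_{(1)}\triangleright a)\,h_{(2)}$ on $\mathcal M$) with $a\in\mathcal A$ bounded, a self-adjoint $D$ with compact resolvent, domain containing $\mathcal M$, bounded $[D,a]$ for $a\in\mathcal A$ and $[D,h]=0$ on $\mathcal M$ for $h\in\mathcal U$, and a grading $\gamma=\gamma^*$, $\gamma^2=1$, anticommuting with $D$ and commuting with $\mathcal A\rtimes\mathcal U$. An antilinear operator $T$ on $\mathcal M$ is equivariant if $T\,h\,v=S(h)^*\,T\,v$ for $h\in\mathcal U$, $v\in\mathcal M$; its antiunitary part is the antiunitary factor of the polar decomposition of its closure. A weak equivariant real structure on an even equivariant spectral triple is an antiunitary $J$ which is the antiunitary part of an equivariant antilinear operator and satisfies $J^2=\pm1$, $JD=\pm DJ$, $J\gamma=\pm\gamma J$ and $[a,JbJ^{-1}],\,[[D,a],JbJ^{-1}]\in\mathrm{OP}^{-\infty}$ for all $a,b\in\mathcal A$. Its $KO$-dimension mod $8$ is $0,2,4,6$ when the signs of $(J^2,JD,J\gamma)$ are $(+,+,+)$, $(-,+,-)$, $(-,+,+)$, $(+,+,-)$ respectively. **Claim.** $(\mathcal A(S^2_{qs}),\mathcal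 H,D,\gamma)$ is an even $U_q(su(2))$-equivariant spectral triple, $T$ is equivariant, and $J$ is the antiunitary part of $T$. Moreover $$J^2=(-1)^{2N},\qquad J\gamma=-\gamma J,\qquad JD=DJ$$ (in particular $J$ maps the domain of $D$ onto itself), and for all $a,b\in\mathcal A(S^2_{qs})$ $$[a,Jb^*J^{-1}]\in\mathrm{OP}^{-\infty},\qquad [[D,a],Jb^*J^{-1}]\in\mathrm{OP}^{-\infty}.$$ Hence $J$ is a weak equivariant real structure, of $KO$-dimension $2$ mod $8$ if $2N$ is odd and $6$ mod $8$ if $2N$ is even. -/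

import Mathlib

open scoped TensorProduct InnerProductSpace

set_option linter.unusedSimpArgs false
set_option linter.unreachableTactic false
set_option linter.unusedTactic false
set_option linter.unnecessarySeqFocus false

noncomputable section

/-- Given an algebra `R` over `ℂ`, the opposite algebra with the conjugate scalar action. Algebra
homomorphisms `R →ₐ[ℂ] ConjOp R` are the antilinear antimultiplicative self-maps of `R`. -/
def ConjOp (R : Type*) : Type _ := Rᵐᵒᵖ

instance instRingConjOp (R : Type*) [Ring R] : Ring (ConjOp R) := inferInstanceAs (Ring Rᵐᵒᵖ)

instance instAlgebraConjOp (R : Type*) [Ring R] [Algebra ℂ R] : Algebra ℂ (ConjOp R) :=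
  RingHom.toAlgebra' ((algebraMap ℂ Rᵐᵒᵖ).comp (starRingEnd ℂ))
    (fun c x => Algebra.commutes (A := Rᵐᵒᵖ) ((starRingEnd ℂ) c) x)

/-- The canonical map `R → ConjOp R`. -/
def ConjOp.op {R : Type*} (x : R) : ConjOp R := MulOpposite.op x

/-- The canonical map `ConjOp R → R`. -/
def ConjOp.unop {R : Type*} (x : ConjOp R) : R := MulOpposite.unop x

section ConjOpLemmas
set_option linter.unusedSectionVars false
variable {R : Type*} [Ring R] [Algebra ℂ R]

theorem ConjOp.unop_injective : Function.Injective (ConjOp.unop (R := R)) :=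
  MulOpposite.unop_injective
@[simp] theorem ConjOp.unop_op (x : R) : ConjOp.unop (ConjOp.op x) = x := rfl
@[simp] theorem ConjOp.unop_mul (x y : ConjOp R) :
    ConjOp.unop (x * y) = ConjOp.unop y * ConjOp.unop x := rfl
@[simp] theorem ConjOp.unop_add (x y : ConjOp R) :
    ConjOp.unop (x + y) = ConjOp.unop x + ConjOp.unop y := rfl
@[simp] theorem ConjOp.unop_sub (x y : ConjOp R) :
    ConjOp.unop (x - y) = ConjOp.unop x - ConjOp.unop y := rfl
@[simp] theorem ConjOp.unop_zero : ConjOp.unop (0 : ConjOp R) = 0 := rfl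
@[simp] theorem ConjOp.unop_one : ConjOp.unop (1 : ConjOp R) = 1 := rfl
theorem ConjOp.unop_algebraMap (c : ℂ) :
    ConjOp.unop (algebraMap ℂ (ConjOp R) c) = algebraMap ℂ R ((starRingEnd ℂ) c) := rfl
@[simp] theorem ConjOp.unop_smul (c : ℂ) (x : ConjOp R) :
    ConjOp.unop (c • x) = (starRingEnd ℂ) c • ConjOp.unop x := by
  rw [Algebra.smul_def, ConjOp.unop_mul, ConjOp.unop_algebraMap, Algebra.smul_def,
    Algebra.commutes]

/-- The star ring structure defined by an involutive antilinear antihomomorphism. -/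
@[reducible] def ConjOp.starRing (f : R →ₐ[ℂ] ConjOp R)
    (hf : ∀ x, ConjOp.unop (f (ConjOp.unop (f x))) = x) : StarRing R where
  star x := ConjOp.unop (f x)
  star_involutive := hf
  star_mul x y := by simp
  star_add x y := by simp

end ConjOpLemmas

/-- The deformation parameter as a complex number. -/
def qC (q : Set.Ioo (0 : ℝ) 1) : ℂ := ((q : ℝ) : ℂ)

theorem qC_ne_zero (q : Set.Ioo (0 : ℝ) 1) : qC q ≠ 0 := by
  unfold qC
  exact_mod_cast q.2.1.ne'

@[simp] theorem conj_qC (q : Set.Ioo (0 : ℝ) 1) : (starRingEnd ℂ) (qC q) = qC q := by simp [qC]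

/-! The Hopf algebra `U_q(su(2))`. -/

/-- The generators of `U_q(su(2))`. -/
inductive UqGen : Type
  | K
  | Kinv
  | E
  | F

/-- The defining relations of `U_q(su(2))`. -/
inductive UqRel (q : Set.Ioo (0 : ℝ) 1) : FreeAlgebra ℂ UqGen → FreeAlgebra ℂ UqGen → Prop
  | K_Kinv : UqRel q (FreeAlgebra.ι ℂ UqGen.K * FreeAlgebra.ι ℂ UqGen.Kinv) 1
  | Kinv_K : UqRel q (FreeAlgebra.ι ℂ UqGen.Kinv * FreeAlgebra.ι ℂ UqGen.K) 1
  | K_E : UqRel q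
      (FreeAlgebra.ι ℂ UqGen.K * FreeAlgebra.ι ℂ UqGen.E * FreeAlgebra.ι ℂ UqGen.Kinv)
      (qC q • FreeAlgebra.ι ℂ UqGen.E)
  | F_K : UqRel q
      (FreeAlgebra.ι ℂ UqGen.Kinv * FreeAlgebra.ι ℂ UqGen.F * FreeAlgebra.ι ℂ UqGen.K)
      (qC q • FreeAlgebra.ι ℂ UqGen.F)
  | E_F : UqRel q
      (FreeAlgebra.ι ℂ UqGen.E * FreeAlgebra.ι ℂ UqGen.F
        - FreeAlgebra.ι ℂ UqGen.F * FreeAlgebra.ι ℂ UqGen.E)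
      ((qC q - (qC q)⁻¹)⁻¹ •
        (FreeAlgebra.ι ℂ UqGen.K * FreeAlgebra.ι ℂ UqGen.K
          - FreeAlgebra.ι ℂ UqGen.Kinv * FreeAlgebra.ι ℂ UqGen.Kinv))

/-- The algebra `U_q(su(2))`. -/
def Uq (q : Set.Ioo (0 : ℝ) 1) : Type := RingQuot (UqRel q)

namespace Uq

instance instRing (q : Set.Ioo (0 : ℝ) 1) : Ring (Uq q) :=
  inferInstanceAs (Ring (RingQuot (UqRel q)))

instance instAlgebra (q : Set.Ioo (0 : ℝ) 1) : Algebra ℂ (Uq q) :=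
  inferInstanceAs (Algebra ℂ (RingQuot (UqRel q)))

/-- The quotient map onto `U_q(su(2))`. -/
def mk (q : Set.Ioo (0 : ℝ) 1) : FreeAlgebra ℂ UqGen →ₐ[ℂ] Uq q := RingQuot.mkAlgHom ℂ (UqRel q)

theorem mk_rel (q : Set.Ioo (0 : ℝ) 1) {x y : FreeAlgebra ℂ UqGen} (h : UqRel q x y) :
    mk q x = mk q y := RingQuot.mkAlgHom_rel ℂ h

/-- The class of a generator in `U_q(su(2))`. -/
def gen (q : Set.Ioo (0 : ℝ) 1) (x : UqGen) : Uq q := mk q (FreeAlgebra.ι ℂ x)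

/-- The generator `K`. -/
abbrev K (q : Set.Ioo (0 : ℝ) 1) : Uq q := gen q UqGen.K
/-- The generator `K⁻¹`. -/
abbrev Kinv (q : Set.Ioo (0 : ℝ) 1) : Uq q := gen q UqGen.Kinv
/-- The generator `E`. -/
abbrev E (q : Set.Ioo (0 : ℝ) 1) : Uq q := gen q UqGen.E
/-- The generator `F = E^*`. -/
abbrev F (q : Set.Ioo (0 : ℝ) 1) : Uq q := gen q UqGen.F

theorem K_mul_Kinv (q : Set.Ioo (0 : ℝ) 1) : K q * Kinv q = 1 := by
  simpa [gen] using mk_rel q UqRel.K_Kinv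

theorem Kinv_mul_K (q : Set.Ioo (0 : ℝ) 1) : Kinv q * K q = 1 := by
  simpa [gen] using mk_rel q UqRel.Kinv_K

theorem K_mul_E_mul_Kinv (q : Set.Ioo (0 : ℝ) 1) :
    K q * E q * Kinv q = qC q • E q := by
  simpa [gen] using mk_rel q UqRel.K_E

theorem Kinv_mul_F_mul_K (q : Set.Ioo (0 : ℝ) 1) :
    Kinv q * F q * K q = qC q • F q := by
  simpa [gen] using mk_rel q UqRel.F_K

theorem E_F_commutator (q : Set.Ioo (0 : ℝ) 1) :
    E q * F q - F q * E q = (qC q - (qC q)⁻¹)⁻¹ •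
      (K q * K q - Kinv q * Kinv q) := by
  simpa [gen] using mk_rel q UqRel.E_F

/-- The universal property of `U_q(su(2))`. -/
def lift (q : Set.Ioo (0 : ℝ) 1) {R : Type*} [Ring R] [Algebra ℂ R] (f : UqGen → R)
    (h1 : f .K * f .Kinv = 1) (h2 : f .Kinv * f .K = 1)
    (h3 : f .K * f .E * f .Kinv = qC q • f .E)
    (h4 : f .Kinv * f .F * f .K = qC q • f .F)
    (h5 : f .E * f .F - f .F * f .E = (qC q - (qC q)⁻¹)⁻¹ •
      (f .K * f .K - f .Kinv * f .Kinv)) : Uq q →ₐ[ℂ] R :=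
  RingQuot.liftAlgHom ℂ ⟨FreeAlgebra.lift ℂ f, by
    intro x y h
    cases h <;> simpa using by assumption⟩

@[simp] theorem lift_gen (q : Set.Ioo (0 : ℝ) 1) {R : Type*} [Ring R] [Algebra ℂ R] (f : UqGen → R)
    (h1 h2 h3 h4 h5) (x : UqGen) : lift q f h1 h2 h3 h4 h5 (gen q x) = f x := by
  exact (RingQuot.liftAlgHom_mkAlgHom_apply ℂ _ _ _).trans (FreeAlgebra.lift_ι_apply f x)

theorem algHom_ext (q : Set.Ioo (0 : ℝ) 1) {R : Type*} [Semiring R] [Algebra ℂ R]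
    {f g : Uq q →ₐ[ℂ] R} (h : ∀ x, f (gen q x) = g (gen q x)) : f = g := by
  refine RingQuot.ringQuot_ext' ℂ f g ?_
  ext x
  exact h x

theorem induction (q : Set.Ioo (0 : ℝ) 1) {p : Uq q → Prop}
    (h0 : ∀ c, p (algebraMap ℂ (Uq q) c)) (h1 : ∀ x, p (gen q x))
    (hmul : ∀ a b, p a → p b → p (a * b)) (hadd : ∀ a b, p a → p b → p (a + b)) (a : Uq q) :
    p a := by
  obtain ⟨y, rfl⟩ : ∃ y, mk q y = a := RingQuot.mkAlgHom_surjective ℂ (UqRel q) a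
  induction y with
  | grade0 r => simpa using h0 r
  | grade1 x => exact h1 x
  | mul a b ha hb => rw [map_mul]; exact hmul _ _ ha hb
  | add a b ha hb => rw [map_add]; exact hadd _ _ ha hb

theorem K_mul_E (q : Set.Ioo (0 : ℝ) 1) : K q * E q = qC q • (E q * K q) := by
  rw [← smul_mul_assoc, ← K_mul_E_mul_Kinv, mul_assoc (K q * E q), Kinv_mul_K, mul_one]

theorem F_mul_K (q : Set.Ioo (0 : ℝ) 1) : F q * K q = qC q • (K q * F q) := by
  rw [← mul_smul_comm, ← Kinv_mul_F_mul_K, ← mul_assoc, ← mul_assoc, K_mul_Kinv, one_mul]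

theorem E_mul_Kinv (q : Set.Ioo (0 : ℝ) 1) : E q * Kinv q = qC q • (Kinv q * E q) := by
  rw [← mul_smul_comm, ← K_mul_E_mul_Kinv, ← mul_assoc, ← mul_assoc, Kinv_mul_K, one_mul]

theorem Kinv_mul_F (q : Set.Ioo (0 : ℝ) 1) : Kinv q * F q = qC q • (F q * Kinv q) := by
  rw [← smul_mul_assoc, ← Kinv_mul_F_mul_K, mul_assoc (Kinv q * F q), K_mul_Kinv, mul_one]

/-- The involution of `U_q(su(2))`, with `K^* = K` and `E^* = F`, as an antilinear
antihomomorphism. -/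
def starHom (q : Set.Ioo (0 : ℝ) 1) : Uq q →ₐ[ℂ] ConjOp (Uq q) :=
  lift q (fun x => match x with
    | .K => ConjOp.op (K q)
    | .Kinv => ConjOp.op (Kinv q)
    | .E => ConjOp.op (F q)
    | .F => ConjOp.op (E q))
    (ConjOp.unop_injective (by simp [Kinv_mul_K]))
    (ConjOp.unop_injective (by simp [K_mul_Kinv]))
    (ConjOp.unop_injective (by simp [← mul_assoc, Kinv_mul_F_mul_K]))
    (ConjOp.unop_injective (by simp [← mul_assoc, K_mul_E_mul_Kinv]))
    (ConjOp.unop_injective (by simp [E_F_commutator]))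

instance instStarRing (q : Set.Ioo (0 : ℝ) 1) : StarRing (Uq q) :=
  ConjOp.starRing (starHom q) (by
    intro x
    induction x using induction with
    | h0 c => simp [ConjOp.unop_algebraMap]
    | h1 x => cases x <;> simp [starHom]
    | hmul a b ha hb => simp [ha, hb]
    | hadd a b ha hb => simp [ha, hb])

theorem star_def (q : Set.Ioo (0 : ℝ) 1) (x : Uq q) : star x = ConjOp.unop (starHom q x) := rfl

instance instStarModule (q : Set.Ioo (0 : ℝ) 1) : StarModule ℂ (Uq q) where
  star_smul c x := by simp [star_def]

theorem star_K (q : Set.Ioo (0 : ℝ) 1) : star (K q) = K q := by simp [star_def, starHom]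
theorem star_E (q : Set.Ioo (0 : ℝ) 1) : star (E q) = F q := by simp [star_def, starHom]

/-- The coproduct `Δ K = K ⊗ K`, `Δ E = E ⊗ K + K⁻¹ ⊗ E`, `Δ F = F ⊗ K + K⁻¹ ⊗ F`. -/
def comulHom (q : Set.Ioo (0 : ℝ) 1) : Uq q →ₐ[ℂ] Uq q ⊗[ℂ] Uq q :=
  lift q (fun x => match x with
    | .K => K q ⊗ₜ K q
    | .Kinv => Kinv q ⊗ₜ Kinv q
    | .E => E q ⊗ₜ K q + Kinv q ⊗ₜ E q
    | .F => F q ⊗ₜ K q + Kinv q ⊗ₜ F q)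
    (by simp [K_mul_Kinv, Algebra.TensorProduct.one_def])
    (by simp [Kinv_mul_K, Algebra.TensorProduct.one_def])
    (by simp [add_mul, mul_add, K_mul_Kinv, K_mul_E_mul_Kinv, mul_assoc (K q) (K q) (Kinv q), TensorProduct.smul_tmul'])
    (by
      simp [add_mul, mul_add, Kinv_mul_K, Kinv_mul_F_mul_K, mul_assoc (Kinv q) (Kinv q) (K q), TensorProduct.smul_tmul'])
    (by
      have hq := qC_ne_zero q
      have e1 : E q * F q = F q * E q + (qC q - (qC q)⁻¹)⁻¹ •
          (K q * K q - Kinv q * Kinv q) := by rw [← E_F_commutator]; abel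
      simp only [add_mul, mul_add, Algebra.TensorProduct.tmul_mul_tmul, e1, K_mul_E, F_mul_K,
        E_mul_Kinv, Kinv_mul_F, TensorProduct.tmul_smul, ← TensorProduct.smul_tmul',
        TensorProduct.tmul_add, TensorProduct.add_tmul, TensorProduct.tmul_sub,
        TensorProduct.sub_tmul, smul_add, smul_sub]
      module)

/-- The counit `ε K = 1`, `ε E = ε F = 0`. -/
def counitHom (q : Set.Ioo (0 : ℝ) 1) : Uq q →ₐ[ℂ] ℂ :=
  lift q (fun x => match x with
    | .K => 1
    | .Kinv => 1
    | .E => 0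
    | .F => 0)
    (by simp) (by simp) (by simp) (by simp) (by simp)

instance instBialgebra (q : Set.Ioo (0 : ℝ) 1) : Bialgebra ℂ (Uq q) :=
  Bialgebra.ofAlgHom (comulHom q) (counitHom q)
    (algHom_ext q (by
      intro x
      cases x <;> simp [comulHom, TensorProduct.tmul_add, TensorProduct.add_tmul, add_assoc]))
    (algHom_ext q (by intro x; cases x <;> simp [comulHom, counitHom]))
    (algHom_ext q (by intro x; cases x <;> simp [comulHom, counitHom]))

theorem comul_gen (q : Set.Ioo (0 : ℝ) 1) (x : UqGen) :
    Coalgebra.comul (R := ℂ) (gen q x) = comulHom q (gen q x) := rfl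

theorem counit_gen (q : Set.Ioo (0 : ℝ) 1) (x : UqGen) :
    Coalgebra.counit (R := ℂ) (gen q x) = counitHom q (gen q x) := rfl

/-- The antipode `S K = K⁻¹`, `S E = -q E`, `S F = -q⁻¹ F`, as an antihomomorphism. -/
def antipodeHom (q : Set.Ioo (0 : ℝ) 1) : Uq q →ₐ[ℂ] (Uq q)ᵐᵒᵖ :=
  lift q (fun x => match x with
    | .K => MulOpposite.op (Kinv q)
    | .Kinv => MulOpposite.op (K q)
    | .E => MulOpposite.op (-qC q • E q)
    | .F => MulOpposite.op (-(qC q)⁻¹ • F q))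
    (MulOpposite.unop_injective (by simp [K_mul_Kinv]))
    (MulOpposite.unop_injective (by simp [Kinv_mul_K]))
    (MulOpposite.unop_injective (by
      simp [← mul_assoc, K_mul_E_mul_Kinv]))
    (MulOpposite.unop_injective (by
      simp [← mul_assoc, Kinv_mul_F_mul_K, smul_smul, mul_comm]))
    (MulOpposite.unop_injective (by
      have hq := qC_ne_zero q
      have e1 : E q * F q = F q * E q + (qC q - (qC q)⁻¹)⁻¹ •
          (K q * K q - Kinv q * Kinv q) := by rw [← E_F_commutator]; abel
      simp only [neg_smul, MulOpposite.unop_sub, MulOpposite.unop_mul, MulOpposite.unop_op, MulOpposite.unop_smul, neg_mul_neg, smul_mul_smul_comm, mul_inv_cancel₀ hq, inv_mul_cancel₀ hq, one_smul, e1]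
      module))

/-- The antipode as a linear map. -/
def antipodeLin (q : Set.Ioo (0 : ℝ) 1) : Uq q →ₗ[ℂ] Uq q :=
  (MulOpposite.opLinearEquiv ℂ).symm.toLinearMap ∘ₗ (antipodeHom q).toLinearMap

theorem antipodeLin_mul (q : Set.Ioo (0 : ℝ) 1) (x y : Uq q) :
    antipodeLin q (x * y) = antipodeLin q y * antipodeLin q x := by
  simp [antipodeLin]

theorem antipodeLin_algebraMap (q : Set.Ioo (0 : ℝ) 1) (c : ℂ) :
    antipodeLin q (algebraMap ℂ (Uq q) c) = algebraMap ℂ (Uq q) c := by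
  simp [antipodeLin]

theorem rTensor_aux (q : Set.Ioo (0 : ℝ) 1) (a b : Uq q ⊗[ℂ] Uq q) (c : ℂ)
    (ha : LinearMap.mul' ℂ (Uq q) ((antipodeLin q).rTensor (Uq q) a) = algebraMap ℂ _ c) :
    LinearMap.mul' ℂ (Uq q) ((antipodeLin q).rTensor (Uq q) (a * b)) =
      c • LinearMap.mul' ℂ (Uq q) ((antipodeLin q).rTensor (Uq q) b) := by
  induction b with
  | zero => simp
  | add x y hx hy => simp [mul_add, hx, hy]
  | tmul x y =>
    have key : ∀ a : Uq q ⊗[ℂ] Uq q,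
        LinearMap.mul' ℂ (Uq q) ((antipodeLin q).rTensor (Uq q) (a * x ⊗ₜ y)) =
          antipodeLin q x * LinearMap.mul' ℂ (Uq q) ((antipodeLin q).rTensor (Uq q) a) * y := by
      intro a
      induction a with
      | zero => simp
      | add u v hu hv => simp [add_mul, mul_add, hu, hv]
      | tmul u v => simp [antipodeLin_mul, mul_assoc]
    rw [key, ha, ← Algebra.commutes, mul_assoc, ← Algebra.smul_def]
    simp

theorem lTensor_aux (q : Set.Ioo (0 : ℝ) 1) (a b : Uq q ⊗[ℂ] Uq q) (c : ℂ)
    (hb : LinearMap.mul' ℂ (Uq q) ((antipodeLin q).lTensor (Uq q) b) = algebraMap ℂ _ c) :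
    LinearMap.mul' ℂ (Uq q) ((antipodeLin q).lTensor (Uq q) (a * b)) =
      c • LinearMap.mul' ℂ (Uq q) ((antipodeLin q).lTensor (Uq q) a) := by
  induction a with
  | zero => simp
  | add x y hx hy => simp [add_mul, hx, hy]
  | tmul x y =>
    have key : ∀ b : Uq q ⊗[ℂ] Uq q,
        LinearMap.mul' ℂ (Uq q) ((antipodeLin q).lTensor (Uq q) (x ⊗ₜ y * b)) =
          x * LinearMap.mul' ℂ (Uq q) ((antipodeLin q).lTensor (Uq q) b) * antipodeLin q y := by
      intro b
      induction b with
      | zero => simp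
      | add u v hu hv => simp [add_mul, mul_add, hu, hv]
      | tmul u v => simp [antipodeLin_mul, mul_assoc]
    rw [key, hb, ← Algebra.commutes, mul_assoc, ← Algebra.smul_def]
    simp

instance instHopfAlgebra (q : Set.Ioo (0 : ℝ) 1) : HopfAlgebra ℂ (Uq q) where
  antipode := antipodeLin q
  mul_antipode_rTensor_comul := by
    ext x
    simp only [LinearMap.comp_apply, Algebra.linearMap_apply]
    induction x using induction with
    | h0 c => simp [Algebra.TensorProduct.algebraMap_apply, antipodeLin_algebraMap]
    | h1 x =>
      have hq := qC_ne_zero q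
      rw [comul_gen, counit_gen]
      cases x <;> simp [comulHom, counitHom, antipodeLin, antipodeHom, K_mul_Kinv, Kinv_mul_K,
        K_mul_E, F_mul_K, smul_smul, hq]
    | hmul a b ha hb =>
      rw [Bialgebra.comul_mul, rTensor_aux q _ _ _ ha, hb, Bialgebra.counit_mul, map_mul,
        Algebra.smul_def]
    | hadd a b ha hb => simp [ha, hb]
  mul_antipode_lTensor_comul := by
    ext x
    simp only [LinearMap.comp_apply, Algebra.linearMap_apply]
    induction x using induction with
    | h0 c =>
      have h1 : antipodeLin q 1 = 1 := by simpa using antipodeLin_algebraMap q 1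
      simp [Algebra.TensorProduct.algebraMap_apply, h1]
    | h1 x =>
      have hq := qC_ne_zero q
      rw [comul_gen, counit_gen]
      cases x <;> simp [comulHom, counitHom, antipodeLin, antipodeHom, K_mul_Kinv, Kinv_mul_K,
        E_mul_Kinv, Kinv_mul_F, smul_smul, hq]
    | hmul a b ha hb =>
      rw [Bialgebra.comul_mul, lTensor_aux q _ _ _ hb, ha, Bialgebra.counit_mul, map_mul,
        Algebra.smul_def, Algebra.commutes]
    | hadd a b ha hb => simp [ha, hb]

end Uq

/-! The coordinate algebra of the Podleś sphere. -/

/-- The generators of the coordinate algebra of the Podleś sphere. -/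
inductive PodlesGen : Type
  | A
  | B
  | Bs

/-- The defining relations of the coordinate algebra of the Podleś sphere `S²_{qs}`, where `Bs`
stands for `B^*`; the second relation is the adjoint of the first one. -/
inductive PodlesRel (q : Set.Ioo (0 : ℝ) 1) (s : ℝ) :
    FreeAlgebra ℂ PodlesGen → FreeAlgebra ℂ PodlesGen → Prop
  | A_B : PodlesRel q s (FreeAlgebra.ι ℂ PodlesGen.A * FreeAlgebra.ι ℂ PodlesGen.B)
      (qC q ^ 2 • (FreeAlgebra.ι ℂ PodlesGen.B * FreeAlgebra.ι ℂ PodlesGen.A))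
  | Bs_A : PodlesRel q s (FreeAlgebra.ι ℂ PodlesGen.Bs * FreeAlgebra.ι ℂ PodlesGen.A)
      (qC q ^ 2 • (FreeAlgebra.ι ℂ PodlesGen.A * FreeAlgebra.ι ℂ PodlesGen.Bs))
  | B_Bs : PodlesRel q s
      (FreeAlgebra.ι ℂ PodlesGen.B * FreeAlgebra.ι ℂ PodlesGen.Bs
        + (FreeAlgebra.ι ℂ PodlesGen.A + (s : ℂ) ^ 2 • 1) * (FreeAlgebra.ι ℂ PodlesGen.A - 1)) 0
  | Bs_B : PodlesRel q s
      (FreeAlgebra.ι ℂ PodlesGen.Bs * FreeAlgebra.ι ℂ PodlesGen.B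
        + (qC q ^ 2 • FreeAlgebra.ι ℂ PodlesGen.A + (s : ℂ) ^ 2 • 1)
          * (qC q ^ 2 • FreeAlgebra.ι ℂ PodlesGen.A - 1)) 0

/-- The coordinate algebra of the Podleś sphere `S²_{qs}`. -/
def PodlesAlg (q : Set.Ioo (0 : ℝ) 1) (s : ℝ) : Type := RingQuot (PodlesRel q s)

namespace PodlesAlg

instance instRing (q : Set.Ioo (0 : ℝ) 1) (s : ℝ) : Ring (PodlesAlg q s) :=
  inferInstanceAs (Ring (RingQuot (PodlesRel q s)))

instance instAlgebra (q : Set.Ioo (0 : ℝ) 1) (s : ℝ) : Algebra ℂ (PodlesAlg q s) :=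
  inferInstanceAs (Algebra ℂ (RingQuot (PodlesRel q s)))

/-- The quotient map onto the coordinate algebra. -/
def mk (q : Set.Ioo (0 : ℝ) 1) (s : ℝ) : FreeAlgebra ℂ PodlesGen →ₐ[ℂ] PodlesAlg q s :=
  RingQuot.mkAlgHom ℂ (PodlesRel q s)

theorem mk_rel (q : Set.Ioo (0 : ℝ) 1) (s : ℝ) {x y : FreeAlgebra ℂ PodlesGen}
    (h : PodlesRel q s x y) : mk q s x = mk q s y := RingQuot.mkAlgHom_rel ℂ h

/-- The class of a generator in the coordinate algebra. -/
def gen (q : Set.Ioo (0 : ℝ) 1) (s : ℝ) (x : PodlesGen) : PodlesAlg q s :=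
  mk q s (FreeAlgebra.ι ℂ x)

/-- The generator `A`. -/
abbrev A (q : Set.Ioo (0 : ℝ) 1) (s : ℝ) : PodlesAlg q s := gen q s PodlesGen.A
/-- The generator `B`. -/
abbrev B (q : Set.Ioo (0 : ℝ) 1) (s : ℝ) : PodlesAlg q s := gen q s PodlesGen.B
/-- The generator `B^*`. -/
abbrev Bs (q : Set.Ioo (0 : ℝ) 1) (s : ℝ) : PodlesAlg q s := gen q s PodlesGen.Bs

variable (q : Set.Ioo (0 : ℝ) 1) (s : ℝ)

theorem A_mul_B : A q s * B q s = qC q ^ 2 • (B q s * A q s) := by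
  simpa [gen] using mk_rel q s PodlesRel.A_B

theorem Bs_mul_A : Bs q s * A q s = qC q ^ 2 • (A q s * Bs q s) := by
  simpa [gen] using mk_rel q s PodlesRel.Bs_A

theorem B_mul_Bs :
    B q s * Bs q s + (A q s + (s : ℂ) ^ 2 • 1) * (A q s - 1) = 0 := by
  simpa [gen] using mk_rel q s PodlesRel.B_Bs

theorem Bs_mul_B :
    Bs q s * B q s + (qC q ^ 2 • A q s + (s : ℂ) ^ 2 • 1) * (qC q ^ 2 • A q s - 1) = 0 := by
  simpa [gen] using mk_rel q s PodlesRel.Bs_B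

/-- The universal property of the coordinate algebra. -/
def lift {R : Type*} [Ring R] [Algebra ℂ R] (f : PodlesGen → R)
    (h1 : f .A * f .B = qC q ^ 2 • (f .B * f .A))
    (h2 : f .Bs * f .A = qC q ^ 2 • (f .A * f .Bs))
    (h3 : f .B * f .Bs + (f .A + (s : ℂ) ^ 2 • 1) * (f .A - 1) = 0)
    (h4 : f .Bs * f .B + (qC q ^ 2 • f .A + (s : ℂ) ^ 2 • 1) * (qC q ^ 2 • f .A - 1) = 0) :
    PodlesAlg q s →ₐ[ℂ] R :=
  RingQuot.liftAlgHom ℂ ⟨FreeAlgebra.lift ℂ f, by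
    intro x y h
    cases h <;> simpa using by assumption⟩

@[simp] theorem lift_gen {R : Type*} [Ring R] [Algebra ℂ R] (f : PodlesGen → R)
    (h1 h2 h3 h4) (x : PodlesGen) : lift q s f h1 h2 h3 h4 (gen q s x) = f x := by
  exact (RingQuot.liftAlgHom_mkAlgHom_apply ℂ _ _ _).trans (FreeAlgebra.lift_ι_apply f x)

theorem algHom_ext {R : Type*} [Semiring R] [Algebra ℂ R]
    {f g : PodlesAlg q s →ₐ[ℂ] R} (h : ∀ x, f (gen q s x) = g (gen q s x)) : f = g := by
  refine RingQuot.ringQuot_ext' ℂ f g ?_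
  ext x
  exact h x

theorem induction {p : PodlesAlg q s → Prop}
    (h0 : ∀ c, p (algebraMap ℂ (PodlesAlg q s) c)) (h1 : ∀ x, p (gen q s x))
    (hmul : ∀ a b, p a → p b → p (a * b)) (hadd : ∀ a b, p a → p b → p (a + b))
    (a : PodlesAlg q s) : p a := by
  obtain ⟨y, rfl⟩ : ∃ y, mk q s y = a := RingQuot.mkAlgHom_surjective ℂ (PodlesRel q s) a
  induction y with
  | grade0 r => simpa using h0 r
  | grade1 x => exact h1 x
  | mul a b ha hb => rw [map_mul]; exact hmul _ _ ha hb
  | add a b ha hb => rw [map_add]; exact hadd _ _ ha hb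

/-- The involution, with `A^* = A`, as an antilinear antihomomorphism. -/
def starHom : PodlesAlg q s →ₐ[ℂ] ConjOp (PodlesAlg q s) :=
  lift q s (fun x => match x with
    | .A => ConjOp.op (A q s)
    | .B => ConjOp.op (Bs q s)
    | .Bs => ConjOp.op (B q s))
    (ConjOp.unop_injective (by simp [Bs_mul_A]))
    (ConjOp.unop_injective (by simp [A_mul_B]))
    (ConjOp.unop_injective (by
      have h := B_mul_Bs q s
      simp [add_mul, mul_sub] at h ⊢
      exact h))
    (ConjOp.unop_injective (by
      have h := Bs_mul_B q s
      simp [add_mul, mul_sub] at h ⊢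
      exact h))

instance instStarRing : StarRing (PodlesAlg q s) :=
  ConjOp.starRing (starHom q s) (by
    intro x
    induction x using induction with
    | h0 c => simp [ConjOp.unop_algebraMap]
    | h1 x => cases x <;> simp [starHom]
    | hmul a b ha hb => simp [ha, hb]
    | hadd a b ha hb => simp [ha, hb])

theorem star_def (x : PodlesAlg q s) : star x = ConjOp.unop (starHom q s x) := rfl

instance instStarModule : StarModule ℂ (PodlesAlg q s) where
  star_smul c x := by simp [star_def]

theorem star_A : star (A q s) = A q s := by simp [star_def, starHom]
theorem star_B : star (B q s) = Bs q s := by simp [star_def, starHom]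

/-- The complex number `q^{1/2}`. -/
def qh : ℂ := ((Real.sqrt (q : ℝ) : ℝ) : ℂ)

theorem qh_sq : qh q ^ 2 = qC q := by
  unfold qh qC
  rw [← Complex.ofReal_pow, Real.sq_sqrt q.2.1.le]

theorem qh_ne_zero : qh q ≠ 0 := by
  intro h
  have := qh_sq q
  rw [h] at this
  exact qC_ne_zero q (by rw [← this]; simp)

/-- The automorphisms `A ↦ A`, `B ↦ c B`, `B^* ↦ c⁻¹ B^*`; `c = q` is the action of `K`, and
`c = q⁻¹` the action of `K⁻¹`. -/
def scale (c : ℂ) (hc : c ≠ 0) : PodlesAlg q s →ₐ[ℂ] PodlesAlg q s :=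
  lift q s (fun x => match x with
    | .A => A q s
    | .B => c • B q s
    | .Bs => c⁻¹ • Bs q s)
    (by simp [A_mul_B, smul_smul, mul_comm])
    (by simp [Bs_mul_A, smul_smul, mul_comm])
    (by simpa [smul_smul, hc] using B_mul_Bs q s)
    (by simpa [smul_smul, hc] using Bs_mul_B q s)

/-- The action of `K`: `K ▷ A = A`, `K ▷ B = q B`, `K ▷ B^* = q⁻¹ B^*`. -/
def actK : PodlesAlg q s →ₐ[ℂ] PodlesAlg q s := scale q s (qC q) (qC_ne_zero q)

/-- The action of `K⁻¹`. -/
def actKinv : PodlesAlg q s →ₐ[ℂ] PodlesAlg q s := scale q s (qC q)⁻¹ (inv_ne_zero (qC_ne_zero q))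

theorem actK_actKinv (x : PodlesAlg q s) : actK q s (actKinv q s x) = x := by
  have : (actK q s).comp (actKinv q s) = AlgHom.id ℂ _ := algHom_ext q s (by
    have hq := qC_ne_zero q
    intro x; cases x <;> simp [actK, actKinv, scale, smul_smul, hq])
  exact DFunLike.congr_fun this x

theorem actKinv_actK (x : PodlesAlg q s) : actKinv q s (actK q s x) = x := by
  have : (actKinv q s).comp (actK q s) = AlgHom.id ℂ _ := algHom_ext q s (by
    have hq := qC_ne_zero q
    intro x; cases x <;> simp [actK, actKinv, scale, smul_smul, hq])
  exact DFunLike.congr_fun this x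

theorem A_mul_Bs : A q s * Bs q s = (qC q ^ 2)⁻¹ • (Bs q s * A q s) := by
  rw [Bs_mul_A, smul_smul, inv_mul_cancel₀ (pow_ne_zero 2 (qC_ne_zero q)), one_smul]

theorem B_mul_Bs' : B q s * Bs q s =
    (s : ℂ) ^ 2 • 1 - A q s * A q s + (1 - (s : ℂ) ^ 2) • A q s := by
  have h := B_mul_Bs q s
  rw [← sub_eq_zero, ← h]
  simp only [mul_sub, add_mul, smul_mul_assoc, one_mul, mul_one]
  module

theorem Bs_mul_B' : Bs q s * B q s =
    (s : ℂ) ^ 2 • 1 - qC q ^ 4 • (A q s * A q s) + (qC q ^ 2 * (1 - (s : ℂ) ^ 2)) • A q s := by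
  have h := Bs_mul_B q s
  rw [← sub_eq_zero, ← h]
  simp only [mul_sub, add_mul, smul_mul_assoc, one_mul, mul_one, mul_smul_comm]
  module

/-- The images of the generators under `E`: `E ▷ A = -q^{-1/2} B`, `E ▷ B = 0`,
`E ▷ B^* = q^{1/2} (1 + q^2) A - q^{1/2} (1 - s^2)`. -/
def genE (x : PodlesGen) : PodlesAlg q s := match x with
  | .A => -(qh q)⁻¹ • B q s
  | .B => 0
  | .Bs => (qh q * (1 + qC q ^ 2)) • A q s - (qh q * (1 - (s : ℂ) ^ 2)) • 1

/-- The images of the generators under `F`: `F ▷ A = q^{-3/2} B^*`,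
`F ▷ B = -q^{-1/2} (1 + q^2) A + q^{-1/2} (1 - s^2)`, `F ▷ B^* = 0`. -/
def genF (x : PodlesGen) : PodlesAlg q s := match x with
  | .A => (qh q ^ 3)⁻¹ • Bs q s
  | .B => -((qh q)⁻¹ * (1 + qC q ^ 2)) • A q s + ((qh q)⁻¹ * (1 - (s : ℂ) ^ 2)) • 1
  | .Bs => 0

/-- The homomorphism `a ↦ (K⁻¹ ▷ a, E ▷ a; 0, K ▷ a)` into triangular matrices; its
multiplicativity encodes `E ▷ (a b) = (E ▷ a) (K ▷ b) + (K⁻¹ ▷ a) (E ▷ b)`. -/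
def matE : PodlesAlg q s →ₐ[ℂ] Matrix (Fin 2) (Fin 2) (PodlesAlg q s) :=
  lift q s (fun x => !![actKinv q s (gen q s x), genE q s x; 0, actK q s (gen q s x)])
    (by
      have h0 := qh_ne_zero q
      ext i j
      fin_cases i <;> fin_cases j <;>
        simp [actK, actKinv, scale, genE, ← qh_sq, A_mul_B, Bs_mul_A, Bs_mul_B', B_mul_Bs',
          smul_smul, Matrix.mul_apply, Matrix.one_fin_two, mul_add, add_mul, mul_sub, sub_mul] <;>
        match_scalars <;> field_simp <;> ring)
    (by
      have h0 := qh_ne_zero q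
      ext i j
      fin_cases i <;> fin_cases j <;>
        simp [actK, actKinv, scale, genE, ← qh_sq, A_mul_B, Bs_mul_A, Bs_mul_B', B_mul_Bs',
          smul_smul, Matrix.mul_apply, Matrix.one_fin_two, mul_add, add_mul, mul_sub, sub_mul] <;>
        match_scalars <;> field_simp <;> ring)
    (by
      have h0 := qh_ne_zero q
      ext i j
      fin_cases i <;> fin_cases j <;>
        simp [actK, actKinv, scale, genE, ← qh_sq, A_mul_B, Bs_mul_A, Bs_mul_B', B_mul_Bs',
          smul_smul, Matrix.mul_apply, Matrix.one_fin_two, mul_add, add_mul, mul_sub, sub_mul] <;>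
        match_scalars <;> field_simp <;> ring)
    (by
      have h0 := qh_ne_zero q
      ext i j
      fin_cases i <;> fin_cases j <;>
        simp [actK, actKinv, scale, genE, ← qh_sq, A_mul_B, Bs_mul_A, Bs_mul_B', B_mul_Bs',
          smul_smul, Matrix.mul_apply, Matrix.one_fin_two, mul_add, add_mul, mul_sub, sub_mul] <;>
        match_scalars <;> field_simp <;> ring)

/-- The homomorphism `a ↦ (K⁻¹ ▷ a, F ▷ a; 0, K ▷ a)` into triangular matrices; its
multiplicativity encodes `F ▷ (a b) = (F ▷ a) (K ▷ b) + (K⁻¹ ▷ a) (F ▷ b)`. -/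
def matF : PodlesAlg q s →ₐ[ℂ] Matrix (Fin 2) (Fin 2) (PodlesAlg q s) :=
  lift q s (fun x => !![actKinv q s (gen q s x), genF q s x; 0, actK q s (gen q s x)])
    (by
      have h0 := qh_ne_zero q
      ext i j
      fin_cases i <;> fin_cases j <;>
        simp [actK, actKinv, scale, genF, ← qh_sq, A_mul_B, Bs_mul_A, Bs_mul_B', B_mul_Bs',
          smul_smul, Matrix.mul_apply, Matrix.one_fin_two, mul_add, add_mul, mul_sub, sub_mul] <;>
        match_scalars <;> field_simp <;> ring)
    (by
      have h0 := qh_ne_zero q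
      ext i j
      fin_cases i <;> fin_cases j <;>
        simp [actK, actKinv, scale, genF, ← qh_sq, A_mul_B, Bs_mul_A, Bs_mul_B', B_mul_Bs',
          smul_smul, Matrix.mul_apply, Matrix.one_fin_two, mul_add, add_mul, mul_sub, sub_mul] <;>
        match_scalars <;> field_simp <;> ring)
    (by
      have h0 := qh_ne_zero q
      ext i j
      fin_cases i <;> fin_cases j <;>
        simp [actK, actKinv, scale, genF, ← qh_sq, A_mul_B, Bs_mul_A, Bs_mul_B', B_mul_Bs',
          smul_smul, Matrix.mul_apply, Matrix.one_fin_two, mul_add, add_mul, mul_sub, sub_mul] <;>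
        match_scalars <;> field_simp <;> ring)
    (by
      have h0 := qh_ne_zero q
      ext i j
      fin_cases i <;> fin_cases j <;>
        simp [actK, actKinv, scale, genF, ← qh_sq, A_mul_B, Bs_mul_A, Bs_mul_B', B_mul_Bs',
          smul_smul, Matrix.mul_apply, Matrix.one_fin_two, mul_add, add_mul, mul_sub, sub_mul] <;>
        match_scalars <;> field_simp <;> ring)


theorem matE_spec (x : PodlesAlg q s) : matE q s x 0 0 = actKinv q s x ∧ matE q s x 1 0 = 0 ∧
    matE q s x 1 1 = actK q s x := by
  induction x using induction with
  | h0 c => simp [Matrix.algebraMap_matrix_apply]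
  | h1 x => simp [matE]
  | hmul a b ha hb => simp [Matrix.mul_apply, ha, hb]
  | hadd a b ha hb => simp [ha, hb]

theorem matF_spec (x : PodlesAlg q s) : matF q s x 0 0 = actKinv q s x ∧ matF q s x 1 0 = 0 ∧
    matF q s x 1 1 = actK q s x := by
  induction x using induction with
  | h0 c => simp [Matrix.algebraMap_matrix_apply]
  | h1 x => simp [matF]
  | hmul a b ha hb => simp [Matrix.mul_apply, ha, hb]
  | hadd a b ha hb => simp [ha, hb]

/-- The action of `E`. -/
def actE : PodlesAlg q s →ₗ[ℂ] PodlesAlg q s where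
  toFun x := matE q s x 0 1
  map_add' x y := by simp
  map_smul' c x := by simp

/-- The action of `F`. -/
def actF : PodlesAlg q s →ₗ[ℂ] PodlesAlg q s where
  toFun x := matF q s x 0 1
  map_add' x y := by simp
  map_smul' c x := by simp

theorem actE_mul (x y : PodlesAlg q s) :
    actE q s (x * y) = actKinv q s x * actE q s y + actE q s x * actK q s y := by
  simp [actE, Matrix.mul_apply, matE_spec]

theorem actF_mul (x y : PodlesAlg q s) :
    actF q s (x * y) = actKinv q s x * actF q s y + actF q s x * actK q s y := by
  simp [actF, Matrix.mul_apply, matF_spec]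

theorem actE_gen (x : PodlesGen) : actE q s (gen q s x) = genE q s x := by simp [actE, matE]
theorem actF_gen (x : PodlesGen) : actF q s (gen q s x) = genF q s x := by simp [actF, matF]

theorem actE_algebraMap (c : ℂ) : actE q s (algebraMap ℂ (PodlesAlg q s) c) = 0 := by
  simp [actE, Matrix.algebraMap_matrix_apply]

theorem actF_algebraMap (c : ℂ) : actF q s (algebraMap ℂ (PodlesAlg q s) c) = 0 := by
  simp [actF, Matrix.algebraMap_matrix_apply]

theorem actE_one : actE q s 1 = 0 := by simpa using actE_algebraMap q s 1
theorem actF_one : actF q s 1 = 0 := by simpa using actF_algebraMap q s 1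

theorem actK_actE (x : PodlesAlg q s) :
    actK q s (actE q s x) = qC q • actE q s (actK q s x) := by
  have hq := qC_ne_zero q
  induction x using induction with
  | h0 c => simp [actE_algebraMap]
  | h1 x => cases x <;> simp [actE_gen, genE, actK, scale, smul_smul, hq, mul_comm]
  | hmul a b ha hb =>
    simp [actE_mul, ha, hb, actK_actKinv, actKinv_actK]
  | hadd a b ha hb => simp [ha, hb]

theorem actF_actK (x : PodlesAlg q s) :
    actF q s (actK q s x) = qC q • actK q s (actF q s x) := by
  have hq := qC_ne_zero q
  induction x using induction with
  | h0 c => simp [actF_algebraMap]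
  | h1 x => cases x <;> simp [actF_gen, genF, actK, scale, smul_smul, hq, mul_comm]
  | hmul a b ha hb =>
    simp [actF_mul, ha, hb, actK_actKinv, actKinv_actK]
  | hadd a b ha hb => simp [ha, hb]

theorem actE_actKinv (x : PodlesAlg q s) :
    actE q s (actKinv q s x) = qC q • actKinv q s (actE q s x) := by
  have h := congrArg (actKinv q s) (actK_actE q s (actKinv q s x))
  rw [actKinv_actK, actK_actKinv, map_smul] at h
  exact h

theorem actKinv_actF (x : PodlesAlg q s) :
    actKinv q s (actF q s x) = qC q • actF q s (actKinv q s x) := by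
  have h := congrArg (actKinv q s) (actF_actK q s (actKinv q s x))
  rw [actK_actKinv, map_smul, actKinv_actK] at h
  exact h

theorem qC_sub_inv_ne_zero : qC q - (qC q)⁻¹ ≠ 0 := by
  have h0 := q.2.1
  have h1 := q.2.2
  unfold qC
  rw [← Complex.ofReal_inv, ← Complex.ofReal_sub, Complex.ofReal_ne_zero]
  have : 1 < (q : ℝ)⁻¹ := (one_lt_inv₀ h0).2 h1
  linarith

theorem actE_actF (x : PodlesAlg q s) :
    actE q s (actF q s x) - actF q s (actE q s x) = (qC q - (qC q)⁻¹)⁻¹ •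
      (actK q s (actK q s x) - actKinv q s (actKinv q s x)) := by
  have hq := qC_ne_zero q
  have hq2 := qC_sub_inv_ne_zero q
  have h0 := qh_ne_zero q
  induction x using induction with
  | h0 c => simp [actE_algebraMap, actF_algebraMap]
  | h1 x =>
    rw [eq_inv_smul_iff₀ hq2]
    cases x <;> simp [actE_gen, actF_gen, genE, genF, actK, actKinv, scale, smul_smul,
      actE_one, actF_one, ← qh_sq]
    · right
      match_scalars <;> field_simp <;> ring
    all_goals match_scalars <;> field_simp <;> ring
  | hmul a b ha hb =>
    have ha' : actE q s (actF q s a) = actF q s (actE q s a) + (qC q - (qC q)⁻¹)⁻¹ •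
      (actK q s (actK q s a) - actKinv q s (actKinv q s a)) := by rw [← ha]; abel
    have hb' : actE q s (actF q s b) = actF q s (actE q s b) + (qC q - (qC q)⁻¹)⁻¹ •
      (actK q s (actK q s b) - actKinv q s (actKinv q s b)) := by rw [← hb]; abel
    simp only [actE_mul, actF_mul, map_add, map_mul, ha', hb', actE_actKinv, actF_actK,
      actKinv_actF, actK_actE, smul_mul_assoc, mul_smul_comm, mul_add, add_mul, mul_sub, sub_mul,
      smul_sub, smul_add]
    module
  | hadd a b ha hb =>
    simp only [map_add]
    rw [add_sub_add_comm, ha, hb]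
    module

/-- The left action of `U_q(su(2))` on the coordinate algebra of the Podleś sphere. -/
def act : Uq q →ₐ[ℂ] Module.End ℂ (PodlesAlg q s) :=
  Uq.lift q (fun x => match x with
    | .K => (actK q s).toLinearMap
    | .Kinv => (actKinv q s).toLinearMap
    | .E => actE q s
    | .F => actF q s)
    (by ext x; simp [actK_actKinv])
    (by ext x; simp [actKinv_actK])
    (by ext x; simp [actK_actE, actK_actKinv])
    (by ext x; simp [actKinv_actF, actKinv_actK])
    (by ext x; simp [actE_actF])

end PodlesAlg

/-! Operators on a Hilbert space. -/

section Generic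

set_option linter.unusedSectionVars false

variable {H : Type*} [NormedAddCommGroup H] [InnerProductSpace ℂ H] [CompleteSpace H]

/-- `C` is the bounded extension of the commutator `[P, T] = P T - T P`, which is defined on the
domain of `P`; in particular `T` preserves the domain of `P`. -/
def IsCommutator (P : H →ₗ.[ℂ] H) (T C : H →L[ℂ] H) : Prop :=
  ∀ x : P.domain, ∃ h : T x ∈ P.domain, P ⟨T x, h⟩ - T (P x) = C x

/-- `T` lies in the domain of `δ^j`, where `δ = [P, · ]`. -/
def InDomDeltaPow (P : H →ₗ.[ℂ] H) : ℕ → (H →L[ℂ] H) → Prop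
  | 0, _ => True
  | j + 1, T => ∃ C : H →L[ℂ] H, IsCommutator P T C ∧ InDomDeltaPow P j C

/-- The class `OP⁰` of operators of order zero, with respect to `P = |D|`. -/
def OPZero (P : H →ₗ.[ℂ] H) : Set (H →L[ℂ] H) := {T | ∀ j, InDomDeltaPow P j T}

/-- `T'` is the bounded operator `P^k T`, which is in particular everywhere defined. -/
def IsPowerMul (P : H →ₗ.[ℂ] H) : ℕ → (H →L[ℂ] H) → (H →L[ℂ] H) → Prop
  | 0, T, T' => T' = T
  | k + 1, T, T' => ∃ R : H →L[ℂ] H, IsPowerMul P k T R ∧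
      ∀ x, ∃ h : R x ∈ P.domain, P ⟨R x, h⟩ = T' x

/-- The class `OP^{-∞}` of smoothing operators: `P^k T` is in `OP⁰` for all `k`. -/
def OPNegInfty (P : H →ₗ.[ℂ] H) : Set (H →L[ℂ] H) :=
  {T | ∀ k, ∃ T' : H →L[ℂ] H, IsPowerMul P k T T' ∧ T' ∈ OPZero P}

/-- `P` is the absolute value `|D|`: the positive self-adjoint operator with the same domain as `D`
and with `‖P x‖ = ‖D x‖`. -/
structure IsModulusOf (P D : H →ₗ.[ℂ] H) : Prop where
  selfAdjoint : IsSelfAdjoint P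
  nonneg : ∀ x : P.domain, 0 ≤ (inner ℂ (x : H) (P x)).re
  domain_eq : P.domain = D.domain
  norm_eq : ∀ (x : H) (hP : x ∈ P.domain) (hD : x ∈ D.domain), ‖P ⟨x, hP⟩‖ = ‖D ⟨x, hD⟩‖

/-- Some resolvent `R = (D - z)⁻¹` exists and is compact. -/
def HasCompactResolvent (D : H →ₗ.[ℂ] H) : Prop :=
  ∃ (z : ℂ) (R : H →L[ℂ] H), IsCompactOperator R ∧
    (∀ y, ∃ h : R y ∈ D.domain, D ⟨R y, h⟩ - z • R y = y) ∧
    ∀ x : D.domain, R (D x - z • (x : H)) = x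

/-- The operator `J T J⁻¹`. -/
def conjBy (J : H ≃ₗᵢ⋆[ℂ] H) (T : H →L[ℂ] H) : H →L[ℂ] H :=
  (J.toContinuousLinearEquiv : H →L⋆[ℂ] H).comp
    (T.comp (J.symm.toContinuousLinearEquiv : H →L⋆[ℂ] H))

theorem conjBy_apply (J : H ≃ₗᵢ⋆[ℂ] H) (T : H →L[ℂ] H) (x : H) :
    conjBy J T x = J (T (J.symm x)) := rfl

/-- `J` is the antiunitary part of the antilinear operator `T` with domain `M`: the closure of `T`
has the polar decomposition `J P` with `P` positive, self-adjoint and injective, and with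
core `M`. -/
def IsAntiunitaryPart (M : Submodule ℂ H) (T : M →ₗ⋆[ℂ] M) (J : H ≃ₗᵢ⋆[ℂ] H) : Prop :=
  ∃ P : H →ₗ.[ℂ] H, IsSelfAdjoint P ∧ (∀ x : P.domain, 0 ≤ (inner ℂ (x : H) (P x)).re) ∧
    (∀ x : P.domain, P x = 0 → x = 0) ∧ P.HasCore M ∧
    ∀ (v : M) (hv : (v : H) ∈ P.domain), (T v : H) = J (P ⟨v, hv⟩)

variable {U A : Type*} [Ring U] [HopfAlgebra ℂ U] [StarRing U] [Ring A] [Algebra ℂ A] [StarRing A]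

/-- The map `h ↦ h ▷ a`. -/
def actOn (act : U →ₐ[ℂ] Module.End ℂ A) (a : A) : U →ₗ[ℂ] A := act.toLinearMap.flip a

/-- `A` is a left `U`-module `*`-algebra: `h ▷ (a b) = (h₁ ▷ a) (h₂ ▷ b)`, `h ▷ 1 = ε(h) 1` and
`h ▷ a^* = (S(h)^* ▷ a)^*`. -/
structure IsModuleStarAlgebra (act : U →ₐ[ℂ] Module.End ℂ A) : Prop where
  act_mul : ∀ h a b, act h (a * b) =
    LinearMap.mul' ℂ A (TensorProduct.map (actOn act a) (actOn act b) (Coalgebra.comul (R := ℂ) h))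
  act_one : ∀ h, act h 1 = Coalgebra.counit (R := ℂ) h • (1 : A)
  act_star : ∀ h a, act h (star a) = star (act (star (HopfAlgebraStruct.antipode ℂ h)) a)

/-- The linear map `h₁ ⊗ h₂ ↦ π(h₁ ▷ a) ρ(h₂) v`. -/
def crossedMap (act : U →ₐ[ℂ] Module.End ℂ A) (M : Submodule ℂ H) (ρ : U →ₐ[ℂ] Module.End ℂ M)
    (π : A →⋆ₐ[ℂ] (H →L[ℂ] H)) (a : A) (v : M) : U ⊗[ℂ] U →ₗ[ℂ] H :=
  TensorProduct.lift ((ContinuousLinearMap.coeLM ℂ).compl₁₂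
    (π.toAlgHom.toLinearMap ∘ₗ actOn act a) (M.subtype ∘ₗ ρ.toLinearMap.flip v))

/-- `(A, H, D, γ)` is an even `U`-equivariant spectral triple. The representation of the crossed
product of `A` and `U` on the dense subspace `M` is given by `π` and `ρ`. -/
structure IsEvenEquivariantSpectralTriple (act : U →ₐ[ℂ] Module.End ℂ A) (M : Submodule ℂ H)
    (ρ : U →ₐ[ℂ] Module.End ℂ M) (π : A →⋆ₐ[ℂ] (H →L[ℂ] H)) (D : H →ₗ.[ℂ] H)
    (γ : H →L[ℂ] H) : Prop where
  moduleStarAlgebra : IsModuleStarAlgebra act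
  dense : Dense (M : Set H)
  star_rep : ∀ (h : U) (v w : M), inner ℂ (ρ h v : H) (w : H) = inner ℂ (v : H) (ρ (star h) w : H)
  invariant : ∀ (a : A) (v : M), π a v ∈ M
  crossed : ∀ (h : U) (a : A) (v : M),
    (ρ h ⟨π a v, invariant a v⟩ : H) = crossedMap act M ρ π a v (Coalgebra.comul (R := ℂ) h)
  selfAdjoint : IsSelfAdjoint D
  compactResolvent : HasCompactResolvent D
  le_domain : M ≤ D.domain
  commutator : ∀ a : A, ∃ C : H →L[ℂ] H, IsCommutator D (π a) C
  D_invariant : ∀ v : M, D ⟨v, le_domain v.2⟩ ∈ M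
  D_equivariant : ∀ (h : U) (v : M),
    D ⟨ρ h v, le_domain (ρ h v).2⟩ = ρ h ⟨D ⟨v, le_domain v.2⟩, D_invariant v⟩
  γ_selfAdjoint : IsSelfAdjoint γ
  γ_sq : γ * γ = 1
  γ_odd : ∀ x : D.domain, ∃ h : γ x ∈ D.domain, γ (D x) + D ⟨γ x, h⟩ = 0
  γ_even : ∀ a : A, π a * γ = γ * π a
  γ_invariant : ∀ v : M, γ v ∈ M
  γ_equivariant : ∀ (h : U) (v : M), (ρ h ⟨γ v, γ_invariant v⟩ : H) = γ (ρ h v)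

/-- An antilinear operator on `M` is equivariant if `T ρ(h) = ρ(S(h)^*) T`. -/
def IsEquivariantAntilinear (M : Submodule ℂ H) (ρ : U →ₐ[ℂ] Module.End ℂ M)
    (T : M →ₗ⋆[ℂ] M) : Prop :=
  ∀ (h : U) (v : M), T (ρ h v) = ρ (star (HopfAlgebraStruct.antipode ℂ h)) (T v)

/-- The signs in `J² = ε`, `J D = ε' D J`, `J γ = ε'' γ J` in the even `KO`-dimensions. -/
def KOSigns (k : ZMod 8) (ε ε' ε'' : ℂ) : Prop :=
  (k = 0 ∧ ε = 1 ∧ ε' = 1 ∧ ε'' = 1) ∨ (k = 2 ∧ ε = -1 ∧ ε' = 1 ∧ ε'' = -1) ∨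
  (k = 4 ∧ ε = -1 ∧ ε' = 1 ∧ ε'' = 1) ∨ (k = 6 ∧ ε = 1 ∧ ε' = 1 ∧ ε'' = -1)

/-- `J` is a weak equivariant real structure of `KO`-dimension `k`, with respect to the ideal of
smoothing operators, on an even equivariant spectral triple; `P` is the absolute value of `D`. -/
structure IsWeakEquivariantRealStructure (M : Submodule ℂ H) (ρ : U →ₐ[ℂ] Module.End ℂ M)
    (π : A →⋆ₐ[ℂ] (H →L[ℂ] H)) (D P : H →ₗ.[ℂ] H) (γ : H →L[ℂ] H) (J : H ≃ₗᵢ⋆[ℂ] H)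
    (k : ZMod 8) : Prop where
  modulus : IsModulusOf P D
  signs : ∃ ε ε' ε'' : ℂ, KOSigns k ε ε' ε'' ∧ (∀ v, J (J v) = ε • v) ∧
    (∀ x : D.domain, ∃ h : J x ∈ D.domain, J (D x) = ε' • D ⟨J x, h⟩) ∧
    ∀ v, J (γ v) = ε'' • γ (J v)
  commutant : ∀ a b : A, π a * conjBy J (π b) - conjBy J (π b) * π a ∈ OPNegInfty P
  firstOrder : ∀ a : A, ∃ C : H →L[ℂ] H, IsCommutator D (π a) C ∧ ∀ b : A,
    C * conjBy J (π b) - conjBy J (π b) * C ∈ OPNegInfty P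
  equivariant : ∃ T : M →ₗ⋆[ℂ] M, IsEquivariantAntilinear M ρ T ∧ IsAntiunitaryPart M T J

end Generic

section Monomial

variable {ι : Type*}

/-- The isometry `x ↦ (i ↦ c i * τ (x (σ i)))` of `ℓ²(ι)`, where `|c i| = 1` and `τ` is the
identity or the complex conjugation. -/
def monomialIsometry (τ : ℂ →+* ℂ) [RingHomIsometric τ] (σ : Equiv.Perm ι) (c : ι → ℂ)
    (hc : ∀ i, ‖c i‖ = 1) : lp (fun _ : ι => ℂ) 2 →ₛₗᵢ[τ] lp (fun _ : ι => ℂ) 2 where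
  toFun x := ⟨fun i => c i * τ (x (σ i)), by
    have h := (lp.memℓp x).summable (by norm_num)
    refine memℓp_gen ?_
    simpa [hc, RingHomIsometric.norm_map, Function.comp_def] using h.comp_injective σ.injective⟩
  map_add' x y := by
    ext i
    simp only [lp.coeFn_add, Pi.add_apply, map_add, mul_add]
  map_smul' a x := by
    ext i
    simp [mul_left_comm]
  norm_map' x := by
    rw [lp.norm_eq_tsum_rpow (by norm_num), lp.norm_eq_tsum_rpow (by norm_num)]
    congr 1
    simp only [LinearMap.coe_mk, AddHom.coe_mk, norm_mul, hc, RingHomIsometric.norm_map, one_mul]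
    exact σ.tsum_eq (fun i => ‖x i‖ ^ (2 : ENNReal).toReal)

@[simp] theorem monomialIsometry_apply (τ : ℂ →+* ℂ) [RingHomIsometric τ] (σ : Equiv.Perm ι)
    (c : ι → ℂ) (hc : ∀ i, ‖c i‖ = 1) (x : lp (fun _ : ι => ℂ) 2) (i : ι) :
    monomialIsometry τ σ c hc x i = c i * τ (x (σ i)) := rfl

theorem monomialIsometry_surjective (τ : ℂ →+* ℂ) [RingHomIsometric τ] [RingHomInvPair τ τ]
    (σ : Equiv.Perm ι) (c : ι → ℂ) (hc : ∀ i, ‖c i‖ = 1) :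
    Function.Surjective (monomialIsometry τ σ c hc) := by
  intro y
  refine ⟨monomialIsometry τ σ.symm (fun i => τ (c (σ.symm i))⁻¹) (by
    intro i
    rw [RingHomIsometric.norm_map, norm_inv, hc, inv_one]) y, ?_⟩
  ext i
  have h0 : c i ≠ 0 := by
    intro h
    have := hc i
    simp [h] at this
  simp [h0]

/-- The diagonal operator of `ℓ²(ι)` with real eigenvalues `w i`, on its maximal domain. -/
def diagonalOperator (w : ι → ℝ) : lp (fun _ : ι => ℂ) 2 →ₗ.[ℂ] lp (fun _ : ι => ℂ) 2 where
  domain :=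
    { carrier := {x | Memℓp (fun i => (w i : ℂ) * x i) 2}
      add_mem' := by
        intro x y hx hy
        have h := Memℓp.add hx hy
        simp only [Set.mem_ofPred_eq] at *
        convert h using 1
        ext i
        simp [mul_add]
      zero_mem' := by
        have h := zero_memℓp (E := fun _ : ι => ℂ) (p := 2)
        simp only [Set.mem_ofPred_eq]
        convert h using 1
        ext i
        simp
      smul_mem' := by
        intro a x hx
        have h := Memℓp.const_smul hx a
        simp only [Set.mem_ofPred_eq] at *
        convert h using 1
        ext i
        simp [mul_left_comm] }
  toFun :=
    { toFun := fun x => ⟨fun i => (w i : ℂ) * (x : lp (fun _ : ι => ℂ) 2) i, x.2⟩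
      map_add' := by
        intro x y
        ext i
        simp only [Submodule.coe_add, lp.coeFn_add, Pi.add_apply, mul_add]
      map_smul' := by
        intro a x
        ext i
        simp [mul_left_comm] }

end Monomial

/-! The spinors on the Podleś sphere. -/

/-- The labels `(l, m, ε)` of the basis `|l, m; ε N⟩` of `H_{-N} ⊕ H_N`, with `N = n / 2`, encoded
as `(2 l, 2 m, ε)`: `l - |N|` and `l - |m|` are natural numbers and `ε = ± 1`. -/
def SpinorLabel (n a b : ℤ) : Prop := |n| ≤ a ∧ 2 ∣ a - |n| ∧ |b| ≤ a ∧ 2 ∣ a - |b|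

/-- The index set of the basis `|l, m; ε N⟩`. -/
def SpinorIdx (n : ℤ) : Type := {p : ℤ × ℤ × ℤˣ // SpinorLabel n p.1 p.2.1}

/-- The Hilbert space `H = H_{-N} ⊕ H_N`, with `N = n / 2`. -/
abbrev Spinors (n : ℤ) : Type := lp (fun _ : SpinorIdx n => ℂ) 2

/-- `l - |N| + 1` for the label `(l, m, ε)`. -/
def SpinorIdx.level {n : ℤ} (i : SpinorIdx n) : ℝ := (i.1.1 : ℝ) / 2 - |(n : ℝ) / 2| + 1

theorem SpinorLabel.neg {n a b : ℤ} (h : SpinorLabel n a b) : SpinorLabel n a (-b) := by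
  unfold SpinorLabel at *
  rwa [abs_neg]

/-- `(l, m, ε) ↦ (l, m, -ε)`. -/
def SpinorIdx.flipSign {n : ℤ} : Equiv.Perm (SpinorIdx n) :=
  Function.Involutive.toPerm (fun i => ⟨(i.1.1, i.1.2.1, -i.1.2.2), i.2⟩)
    (fun i => by apply Subtype.ext; simp)

/-- `(l, m, ε) ↦ (l, -m, -ε)`. -/
def SpinorIdx.flipBoth {n : ℤ} : Equiv.Perm (SpinorIdx n) :=
  Function.Involutive.toPerm (fun i => ⟨(i.1.1, -i.1.2.1, -i.1.2.2), i.2.neg⟩)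
    (fun i => by apply Subtype.ext; simp)

open Classical in
/-- The basis vector with a given label. -/
def spinorBasis {n : ℤ} (i : SpinorIdx n) : Spinors n := lp.single 2 i (1 : ℂ)

open Classical in
/-- The basis vector `|l, m; ε N⟩` with `a = 2 l` and `b = 2 m`; it is `0` for labels that do not
occur. -/
def ket (n a b : ℤ) (ε : ℤˣ) : Spinors n :=
  if h : SpinorLabel n a b then spinorBasis ⟨(a, b, ε), h⟩ else 0

/-- The sign `F |l, m; ± N⟩ = |l, m; ∓ N⟩` of the Dirac operator. -/
def signOperator (n : ℤ) : Spinors n →L[ℂ] Spinors n :=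
  (monomialIsometry (RingHom.id ℂ) SpinorIdx.flipSign (fun _ => 1)
    (fun _ => norm_one)).toContinuousLinearMap

/-- The operator `|D|`, with `|D| |l, m; ± N⟩ = (l - |N| + 1) |l, m; ± N⟩`. -/
def absDirac (n : ℤ) : Spinors n →ₗ.[ℂ] Spinors n := diagonalOperator SpinorIdx.level

/-- The Dirac operator `D = F |D|`, that is `D |l, m; ± N⟩ = (l - |N| + 1) |l, m; ∓ N⟩`. -/
def dirac (n : ℤ) : Spinors n →ₗ.[ℂ] Spinors n :=
  (signOperator n).toLinearMap.compPMap (absDirac n)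

/-- The grading `γ`, which is `1` on `H_{-N}` and `-1` on `H_N`. -/
def grading (n : ℤ) : Spinors n →L[ℂ] Spinors n :=
  (monomialIsometry (RingHom.id ℂ) (Equiv.refl _) (fun i => -((i.1.2.2 : ℤ) : ℂ)) (by
    intro i
    rcases Int.units_eq_one_or i.1.2.2 with h | h <;> simp [h])).toContinuousLinearMap

theorem norm_neg_one_zpow (k : ℤ) : ‖(-1 : ℂ) ^ k‖ = 1 := by simp

/-- The antiunitary operator `J`, with `J |l, m; ± N⟩ = (-1)^{m + N} |l, -m; ∓ N⟩`. -/
def realStructure (n : ℤ) : Spinors n ≃ₗᵢ⋆[ℂ] Spinors n :=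
  LinearIsometryEquiv.ofSurjective
    (monomialIsometry (starRingEnd ℂ) SpinorIdx.flipBoth
      (fun i => (-1 : ℂ) ^ ((-i.1.2.1 + n) / 2)) (fun _ => norm_neg_one_zpow _))
    (monomialIsometry_surjective _ _ _ _)

theorem spinorBasis_self {n : ℤ} (i : SpinorIdx n) : spinorBasis i i = 1 := by
  classical
  exact lp.single_apply_self _ _ _

theorem spinorBasis_ne {n : ℤ} {i j : SpinorIdx n} (h : i ≠ j) : spinorBasis j i = 0 := by
  classical
  exact lp.single_apply_ne _ _ _ h

theorem ket_apply_self {n a b : ℤ} {ε : ℤˣ} {i : SpinorIdx n} (h : i.1 = (a, b, ε)) :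
    ket n a b ε i = 1 := by
  have h1 : SpinorLabel n a b := by
    have h2 := i.2
    rw [h] at h2
    exact h2
  have h3 : i = ⟨(a, b, ε), h1⟩ := Subtype.ext h
  rw [ket, dif_pos h1, h3]
  exact spinorBasis_self _

theorem ket_apply_ne {n a b : ℤ} {ε : ℤˣ} {i : SpinorIdx n} (h : i.1 ≠ (a, b, ε)) :
    ket n a b ε i = 0 := by
  unfold ket
  split_ifs with h1
  · exact spinorBasis_ne fun h2 => h (congrArg Subtype.val h2)
  · rfl

theorem grading_ket (n a b : ℤ) (ε : ℤˣ) :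
    grading n (ket n a b ε) = -((ε : ℤ) : ℂ) • ket n a b ε := by
  ext i
  have key : grading n (ket n a b ε) i = -((i.1.2.2 : ℤ) : ℂ) * ket n a b ε i := rfl
  have key2 : (-((ε : ℤ) : ℂ) • ket n a b ε) i = -((ε : ℤ) : ℂ) * ket n a b ε i := rfl
  rw [key, key2]
  by_cases h : i.1 = (a, b, ε)
  · rw [h]
  · rw [ket_apply_ne h, mul_zero, mul_zero]

theorem realStructure_ket (n a b : ℤ) (ε : ℤˣ) :
    realStructure n (ket n a b ε) = (-1 : ℂ) ^ ((b + n) / 2) • ket n a (-b) (-ε) := by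
  ext i
  have e : ((SpinorIdx.flipBoth i).1 = (a, b, ε)) ↔ i.1 = (a, -b, -ε) := by
    obtain ⟨⟨a', b', ε'⟩, hi⟩ := i
    change (a', -b', -ε') = (a, b, ε) ↔ (a', b', ε') = (a, -b, -ε)
    simp [Prod.ext_iff, neg_eq_iff_eq_neg]
  have key : realStructure n (ket n a b ε) i = (-1 : ℂ) ^ ((-i.1.2.1 + n) / 2) *
      starRingEnd ℂ (ket n a b ε (SpinorIdx.flipBoth i)) := rfl
  have key2 : ((-1 : ℂ) ^ ((b + n) / 2) • ket n a (-b) (-ε)) i =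
      (-1 : ℂ) ^ ((b + n) / 2) * ket n a (-b) (-ε) i := rfl
  rw [key, key2]
  by_cases h : i.1 = (a, -b, -ε)
  · rw [ket_apply_self h, ket_apply_self (e.2 h), h, neg_neg, map_one]
  · rw [ket_apply_ne h, ket_apply_ne (mt e.1 h), map_zero, mul_zero, mul_zero]

theorem ket_mem_absDirac_domain (n a b : ℤ) (ε : ℤˣ) : ket n a b ε ∈ (absDirac n).domain := by
  refine memℓp_gen (summable_of_hasFiniteSupport (Set.Finite.subset
    ((Set.finite_singleton (a, b, ε)).preimage Subtype.val_injective.injOn) ?_))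
  intro i hi
  by_contra h
  have h0 : ket n a b ε i = 0 := ket_apply_ne h
  refine hi ?_
  change ‖(SpinorIdx.level i : ℂ) * ket n a b ε i‖ ^ (2 : ENNReal).toReal = 0
  rw [h0]
  norm_num

theorem dirac_ket (n a b : ℤ) (ε : ℤˣ) :
    dirac n ⟨ket n a b ε, ket_mem_absDirac_domain n a b ε⟩ =
      (((a : ℝ) / 2 - |(n : ℝ) / 2| + 1 : ℝ) : ℂ) • ket n a b (-ε) := by
  ext i
  have e : ((SpinorIdx.flipSign i).1 = (a, b, ε)) ↔ i.1 = (a, b, -ε) := by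
    obtain ⟨⟨a', b', ε'⟩, hi⟩ := i
    change (a', b', -ε') = (a, b, ε) ↔ (a', b', ε') = (a, b, -ε)
    simp [Prod.ext_iff, neg_eq_iff_eq_neg]
  have key : dirac n ⟨ket n a b ε, ket_mem_absDirac_domain n a b ε⟩ i =
      ((SpinorIdx.flipSign i).level : ℂ) * ket n a b ε (SpinorIdx.flipSign i) :=
    one_mul _
  have key2 : ((((a : ℝ) / 2 - |(n : ℝ) / 2| + 1 : ℝ) : ℂ) • ket n a b (-ε)) i =
      (((a : ℝ) / 2 - |(n : ℝ) / 2| + 1 : ℝ) : ℂ) * ket n a b (-ε) i := rfl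
  rw [key, key2]
  by_cases h : i.1 = (a, b, -ε)
  · rw [ket_apply_self h, ket_apply_self (e.2 h), SpinorIdx.level, e.2 h]
  · rw [ket_apply_ne h, ket_apply_ne (mt e.1 h), mul_zero, mul_zero]

/-! The action of `U_q(su(2))` on finite sums of basis vectors. -/

/-- The `q`-number `[x]`. -/
def qNum (q x : ℝ) : ℝ := (q ^ x - q ^ (-x)) / (q - q⁻¹)

open Classical in
/-- The formal basis vector `|l, m; ε N⟩`; it is `0` for labels that do not occur. -/
def formalKet (n a b : ℤ) (ε : ℤˣ) : SpinorIdx n →₀ ℂ :=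
  if h : SpinorLabel n a b then Finsupp.single ⟨(a, b, ε), h⟩ 1 else 0

/-- The coefficient `([l - m] [l + m + 1])^{1/2}` for `a = 2 l` and `b = 2 m`. -/
def ladderCoeff (q : ℝ) (a b : ℤ) : ℝ :=
  √(qNum q ((a : ℝ) / 2 - (b : ℝ) / 2) * qNum q ((a : ℝ) / 2 + (b : ℝ) / 2 + 1))

/-- `K^c |l, m; ε N⟩ = q^{c m} |l, m; ε N⟩`. -/
def formalK (q : ℝ) (n : ℤ) (c : ℝ) : Module.End ℂ (SpinorIdx n →₀ ℂ) :=
  Finsupp.linearCombination ℂ fun i =>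
    ((q ^ (c * ((i.1.2.1 : ℝ) / 2)) : ℝ) : ℂ) • formalKet n i.1.1 i.1.2.1 i.1.2.2

/-- `E |l, m; ε N⟩ = ([l - m] [l + m + 1])^{1/2} |l, m + 1; ε N⟩`. -/
def formalE (q : ℝ) (n : ℤ) : Module.End ℂ (SpinorIdx n →₀ ℂ) :=
  Finsupp.linearCombination ℂ fun i =>
    (ladderCoeff q i.1.1 i.1.2.1 : ℂ) • formalKet n i.1.1 (i.1.2.1 + 2) i.1.2.2

/-- `F |l, m; ε N⟩ = ([l + m] [l - m + 1])^{1/2} |l, m - 1; ε N⟩`. -/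
def formalF (q : ℝ) (n : ℤ) : Module.End ℂ (SpinorIdx n →₀ ℂ) :=
  Finsupp.linearCombination ℂ fun i =>
    (ladderCoeff q i.1.1 (-i.1.2.1) : ℂ) • formalKet n i.1.1 (i.1.2.1 - 2) i.1.2.2

theorem formal_ext {n : ℤ} {f g : Module.End ℂ (SpinorIdx n →₀ ℂ)}
    (h : ∀ a b ε, SpinorLabel n a b → f (formalKet n a b ε) = g (formalKet n a b ε)) : f = g := by
  refine Finsupp.lhom_ext' fun i => LinearMap.ext_ring ?_
  have := h i.1.1 i.1.2.1 i.1.2.2 i.2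
  have e : formalKet n i.1.1 i.1.2.1 i.1.2.2 = Finsupp.single i 1 := dif_pos i.2
  rw [e] at this
  simpa using this

theorem formalKet_eq_zero {n a b : ℤ} (ε : ℤˣ) (h : ¬ SpinorLabel n a b) :
    formalKet n a b ε = 0 := dif_neg h

theorem linearCombination_formalKet {n a b : ℤ} (ε : ℤˣ) (h : SpinorLabel n a b)
    (f : SpinorIdx n → SpinorIdx n →₀ ℂ) :
    Finsupp.linearCombination ℂ f (formalKet n a b ε) = f ⟨(a, b, ε), h⟩ := by
  rw [formalKet, dif_pos h]
  exact (Finsupp.linearCombination_single ℂ _ _).trans (one_smul ℂ _)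

theorem formalK_formalKet (q : ℝ) (n a b : ℤ) (c : ℝ) (ε : ℤˣ) :
    formalK q n c (formalKet n a b ε) =
      ((q ^ (c * ((b : ℝ) / 2)) : ℝ) : ℂ) • formalKet n a b ε := by
  by_cases h : SpinorLabel n a b
  · exact linearCombination_formalKet ε h _
  · simp [formalKet_eq_zero ε h]

theorem ladderCoeff_self (q : ℝ) (a : ℤ) : ladderCoeff q a a = 0 := by
  simp [ladderCoeff, qNum]

theorem formalE_formalKet (q : ℝ) {n a b : ℤ} (ε : ℤˣ) (h : SpinorLabel n a b) :
    formalE q n (formalKet n a b ε) =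
      (ladderCoeff q a b : ℂ) • formalKet n a (b + 2) ε := linearCombination_formalKet ε h _

theorem formalF_formalKet (q : ℝ) {n a b : ℤ} (ε : ℤˣ) (h : SpinorLabel n a b) :
    formalF q n (formalKet n a b ε) =
      (ladderCoeff q a (-b) : ℂ) • formalKet n a (b - 2) ε := linearCombination_formalKet ε h _

theorem qNum_nonneg {q x : ℝ} (h0 : 0 < q) (h1 : q < 1) (hx : 0 ≤ x) : 0 ≤ qNum q x := by
  refine div_nonneg_of_nonpos ?_ ?_
  · have := Real.rpow_le_rpow_of_exponent_ge h0 h1.le (by linarith : -x ≤ x)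
    linarith
  · have : 1 < q⁻¹ := (one_lt_inv₀ h0).2 h1
    linarith

theorem ladderCoeff_sq {q : ℝ} (h0 : 0 < q) (h1 : q < 1) {a b : ℤ} (h : |b| ≤ a) :
    ladderCoeff q a b ^ 2 =
      qNum q ((a : ℝ) / 2 - (b : ℝ) / 2) * qNum q ((a : ℝ) / 2 + (b : ℝ) / 2 + 1) := by
  have ⟨h2, h3⟩ := abs_le.1 h
  have h2' : -(a : ℝ) ≤ b := by exact_mod_cast h2
  have h3' : (b : ℝ) ≤ a := by exact_mod_cast h3
  exact Real.sq_sqrt (mul_nonneg (qNum_nonneg h0 h1 (by linarith))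
    (qNum_nonneg h0 h1 (by linarith)))

theorem SpinorLabel.up {n a b : ℤ} (h : SpinorLabel n a b) (hb : b ≠ a) :
    SpinorLabel n a (b + 2) := by
  unfold SpinorLabel at *
  rcases abs_cases b with h1 | h1 <;> rcases abs_cases (b + 2) with h2 | h2 <;> omega

theorem SpinorLabel.down {n a b : ℤ} (h : SpinorLabel n a b) (hb : b ≠ -a) :
    SpinorLabel n a (b - 2) := by
  unfold SpinorLabel at *
  rcases abs_cases b with h1 | h1 <;> rcases abs_cases (b - 2) with h2 | h2 <;> omega

theorem ladderCoeff_symm (q : ℝ) (a b : ℤ) : ladderCoeff q a (-(b + 2)) = ladderCoeff q a b := by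
  unfold ladderCoeff
  rw [mul_comm]
  push_cast
  congr 3 <;> ring

theorem formalF_formalE {q : ℝ} {n a b : ℤ} (ε : ℤˣ) (h : SpinorLabel n a b) :
    formalF q n (formalE q n (formalKet n a b ε)) =
      ((ladderCoeff q a b ^ 2 : ℝ) : ℂ) • formalKet n a b ε := by
  rw [formalE_formalKet q ε h, map_smul]
  by_cases hb : b = a
  · subst hb
    simp [ladderCoeff_self]
  · rw [formalF_formalKet q ε (h.up hb), ladderCoeff_symm, smul_smul, add_sub_cancel_right]
    push_cast
    rw [pow_two]

theorem formalE_formalF {q : ℝ} {n a b : ℤ} (ε : ℤˣ) (h : SpinorLabel n a b) :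
    formalE q n (formalF q n (formalKet n a b ε)) =
      ((ladderCoeff q a (-b) ^ 2 : ℝ) : ℂ) • formalKet n a b ε := by
  rw [formalF_formalKet q ε h, map_smul]
  by_cases hb : b = -a
  · subst hb
    simp [ladderCoeff_self]
  · have e := ladderCoeff_symm q a (b - 2)
    rw [formalE_formalKet q ε (h.down hb), ← e, smul_smul, sub_add_cancel]
    push_cast
    rw [pow_two]

theorem qNum_identity {q : ℝ} (h0 : 0 < q) (h1 : q < 1) (l m : ℝ) :
    qNum q (l + m) * qNum q (l - m + 1) - qNum q (l - m) * qNum q (l + m + 1) =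
      (q - q⁻¹)⁻¹ * (q ^ m * q ^ m - q ^ (-m) * q ^ (-m)) := by
  have hq : q - q⁻¹ ≠ 0 := by
    have : 1 < q⁻¹ := (one_lt_inv₀ h0).2 h1
    linarith
  have hq2 : q ^ 2 - 1 ≠ 0 := by nlinarith
  have hl := Real.rpow_pos_of_pos h0 l
  have hm := Real.rpow_pos_of_pos h0 m
  unfold qNum
  simp only [neg_add, neg_sub, sub_eq_add_neg, neg_neg, Real.rpow_add h0, Real.rpow_neg h0.le,
    Real.rpow_one]
  rw [← sub_eq_add_neg q] 
  field_simp
  ring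

/-- The representation of `U_q(su(2))` on finite formal sums of basis vectors. -/
def formalAction (q : Set.Ioo (0 : ℝ) 1) (n : ℤ) :
    Uq q →ₐ[ℂ] Module.End ℂ (SpinorIdx n →₀ ℂ) :=
  Uq.lift q (fun x => match x with
    | .K => formalK q n 1
    | .Kinv => formalK q n (-1)
    | .E => formalE q n
    | .F => formalF q n)
    (formal_ext fun a b ε h => by
      have h0 := q.2.1
      simp [formalK_formalKet, smul_smul, ← Complex.ofReal_mul, -Complex.coe_smul,
        ← Real.rpow_add h0])
    (formal_ext fun a b ε h => by
      have h0 := q.2.1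
      simp [formalK_formalKet, smul_smul, ← Complex.ofReal_mul, -Complex.coe_smul,
        ← Real.rpow_add h0])
    (formal_ext fun a b ε h => by
      have h0 := q.2.1
      have e : (q : ℝ) ^ (-1 * ((b : ℝ) / 2)) * (q : ℝ) ^ (1 * (((b + 2 : ℤ) : ℝ) / 2)) = q := by
        rw [← Real.rpow_add h0]
        push_cast
        rw [show -1 * ((b : ℝ) / 2) + 1 * (((b : ℝ) + 2) / 2) = 1 by ring, Real.rpow_one]
      simp only [Module.End.mul_apply, LinearMap.smul_apply, formalK_formalKet,
        formalE_formalKet _ ε h, map_smul, smul_smul, qC]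
      congr 1
      rw [mul_left_comm, ← Complex.ofReal_mul, e, mul_comm])
    (formal_ext fun a b ε h => by
      have h0 := q.2.1
      have e : (q : ℝ) ^ (1 * ((b : ℝ) / 2)) * (q : ℝ) ^ (-1 * (((b - 2 : ℤ) : ℝ) / 2)) = q := by
        rw [← Real.rpow_add h0]
        push_cast
        rw [show 1 * ((b : ℝ) / 2) + -1 * (((b : ℝ) - 2) / 2) = 1 by ring, Real.rpow_one]
      simp only [Module.End.mul_apply, LinearMap.smul_apply, formalK_formalKet,
        formalF_formalKet _ ε h, map_smul, smul_smul, qC]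
      congr 1
      rw [mul_left_comm, ← Complex.ofReal_mul, e, mul_comm])
    (formal_ext fun a b ε h => by
      have h0 := q.2.1
      have h1 := q.2.2
      have e := qNum_identity h0 h1 ((a : ℝ) / 2) ((b : ℝ) / 2)
      simp only [Module.End.mul_apply, LinearMap.smul_apply, LinearMap.sub_apply,
        formalK_formalKet, formalE_formalF ε h, formalF_formalE ε h, map_smul, smul_smul, qC,
        ← sub_smul]
      congr 1
      rw [ladderCoeff_sq h0 h1 h.2.2.1, ladderCoeff_sq h0 h1 (by rw [abs_neg]; exact h.2.2.1)]
      have e1 : (a : ℝ) / 2 - ((-b : ℤ) : ℝ) / 2 = a / 2 + b / 2 := by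
        push_cast
        ring
      have e2 : (a : ℝ) / 2 + ((-b : ℤ) : ℝ) / 2 + 1 = a / 2 - b / 2 + 1 := by
        push_cast
        ring
      rw [e1, e2]
      simp only [one_mul, neg_mul]
      exact_mod_cast e)

/-- The inclusion of finite formal sums into the Hilbert space. -/
def formalInclusion (n : ℤ) : (SpinorIdx n →₀ ℂ) →ₗ[ℂ] Spinors n :=
  Finsupp.linearCombination ℂ spinorBasis

theorem formalInclusion_apply {n : ℤ} (x : SpinorIdx n →₀ ℂ) (i : SpinorIdx n) :
    formalInclusion n x i = x i := by
  classical
  induction x using Finsupp.induction_linear with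
  | zero => simp
  | add f g hf hg => simp [hf, hg]
  | single j c =>
    by_cases h : i = j
    · subst h
      simp [formalInclusion, spinorBasis_self]
    · simp [formalInclusion, spinorBasis_ne h, Finsupp.single_apply, Ne.symm h]

theorem formalInclusion_injective (n : ℤ) : Function.Injective (formalInclusion n) := by
  intro x y h
  ext i
  rw [← formalInclusion_apply, h, formalInclusion_apply]

/-- The dense subspace of finite linear combinations of the basis vectors. -/
def finiteSpinors (n : ℤ) : Submodule ℂ (Spinors n) := LinearMap.range (formalInclusion n)

/-- The representation of `U_q(su(2))` on the finite linear combinations of basis vectors, where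
each `|l, · ; ± N⟩` spans a copy of the irreducible representation `V_l`. -/
def spinorAction (q : Set.Ioo (0 : ℝ) 1) (n : ℤ) : Uq q →ₐ[ℂ] Module.End ℂ (finiteSpinors n) :=
  ((LinearEquiv.ofInjective (formalInclusion n)
    (formalInclusion_injective n)).conjAlgEquiv ℂ).toAlgHom.comp (formalAction q n)

/-! The representation of the coordinate algebra on spinors. -/

/-- The coefficient `α_{N,l}(s)`. -/
def coeffAlpha (q s N l : ℝ) : ℝ :=
  1 / qNum q (2 * l) *
    √(qNum q 2 * qNum q (l + N) * qNum q (l - N) / (qNum q (2 * l - 1) * qNum q (2 * l + 1))) *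
    √((q ^ (l + N) + q ^ (-(l + N)) * s ^ 2) * (q ^ (l - N) * s ^ 2 + q ^ (-(l - N))))

/-- The coefficient `β_{N,l}(s)`. -/
def coeffBeta (q s N l : ℝ) : ℝ :=
  ((qNum q (2 * l) - q ^ (l + N + 1) * qNum q 2 * qNum q (l - N)) * (1 - s ^ 2)
      + q * qNum q 2 * qNum q (2 * N) * s ^ 2) /
    (q ^ 2 * qNum q (2 * l) * qNum q (2 * l + 2))

/-- The coefficient `A⁺_{l,m}`. -/
def coeffAplus (q s N l m : ℝ) : ℝ :=
  q ^ m * √(qNum q 2 * qNum q (l - m + 1) * qNum q (l + m + 1)) * coeffAlpha q s N (l + 1)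

/-- The coefficient `A⁰_{l,m}`. -/
def coeffAzero (q s N l m : ℝ) : ℝ :=
  (qNum q (2 * l) - q ^ (l + m + 1) * qNum q 2 * qNum q (l - m)) * coeffBeta q s N l

/-- The coefficient `B⁺_{l,m}`. -/
def coeffBplus (q s N l m : ℝ) : ℝ :=
  q ^ (-l + m) * √(qNum q (l + m + 1) * qNum q (l + m + 2)) * coeffAlpha q s N (l + 1)

/-- The coefficient `B⁰_{l,m}`. -/
def coeffBzero (q s N l m : ℝ) : ℝ :=
  -q ^ (m + 2) * √(qNum q 2 * qNum q (l - m) * qNum q (l + m + 1)) * coeffBeta q s N l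

/-- The coefficient `B⁻_{l,m}`. -/
def coeffBminus (q s N l m : ℝ) : ℝ :=
  -q ^ (l + m + 1) * √(qNum q (l - m) * qNum q (l - m - 1)) * coeffAlpha q s N l

/-- The element `x₁ = (q [2])^{1/2} B`. -/
def PodlesAlg.x1 (q : Set.Ioo (0 : ℝ) 1) (s : ℝ) : PodlesAlg q s :=
  ((√(q * qNum q 2) : ℝ) : ℂ) • PodlesAlg.B q s

/-- The element `x₀ = -q [2] A + (1 - s²)`. -/
def PodlesAlg.x0 (q : Set.Ioo (0 : ℝ) 1) (s : ℝ) : PodlesAlg q s :=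
  -((q * qNum q 2 : ℝ) : ℂ) • PodlesAlg.A q s + ((1 - s ^ 2 : ℝ) : ℂ) • 1

/-- `π` is the representation on `H_{-N} ⊕ H_N` determined by its values on the generators
`x₁` and `x₀`. -/
def IsSpinorRep (q : Set.Ioo (0 : ℝ) 1) (s : ℝ) (n : ℤ)
    (π : PodlesAlg q s →⋆ₐ[ℂ] (Spinors n →L[ℂ] Spinors n)) : Prop :=
  ∀ (a b : ℤ) (ε : ℤˣ), SpinorLabel n a b →
    ∀ l m N : ℝ, l = (a : ℝ) / 2 → m = (b : ℝ) / 2 → N = ((ε : ℤ) : ℝ) * ((n : ℝ) / 2) →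
    π (PodlesAlg.x1 q s) (ket n a b ε) =
      (coeffBplus q s N l m : ℂ) • ket n (a + 2) (b + 2) ε +
      (coeffBzero q s N l m : ℂ) • ket n a (b + 2) ε +
      (coeffBminus q s N l m : ℂ) • ket n (a - 2) (b + 2) ε ∧
    π (PodlesAlg.x0 q s) (ket n a b ε) =
      (coeffAplus q s N l m : ℂ) • ket n (a + 2) b ε +
      (coeffAzero q s N l m : ℂ) • ket n a b ε +
      (coeffAplus q s N (l - 1) m : ℂ) • ket n (a - 2) b ε

end

/-! Write a = 2l and b = 2m. Every operator that occurs is a finite sum of weighted shifts (a, b, ε)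
↦ (a + p, b + r, εη), formalized as `IsShift`. A shift whose weights decay faster than every power
of a is smoothing: commuting with |D| only multiplies it by p/2, and multiplying by |D| on the left
changes the weights by a factor of linear growth (`rapidSpan_subset_OPNegInfty`).

The commutation relations modulo smoothing operators come from a separation of variables. After
powers of q are extracted, α_l and β_l become functions of x = q^{2l} which converge to s and q(1 -
s²) with an error O(q^l). Hence each homogeneous component of A and B has, up to O(q^l), weights
depending on l + m alone. These decay exponentially in l + m, except for the component of B raising
l and m together: its weights converge exponentially to a constant, and it fixes l - m. Such
operators form `oneSidedSpan` with σ = 1. Conjugation by J replaces m by -m and leads to σ = -1.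
Elements of opposite classes commute modulo smoothing operators
(`oneSidedSpan_commutator_mem_rapidSpan`). Indeed two decaying weights multiply to something
exponentially small in (l + m) + (l - m) = 2l. A constant shift of one class leaves unchanged the
variable on which the weights of the other class depend, so both orders of multiplication carry the
same weight and differ only by the admissibility of the intermediate label; this happens near an
edge of the label set, where the weight is already O(q^l).

For the first-order condition let F be the sign of D, so that [D, T] = F[|D|, T] + [F, T]|D|. The
limiting weights do not see ε, so [F, T] is smoothing, and [|D|, T] stays in the class of T. The
Leibniz rule passes from generators to the whole algebra.

Existence of the representation: the defining relations split according to the change of l, and each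
component is a scalar identity between weights. All these identities follow from a recursion for β
and two relations between α² and β (`betaReduced_recursion`, `alpha_beta_relation`,
`alpha_beta_quadratic`). Uniqueness holds because the basis spans a dense subspace. Equivariance is
verified for K and E against A and B and for F against B; taking adjoints gives the other pairs of
generators, and compatibility of the coproduct with products gives the rest. Finally T = JP with P =
q^{m+N} diagonal, and the factor -q gained when m increases by 1 is the one in S(E) = -qE. -/

noncomputable section

/-- The coefficient of `x` at the label `(a, b, ε)`; it is `0` for labels that do not occur. -/
def coord {n : ℤ} (x : Spinors n) (a b : ℤ) (ε : ℤˣ) : ℂ :=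
  open Classical in if h : SpinorLabel n a b then x ⟨(a, b, ε), h⟩ else 0

/-! ### Coordinates, extended by zero to all of ℤ × ℤ × ℤˣ. -/

section Coordinates

variable {n : ℤ}

theorem coord_of_label (x : Spinors n) {a b : ℤ} (ε : ℤˣ) (h : SpinorLabel n a b) :
    coord x a b ε = x ⟨(a, b, ε), h⟩ := dif_pos h

theorem coord_of_not_label (x : Spinors n) {a b : ℤ} (ε : ℤˣ) (h : ¬ SpinorLabel n a b) :
    coord x a b ε = 0 := dif_neg h

theorem coord_idx (x : Spinors n) (i : SpinorIdx n) : coord x i.1.1 i.1.2.1 i.1.2.2 = x i :=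
  dif_pos i.2

theorem coord_add (x y : Spinors n) (a b : ℤ) (ε : ℤˣ) :
    coord (x + y) a b ε = coord x a b ε + coord y a b ε := by
  by_cases h : SpinorLabel n a b
  · simp only [coord_of_label _ _ h]
    rfl
  · simp [coord_of_not_label _ _ h]

theorem coord_sub (x y : Spinors n) (a b : ℤ) (ε : ℤˣ) :
    coord (x - y) a b ε = coord x a b ε - coord y a b ε := by
  by_cases h : SpinorLabel n a b
  · simp only [coord_of_label _ _ h]
    rfl
  · simp [coord_of_not_label _ _ h]

theorem coord_smul (c : ℂ) (x : Spinors n) (a b : ℤ) (ε : ℤˣ) :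
    coord (c • x) a b ε = c * coord x a b ε := by
  by_cases h : SpinorLabel n a b
  · simp only [coord_of_label _ _ h]
    rfl
  · simp [coord_of_not_label _ _ h]

theorem ext_coord {x y : Spinors n}
    (h : ∀ a b ε, SpinorLabel n a b → coord x a b ε = coord y a b ε) : x = y := by
  ext i
  rw [← coord_idx, ← coord_idx]
  exact h _ _ _ i.2

theorem coord_ket_self {a b : ℤ} (ε : ℤˣ) (h : SpinorLabel n a b) :
    coord (ket n a b ε) a b ε = 1 := by
  rw [coord_of_label _ _ h]
  exact ket_apply_self rfl

theorem ket_eq_zero {a b : ℤ} (ε : ℤˣ) (h : ¬ SpinorLabel n a b) : ket n a b ε = 0 := dif_neg h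

theorem coord_ket_ne {a b a' b' : ℤ} {ε ε' : ℤˣ} (h : (a', b', ε') ≠ (a, b, ε)) :
    coord (ket n a b ε) a' b' ε' = 0 := by
  by_cases h' : SpinorLabel n a' b'
  · rw [coord_of_label _ _ h']
    exact ket_apply_ne h
  · exact coord_of_not_label _ _ h'

theorem spinorBasis_eq_ket (i : SpinorIdx n) : spinorBasis i = ket n i.1.1 i.1.2.1 i.1.2.2 := by
  rw [ket, dif_pos i.2]
  rfl

theorem inner_ket_left (a b : ℤ) (ε : ℤˣ) (x : Spinors n) :
    inner ℂ (ket n a b ε) x = coord x a b ε := by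
  classical
  by_cases h : SpinorLabel n a b
  · rw [coord_of_label _ _ h, ket, dif_pos h]
    unfold spinorBasis
    refine (lp.inner_single_left (𝕜 := ℂ) (G := fun _ : SpinorIdx n => ℂ) _ (1 : ℂ) x).trans ?_
    simp
  · rw [coord_of_not_label _ _ h, ket_eq_zero _ h, inner_zero_left]

theorem norm_ket_le (a b : ℤ) (ε : ℤˣ) : ‖ket n a b ε‖ ≤ 1 := by
  by_cases h : SpinorLabel n a b
  · have h1 : inner ℂ (ket n a b ε) (ket n a b ε) = (1 : ℂ) := by
      rw [inner_ket_left, coord_ket_self _ h]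
    have h2 := inner_self_eq_norm_sq_to_K (𝕜 := ℂ) (ket n a b ε)
    rw [h1] at h2
    have h3 : ‖ket n a b ε‖ ^ 2 = 1 := by
      have h4 : (1 : ℂ) = ((‖ket n a b ε‖ ^ 2 : ℝ) : ℂ) := by
        rw [h2]
        simp
      exact_mod_cast h4.symm
    nlinarith [norm_nonneg (ket n a b ε)]
  · simp [ket_eq_zero _ h]

theorem norm_coord_le (x : Spinors n) (a b : ℤ) (ε : ℤˣ) : ‖coord x a b ε‖ ≤ ‖x‖ := by
  rw [← inner_ket_left]
  exact (norm_inner_le_norm _ _).trans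
    (mul_le_of_le_one_left (norm_nonneg _) (norm_ket_le a b ε))

/-- The closed linear span of the basis vectors is everything. -/
theorem dense_finiteSpinors (n : ℤ) : Dense (finiteSpinors n : Set (Spinors n)) := by
  classical
  intro x
  have h := lp.hasSum_single (E := fun _ : SpinorIdx n => ℂ) (p := 2) (by norm_num) x
  refine mem_closure_of_tendsto h (Filter.Eventually.of_forall fun s => ?_)
  refine Submodule.sum_mem _ fun i _ => ⟨Finsupp.single i (x i), ?_⟩
  rw [formalInclusion, Finsupp.linearCombination_single]
  ext j
  by_cases hj : j = i
  · subst hj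
    simp [spinorBasis_self]
  · simp [spinorBasis_ne hj, hj]

theorem ket_mem_finiteSpinors (a b : ℤ) (ε : ℤˣ) : ket n a b ε ∈ finiteSpinors n := by
  by_cases h : SpinorLabel n a b
  · refine ⟨formalKet n a b ε, ?_⟩
    rw [formalKet, dif_pos h, ket, dif_pos h]
    exact (Finsupp.linearCombination_single ℂ _ _).trans (one_smul ℂ _)
  · rw [ket_eq_zero _ h]
    exact zero_mem _

/-- Induction on finite linear combinations of basis vectors. -/
theorem finiteSpinors_induction {p : Spinors n → Prop}
    (hket : ∀ a b ε, SpinorLabel n a b → p (ket n a b ε)) (hzero : p 0)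
    (hadd : ∀ x y, p x → p y → p (x + y)) (hsmul : ∀ (c : ℂ) x, p x → p (c • x))
    {x : Spinors n} (hx : x ∈ finiteSpinors n) : p x := by
  obtain ⟨y, rfl⟩ := hx
  induction y using Finsupp.induction_linear with
  | zero => simpa using hzero
  | add f g hf hg => rw [map_add]; exact hadd _ _ hf hg
  | single i c =>
    rw [formalInclusion, Finsupp.linearCombination_single, spinorBasis_eq_ket]
    exact hsmul _ _ (hket _ _ _ i.2)

/-- Density of the finite sums reduces equality of bounded operators to basis vectors; the
uniqueness of the representation rests on this. -/
theorem clm_ext_ket {S T : Spinors n →L[ℂ] Spinors n}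
    (h : ∀ a b ε, SpinorLabel n a b → S (ket n a b ε) = T (ket n a b ε)) : S = T := by
  refine ContinuousLinearMap.coeFn_injective
    (Continuous.ext_on (dense_finiteSpinors n) S.continuous T.continuous fun x hx => ?_)
  refine finiteSpinors_induction (p := fun x => S x = T x) h (by simp) ?_ ?_ hx
  · intro x y hx hy
    simp [hx, hy]
  · intro c x hx
    simp [hx]

end Coordinates

/-! Weighted shifts. -/

/-- `T |a, b, ε⟩ = f(a, b, ε) |a + p, b + r, ε η⟩`. -/
def IsShift {n : ℤ} (T : Spinors n →L[ℂ] Spinors n) (p r : ℤ) (η : ℤˣ)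
    (f : ℤ → ℤ → ℤˣ → ℂ) : Prop :=
  ∀ x a b ε, coord (T x) (a + p) (b + r) (ε * η) = f a b ε * coord x a b ε

theorem mul_units_self (ε η : ℤˣ) : ε * η * η = ε := by
  rw [mul_assoc, Int.units_mul_self, mul_one]

namespace IsShift

variable {n : ℤ} {S T : Spinors n →L[ℂ] Spinors n} {p r p' r' : ℤ} {η η' : ℤˣ}
  {f g : ℤ → ℤ → ℤˣ → ℂ}

/-- The test vector is `ket n a b ε`: a coordinate at a label that does not occur is `0` by
convention, so transitions leaving the label set have weight zero. -/
theorem support (hT : IsShift T p r η f) {a b : ℤ} (ε : ℤˣ) (h : SpinorLabel n a b)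
    (h' : ¬ SpinorLabel n (a + p) (b + r)) : f a b ε = 0 := by
  have := hT (ket n a b ε) a b ε
  rwa [coord_of_not_label _ _ h', coord_ket_self _ h, mul_one, eq_comm] at this

theorem norm_coeff_le (hT : IsShift T p r η f) {a b : ℤ} (ε : ℤˣ) (h : SpinorLabel n a b) :
    ‖f a b ε‖ ≤ ‖T‖ := by
  have := hT (ket n a b ε) a b ε
  rw [coord_ket_self _ h, mul_one] at this
  rw [← this]
  refine (norm_coord_le _ _ _ _).trans ((T.le_opNorm _).trans ?_)
  exact mul_le_of_le_one_right (norm_nonneg _) (norm_ket_le a b ε)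

/-- At labels that do not occur the weight multiplies a zero coordinate, so only its values on
admissible labels matter. -/
theorem congr (hT : IsShift T p r η f) (h : ∀ a b ε, SpinorLabel n a b → f a b ε = g a b ε) :
    IsShift T p r η g := by
  intro x a b ε
  rw [hT]
  by_cases hl : SpinorLabel n a b
  · rw [h _ _ _ hl]
  · rw [coord_of_not_label _ _ hl, mul_zero, mul_zero]

theorem unique (hS : IsShift S p r η f) (hT : IsShift T p r η f) : S = T := by
  ext x : 1
  refine ext_coord fun a b ε _ => ?_
  have h1 := hS x (a - p) (b - r) (ε * η)
  have h2 := hT x (a - p) (b - r) (ε * η)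
  rw [sub_add_cancel, sub_add_cancel, mul_units_self] at h1 h2
  rw [h1, h2]

theorem apply_ket (hT : IsShift T p r η f) {a b : ℤ} (ε : ℤˣ) (h : SpinorLabel n a b) :
    T (ket n a b ε) = f a b ε • ket n (a + p) (b + r) (ε * η) := by
  refine ext_coord fun a' b' ε' h' => ?_
  have h1 := hT (ket n a b ε) (a' - p) (b' - r) (ε' * η)
  rw [sub_add_cancel, sub_add_cancel, mul_units_self] at h1
  rw [h1, coord_smul]
  by_cases e : (a', b', ε') = (a + p, b + r, ε * η)
  · simp only [Prod.mk.injEq] at e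
    obtain ⟨rfl, rfl, rfl⟩ := e
    rw [add_sub_cancel_right, add_sub_cancel_right, mul_units_self, coord_ket_self _ h,
      coord_ket_self _ h']
  · rw [coord_ket_ne e, coord_ket_ne, mul_zero, mul_zero]
    contrapose! e
    simp only [Prod.mk.injEq] at e ⊢
    obtain ⟨rfl, rfl, rfl⟩ := e
    simp [mul_units_self]

theorem zero (p r : ℤ) (η : ℤˣ) :
    IsShift (0 : Spinors n →L[ℂ] Spinors n) p r η (fun _ _ _ => 0) := by
  intro x a b ε
  rw [zero_mul]
  change coord 0 _ _ _ = 0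
  simpa using coord_smul 0 (0 : Spinors n) (a + p) (b + r) (ε * η)

theorem one : IsShift (1 : Spinors n →L[ℂ] Spinors n) 0 0 1 (fun _ _ _ => 1) := by
  intro x a b ε
  simp

theorem add (hS : IsShift S p r η f) (hT : IsShift T p r η g) :
    IsShift (S + T) p r η (fun a b ε => f a b ε + g a b ε) := by
  intro x a b ε
  rw [add_mul, ← hS, ← hT, ← coord_add]
  rfl

theorem sub (hS : IsShift S p r η f) (hT : IsShift T p r η g) :
    IsShift (S - T) p r η (fun a b ε => f a b ε - g a b ε) := by
  intro x a b ε
  rw [sub_mul, ← hS, ← hT, ← coord_sub]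
  rfl

theorem smul (c : ℂ) (hT : IsShift T p r η f) :
    IsShift (c • T) p r η (fun a b ε => c * f a b ε) := by
  intro x a b ε
  rw [mul_assoc, ← hT, ← coord_smul]
  rfl

theorem mul (hS : IsShift S p r η f) (hT : IsShift T p' r' η' g) :
    IsShift (S * T) (p' + p) (r' + r) (η' * η)
      (fun a b ε => f (a + p') (b + r') (ε * η') * g a b ε) := by
  intro x a b ε
  rw [mul_assoc, ← hT, ← hS, add_assoc, add_assoc, mul_assoc]
  rfl

theorem cast (hT : IsShift T p r η f) (hp : p = p') (hr : r = r') (hη : η = η') :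
    IsShift T p' r' η' f := by
  subst hp hr hη
  exact hT

/-- The weight of the adjoint at a label is the conjugate weight of the transition arriving there.
If that transition starts outside the label set, the adjoint must send the vector to `0`, and `h`
ensures that the formula does so. -/
theorem adjoint (hT : IsShift T p r η f)
    (h : ∀ a b ε, ¬ SpinorLabel n a b → SpinorLabel n (a + p) (b + r) → f a b ε = 0) :
    IsShift (star T) (-p) (-r) η
      (fun a b ε => starRingEnd ℂ (f (a - p) (b - r) (ε * η))) := by
  intro x a b ε
  rw [← inner_ket_left, ContinuousLinearMap.star_eq_adjoint,
    ContinuousLinearMap.adjoint_inner_right]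
  by_cases hl : SpinorLabel n (a + -p) (b + -r)
  · rw [hT.apply_ket _ hl, inner_smul_left, inner_ket_left]
    simp [sub_eq_add_neg, mul_units_self]
  · rw [ket_eq_zero _ hl, map_zero, inner_zero_left]
    by_cases hl' : SpinorLabel n a b
    · have := h (a - p) (b - r) (ε * η) (by rwa [sub_eq_add_neg, sub_eq_add_neg])
        (by simpa using hl')
      simp [this]
    · simp [coord_of_not_label _ _ hl']

end IsShift

/-- On the whole lattice a translation of labels is injective, so norms before and after a shift can
be compared without recording which translates are admissible. -/
theorem extend_coord {n : ℤ} (x : Spinors n) (c : ℝ) (hc : c ≠ 0) :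
    (fun P : ℤ × ℤ × ℤˣ => ‖coord x P.1 P.2.1 P.2.2‖ ^ c) =
      Function.extend (fun i : SpinorIdx n => i.1) (fun i => ‖x i‖ ^ c) 0 := by
  funext P
  by_cases h : SpinorLabel n P.1 P.2.1
  · rw [coord_of_label _ _ h]
    exact (Subtype.val_injective.extend_apply (fun i : SpinorIdx n => ‖x i‖ ^ c) 0 ⟨P, h⟩).symm
  · rw [coord_of_not_label _ _ h, Function.extend_apply', norm_zero, Real.zero_rpow hc]
    · rfl
    · rintro ⟨i, rfl⟩
      exact h i.2

/-- The operator reads the coordinate at a translated label and multiplies it by the weight.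
Translation is injective, so the ℓ² norm grows at most by the bound of the weights. The support
condition `hsupp` makes the shift identity hold also at target labels that do not occur. -/
theorem exists_isShift {n : ℤ} (p r : ℤ) (η : ℤˣ) (f : ℤ → ℤ → ℤˣ → ℂ)
    (hsupp : ∀ a b ε, SpinorLabel n a b → ¬ SpinorLabel n (a + p) (b + r) → f a b ε = 0)
    (hbdd : ∃ C : ℝ, ∀ a b ε, SpinorLabel n a b → ‖f a b ε‖ ≤ C) :
    ∃ T : Spinors n →L[ℂ] Spinors n, IsShift T p r η f := by
  obtain ⟨C, hC⟩ := hbdd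
  have hc : (2 : ENNReal).toReal ≠ 0 := by norm_num
  -- `e` assigns to an output label the input label from which it is fed; this need not be
  -- admissible, hence the values in the full lattice.
  let e : SpinorIdx n → ℤ × ℤ × ℤˣ := fun i => (i.1.1 - p, i.1.2.1 - r, i.1.2.2 * η)
  have he : Function.Injective e := by
    intro i j hij
    simp only [e, Prod.mk.injEq, sub_left_inj, mul_left_inj] at hij
    exact Subtype.ext (Prod.ext hij.1 (Prod.ext hij.2.1 hij.2.2))
  let F : Spinors n → SpinorIdx n → ℂ := fun x i =>
    f (e i).1 (e i).2.1 (e i).2.2 * coord x (e i).1 (e i).2.1 (e i).2.2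
  have hval : Function.Injective (fun i : SpinorIdx n => i.1) := Subtype.val_injective
  have hb : ∀ x i, ‖F x i‖ ^ (2 : ENNReal).toReal ≤ |C| ^ (2 : ENNReal).toReal *
      ‖coord x (e i).1 (e i).2.1 (e i).2.2‖ ^ (2 : ENNReal).toReal := by
    intro x i
    rw [← Real.mul_rpow (abs_nonneg _) (norm_nonneg _)]
    refine Real.rpow_le_rpow (norm_nonneg _) ?_ (by norm_num)
    rw [norm_mul]
    by_cases h : SpinorLabel n (e i).1 (e i).2.1
    · exact mul_le_mul_of_nonneg_right ((hC _ _ _ h).trans (le_abs_self _)) (norm_nonneg _)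
    · simp [coord_of_not_label _ _ h]
  have hx : ∀ x : Spinors n, HasSum (fun P : ℤ × ℤ × ℤˣ =>
      ‖coord x P.1 P.2.1 P.2.2‖ ^ (2 : ENNReal).toReal) (‖x‖ ^ (2 : ENNReal).toReal) := by
    intro x
    rw [extend_coord x _ hc, hasSum_extend_zero hval]
    exact lp.hasSum_norm (by norm_num) x
  have hs : ∀ x : Spinors n, Summable fun i =>
      ‖coord x (e i).1 (e i).2.1 (e i).2.2‖ ^ (2 : ENNReal).toReal := fun x =>
    (hx x).summable.comp_injective he
  have hF : ∀ x, Memℓp (F x) 2 := fun x => memℓp_gen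
    (((hs x).mul_left _).of_nonneg_of_le (fun i => by positivity) (hb x))
  let L : Spinors n →ₗ[ℂ] Spinors n :=
    { toFun := fun x => ⟨F x, hF x⟩
      map_add' := by
        intro x y
        ext i
        change F (x + y) i = F x i + F y i
        simp only [F, coord_add, mul_add]
      map_smul' := by
        intro c x
        ext i
        change F (c • x) i = c * F x i
        simp only [F, coord_smul]
        ring }
  refine ⟨L.mkContinuous |C| ?_, ?_⟩
  · intro x
    refine lp.norm_le_of_tsum_le (by norm_num) (by positivity) ?_
    rw [Real.mul_rpow (abs_nonneg _) (norm_nonneg _)]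
    refine (Summable.tsum_le_tsum (hb x)
      (((hs x).mul_left _).of_nonneg_of_le (fun i => by positivity) (hb x))
      ((hs x).mul_left _)).trans ?_
    rw [tsum_mul_left, ← (hx x).tsum_eq]
    refine mul_le_mul_of_nonneg_left ?_ (by positivity)
    exact tsum_comp_le_tsum_of_inj (hx x).summable (fun P => by positivity) he
  · intro x a b ε
    by_cases h : SpinorLabel n (a + p) (b + r)
    · rw [coord_of_label _ _ h]
      change F x _ = _
      simp [F, e, mul_units_self]
    · rw [coord_of_not_label _ _ h]
      by_cases h' : SpinorLabel n a b
      · rw [hsupp _ _ _ h' h, zero_mul]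
      · rw [coord_of_not_label _ _ h', mul_zero]

end

noncomputable section

/-! Commutators with unbounded operators. -/

section Commutators

set_option linter.unusedSectionVars false

variable {H : Type*} [NormedAddCommGroup H] [InnerProductSpace ℂ H] [CompleteSpace H]
  {P : H →ₗ.[ℂ] H} {S T C C' : H →L[ℂ] H}

theorem LinearPMap.exists_apply_add (P : H →ₗ.[ℂ] H) {x y u v : H}
    (hx : ∃ h : x ∈ P.domain, P ⟨x, h⟩ = u) (hy : ∃ h : y ∈ P.domain, P ⟨y, h⟩ = v) :
    ∃ h : x + y ∈ P.domain, P ⟨x + y, h⟩ = u + v := by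
  obtain ⟨h1, rfl⟩ := hx
  obtain ⟨h2, rfl⟩ := hy
  exact ⟨add_mem h1 h2, P.map_add ⟨x, h1⟩ ⟨y, h2⟩⟩

theorem LinearPMap.exists_apply_smul (P : H →ₗ.[ℂ] H) (c : ℂ) {x u : H}
    (hx : ∃ h : x ∈ P.domain, P ⟨x, h⟩ = u) :
    ∃ h : c • x ∈ P.domain, P ⟨c • x, h⟩ = c • u := by
  obtain ⟨h1, rfl⟩ := hx
  exact ⟨P.domain.smul_mem c h1, P.map_smul c ⟨x, h1⟩⟩

theorem LinearPMap.exists_apply_zero (P : H →ₗ.[ℂ] H) :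
    ∃ h : (0 : H) ∈ P.domain, P ⟨0, h⟩ = 0 := ⟨zero_mem _, P.map_zero⟩

theorem isCommutator_iff : IsCommutator P T C ↔
    ∀ x : P.domain, ∃ h : T x ∈ P.domain, P ⟨T x, h⟩ = T (P x) + C x :=
  forall_congr' fun x => exists_congr fun h => by rw [sub_eq_iff_eq_add']

theorem IsCommutator.zero : IsCommutator P 0 0 := by
  rw [isCommutator_iff]
  intro x
  simpa using P.exists_apply_zero

theorem IsCommutator.one : IsCommutator P 1 0 := by
  rw [isCommutator_iff]
  intro x
  exact ⟨x.2, by simp⟩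

theorem IsCommutator.add (h1 : IsCommutator P S C) (h2 : IsCommutator P T C') :
    IsCommutator P (S + T) (C + C') := by
  rw [isCommutator_iff] at *
  intro x
  have := P.exists_apply_add (h1 x) (h2 x)
  simp only [add_apply]
  rwa [add_add_add_comm] at this

theorem IsCommutator.smul (c : ℂ) (h1 : IsCommutator P S C) :
    IsCommutator P (c • S) (c • C) := by
  rw [isCommutator_iff] at *
  intro x
  have := P.exists_apply_smul c (h1 x)
  rwa [smul_add] at this

/-- Leibniz rule. Since `T` preserves the domain of `P`, the commutator identity of `S` may be
applied to `T x`. -/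
theorem IsCommutator.mul (h1 : IsCommutator P S C) (h2 : IsCommutator P T C') :
    IsCommutator P (S * T) (C * T + S * C') := by
  rw [isCommutator_iff] at *
  intro x
  obtain ⟨h3, h4⟩ := h2 x
  obtain ⟨h5, h6⟩ := h1 ⟨_, h3⟩
  refine ⟨h5, ?_⟩
  simp only [add_apply, mul_apply_eq_comp]
  change P ⟨S (T x), h5⟩ = _
  rw [h6, h4, map_add]
  abel

end Commutators

/-! The absolute value of the Dirac operator. -/

section AbsDirac

variable {n : ℤ}

/-- `l - |N| + 1` for `a = 2 l` and `n = 2 N`. -/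
def levelOf (n a : ℤ) : ℝ := (a : ℝ) / 2 - |(n : ℝ) / 2| + 1

theorem coord_absDirac (x : (absDirac n).domain) (a b : ℤ) (ε : ℤˣ) :
    coord (absDirac n x) a b ε = (levelOf n a : ℂ) * coord (x : Spinors n) a b ε := by
  by_cases h : SpinorLabel n a b
  · rw [coord_of_label _ _ h, coord_of_label _ _ h]
    rfl
  · rw [coord_of_not_label _ _ h, coord_of_not_label _ _ h, mul_zero]

/-- The domain is maximal: a vector belongs to it as soon as its rescaled coordinates are those of
some vector of ℓ². -/
theorem absDirac_eq_of_coord {x y : Spinors n} (h : ∀ a b ε, SpinorLabel n a b →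
    coord y a b ε = (levelOf n a : ℂ) * coord x a b ε) :
    ∃ hx : x ∈ (absDirac n).domain, absDirac n ⟨x, hx⟩ = y := by
  have e : ∀ i : SpinorIdx n, y i = (i.level : ℂ) * x i := by
    intro i
    rw [← coord_idx, h _ _ _ i.2, coord_idx]
    rfl
  have hx : x ∈ (absDirac n).domain := by
    change Memℓp (fun i => (SpinorIdx.level i : ℂ) * x i) 2
    rw [← funext e]
    exact lp.memℓp y
  refine ⟨hx, ext_coord fun a b ε hl => ?_⟩
  rw [coord_absDirac, h _ _ _ hl]

/-- The eigenvalue of |D| is affine in a with slope 1/2, so moving a by p changes it by p/2,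
independently of the vector. -/
theorem IsShift.isCommutator {T : Spinors n →L[ℂ] Spinors n} {p r : ℤ} {η : ℤˣ}
    {f : ℤ → ℤ → ℤˣ → ℂ} (hT : IsShift T p r η f) :
    IsCommutator (absDirac n) T (((p : ℂ) / 2) • T) := by
  rw [isCommutator_iff]
  intro x
  refine absDirac_eq_of_coord fun a b ε _ => ?_
  have h1 := hT x (a - p) (b - r) (ε * η)
  have h2 := hT (absDirac n x) (a - p) (b - r) (ε * η)
  rw [sub_add_cancel, sub_add_cancel, mul_units_self] at h1 h2
  rw [coord_add, h2, smul_apply, coord_smul, h1, coord_absDirac]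
  simp only [levelOf]
  push_cast
  ring

end AbsDirac

/-! Operators of finite propagation and smoothing operators. -/

theorem SpinorLabel.nonneg {n a b : ℤ} (h : SpinorLabel n a b) : 0 ≤ a := (abs_nonneg n).trans h.1

theorem SpinorLabel.nonneg' {n a b : ℤ} (h : SpinorLabel n a b) : (0 : ℝ) ≤ a := by
  exact_mod_cast h.nonneg

/-- Rapid decay of coefficients with respect to `a = 2 l`. -/
def RapidDecay (n : ℤ) (f : ℤ → ℤ → ℤˣ → ℂ) : Prop :=
  ∀ k : ℕ, ∃ C : ℝ, ∀ a b ε, SpinorLabel n a b → ‖f a b ε‖ * (1 + (a : ℝ)) ^ k ≤ C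

/-- The finite sums of weighted shifts. -/
def shiftSpan (n : ℤ) : Submodule ℂ (Spinors n →L[ℂ] Spinors n) :=
  Submodule.span ℂ {T | ∃ p r η f, IsShift T p r η f}

/-- The finite sums of weighted shifts with rapidly decaying weights. -/
def rapidSpan (n : ℤ) : Submodule ℂ (Spinors n →L[ℂ] Spinors n) :=
  Submodule.span ℂ {T | ∃ p r η f, IsShift T p r η f ∧ RapidDecay n f}

section Spans

variable {n : ℤ} {S T : Spinors n →L[ℂ] Spinors n} {p r : ℤ} {η : ℤˣ} {f g : ℤ → ℤ → ℤˣ → ℂ}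

theorem IsShift.mem_shiftSpan (h : IsShift T p r η f) : T ∈ shiftSpan n :=
  Submodule.subset_span ⟨p, r, η, f, h⟩

theorem IsShift.mem_rapidSpan (h : IsShift T p r η f) (hf : RapidDecay n f) : T ∈ rapidSpan n :=
  Submodule.subset_span ⟨p, r, η, f, h, hf⟩

theorem rapidSpan_le_shiftSpan : rapidSpan n ≤ shiftSpan n :=
  Submodule.span_mono fun _ ⟨p, r, η, f, h, _⟩ => ⟨p, r, η, f, h⟩

/-- A factor of linear growth costs one power of 1 + a, and rapid decay has powers to spare. This
covers bounded multipliers as well as the eigenvalues of |D|. -/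
theorem RapidDecay.of_le (hf : RapidDecay n f) (K : ℝ)
    (h : ∀ a b ε, SpinorLabel n a b → ‖g a b ε‖ ≤ K * (1 + (a : ℝ)) * ‖f a b ε‖) :
    RapidDecay n g := by
  intro k
  obtain ⟨C, hC⟩ := hf (k + 1)
  refine ⟨|K| * C, fun a b ε hl => ?_⟩
  have h0 := hl.nonneg'
  calc ‖g a b ε‖ * (1 + (a : ℝ)) ^ k
      ≤ |K| * (1 + (a : ℝ)) * ‖f a b ε‖ * (1 + (a : ℝ)) ^ k := by
        refine mul_le_mul_of_nonneg_right ((h a b ε hl).trans ?_) (by positivity)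
        gcongr
        exact le_abs_self K
    _ = |K| * (‖f a b ε‖ * (1 + (a : ℝ)) ^ (k + 1)) := by ring
    _ ≤ |K| * C := mul_le_mul_of_nonneg_left (hC a b ε hl) (abs_nonneg _)

theorem RapidDecay.bdd (hf : RapidDecay n f) :
    ∃ C : ℝ, ∀ a b ε, SpinorLabel n a b → ‖f a b ε‖ ≤ C := by
  simpa using hf 0

/-- The weights 1 + a before and after a translation are comparable up to a constant, so rapid decay
can be transported along shifts. -/
theorem one_add_le_mul {a p : ℝ} (h : 0 ≤ a + p) : 1 + a ≤ (1 + |p|) * (1 + (a + p)) := by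
  nlinarith [abs_nonneg p, neg_abs_le p, mul_nonneg (abs_nonneg p) h]

/-- A criterion for rapid decay along a translation of the labels. -/
theorem RapidDecay.translate (hf : RapidDecay n f) (p : ℤ) (K : ℝ)
    (h : ∀ a b ε, SpinorLabel n a b → g a b ε ≠ 0 →
      ∃ b' ε', SpinorLabel n (a + p) b' ∧ ‖g a b ε‖ ≤ K * ‖f (a + p) b' ε'‖) :
    RapidDecay n g := by
  intro k
  obtain ⟨C, hC⟩ := hf k
  refine ⟨|K| * ((1 + |(p : ℝ)|) ^ k * |C|), fun a b ε hl => ?_⟩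
  by_cases hg : g a b ε = 0
  · rw [hg, norm_zero, zero_mul]
    positivity
  obtain ⟨b', ε', hl', h2⟩ := h a b ε hl hg
  have h0 := hl.nonneg'
  have h1 : (0 : ℝ) ≤ a + p := by exact_mod_cast hl'.nonneg
  have h3 := hC _ _ ε' hl'
  push_cast at h3
  calc ‖g a b ε‖ * (1 + (a : ℝ)) ^ k
      ≤ (|K| * ‖f (a + p) b' ε'‖) * ((1 + |(p : ℝ)|) * (1 + (a + p))) ^ k := by
        refine mul_le_mul (h2.trans ?_) ?_ (by positivity) (by positivity)
        · gcongr
          exact le_abs_self K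
        · gcongr
          exact one_add_le_mul h1
    _ = |K| * ((1 + |(p : ℝ)|) ^ k * (‖f (a + p) b' ε'‖ * (1 + ((a : ℝ) + p)) ^ k)) := by
        rw [mul_pow]
        ring
    _ ≤ |K| * ((1 + |(p : ℝ)|) ^ k * |C|) := by
        gcongr
        exact h3.trans (le_abs_self _)

theorem one_mem_shiftSpan : (1 : Spinors n →L[ℂ] Spinors n) ∈ shiftSpan n :=
  IsShift.one.mem_shiftSpan

theorem mul_mem_shiftSpan (hS : S ∈ shiftSpan n) (hT : T ∈ shiftSpan n) :
    S * T ∈ shiftSpan n := by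
  induction hS using Submodule.span_induction with
  | zero => rw [zero_mul]; exact zero_mem _
  | add x y _ _ hx hy => rw [add_mul]; exact add_mem hx hy
  | smul c x _ hx => rw [smul_mul_assoc]; exact Submodule.smul_mem _ _ hx
  | mem x hx =>
    obtain ⟨p, r, η, f, hx⟩ := hx
    induction hT using Submodule.span_induction with
    | zero => rw [mul_zero]; exact zero_mem _
    | add x y _ _ hx hy => rw [mul_add]; exact add_mem hx hy
    | smul c x _ hx => rw [mul_smul_comm]; exact Submodule.smul_mem _ _ hx
    | mem y hy =>
      obtain ⟨p, r, η, f, hy⟩ := hy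
      exact (hx.mul hy).mem_shiftSpan

/-- The weights of the left factor are bounded by its norm on admissible labels; where the right
factor leaves the label set its own weight is zero. -/
theorem mul_mem_rapidSpan_right (hS : S ∈ shiftSpan n) (hT : T ∈ rapidSpan n) :
    S * T ∈ rapidSpan n := by
  induction hS using Submodule.span_induction with
  | zero => rw [zero_mul]; exact zero_mem _
  | add x y _ _ hx hy => rw [add_mul]; exact add_mem hx hy
  | smul c x _ hx => rw [smul_mul_assoc]; exact Submodule.smul_mem _ _ hx
  | mem x hx =>
    obtain ⟨p, r, η, f, hx⟩ := hx
    induction hT using Submodule.span_induction with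
    | zero => rw [mul_zero]; exact zero_mem _
    | add x y _ _ hx hy => rw [mul_add]; exact add_mem hx hy
    | smul c x _ hx => rw [mul_smul_comm]; exact Submodule.smul_mem _ _ hx
    | mem y hy =>
      obtain ⟨p', r', η', f', hy, hf'⟩ := hy
      refine (hx.mul hy).mem_rapidSpan (hf'.of_le ‖x‖ fun a b ε hl => ?_)
      by_cases hl' : SpinorLabel n (a + p') (b + r')
      · rw [norm_mul]
        refine mul_le_mul_of_nonneg_right ?_ (norm_nonneg _)
        have h0 := hl.nonneg'
        exact (hx.norm_coeff_le _ hl').trans (by nlinarith [norm_nonneg x])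
      · simp [hy.support ε hl hl']

/-- Here the decaying weight is evaluated after the move made by the right factor, so the decay has
to be carried back to the starting label. -/
theorem mul_mem_rapidSpan_left (hS : S ∈ rapidSpan n) (hT : T ∈ shiftSpan n) :
    S * T ∈ rapidSpan n := by
  induction hS using Submodule.span_induction with
  | zero => rw [zero_mul]; exact zero_mem _
  | add x y _ _ hx hy => rw [add_mul]; exact add_mem hx hy
  | smul c x _ hx => rw [smul_mul_assoc]; exact Submodule.smul_mem _ _ hx
  | mem x hx =>
    obtain ⟨p, r, η, f, hx, hf⟩ := hx
    induction hT using Submodule.span_induction with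
    | zero => rw [mul_zero]; exact zero_mem _
    | add x y _ _ hx hy => rw [mul_add]; exact add_mem hx hy
    | smul c x _ hx => rw [mul_smul_comm]; exact Submodule.smul_mem _ _ hx
    | mem y hy =>
      obtain ⟨p', r', η', f', hy⟩ := hy
      refine (hx.mul hy).mem_rapidSpan (hf.translate p' ‖y‖ fun a b ε hl h0 => ?_)
      by_cases hl' : SpinorLabel n (a + p') (b + r')
      · refine ⟨b + r', ε * η', hl', ?_⟩
        rw [norm_mul, mul_comm]
        exact mul_le_mul_of_nonneg_right (hy.norm_coeff_le _ hl) (norm_nonneg _)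
      · exact absurd (by simp [hy.support ε hl hl']) h0

/-- The weights cut off to the transitions between labels. -/
def cutOff (n p r : ℤ) (f : ℤ → ℤ → ℤˣ → ℂ) (a b : ℤ) (ε : ℤˣ) : ℂ :=
  open Classical in
  if SpinorLabel n a b ∧ SpinorLabel n (a + p) (b + r) then f a b ε else 0

theorem cutOff_of_labels {a b : ℤ} (h : SpinorLabel n a b) (h' : SpinorLabel n (a + p) (b + r))
    (f : ℤ → ℤ → ℤˣ → ℂ) (ε : ℤˣ) : cutOff n p r f a b ε = f a b ε := if_pos ⟨h, h'⟩

theorem cutOff_eq_zero {a b : ℤ} (h : ¬(SpinorLabel n a b ∧ SpinorLabel n (a + p) (b + r)))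
    (f : ℤ → ℤ → ℤˣ → ℂ) (ε : ℤˣ) : cutOff n p r f a b ε = 0 := if_neg h

theorem norm_cutOff_le (f : ℤ → ℤ → ℤˣ → ℂ) (a b : ℤ) (ε : ℤˣ) :
    ‖cutOff n p r f a b ε‖ ≤ ‖f a b ε‖ := by
  unfold cutOff
  split_ifs
  · rfl
  · simp

theorem exists_isShift_cutOff (p r : ℤ) (η : ℤˣ) (f : ℤ → ℤ → ℤˣ → ℂ)
    (hf : ∃ C : ℝ, ∀ a b ε, SpinorLabel n a b → ‖f a b ε‖ ≤ C) :
    ∃ T : Spinors n →L[ℂ] Spinors n, IsShift T p r η (cutOff n p r f) := by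
  obtain ⟨C, hC⟩ := hf
  exact exists_isShift p r η _ (fun a b ε _ h => cutOff_eq_zero (fun h' => h h'.2) f ε)
    ⟨C, fun a b ε h => (norm_cutOff_le f a b ε).trans (hC a b ε h)⟩

theorem IsShift.cutOff (hT : IsShift T p r η f) : IsShift T p r η (cutOff n p r f) := by
  refine hT.congr fun a b ε h => ?_
  by_cases h' : SpinorLabel n (a + p) (b + r)
  · rw [cutOff_of_labels h h']
  · rw [cutOff_eq_zero (fun h'' => h' h''.2), hT.support ε h h']

/-- Truncating the weights to genuine transitions does not change the operator and makes the support
condition of `IsShift.adjoint` automatic. -/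
theorem IsShift.star_cutOff (hT : IsShift T p r η f) : IsShift (star T) (-p) (-r) η
    (_root_.cutOff n (-p) (-r) fun a b ε => starRingEnd ℂ (f (a - p) (b - r) (ε * η))) := by
  refine (hT.cutOff.adjoint fun a b ε h _ => cutOff_eq_zero (fun h' => h h'.1) f ε).congr ?_
  intro a b ε h
  by_cases h' : SpinorLabel n (a - p) (b - r)
  · rw [cutOff_of_labels h' (by simpa using h), cutOff_of_labels h h']
  · rw [cutOff_eq_zero (fun h'' => h' h''.1), map_zero]
    exact (cutOff_eq_zero (fun h'' => h' h''.2) _ _).symm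

theorem star_mem_shiftSpan (hT : T ∈ shiftSpan n) : star T ∈ shiftSpan n := by
  induction hT using Submodule.span_induction with
  | zero => rw [star_zero]; exact zero_mem _
  | add x y _ _ hx hy => rw [star_add]; exact add_mem hx hy
  | smul c x _ hx => rw [star_smul]; exact Submodule.smul_mem _ _ hx
  | mem x hx =>
    obtain ⟨p, r, η, f, hx⟩ := hx
    exact hx.star_cutOff.mem_shiftSpan

theorem star_mem_rapidSpan (hT : T ∈ rapidSpan n) : star T ∈ rapidSpan n := by
  induction hT using Submodule.span_induction with
  | zero => rw [star_zero]; exact zero_mem _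
  | add x y _ _ hx hy => rw [star_add]; exact add_mem hx hy
  | smul c x _ hx => rw [star_smul]; exact Submodule.smul_mem _ _ hx
  | mem x hx =>
    obtain ⟨p, r, η, f, hx, hf⟩ := hx
    refine hx.star_cutOff.mem_rapidSpan (hf.translate (-p) 1 fun a b ε hl h0 => ?_)
    by_cases h' : SpinorLabel n (a - p) (b - r)
    · refine ⟨b - r, ε * η, h', ?_⟩
      rw [cutOff_of_labels hl h']
      simp [sub_eq_add_neg]
    · exact absurd (cutOff_eq_zero (fun h'' => h' h''.2) _ _) h0

theorem exists_commutator_of_mem_rapidSpan (hT : T ∈ rapidSpan n) :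
    ∃ C ∈ rapidSpan n, IsCommutator (absDirac n) T C := by
  induction hT using Submodule.span_induction with
  | zero => exact ⟨0, zero_mem _, IsCommutator.zero⟩
  | add x y _ _ hx hy =>
    obtain ⟨C, h1, h2⟩ := hx
    obtain ⟨C', h3, h4⟩ := hy
    exact ⟨C + C', add_mem h1 h3, h2.add h4⟩
  | smul c x _ hx =>
    obtain ⟨C, h1, h2⟩ := hx
    exact ⟨c • C, Submodule.smul_mem _ _ h1, h2.smul c⟩
  | mem x hx =>
    obtain ⟨p, r, η, f, hx, hf⟩ := hx
    exact ⟨_, Submodule.smul_mem _ _ (hx.mem_rapidSpan hf), hx.isCommutator⟩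

theorem abs_levelOf_le {a : ℤ} (ha : 0 ≤ (a : ℝ)) (p : ℤ) :
    |levelOf n (a + p)| ≤ (1 + |(p : ℝ)| + |(n : ℝ)|) * (1 + (a : ℝ)) := by
  have h1 := abs_nonneg (p : ℝ)
  have h2 := abs_nonneg (n : ℝ)
  have h3 := le_abs_self (p : ℝ)
  have h4 := neg_abs_le (p : ℝ)
  unfold levelOf
  rw [abs_div, abs_two]
  push_cast
  rw [abs_le]
  constructor <;> nlinarith [mul_nonneg h1 ha, mul_nonneg h2 ha]

/-- Left multiplication by |D| multiplies the weight by the eigenvalue at the target label, which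
grows linearly in a. -/
theorem exists_absDirac_mul_of_mem_rapidSpan (hT : T ∈ rapidSpan n) :
    ∃ C ∈ rapidSpan n, ∀ x, ∃ h : T x ∈ (absDirac n).domain, absDirac n ⟨T x, h⟩ = C x := by
  induction hT using Submodule.span_induction with
  | zero => exact ⟨0, zero_mem _, fun x => (absDirac n).exists_apply_zero⟩
  | add x y _ _ hx hy =>
    obtain ⟨C, h1, h2⟩ := hx
    obtain ⟨C', h3, h4⟩ := hy
    exact ⟨C + C', add_mem h1 h3, fun v => (absDirac n).exists_apply_add (h2 v) (h4 v)⟩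
  | smul c x _ hx =>
    obtain ⟨C, h1, h2⟩ := hx
    exact ⟨c • C, Submodule.smul_mem _ _ h1, fun v => (absDirac n).exists_apply_smul c (h2 v)⟩
  | mem T hx =>
    obtain ⟨p, r, η, f, hx, hf⟩ := hx
    have hg : RapidDecay n (fun a b ε => (levelOf n (a + p) : ℂ) * f a b ε) := by
      refine hf.of_le (1 + |(p : ℝ)| + |(n : ℝ)|) fun a b ε hl => ?_
      rw [norm_mul, Complex.norm_real, Real.norm_eq_abs]
      exact mul_le_mul_of_nonneg_right (abs_levelOf_le hl.nonneg' p) (norm_nonneg _)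
    obtain ⟨C, hC⟩ := exists_isShift (n := n) p r η _
      (fun a b ε h h' => by rw [hx.support ε h h', mul_zero]) hg.bdd
    refine ⟨C, hC.mem_rapidSpan hg, fun x => absDirac_eq_of_coord fun a b ε _ => ?_⟩
    have h1 := hx x (a - p) (b - r) (ε * η)
    have h2 := hC x (a - p) (b - r) (ε * η)
    simp only [sub_add_cancel, mul_units_self] at h1 h2
    rw [h1, h2, mul_assoc]

theorem rapidSpan_subset_OPZero (hT : T ∈ rapidSpan n) : T ∈ OPZero (absDirac n) := by
  intro j
  induction j generalizing T with
  | zero => trivial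
  | succ j ih =>
    obtain ⟨C, h1, h2⟩ := exists_commutator_of_mem_rapidSpan hT
    exact ⟨C, h2, ih h1⟩

/-- `rapidSpan` is stable under left multiplication by |D| and under [|D|, · ]. Hence every |D|^k T
is again in `rapidSpan`, and all its iterated commutators exist. -/
theorem rapidSpan_subset_OPNegInfty (hT : T ∈ rapidSpan n) : T ∈ OPNegInfty (absDirac n) := by
  have key : ∀ k, ∃ T' ∈ rapidSpan n, IsPowerMul (absDirac n) k T T' := by
    intro k
    induction k with
    | zero => exact ⟨T, hT, rfl⟩
    | succ k ih =>
      obtain ⟨R, h1, h2⟩ := ih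
      obtain ⟨C, h3, h4⟩ := exists_absDirac_mul_of_mem_rapidSpan h1
      exact ⟨C, h3, R, h2, h4⟩
  intro k
  obtain ⟨T', h1, h2⟩ := key k
  exact ⟨T', h2, rapidSpan_subset_OPZero h1⟩

/-- If `T` is smoothing, then so is the bounded operator `T |D|`. -/
theorem exists_mul_absDirac_of_mem_rapidSpan (hT : T ∈ rapidSpan n) :
    ∃ C ∈ rapidSpan n, ∀ x : (absDirac n).domain, T (absDirac n x) = C x := by
  obtain ⟨C, h1, h2⟩ := exists_commutator_of_mem_rapidSpan hT
  obtain ⟨C', h3, h4⟩ := exists_absDirac_mul_of_mem_rapidSpan hT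
  -- T|D| = |D|T - [|D|, T], where both terms on the right are smoothing.
  refine ⟨C' - C, sub_mem h3 h1, fun x => ?_⟩
  obtain ⟨h5, h6⟩ := h2 x
  obtain ⟨h7, h8⟩ := h4 x
  change _ = C' x - C x
  rw [← h8, ← h6]
  abel

end Spans

/-! The operators `γ`, `J` and the sign of the Dirac operator. -/

section Signs

variable {n : ℤ}

theorem coord_signOperator (x : Spinors n) (a b : ℤ) (ε : ℤˣ) :
    coord (signOperator n x) a b ε = coord x a b (-ε) := by
  by_cases h : SpinorLabel n a b
  · rw [coord_of_label _ _ h, coord_of_label _ _ h]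
    exact one_mul _
  · rw [coord_of_not_label _ _ h, coord_of_not_label _ _ h]

theorem coord_grading (x : Spinors n) (a b : ℤ) (ε : ℤˣ) :
    coord (grading n x) a b ε = -((ε : ℤ) : ℂ) * coord x a b ε := by
  by_cases h : SpinorLabel n a b
  · rw [coord_of_label _ _ h, coord_of_label _ _ h]
    rfl
  · rw [coord_of_not_label _ _ h, coord_of_not_label _ _ h, mul_zero]

theorem coord_realStructure (x : Spinors n) (a b : ℤ) (ε : ℤˣ) :
    coord (realStructure n x) a b ε =
      (-1 : ℂ) ^ ((-b + n) / 2) * starRingEnd ℂ (coord x a (-b) (-ε)) := by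
  by_cases h : SpinorLabel n a b
  · rw [coord_of_label _ _ h, coord_of_label _ _ h.neg]
    rfl
  · rw [coord_of_not_label _ _ h, coord_of_not_label _ _ (fun h' => h (by simpa using h'.neg)),
      map_zero, mul_zero]

theorem isShift_signOperator : IsShift (signOperator n) 0 0 (-1) (fun _ _ _ => 1) := by
  intro x a b ε
  rw [coord_signOperator]
  simp

theorem isShift_grading : IsShift (grading n) 0 0 1 (fun _ _ ε => -((ε : ℤ) : ℂ)) := by
  intro x a b ε
  simp only [add_zero, mul_one, coord_grading]

/-- Both n and b have the parity of a, so m + N is an integer and the integer division in (b + n) /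
2 is exact. -/
theorem SpinorLabel.two_dvd {a b : ℤ} (h : SpinorLabel n a b) : 2 ∣ b - n := by
  obtain ⟨_, h1, _, h2⟩ := h
  rcases abs_choice n with h3 | h3 <;> rcases abs_choice b with h4 | h4 <;>
    rw [h3] at h1 <;> rw [h4] at h2 <;> omega

theorem neg_one_zpow_mul_self (k : ℤ) : (-1 : ℂ) ^ k * (-1 : ℂ) ^ k = 1 := by
  rw [← mul_zpow]
  simp

/-- The phases contribute the exponents -m + N and m + N, whose sum is 2N = n; complex conjugation
does not affect a power of -1. -/
theorem realStructure_realStructure (x : Spinors n) :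
    realStructure n (realStructure n x) = (-1 : ℂ) ^ n • x := by
  refine ext_coord fun a b ε h => ?_
  rw [coord_realStructure, coord_realStructure, coord_smul, map_mul, Complex.conj_conj, neg_neg,
    neg_neg, map_zpow₀, map_neg, map_one, ← mul_assoc, ← zpow_add₀ (by norm_num)]
  have := h.two_dvd
  congr 2
  omega

theorem realStructure_symm (x : Spinors n) :
    (realStructure n).symm x = (-1 : ℂ) ^ n • realStructure n x := by
  rw [LinearIsometryEquiv.symm_apply_eq, map_smulₛₗ, realStructure_realStructure, smul_smul,
    map_zpow₀, map_neg, map_one, neg_one_zpow_mul_self, one_smul]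

/-- J reverses b and ε, so r changes sign while p and η are kept. The phases at source and target
combine with the scalar (-1)^n in J⁻¹ = (-1)^n J to a sign that does not depend on the label. -/
theorem IsShift.conjBy {T : Spinors n →L[ℂ] Spinors n} {p r : ℤ} {η : ℤˣ}
    {f : ℤ → ℤ → ℤˣ → ℂ} (hT : IsShift T p r η f) :
    IsShift (conjBy (realStructure n) T) p (-r) η
      (_root_.cutOff n p (-r) fun a b ε => (-1 : ℂ) ^ (r / 2) * starRingEnd ℂ (f a (-b) (-ε))) := by
  have key : IsShift (_root_.conjBy (realStructure n) T) p (-r) η (fun a b ε =>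
      (-1 : ℂ) ^ n * ((-1 : ℂ) ^ ((-(b + -r) + n) / 2) * (-1 : ℂ) ^ ((b + n) / 2)) *
        starRingEnd ℂ (f a (-b) (-ε))) := by
    intro x a b ε
    rw [conjBy_apply, realStructure_symm, map_smul, map_smulₛₗ, coord_smul, coord_realStructure,
      map_zpow₀, map_neg, map_one]
    have h := hT (realStructure n x) a (-b) (-ε)
    rw [show -(b + -r) = -b + r by ring, show -(ε * η) = -ε * η by simp, h, coord_realStructure]
    simp only [map_mul, map_zpow₀, map_neg, map_one, neg_neg, Complex.conj_conj]
    ring_nf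
  -- On admissible transitions b and b - r have the parity of n, so r is even and all halvings are
  -- exact; elsewhere the cut-off makes both weights zero.
  refine key.cutOff.congr fun a b ε h => ?_
  by_cases h' : SpinorLabel n (a + p) (b + -r)
  · rw [cutOff_of_labels h h', cutOff_of_labels h h', ← zpow_add₀ (by norm_num),
      ← zpow_add₀ (by norm_num)]
    have h1 := h.two_dvd
    have h2 := h'.two_dvd
    have h3 : n + ((-(b + -r) + n) / 2 + (b + n) / 2) = r / 2 + n + n := by omega
    rw [h3, zpow_add₀ (by norm_num), zpow_add₀ (by norm_num), mul_assoc ((-1 : ℂ) ^ (r / 2)),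
      neg_one_zpow_mul_self, mul_one]
  · rw [cutOff_eq_zero (fun h'' => h' h''.2), cutOff_eq_zero (fun h'' => h' h''.2)]

end Signs

/-! ### Conjugation of bounded operators by an antiunitary. -/

section ConjBy

set_option linter.unusedSectionVars false

variable {H : Type*} [NormedAddCommGroup H] [InnerProductSpace ℂ H] [CompleteSpace H]
  (J : H ≃ₗᵢ⋆[ℂ] H)

theorem conjBy_add (S T : H →L[ℂ] H) : conjBy J (S + T) = conjBy J S + conjBy J T := by
  ext x
  simp [conjBy_apply]

theorem conjBy_zero : conjBy J 0 = 0 := by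
  ext x
  simp [conjBy_apply]

theorem conjBy_one : conjBy J 1 = 1 := by
  ext x
  simp [conjBy_apply]

theorem conjBy_smul (c : ℂ) (T : H →L[ℂ] H) :
    conjBy J (c • T) = starRingEnd ℂ c • conjBy J T := by
  ext x
  exact map_smulₛₗ J c _

theorem conjBy_mul (S T : H →L[ℂ] H) : conjBy J (S * T) = conjBy J S * conjBy J T := by
  ext x
  simp [conjBy_apply]

end ConjBy

section ConjBySpans

variable {n : ℤ} {T : Spinors n →L[ℂ] Spinors n}

theorem conjBy_mem_shiftSpan (hT : T ∈ shiftSpan n) :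
    conjBy (realStructure n) T ∈ shiftSpan n := by
  induction hT using Submodule.span_induction with
  | zero => rw [conjBy_zero]; exact zero_mem _
  | add x y _ _ hx hy => rw [conjBy_add]; exact add_mem hx hy
  | smul c x _ hx => rw [conjBy_smul]; exact Submodule.smul_mem _ _ hx
  | mem x hx =>
    obtain ⟨p, r, η, f, hx⟩ := hx
    exact hx.conjBy.mem_shiftSpan

theorem conjBy_mem_rapidSpan (hT : T ∈ rapidSpan n) :
    conjBy (realStructure n) T ∈ rapidSpan n := by
  induction hT using Submodule.span_induction with
  | zero => rw [conjBy_zero]; exact zero_mem _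
  | add x y _ _ hx hy => rw [conjBy_add]; exact add_mem hx hy
  | smul c x _ hx => rw [conjBy_smul]; exact Submodule.smul_mem _ _ hx
  | mem x hx =>
    obtain ⟨p, r, η, f, hx, hf⟩ := hx
    refine hx.conjBy.mem_rapidSpan (hf.translate 0 1 fun a b ε hl _ => ?_)
    refine ⟨-b, -ε, by simpa using hl.neg, (norm_cutOff_le _ a b ε).trans ?_⟩
    simp

end ConjBySpans

end

noncomputable section

/-! Operators depending, up to smoothing operators, only on one of `l + m` and `l - m`. -/

theorem bounded_pow_mul_geometric {h : ℝ} (h0 : 0 < h) (h1 : h < 1) (k : ℕ) :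
    ∃ C : ℝ, ∀ a : ℤ, 0 ≤ a → h ^ a * (1 + (a : ℝ)) ^ k ≤ C := by
  have ht := tendsto_pow_const_mul_const_pow_of_abs_lt_one k (by rwa [abs_of_pos h0] : |h| < 1)
  obtain ⟨C, hC⟩ := ht.bddAbove_range
  -- The convergent sequence is sampled at a + 1 to produce (1 + a)^k; the surplus power of h is
  -- repaid by h⁻¹.
  refine ⟨h⁻¹ * C, fun a ha => ?_⟩
  lift a to ℕ using ha
  have h2 : ((a + 1 : ℕ) : ℝ) ^ k * h ^ (a + 1) ≤ C := hC ⟨a + 1, rfl⟩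
  have h3 : h ^ (a : ℤ) * (1 + ((a : ℤ) : ℝ)) ^ k =
      h⁻¹ * (((a + 1 : ℕ) : ℝ) ^ k * h ^ (a + 1)) := by
    push_cast
    rw [zpow_natCast, pow_succ]
    field_simp
    ring
  rw [h3]
  gcongr

theorem rapidDecay_of_le_zpow {n : ℤ} {h : ℝ} (h0 : 0 < h) (h1 : h < 1) {f : ℤ → ℤ → ℤˣ → ℂ}
    (K : ℝ) (hf : ∀ a b ε, SpinorLabel n a b → ‖f a b ε‖ ≤ K * h ^ a) : RapidDecay n f := by
  intro k
  obtain ⟨C, hC⟩ := bounded_pow_mul_geometric h0 h1 k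
  refine ⟨|K| * C, fun a b ε hl => ?_⟩
  have h2 := hl.nonneg'
  calc ‖f a b ε‖ * (1 + (a : ℝ)) ^ k ≤ |K| * h ^ a * (1 + (a : ℝ)) ^ k := by
        refine mul_le_mul_of_nonneg_right ((hf a b ε hl).trans ?_) (by positivity)
        gcongr
        exact le_abs_self K
    _ = |K| * (h ^ a * (1 + (a : ℝ)) ^ k) := by ring
    _ ≤ |K| * C := mul_le_mul_of_nonneg_left (hC a hl.nonneg) (abs_nonneg _)

/-- Shifts with weights depending on `a + σ b` only, which are constant if `a - σ b` is invariant
under the shift, or decay exponentially. -/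
def oneSidedShifts (h : ℝ) (n σ : ℤ) : Set (Spinors n →L[ℂ] Spinors n) :=
  {T | ∃ (p r : ℤ) (φ : ℤ → ℂ), IsShift T p r 1 (cutOff n p r fun a b _ => φ (a + σ * b)) ∧
    ((p = σ * r ∧ φ = fun _ => 1) ∨ ∃ C : ℝ, ∀ t, ‖φ t‖ ≤ C * h ^ t)}

/-- The operators which are sums of elements of `oneSidedShifts` up to smoothing operators. -/
def oneSidedSpan (h : ℝ) (n σ : ℤ) : Submodule ℂ (Spinors n →L[ℂ] Spinors n) :=
  Submodule.span ℂ (oneSidedShifts h n σ ∪ {T | T ∈ rapidSpan n})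

section OneSided

variable {h : ℝ} {n : ℤ} {σ : ℤ} {S T : Spinors n →L[ℂ] Spinors n}

theorem oneSidedSpan_of_mem_rapidSpan (hT : T ∈ rapidSpan n) : T ∈ oneSidedSpan h n σ :=
  Submodule.subset_span (Or.inr hT)

theorem oneSidedSpan_le_shiftSpan : oneSidedSpan h n σ ≤ shiftSpan n := by
  refine Submodule.span_le.2 (Set.union_subset ?_ rapidSpan_le_shiftSpan)
  rintro T ⟨p, r, φ, hT, _⟩
  exact hT.mem_shiftSpan

/-- The adjoint reverses the shift and translates the argument of φ by p + σr. The condition p = σr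
survives the change of signs, and an exponential bound changes only by a constant factor. -/
theorem star_mem_oneSidedSpan (h0 : 0 < h) (hT : T ∈ oneSidedSpan h n σ) :
    star T ∈ oneSidedSpan h n σ := by
  induction hT using Submodule.span_induction with
  | zero => rw [star_zero]; exact zero_mem _
  | add x y _ _ hx hy => rw [star_add]; exact add_mem hx hy
  | smul c x _ hx => rw [star_smul]; exact Submodule.smul_mem _ _ hx
  | mem T hT =>
    rcases hT with ⟨p, r, φ, hT, hφ⟩ | hT
    · refine Submodule.subset_span (Or.inl ⟨-p, -r,
        fun t => starRingEnd ℂ (φ (t - p - σ * r)), ?_, ?_⟩)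
      · refine hT.star_cutOff.congr fun a b ε hl => ?_
        by_cases hl' : SpinorLabel n (a + -p) (b + -r)
        · rw [cutOff_of_labels hl hl', cutOff_of_labels hl hl', cutOff_of_labels
            (by rwa [← sub_eq_add_neg, ← sub_eq_add_neg] at hl') (by simpa using hl)]
          congr 2
          ring
        · rw [cutOff_eq_zero (fun h => hl' h.2), cutOff_eq_zero (fun h => hl' h.2)]
      · rcases hφ with ⟨h1, h2⟩ | ⟨C, hC⟩
        · left
          refine ⟨by rw [h1]; ring, ?_⟩
          rw [h2]
          simp
        · right
          refine ⟨C * h ^ (-p - σ * r), fun t => ?_⟩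
          rw [RCLike.norm_conj, mul_assoc, ← zpow_add₀ h0.ne']
          convert hC (t - p - σ * r) using 3
          ring
    · exact oneSidedSpan_of_mem_rapidSpan (star_mem_rapidSpan hT)

/-- J exchanges m and -m and so turns functions of l + m into functions of l - m. This separates the
variables of the algebra from those of its conjugate. -/
theorem conjBy_mem_oneSidedSpan (hT : T ∈ oneSidedSpan h n σ) :
    conjBy (realStructure n) T ∈ oneSidedSpan h n (-σ) := by
  induction hT using Submodule.span_induction with
  | zero => rw [conjBy_zero]; exact zero_mem _
  | add x y _ _ hx hy => rw [conjBy_add]; exact add_mem hx hy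
  | smul c x _ hx => rw [conjBy_smul]; exact Submodule.smul_mem _ _ hx
  | mem T hT =>
    rcases hT with ⟨p, r, φ, hT, hφ⟩ | hT
    · have e : conjBy (realStructure n) T =
          (-1 : ℂ) ^ (r / 2) • ((-1 : ℂ) ^ (r / 2) • conjBy (realStructure n) T) := by
        rw [smul_smul, neg_one_zpow_mul_self, one_smul]
      rw [e]
      refine Submodule.smul_mem _ _ (Submodule.subset_span (Or.inl ⟨p, -r,
        fun t => starRingEnd ℂ (φ t), ?_, ?_⟩))
      · refine (hT.conjBy.smul _).congr fun a b ε hl => ?_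
        by_cases hl' : SpinorLabel n (a + p) (b + -r)
        · rw [cutOff_of_labels hl hl', cutOff_of_labels hl hl', ← mul_assoc,
            neg_one_zpow_mul_self, one_mul, cutOff_of_labels hl.neg (by simpa [add_comm] using hl'.neg)]
          congr 2
          ring
        · rw [cutOff_eq_zero (fun h => hl' h.2), cutOff_eq_zero (fun h => hl' h.2), mul_zero]
      · rcases hφ with ⟨h1, h2⟩ | ⟨C, hC⟩
        · left
          refine ⟨by rw [h1]; ring, ?_⟩
          rw [h2]
          simp
        · right
          exact ⟨C, fun t => by rw [RCLike.norm_conj]; exact hC t⟩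
    · exact oneSidedSpan_of_mem_rapidSpan (conjBy_mem_rapidSpan hT)

theorem exists_commutator_of_mem_oneSidedSpan (hT : T ∈ oneSidedSpan h n σ) :
    ∃ C ∈ oneSidedSpan h n σ, IsCommutator (absDirac n) T C := by
  induction hT using Submodule.span_induction with
  | zero => exact ⟨0, zero_mem _, IsCommutator.zero⟩
  | add x y _ _ hx hy =>
    obtain ⟨C, h1, h2⟩ := hx
    obtain ⟨C', h3, h4⟩ := hy
    exact ⟨C + C', add_mem h1 h3, h2.add h4⟩
  | smul c x _ hx =>
    obtain ⟨C, h1, h2⟩ := hx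
    exact ⟨c • C, Submodule.smul_mem _ _ h1, h2.smul c⟩
  | mem x hx =>
    rcases hx with hx | hx
    · have hx' : x ∈ oneSidedSpan h n σ := Submodule.subset_span (Or.inl hx)
      obtain ⟨p, r, φ, hx, hφ⟩ := hx
      exact ⟨_, Submodule.smul_mem _ _ hx', hx.isCommutator⟩
    · obtain ⟨C, h1, h2⟩ := exists_commutator_of_mem_rapidSpan hx
      exact ⟨C, oneSidedSpan_of_mem_rapidSpan h1, h2⟩

theorem signOperator_mem_shiftSpan : signOperator n ∈ shiftSpan n :=
  isShift_signOperator.mem_shiftSpan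

theorem commutator_mem_rapidSpan_left (hS : S ∈ shiftSpan n) (hT : T ∈ rapidSpan n) :
    S * T - T * S ∈ rapidSpan n :=
  sub_mem (mul_mem_rapidSpan_right hS hT) (mul_mem_rapidSpan_left hT hS)

theorem commutator_mem_rapidSpan_right (hS : S ∈ rapidSpan n) (hT : T ∈ shiftSpan n) :
    S * T - T * S ∈ rapidSpan n :=
  sub_mem (mul_mem_rapidSpan_left hS hT) (mul_mem_rapidSpan_right hT hS)

/-- The weights of a one-sided shift do not depend on ε and the shift preserves ε, so it commutes
exactly with the sign of D. Only the smoothing summands contribute. -/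
theorem signOperator_commutator_mem_rapidSpan (hT : T ∈ oneSidedSpan h n σ) :
    signOperator n * T - T * signOperator n ∈ rapidSpan n := by
  induction hT using Submodule.span_induction with
  | zero => simp
  | add x y _ _ hx hy =>
    have := add_mem hx hy
    convert this using 1
    noncomm_ring
  | smul c x _ hx =>
    have := Submodule.smul_mem _ c hx
    rwa [smul_sub, ← mul_smul_comm, ← smul_mul_assoc] at this
  | mem x hx =>
    rcases hx with ⟨p, r, φ, hx, _⟩ | hx
    · have e : signOperator n * x = x * signOperator n := by
        refine ((isShift_signOperator.mul hx).cast (by ring) (by ring) (mul_comm _ _)).unique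
          ((hx.mul isShift_signOperator).congr fun a b ε _ => ?_)
        simp only [add_zero, mul_one, one_mul]
        rfl
      rw [e, sub_self]
      exact zero_mem _
    · exact commutator_mem_rapidSpan_left signOperator_mem_shiftSpan hx

/-- The admissibility of a label becomes linear inequalities and parities in a and b, within reach
of `omega`. -/
theorem spinorLabel_iff {n a b : ℤ} :
    SpinorLabel n a b ↔ |n| ≤ a ∧ 2 ∣ a - n ∧ -a ≤ b ∧ b ≤ a ∧ 2 ∣ a - b := by
  have par : ∀ x y : ℤ, 2 ∣ x - |y| ↔ 2 ∣ x - y := by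
    intro x y
    rcases abs_choice y with h | h <;> rw [h]
    omega
  unfold SpinorLabel
  rw [par, par, (abs_le : |b| ≤ a ↔ _), and_assoc]

/-- The two intermediate labels of a two-step path are compared. The bottom edge is excluded by
`ha`. The move (p, r) preserves a - σb, so each intermediate label shares this quantity with one of
the two endpoints and satisfies a - σb ≥ 0. For the edge a + σb ≥ 0 either the quantity is large, or
(p', r') preserves it and the same argument applies. Only parity remains, and it is the same for
both labels. -/
theorem label_iff_of_large (hσ : σ = 1 ∨ σ = -1) {p r p' r' a b : ℤ} (hp : p = σ * r)
    (h1 : SpinorLabel n a b) (h2 : SpinorLabel n (a + p' + p) (b + r' + r))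
    (ha : |n| + 2 * (|p| + |p'| + |r'|) ≤ a)
    (hb : |n| + 2 * (|p| + |p'| + |r'|) ≤ a + σ * b ∨ p' = -σ * r') :
    SpinorLabel n (a + p') (b + r') ↔ SpinorLabel n (a + p) (b + r) := by
  have hp1 := neg_abs_le p
  have hp2 := le_abs_self p
  have hp1' := neg_abs_le p'
  have hp2' := le_abs_self p'
  have hr1' := neg_abs_le r'
  have hr2' := le_abs_self r'
  have hn := abs_nonneg n
  simp only [spinorLabel_iff] at *
  obtain ⟨h3, h4, h5, h6, h11⟩ := h1
  obtain ⟨h7, h8, h9, h10, h12⟩ := h2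
  generalize |n| = N at *
  generalize |p| = P at *
  generalize |p'| = P' at *
  generalize |r'| = R' at *
  have hpar : 2 ∣ p ↔ 2 ∣ p' := by omega
  by_cases h2p : 2 ∣ p
  · have h2p' := hpar.1 h2p
    rcases hσ with rfl | rfl <;>
    exact iff_of_true ⟨by omega, by omega, by omega, by omega, by omega⟩
      ⟨by omega, by omega, by omega, by omega, by omega⟩
  · have h2p' := mt hpar.2 h2p
    exact iff_of_false (fun h => by omega) (fun h => by omega)

theorem SpinorLabel.add_nonneg {a b : ℤ} (h : SpinorLabel n a b) (hσ : σ = 1 ∨ σ = -1) :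
    0 ≤ a + σ * b := by
  rw [spinorLabel_iff] at h
  rcases hσ with rfl | rfl <;> omega

/-- `S` preserves a - σb, the only variable in the weight ψ of `T`, so `S * T` and `T * S` carry the
same weight ψ(a - σb) and differ at most by the admissibility of the intermediate label. By
`label_iff_of_large` this difference is confined to a neighbourhood of the edges, where ψ(a - σb) is
O(h^a). -/
theorem constant_commutator_mem_rapidSpan (h0 : 0 < h) (h1 : h < 1) (hσ : σ = 1 ∨ σ = -1)
    {p r : ℤ} (hp : p = σ * r) (hS : IsShift S p r 1 (cutOff n p r fun _ _ _ => 1))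
    (hT : T ∈ oneSidedShifts h n (-σ)) : S * T - T * S ∈ rapidSpan n := by
  obtain ⟨p', r', ψ, hT, hψ⟩ := hT
  have hST := (hS.mul hT).sub ((hT.mul hS).cast (add_comm p p') (add_comm r r') rfl)
  set M := |n| + 2 * (|p| + |p'| + |r'|) with hM
  have hM0 : 0 ≤ M := by positivity
  -- Near the bottom a ≤ M, the bound h^(a - M) is at least 1. Near the edge a + σb < M with M ≤ a,
  -- one has a - σb = 2a - (a + σb) ≥ a, so a decaying ψ is O(h^a); for constant ψ this second case
  -- does not arise, because then p' = -σr'.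
  have hbound : ∃ K : ℝ, 0 ≤ K ∧ ∀ a b, SpinorLabel n a b →
      (M ≤ a → ¬(M ≤ a + σ * b ∨ p' = -σ * r') → ‖ψ (a - σ * b)‖ ≤ K * h ^ a) ∧
      (a ≤ M → ‖ψ (a - σ * b)‖ ≤ K * h ^ a) := by
    rcases hψ with ⟨h2, h3⟩ | ⟨C, hC⟩
    · refine ⟨h ^ (-M), by positivity, fun a b hl => ⟨fun _ h4 => absurd (Or.inr h2) h4, ?_⟩⟩
      intro h4
      rw [h3, norm_one, ← zpow_add₀ h0.ne']
      exact one_le_zpow_of_nonpos₀ h0 h1.le (by linarith)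
    · refine ⟨|C| * h ^ (-M), by positivity, fun a b hl => ?_⟩
      have h5 := hl.nonneg
      have h6 := hl.add_nonneg hσ
      have h7 := hl.add_nonneg (σ := -σ) (by rcases hσ with rfl | rfl <;> simp)
      have key : ∀ m : ℤ, m ≤ a - σ * b → ‖ψ (a - σ * b)‖ ≤ |C| * h ^ m := by
        intro m hm
        refine (hC _).trans ?_
        refine mul_le_mul (le_abs_self C) ?_ (by positivity) (abs_nonneg _)
        exact zpow_le_zpow_right_of_le_one₀ h0 h1.le hm
      rw [mul_assoc, ← zpow_add₀ h0.ne']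
      constructor
      · intro h2 h3
        push Not at h3
        exact key _ (by linarith)
      · intro h2
        exact key _ (by linarith)
  obtain ⟨K, hK0, hK⟩ := hbound
  refine hST.mem_rapidSpan (rapidDecay_of_le_zpow h0 h1 K fun a b ε hl => ?_)
  by_cases hl2 : SpinorLabel n (a + p' + p) (b + r' + r)
  · have hl2' : SpinorLabel n (a + p + p') (b + r + r') := by
      rwa [add_right_comm a, add_right_comm b]
    have h3 : a + p + -σ * (b + r) = a - σ * b := by rw [hp]; ring
    have h4 : a + -σ * b = a - σ * b := by ring
    have e1 : cutOff n p r (fun _ _ _ => 1) (a + p') (b + r') (ε * 1) *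
        cutOff n p' r' (fun a b _ => ψ (a + -σ * b)) a b ε =
        (open Classical in if SpinorLabel n (a + p') (b + r') then ψ (a - σ * b) else 0) := by
      by_cases hA : SpinorLabel n (a + p') (b + r')
      · rw [if_pos hA, cutOff_of_labels hA hl2, cutOff_of_labels hl hA, one_mul, h4]
      · rw [if_neg hA, cutOff_eq_zero (p := p') (fun h => hA h.2), mul_zero]
    have e2 : cutOff n p' r' (fun a b _ => ψ (a + -σ * b)) (a + p) (b + r) (ε * 1) *
        cutOff n p r (fun _ _ _ => 1) a b ε =
        (open Classical in if SpinorLabel n (a + p) (b + r) then ψ (a - σ * b) else 0) := by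
      by_cases hA : SpinorLabel n (a + p) (b + r)
      · rw [if_pos hA, cutOff_of_labels hA hl2', cutOff_of_labels hl hA, mul_one, h3]
      · rw [if_neg hA, cutOff_eq_zero (p := p) (fun h => hA h.2), mul_zero]
    rw [e1, e2]
    have h2 : ∀ P Q : Prop, ∀ z : ℂ, ‖(open Classical in (if P then z else 0) -
        (if Q then z else 0))‖ ≤ ‖z‖ := by
      intro P Q z
      split_ifs <;> simp
    by_cases h3 : a ≤ M
    · exact (h2 _ _ _).trans ((hK a b hl).2 h3)
    by_cases h4 : M ≤ a + σ * b ∨ p' = -σ * r'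
    · have h5 := label_iff_of_large hσ hp hl hl2 (by omega) h4
      have h6 : 0 ≤ K * h ^ a := by positivity
      by_cases hA : SpinorLabel n (a + p') (b + r')
      · rwa [if_pos hA, if_pos (h5.1 hA), sub_self, norm_zero]
      · rwa [if_neg hA, if_neg (mt h5.2 hA), sub_self, norm_zero]
    · exact (h2 _ _ _).trans ((hK a b hl).1 (by omega) h4)
  · rw [cutOff_eq_zero (p := p) (r := r) (a := a + p') (fun h => hl2 h.2),
      cutOff_eq_zero (p := p') (r := r') (a := a + p)
        (fun h => hl2 (by simpa [add_right_comm] using h.2))]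
    simp only [zero_mul, sub_zero, norm_zero]
    positivity

/-- The exponents a + σb and a - σb add up to 2a, up to a constant coming from the first move, so
the product of the weights decays in a uniformly in b. -/
theorem decaying_mul_mem_rapidSpan (h0 : 0 < h) (h1 : h < 1)
    {p r p' r' : ℤ} {φ ψ : ℤ → ℂ} {C C' : ℝ}
    (hS : IsShift S p r 1 (cutOff n p r fun a b _ => φ (a + σ * b)))
    (hφ : ∀ t, ‖φ t‖ ≤ C * h ^ t)
    (hT : IsShift T p' r' 1 (cutOff n p' r' fun a b _ => ψ (a + -σ * b)))
    (hψ : ∀ t, ‖ψ t‖ ≤ C' * h ^ t) : S * T ∈ rapidSpan n := by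
  refine (hS.mul hT).mem_rapidSpan (rapidDecay_of_le_zpow h0 h1
    (|C| * |C'| * h ^ (p' + σ * r')) fun a b ε hl => ?_)
  rw [norm_mul]
  calc _ ≤ ‖φ (a + p' + σ * (b + r'))‖ * ‖ψ (a + -σ * b)‖ :=
        mul_le_mul (norm_cutOff_le _ _ _ _) (norm_cutOff_le _ _ _ _) (norm_nonneg _)
          (norm_nonneg _)
    _ ≤ (|C| * h ^ (a + p' + σ * (b + r'))) * (|C'| * h ^ (a + -σ * b)) := by
        refine mul_le_mul ((hφ _).trans ?_) ((hψ _).trans ?_) (norm_nonneg _) (by positivity) <;>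
        · gcongr
          exact le_abs_self _
    _ = |C| * |C'| * h ^ (p' + σ * r') * h ^ (2 * a) := by
        rw [mul_mul_mul_comm, ← zpow_add₀ h0.ne', mul_assoc (|C| * |C'|), ← zpow_add₀ h0.ne']
        congr 2
        ring
    _ ≤ |C| * |C'| * h ^ (p' + σ * r') * h ^ a := by
        refine mul_le_mul_of_nonneg_left ?_ (by positivity)
        exact zpow_le_zpow_right_of_le_one₀ h0 h1.le (by linarith [hl.nonneg])

theorem oneSidedShifts_commutator_mem_rapidSpan (h0 : 0 < h) (h1 : h < 1)
    (hS : S ∈ oneSidedShifts h n 1) (hT : T ∈ oneSidedShifts h n (-1)) :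
    S * T - T * S ∈ rapidSpan n := by
  obtain ⟨p, r, φ, hS', hφ⟩ := id hS
  obtain ⟨p', r', ψ, hT', hψ⟩ := id hT
  rcases hφ with ⟨h2, rfl⟩ | ⟨C, hC⟩
  · exact constant_commutator_mem_rapidSpan h0 h1 (Or.inl rfl) h2 hS' hT
  rcases hψ with ⟨h3, rfl⟩ | ⟨C', hC'⟩
  -- The roles of the two factors are exchanged, with σ = -1 in place of σ = 1.
  · rw [← neg_sub]
    exact neg_mem (constant_commutator_mem_rapidSpan h0 h1 (Or.inr rfl) h3 hT'
      (by rwa [neg_neg]))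
  -- With two decaying profiles each of the two products is smoothing by itself.
  · refine sub_mem (decaying_mul_mem_rapidSpan h0 h1 hS' hC hT' hC') ?_
    refine decaying_mul_mem_rapidSpan (p' := p) (r' := r) h0 h1 hT' hC' ?_ hC
    simpa using hS'

theorem oneSidedSpan_commutator_mem_rapidSpan (h0 : 0 < h) (h1 : h < 1)
    (hS : S ∈ oneSidedSpan h n 1) (hT : T ∈ oneSidedSpan h n (-1)) :
    S * T - T * S ∈ rapidSpan n := by
  have hT' := oneSidedSpan_le_shiftSpan hT
  induction hS using Submodule.span_induction with
  | zero => simp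
  | add x y _ _ hx hy =>
    convert add_mem hx hy using 1
    noncomm_ring
  | smul c x _ hx =>
    have := Submodule.smul_mem _ c hx
    rwa [smul_sub, ← smul_mul_assoc, ← mul_smul_comm] at this
  | mem x hx =>
    rcases hx with hx | hx
    · clear hT'
      have hx' := oneSidedSpan_le_shiftSpan (Submodule.subset_span (Or.inl hx))
      induction hT using Submodule.span_induction with
      | zero => simp
      | add x y _ _ hx hy =>
        convert add_mem hx hy using 1
        noncomm_ring
      | smul c x _ hx =>
        have := Submodule.smul_mem _ c hx
        rwa [smul_sub, ← mul_smul_comm, ← smul_mul_assoc] at this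
      | mem y hy =>
        rcases hy with hy | hy
        · exact oneSidedShifts_commutator_mem_rapidSpan h0 h1 hx hy
        · exact commutator_mem_rapidSpan_left hx' hy
    · exact commutator_mem_rapidSpan_right hx hT'

/-- A shift whose weights are asymptotically functions of `a + σ b`. -/
theorem IsShift.mem_oneSidedSpan (h0 : 0 < h) (h1 : h < 1) (hσ : σ = 1 ∨ σ = -1) {p r : ℤ}
    {f : ℤ → ℤ → ℤˣ → ℂ} (hT : IsShift T p r 1 f) (φ : ℤ → ℂ) (c : ℂ) (K K' : ℝ)
    (hφ : ∀ a b ε, SpinorLabel n a b → SpinorLabel n (a + p) (b + r) →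
      ‖f a b ε - φ (a + σ * b)‖ ≤ K * h ^ a)
    (hc : ∀ t, 0 ≤ t → ‖φ t - c‖ ≤ K' * h ^ t) (hc' : c = 0 ∨ p = σ * r) :
    T ∈ oneSidedSpan h n σ := by
  -- The decaying part of φ. It is set to zero for negative t, where nothing is known about φ;
  -- admissible labels satisfy a + σb ≥ 0.
  let φ' : ℤ → ℂ := fun t => if 0 ≤ t then φ t - c else 0
  have hφ' : ∀ t, ‖φ' t‖ ≤ |K'| * h ^ t := by
    intro t
    by_cases ht : 0 ≤ t
    · simp only [φ', if_pos ht]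
      refine (hc t ht).trans ?_
      gcongr
      exact le_abs_self K'
    · simp only [φ', if_neg ht, norm_zero]
      positivity
  obtain ⟨T1, hT1⟩ := exists_isShift_cutOff (n := n) p r 1 (fun a b _ => φ' (a + σ * b))
    ⟨|K'|, fun a b ε hl => (hφ' _).trans (mul_le_of_le_one_right (abs_nonneg _)
      (zpow_le_one₀ h0 h1.le (hl.add_nonneg hσ)))⟩
  obtain ⟨T2, hT2⟩ := exists_isShift_cutOff (n := n) p r 1 (fun _ _ _ => 1)
    ⟨1, fun a b ε hl => by simp⟩
  -- `T1` carries the decaying part and `c • T2` the limit; what is left has weights O(h^a). The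
  -- constant part is admitted to the span only when it vanishes or p = σr.
  have h3 : T - (T1 + c • T2) ∈ rapidSpan n := by
    refine (hT.sub (hT1.add (hT2.smul c))).mem_rapidSpan
      (rapidDecay_of_le_zpow h0 h1 |K| fun a b ε hl => ?_)
    by_cases hl' : SpinorLabel n (a + p) (b + r)
    · rw [cutOff_of_labels hl hl', cutOff_of_labels hl hl']
      simp only [φ', if_pos (hl.add_nonneg hσ), mul_one, sub_add_cancel]
      refine (hφ a b ε hl hl').trans ?_
      gcongr
      exact le_abs_self K
    · rw [cutOff_eq_zero (fun h => hl' h.2), cutOff_eq_zero (fun h => hl' h.2),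
        hT.support ε hl hl']
      simp only [mul_zero, add_zero, sub_zero, norm_zero]
      positivity
  have h4 : T1 ∈ oneSidedSpan h n σ :=
    Submodule.subset_span (Or.inl ⟨p, r, φ', hT1, Or.inr ⟨_, hφ'⟩⟩)
  have h5 : c • T2 ∈ oneSidedSpan h n σ := by
    rcases hc' with rfl | h5
    · rw [zero_smul]
      exact zero_mem _
    · exact Submodule.smul_mem _ _ (Submodule.subset_span
        (Or.inl ⟨p, r, fun _ => 1, hT2, Or.inl ⟨h5, rfl⟩⟩))
  have := add_mem (oneSidedSpan_of_mem_rapidSpan (h := h) (σ := σ) h3) (add_mem h4 h5)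
  rwa [sub_add_cancel] at this

end OneSided

end

noncomputable section

/-! The matrix coefficients of the generators of the Podleś sphere. -/

/-- With x = q^{2l} and v = q^{2M}, this is β_l divided by (q⁻¹ - q) x / q. The exponentially small
factor is gone, and the rest is a rational function of x regular at x = 0. -/
def betaReduced (q s v x : ℝ) : ℝ :=
  q * ((1 - (1 + q ^ 2) * v * x + q ^ 2 * x ^ 2) * (1 - s ^ 2) +
    (1 + q ^ 2) * (v⁻¹ - v) * s ^ 2 * x) / ((1 - x ^ 2) * (1 - q ^ 4 * x ^ 2))
-- The first two factors come from [l + M] and [l - M], the other two from the second square root in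
-- α_l.
def alphaNum (s v x : ℝ) : ℝ :=
  (1 - x * v) * (1 - x * v⁻¹) * (s ^ 2 + x * v) * (1 + s ^ 2 * x * v⁻¹)

/-- Raising l by 1 replaces x by q²x. This recursion is all that is needed about β in the components
of the defining relations that change l by one step. -/
theorem betaReduced_recursion {q s v x : ℝ} (hq : q ≠ 0) (h1 : 1 - x ^ 2 ≠ 0) (h2 : 1 - q ^ 4 * x ^ 2 ≠ 0)
    (h3 : 1 - q ^ 8 * x ^ 2 ≠ 0) :
    (1 - q ^ 2) * (1 - s ^ 2) + q * betaReduced q s v x * (1 - x ^ 2) =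
      betaReduced q s v (q ^ 2 * x) / q * (1 - q ^ 8 * x ^ 2) := by
  have e : 1 - (q ^ 2 * x) ^ 2 = 1 - q ^ 4 * x ^ 2 := by ring
  have e' : 1 - q ^ 4 * (q ^ 2 * x) ^ 2 = 1 - q ^ 8 * x ^ 2 := by ring
  unfold betaReduced
  rw [e, e']
  field_simp
  ring

/-- `P` and `P'` stand for α_l² (1 - x²/q²) and α_{l+1}² (1 - q⁶x²) in reduced form. In these
combinations the factor 1 - x²/q², which vanishes for l = 1/2, does not occur in a denominator. -/
theorem alpha_beta_relation {q s v x b P P' : ℝ} (hq : q ≠ 0) (hv : v ≠ 0) (h1 : 1 - x ^ 2 ≠ 0)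
    (h2 : 1 - q ^ 4 * x ^ 2 ≠ 0) (h3 : 1 - q ^ 2 * x ^ 2 ≠ 0)
    (hb : b = betaReduced q s v x)
    (hP : P = alphaNum s v x / ((1 - x ^ 2) ^ 2 * (1 - q ^ 2 * x ^ 2)))
    (hP' : P' = alphaNum s v (q ^ 2 * x) / ((1 - q ^ 4 * x ^ 2) ^ 2 * (1 - q ^ 2 * x ^ 2))) :
    q * (1 + q ^ 2) * (P - P') = (1 - q ^ 2) * b * (1 - s ^ 2 - (1 + q ^ 2 * x ^ 2) * b / q) := by
  unfold betaReduced at hb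
  unfold alphaNum at hP hP'
  rw [hb, hP, hP']
  field_simp
  ring

/-- The second relation between α² and β, quadratic in β. It enters the parts of the two sphere
relations that preserve l and contains the constant term s². -/
theorem alpha_beta_quadratic {q s v x b P P' : ℝ} (hq : q ≠ 0) (hv : v ≠ 0) (h1 : 1 - x ^ 2 ≠ 0)
    (h2 : 1 - q ^ 4 * x ^ 2 ≠ 0) (h3 : 1 - q ^ 2 * x ^ 2 ≠ 0)
    (hb : b = betaReduced q s v x)
    (hP : P = alphaNum s v x / ((1 - x ^ 2) ^ 2 * (1 - q ^ 2 * x ^ 2)))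
    (hP' : P' = alphaNum s v (q ^ 2 * x) / ((1 - q ^ 4 * x ^ 2) ^ 2 * (1 - q ^ 2 * x ^ 2))) :
    (1 + q ^ 2) ^ 2 * (P - x ^ 2 * b ^ 2 - q ^ 2 * x ^ 2 * P' - s ^ 2)
      + (1 - s ^ 2 - (1 + q ^ 2 * x ^ 2) * b / q) ^ 2
      - (1 + q ^ 2) * (1 - s ^ 2) * (1 - s ^ 2 - (1 + q ^ 2 * x ^ 2) * b / q) = 0 := by
  unfold betaReduced at hb
  unfold alphaNum at hP hP'
  rw [hb, hP, hP']
  field_simp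
  ring

/-- `√(1 - q^t)`. -/
def rootOneSub (q : ℝ) (t : ℤ) : ℝ := √(1 - q ^ t)

/-- `q^{2 M}` for `M = ε N`, `n = 2 N`. -/
def weightParam (q : ℝ) (n : ℤ) (ε : ℤˣ) : ℝ := q ^ ((ε : ℤ) * n)

/-- The reduced coefficient `β` as a function of `a = 2 l`. -/
def betaCoeff (q s : ℝ) (n a : ℤ) (ε : ℤˣ) : ℝ := betaReduced q s (weightParam q n ε) (q ^ a)

/-- The square of the reduced coefficient `α` as a function of `x = q^{2 l}`. -/
def alphaSq (q s v x : ℝ) : ℝ :=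
  alphaNum s v x / ((1 - x ^ 2) ^ 2 * ((1 - x ^ 2 / q ^ 2) * (1 - q ^ 2 * x ^ 2)))

/-- The reduced coefficient `α` as a function of `a = 2 l`. -/
def alphaCoeff (q s : ℝ) (n a : ℤ) (ε : ℤˣ) : ℝ := √(alphaSq q s (weightParam q n ε) (q ^ a))

/-- The coefficient of `A` along `(l, m) ↦ (l + 1, m)`. -/
def coeffAup (q s : ℝ) (n a b : ℤ) (ε : ℤˣ) : ℝ :=
  -√q ^ (a + b) * rootOneSub q (a - b + 2) * rootOneSub q (a + b + 2) *
    alphaCoeff q s n (a + 2) ε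

/-- The diagonal coefficient of `A`. -/
def coeffAdiag (q s : ℝ) (n a b : ℤ) (ε : ℤˣ) : ℝ :=
  (1 - s ^ 2 - (1 - (1 + q ^ 2) * q ^ (a + b) + q ^ 2 * (q ^ a) ^ 2) *
    betaCoeff q s n a ε / q) / (1 + q ^ 2)

/-- The coefficient of `B` along `(l, m) ↦ (l + 1, m + 1)`. -/
def coeffBup (q s : ℝ) (n a b : ℤ) (ε : ℤˣ) : ℝ :=
  rootOneSub q (a + b + 2) * rootOneSub q (a + b + 4) * alphaCoeff q s n (a + 2) ε

/-- The coefficient of `B` along `(l, m) ↦ (l, m + 1)`. -/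
def coeffBmid (q s : ℝ) (n a b : ℤ) (ε : ℤˣ) : ℝ :=
  -√q ^ (a + b) * rootOneSub q (a - b) * rootOneSub q (a + b + 2) * betaCoeff q s n a ε

/-- The coefficient of `B` along `(l, m) ↦ (l - 1, m + 1)`. -/
def coeffBdown (q s : ℝ) (n a b : ℤ) (ε : ℤˣ) : ℝ :=
  -q * q ^ (a + b) * rootOneSub q (a - b) * rootOneSub q (a - b - 2) * alphaCoeff q s n a ε

/-! ### Reduced form of α and β: powers of q extracted from the q-numbers. -/

section Comparison

variable {q s : ℝ} {n : ℤ}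

/-- Real powers with half-integral exponents become integer powers of √q, so that `field_simp` and
`ring` can handle them. -/
theorem rpow_half (h0 : 0 < q) {x : ℝ} {t : ℤ} (hx : x = (t : ℝ) / 2) : q ^ x = √q ^ t := by
  rw [hx, Real.sqrt_eq_rpow, ← Real.rpow_intCast, ← Real.rpow_mul h0.le]
  congr 1
  ring

theorem sqrt_zpow_sq (h0 : 0 < q) (t : ℤ) : (√q ^ t) ^ 2 = q ^ t := by
  rw [← zpow_natCast, ← zpow_mul, mul_comm, zpow_mul, zpow_natCast, Real.sq_sqrt h0.le]

theorem inv_sub_pos (h0 : 0 < q) (h1 : q < 1) : 0 < q⁻¹ - q := by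
  have : 1 < q⁻¹ := (one_lt_inv₀ h0).2 h1
  linarith

theorem qNum_half (h0 : 0 < q) {x : ℝ} {t : ℤ} (hx : x = (t : ℝ) / 2) :
    qNum q x = √q ^ (-t) * (1 - q ^ t) / (q⁻¹ - q) := by
  have h2 : -x = ((-t : ℤ) : ℝ) / 2 := by rw [hx]; push_cast; ring
  have h3 : √q ^ t ≠ 0 := zpow_ne_zero _ (Real.sqrt_pos.2 h0).ne'
  rw [qNum, rpow_half h0 hx, rpow_half h0 h2, ← sqrt_zpow_sq h0 t, zpow_neg, ← neg_sub q⁻¹ q,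
    div_neg, ← neg_div]
  congr 1
  field_simp
  ring

/-- Evenness of t + u makes the square root of the extracted power of q an integer power of √q. Only
the first factor needs to be nonnegative for the root of the product to split. -/
theorem sqrt_qNum_mul (h0 : 0 < q) (h1 : q < 1) {x y : ℝ} {t u k : ℤ} (hx : x = (t : ℝ) / 2)
    (hy : y = (u : ℝ) / 2) (ht : 0 ≤ t) (hk : t + u = 2 * k) :
    √(qNum q x * qNum q y) =
      √q ^ (-k) / (q⁻¹ - q) * (rootOneSub q t * rootOneSub q u) := by
  have hd := inv_sub_pos h0 h1
  have h2 : qNum q x * qNum q y = (√q ^ (-k) / (q⁻¹ - q)) ^ 2 * ((1 - q ^ t) * (1 - q ^ u)) := by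
    rw [qNum_half h0 hx, qNum_half h0 hy, div_pow, sqrt_zpow_sq h0]
    have : √q ^ (-t) * √q ^ (-u) = q ^ (-k) := by
      rw [← zpow_add₀ (Real.sqrt_pos.2 h0).ne', ← sqrt_zpow_sq h0 (-k), ← zpow_natCast, ← zpow_mul]
      congr 1
      push_cast
      linarith
    rw [← this]
    field_simp
  have h3 : 0 ≤ 1 - q ^ t := sub_nonneg.2 (zpow_le_one₀ h0 h1.le ht)
  rw [h2, Real.sqrt_mul (sq_nonneg _), Real.sqrt_sq (by positivity), Real.sqrt_mul h3]
  rfl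

theorem qNum_two (h0 : 0 < q) (h1 : q < 1) : qNum q 2 = (1 + q ^ 2) / q := by
  have hd := inv_sub_pos h0 h1
  have h2 : (1 - q ^ 2) ≠ 0 := by nlinarith
  rw [qNum_half h0 (t := 4) (by norm_num), show (-4 : ℤ) = 2 * (-2) by norm_num, zpow_mul]
  have : √q ^ (2 : ℤ) = q := by rw [zpow_ofNat, Real.sq_sqrt h0.le]
  rw [this, div_eq_div_iff hd.ne' h0.ne', zpow_neg]
  field_simp
  norm_cast
  ring

theorem weightParam_pos (h0 : 0 < q) (n : ℤ) (ε : ℤˣ) : 0 < weightParam q n ε := zpow_pos h0 _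

theorem one_sub_zpow_sq_pos (h0 : 0 < q) (h1 : q < 1) {a : ℤ} (ha : 0 < a) :
    0 < 1 - (q ^ a) ^ 2 := by
  have h2 : q ^ a < 1 := zpow_lt_one₀ h0 h1 ha
  have h3 : 0 < q ^ a := zpow_pos h0 a
  nlinarith

theorem units_mul_le_abs (n : ℤ) (ε : ℤˣ) : (ε : ℤ) * n ≤ |n| := by
  rcases Int.units_eq_one_or ε with rfl | rfl
  · simpa using le_abs_self n
  · simpa using neg_le_abs n

theorem neg_abs_le_units_mul (n : ℤ) (ε : ℤˣ) : -|n| ≤ (ε : ℤ) * n := by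
  rcases Int.units_eq_one_or ε with rfl | rfl
  · simpa using neg_abs_le n
  · simpa using le_abs_self n

theorem coeffBeta_eq (h0 : 0 < q) (h1 : q < 1) {a : ℤ} (ha : 0 < a) (ε : ℤˣ) {N l : ℝ}
    (hN : N = ((ε : ℤ) : ℝ) * ((n : ℝ) / 2)) (hl : l = (a : ℝ) / 2) :
    coeffBeta q s N l = (q⁻¹ - q) * q ^ a * betaCoeff q s n a ε / q := by
  have hd := inv_sub_pos h0 h1
  have hh := Real.sqrt_pos.2 h0
  have hH : 0 < √q ^ a := zpow_pos hh a
  have hw : 0 < √q ^ ((ε : ℤ) * n) := zpow_pos hh _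
  have e1 : qNum q (2 * l) = ((√q ^ a) ^ 2)⁻¹ * (1 - (q ^ a) ^ 2) / (q⁻¹ - q) := by
    rw [qNum_half h0 (t := 2 * a) (by rw [hl]; push_cast; ring), zpow_neg, mul_comm 2 a, zpow_mul,
      zpow_mul, zpow_ofNat, zpow_ofNat]
  have e2 : qNum q (2 * l + 2) =
      ((√q ^ a) ^ 2 * q ^ 2)⁻¹ * (1 - q ^ 4 * (q ^ a) ^ 2) / (q⁻¹ - q) := by
    have : √q ^ 4 = q ^ 2 := by
      rw [show 4 = 2 * 2 by norm_num, pow_mul, Real.sq_sqrt h0.le]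
    rw [qNum_half h0 (t := a * 2 + 4) (by rw [hl]; push_cast; ring), zpow_neg,
      zpow_add₀ hh.ne', zpow_add₀ h0.ne', zpow_mul, zpow_mul, zpow_ofNat, zpow_ofNat, zpow_ofNat,
      zpow_ofNat, this]
    ring
  have e3 : qNum q (l - N) = √q ^ ((ε : ℤ) * n) * (√q ^ a)⁻¹ *
      (1 - q ^ a * (weightParam q n ε)⁻¹) / (q⁻¹ - q) := by
    rw [qNum_half h0 (t := a - (ε : ℤ) * n) (by rw [hl, hN]; push_cast; ring), neg_sub,
      zpow_sub₀ hh.ne', zpow_sub₀ h0.ne']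
    rfl
  have e4 : qNum q (2 * N) = ((√q ^ ((ε : ℤ) * n)) ^ 2)⁻¹ *
      (1 - (weightParam q n ε) ^ 2) / (q⁻¹ - q) := by
    rw [qNum_half h0 (t := ((ε : ℤ) * n) * 2) (by rw [hN]; push_cast; ring), zpow_neg,
      zpow_mul (√q) ((ε : ℤ) * n) 2, zpow_mul q ((ε : ℤ) * n) 2, zpow_ofNat, zpow_ofNat]
    rfl
  have e5 : q ^ (l + N + 1) = √q ^ a * √q ^ ((ε : ℤ) * n) * q := by
    rw [rpow_half h0 (t := a + (ε : ℤ) * n + 2) (by rw [hl, hN]; push_cast; ring),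
      zpow_add₀ hh.ne', zpow_add₀ hh.ne', zpow_ofNat, Real.sq_sqrt h0.le]
  have hx := sqrt_zpow_sq h0 a
  have hv : (√q ^ ((ε : ℤ) * n)) ^ 2 = weightParam q n ε := sqrt_zpow_sq h0 _
  have hv0 := weightParam_pos h0 n ε
  have hx0 : 0 < q ^ a := zpow_pos h0 a
  have h2 := one_sub_zpow_sq_pos h0 h1 ha
  have h3 : 0 < 1 - q ^ 4 * (q ^ a) ^ 2 := by
    have : q ^ 4 < 1 := pow_lt_one₀ h0.le h1 (by norm_num)
    nlinarith [sq_nonneg (q ^ a)]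
  unfold coeffBeta betaCoeff betaReduced
  rw [qNum_two h0 h1, e1, e2, e3, e4, e5, ← hv, ← hx]
  rw [← hx] at h2 h3
  -- From here on a rational identity in q, H = q^l, w = q^M and d.
  generalize √q ^ a = H at *
  generalize √q ^ ((ε : ℤ) * n) = w at *
  generalize q⁻¹ - q = d at *
  field_simp
  ring

theorem coeffAlpha_eq (h0 : 0 < q) (h1 : q < 1) {a : ℤ} (ha : 0 < a) (hn : |n| ≤ a) (ε : ℤˣ)
    {N l : ℝ} (hN : N = ((ε : ℤ) : ℝ) * ((n : ℝ) / 2)) (hl : l = (a : ℝ) / 2) :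
    coeffAlpha q s N l = (q⁻¹ - q) * √(qNum q 2) * q ^ a * alphaCoeff q s n a ε := by
  have hd := inv_sub_pos h0 h1
  have hh := Real.sqrt_pos.2 h0
  have hH : 0 < √q ^ a := zpow_pos hh a
  have hw : 0 < √q ^ ((ε : ℤ) * n) := zpow_pos hh _
  have hn1 : (ε : ℤ) * n ≤ a := (units_mul_le_abs n ε).trans hn
  have hn2 : -a ≤ (ε : ℤ) * n := (neg_le_neg hn).trans (neg_abs_le_units_mul n ε)
  have hN1 : 0 ≤ l - N := by
    have : (((ε : ℤ) * n : ℤ) : ℝ) ≤ a := by exact_mod_cast hn1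
    push_cast at this
    rw [hl, hN]
    linarith
  have hN2 : 0 ≤ l + N := by
    have : ((-a : ℤ) : ℝ) ≤ (((ε : ℤ) * n : ℤ) : ℝ) := by exact_mod_cast hn2
    push_cast at this
    rw [hl, hN]
    linarith
  have hl1 : 0 ≤ 2 * l - 1 := by
    have : (1 : ℝ) ≤ a := by exact_mod_cast ha
    rw [hl]
    linarith
  have e1 : qNum q (2 * l) = ((√q ^ a) ^ 2)⁻¹ * (1 - (q ^ a) ^ 2) / (q⁻¹ - q) := by
    rw [qNum_half h0 (t := 2 * a) (by rw [hl]; push_cast; ring), zpow_neg, mul_comm 2 a, zpow_mul,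
      zpow_mul, zpow_ofNat, zpow_ofNat]
  have e2 : qNum q (2 * l + 1) =
      ((√q ^ a) ^ 2 * q)⁻¹ * (1 - q ^ 2 * (q ^ a) ^ 2) / (q⁻¹ - q) := by
    rw [qNum_half h0 (t := a * 2 + 2) (by rw [hl]; push_cast; ring), zpow_neg,
      zpow_add₀ hh.ne', zpow_add₀ h0.ne', zpow_mul, zpow_mul, zpow_ofNat, zpow_ofNat, zpow_ofNat,
      zpow_ofNat, Real.sq_sqrt h0.le]
    ring
  have e2' : qNum q (2 * l - 1) =
      ((√q ^ a) ^ 2)⁻¹ * q * (1 - (q ^ a) ^ 2 / q ^ 2) / (q⁻¹ - q) := by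
    rw [qNum_half h0 (t := a * 2 - 2) (by rw [hl]; push_cast; ring), zpow_neg,
      zpow_sub₀ hh.ne', zpow_sub₀ h0.ne', zpow_mul, zpow_mul, zpow_ofNat, zpow_ofNat, zpow_ofNat,
      zpow_ofNat, Real.sq_sqrt h0.le, inv_div]
    ring
  have e3 : qNum q (l - N) = √q ^ ((ε : ℤ) * n) * (√q ^ a)⁻¹ *
      (1 - q ^ a * (weightParam q n ε)⁻¹) / (q⁻¹ - q) := by
    rw [qNum_half h0 (t := a - (ε : ℤ) * n) (by rw [hl, hN]; push_cast; ring), neg_sub,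
      zpow_sub₀ hh.ne', zpow_sub₀ h0.ne']
    rfl
  have e4 : qNum q (l + N) = (√q ^ ((ε : ℤ) * n) * √q ^ a)⁻¹ *
      (1 - q ^ a * weightParam q n ε) / (q⁻¹ - q) := by
    rw [qNum_half h0 (t := (ε : ℤ) * n + a) (by rw [hl, hN]; push_cast; ring), zpow_neg,
      zpow_add₀ hh.ne', zpow_add₀ h0.ne', mul_comm (q ^ ((ε : ℤ) * n))]
    rfl
  have e5 : q ^ (l + N) = √q ^ a * √q ^ ((ε : ℤ) * n) := by
    rw [rpow_half h0 (t := a + (ε : ℤ) * n) (by rw [hl, hN]; push_cast; ring),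
      zpow_add₀ hh.ne']
  have e6 : q ^ (l - N) = √q ^ a / √q ^ ((ε : ℤ) * n) := by
    rw [rpow_half h0 (t := a - (ε : ℤ) * n) (by rw [hl, hN]; push_cast; ring),
      zpow_sub₀ hh.ne']
  have hx := sqrt_zpow_sq h0 a
  have hv : (√q ^ ((ε : ℤ) * n)) ^ 2 = weightParam q n ε := sqrt_zpow_sq h0 _
  have h2 := one_sub_zpow_sq_pos h0 h1 ha
  have h2' : 0 ≤ qNum q 2 := qNum_nonneg h0 h1 (by norm_num)
  have hU : 0 ≤ qNum q 2 * qNum q (l + N) * qNum q (l - N) /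
      (qNum q (2 * l - 1) * qNum q (2 * l + 1)) :=
    div_nonneg (mul_nonneg (mul_nonneg h2' (qNum_nonneg h0 h1 hN2)) (qNum_nonneg h0 h1 hN1))
      (mul_nonneg (qNum_nonneg h0 h1 hl1) (qNum_nonneg h0 h1 (by linarith)))
  unfold coeffAlpha alphaCoeff alphaSq
  -- The two radicals on the left are merged into one, and on the right the square (1 - x²)² is
  -- taken out of the radical; `key` then compares the radicands.
  rw [mul_assoc (1 / qNum q (2 * l)), ← Real.sqrt_mul hU,
    mul_comm ((1 - (q ^ a) ^ 2) ^ 2) ((1 - (q ^ a) ^ 2 / q ^ 2) * (1 - q ^ 2 * (q ^ a) ^ 2)),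
    ← div_div (alphaNum s (weightParam q n ε) (q ^ a)), Real.sqrt_div' _ (sq_nonneg _), Real.sqrt_sq h2.le, Real.rpow_neg h0.le,
    Real.rpow_neg h0.le]
  have key : qNum q 2 * qNum q (l + N) * qNum q (l - N) /
        (qNum q (2 * l - 1) * qNum q (2 * l + 1)) *
      ((q ^ (l + N) + (q ^ (l + N))⁻¹ * s ^ 2) * (q ^ (l - N) * s ^ 2 + (q ^ (l - N))⁻¹)) =
      qNum q 2 * (alphaNum s (weightParam q n ε) (q ^ a) /
        ((1 - (q ^ a) ^ 2 / q ^ 2) * (1 - q ^ 2 * (q ^ a) ^ 2))) := by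
    rw [e2, e2', e3, e4, e5, e6]
    unfold alphaNum
    rw [← hx, ← hv]
    -- This factor vanishes for l = 1/2, so it is kept as an opaque denominator. Both sides contain
    -- it in the same place and agree also under the convention x / 0 = 0.
    generalize 1 - ((√q ^ a) ^ 2) ^ 2 / q ^ 2 = e
    generalize 1 - q ^ 2 * ((√q ^ a) ^ 2) ^ 2 = e'
    generalize √q ^ a = H at *
    generalize √q ^ ((ε : ℤ) * n) = w at *
    generalize q⁻¹ - q = d at *
    field_simp
    ring
  rw [key, Real.sqrt_mul h2', e1, hx]
  have hx0 : 0 < q ^ a := zpow_pos h0 a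
  generalize q⁻¹ - q = d at *
  field_simp

end Comparison

end

noncomputable section

/-! ### Reduced form of the matrix coefficients of A and B. -/

section Comparison

variable {q s : ℝ} {n a b : ℤ} {ε : ℤˣ} {N l m : ℝ}

theorem SpinorLabel.pos {n a b : ℤ} (h : SpinorLabel n a b) (hn : n ≠ 0) : 0 < a :=
  (abs_pos.2 hn).trans_le h.1

theorem sqrt_q_mul_qNum_two (h0 : 0 < q) : √(q * qNum q 2) = √q * √(qNum q 2) :=
  Real.sqrt_mul h0.le _

theorem q_mul_qNum_two (h0 : 0 < q) (h1 : q < 1) : q * qNum q 2 = 1 + q ^ 2 := by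
  rw [qNum_two h0 h1]
  field_simp

theorem coeffBplus_eq (h0 : 0 < q) (h1 : q < 1) (hn : n ≠ 0) (h : SpinorLabel n a b)
    (hl : l = (a : ℝ) / 2) (hm : m = (b : ℝ) / 2) (hN : N = ((ε : ℤ) : ℝ) * ((n : ℝ) / 2)) :
    coeffBplus q s N l m = √(q * qNum q 2) * coeffBup q s n a b ε := by
  have hd := inv_sub_pos h0 h1
  have hh := Real.sqrt_pos.2 h0
  have ha := h.pos hn
  have h2 := spinorLabel_iff.1 h
  unfold coeffBplus coeffBup
  rw [coeffAlpha_eq h0 h1 (a := a + 2) (by omega) (by omega) ε hN (by rw [hl]; push_cast; ring),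
    sqrt_qNum_mul h0 h1 (t := a + b + 2) (u := a + b + 4) (k := a + b + 3)
      (by rw [hl, hm]; push_cast; ring) (by rw [hl, hm]; push_cast; ring) (by omega) (by omega),
    rpow_half h0 (t := b - a) (by rw [hl, hm]; push_cast; ring), sqrt_q_mul_qNum_two h0,
    ← sqrt_zpow_sq h0 (a + 2)]
  simp only [zpow_neg, zpow_add₀ hh.ne', zpow_sub₀ hh.ne', zpow_ofNat]
  have hH : 0 < √q ^ a := zpow_pos hh a
  have hG : 0 < √q ^ b := zpow_pos hh b
  generalize q⁻¹ - q = d at *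
  field_simp

theorem coeffBzero_eq (h0 : 0 < q) (h1 : q < 1) (hn : n ≠ 0) (h : SpinorLabel n a b)
    (hl : l = (a : ℝ) / 2) (hm : m = (b : ℝ) / 2) (hN : N = ((ε : ℤ) : ℝ) * ((n : ℝ) / 2)) :
    coeffBzero q s N l m = √(q * qNum q 2) * coeffBmid q s n a b ε := by
  have hd := inv_sub_pos h0 h1
  have hh := Real.sqrt_pos.2 h0
  have ha := h.pos hn
  have h2 := spinorLabel_iff.1 h
  have hq := Real.sq_sqrt h0.le
  unfold coeffBzero coeffBmid
  rw [coeffBeta_eq h0 h1 ha ε hN hl, mul_assoc (qNum q 2),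
    Real.sqrt_mul (qNum_nonneg h0 h1 (by norm_num)),
    sqrt_qNum_mul h0 h1 (t := a - b) (u := a + b + 2) (k := a + 1)
      (by rw [hl, hm]; push_cast; ring) (by rw [hl, hm]; push_cast; ring) (by omega) (by omega),
    rpow_half h0 (t := b + 4) (by rw [hm]; push_cast; ring), sqrt_q_mul_qNum_two h0,
    ← sqrt_zpow_sq h0 a]
  simp only [zpow_neg, zpow_add₀ hh.ne', zpow_sub₀ hh.ne', zpow_ofNat]
  have hH : 0 < √q ^ a := zpow_pos hh a
  have hG : 0 < √q ^ b := zpow_pos hh b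
  generalize q⁻¹ - q = d at *
  generalize betaCoeff q s n a ε = β
  generalize rootOneSub q _ = r1
  generalize rootOneSub q _ = r2
  generalize √(qNum q 2) = g
  -- The variable is now k = √q, with q eliminated in favour of k².
  generalize √q = k at *
  subst hq
  field_simp

theorem coeffBminus_eq (h0 : 0 < q) (h1 : q < 1) (hn : n ≠ 0) (h : SpinorLabel n a b)
    (hl : l = (a : ℝ) / 2) (hm : m = (b : ℝ) / 2) (hN : N = ((ε : ℤ) : ℝ) * ((n : ℝ) / 2)) :
    coeffBminus q s N l m = √(q * qNum q 2) * coeffBdown q s n a b ε := by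
  have hd := inv_sub_pos h0 h1
  have hh := Real.sqrt_pos.2 h0
  have ha := h.pos hn
  have h2 := spinorLabel_iff.1 h
  have hq := Real.sq_sqrt h0.le
  unfold coeffBminus coeffBdown
  rw [coeffAlpha_eq h0 h1 ha (by omega) ε hN hl,
    sqrt_qNum_mul h0 h1 (t := a - b) (u := a - b - 2) (k := a - b - 1)
      (by rw [hl, hm]; push_cast; ring) (by rw [hl, hm]; push_cast; ring) (by omega) (by omega),
    rpow_half h0 (t := a + b + 2) (by rw [hl, hm]; push_cast; ring), sqrt_q_mul_qNum_two h0,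
    ← sqrt_zpow_sq h0 a, ← sqrt_zpow_sq h0 (a + b)]
  simp only [zpow_neg, zpow_add₀ hh.ne', zpow_sub₀ hh.ne', zpow_ofNat]
  have hH : 0 < √q ^ a := zpow_pos hh a
  have hG : 0 < √q ^ b := zpow_pos hh b
  generalize q⁻¹ - q = d at *
  generalize alphaCoeff q s n a ε = β
  generalize rootOneSub q _ = r1
  generalize rootOneSub q _ = r2
  generalize √(qNum q 2) = g
  generalize √q = k at *
  subst hq
  field_simp

/-- The hypotheses are weaker than admissibility of (a, b), because the lowering term of x₀ uses the
formula at l - 1, where (a - 2, b) need not be a label. -/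
theorem coeffAplus_eq (h0 : 0 < q) (h1 : q < 1) (hn : n ≠ 0) (ha : |n| ≤ a + 2) (hab : b ≤ a + 2)
    (hl : l = (a : ℝ) / 2) (hm : m = (b : ℝ) / 2) (hN : N = ((ε : ℤ) : ℝ) * ((n : ℝ) / 2)) :
    coeffAplus q s N l m = -(q * qNum q 2) * coeffAup q s n a b ε := by
  have hd := inv_sub_pos h0 h1
  have hh := Real.sqrt_pos.2 h0
  have hq := Real.sq_sqrt h0.le
  have hn' := abs_pos.2 hn
  have h2 := qNum_nonneg h0 h1 (x := 2) (by norm_num)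
  have hg := Real.sq_sqrt h2
  unfold coeffAplus coeffAup
  rw [coeffAlpha_eq h0 h1 (a := a + 2) (by omega) (by omega) ε hN (by rw [hl]; push_cast; ring),
    mul_assoc (qNum q 2), Real.sqrt_mul h2,
    sqrt_qNum_mul h0 h1 (t := a - b + 2) (u := a + b + 2) (k := a + 2)
      (by rw [hl, hm]; push_cast; ring) (by rw [hl, hm]; push_cast; ring) (by omega) (by omega),
    rpow_half h0 hm, ← sqrt_zpow_sq h0 (a + 2)]
  simp only [zpow_neg, zpow_add₀ hh.ne', zpow_sub₀ hh.ne', zpow_ofNat]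
  have hH : 0 < √q ^ a := zpow_pos hh a
  have hG : 0 < √q ^ b := zpow_pos hh b
  rw [← hg, Real.sqrt_sq (Real.sqrt_nonneg _)]
  generalize q⁻¹ - q = d at *
  generalize alphaCoeff q s n (a + 2) ε = β
  generalize rootOneSub q _ = r1
  generalize rootOneSub q _ = r2
  generalize √(qNum q 2) = g
  generalize √q = k at *
  subst hq
  field_simp

theorem coeffAzero_eq (h0 : 0 < q) (h1 : q < 1) (hn : n ≠ 0) (h : SpinorLabel n a b)
    (hl : l = (a : ℝ) / 2) (hm : m = (b : ℝ) / 2) (hN : N = ((ε : ℤ) : ℝ) * ((n : ℝ) / 2)) :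
    coeffAzero q s N l m = -(q * qNum q 2) * coeffAdiag q s n a b ε + (1 - s ^ 2) := by
  have hd := inv_sub_pos h0 h1
  have hh := Real.sqrt_pos.2 h0
  have hq := Real.sq_sqrt h0.le
  have e1 : qNum q (2 * l) = ((√q ^ a) ^ 2)⁻¹ * (1 - (q ^ a) ^ 2) / (q⁻¹ - q) := by
    rw [qNum_half h0 (t := 2 * a) (by rw [hl]; push_cast; ring), zpow_neg, mul_comm 2 a, zpow_mul,
      zpow_mul, zpow_ofNat, zpow_ofNat]
  unfold coeffAzero coeffAdiag
  rw [coeffBeta_eq h0 h1 (h.pos hn) ε hN hl, e1, q_mul_qNum_two h0 h1, qNum_two h0 h1,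
    qNum_half h0 (t := a - b) (by rw [hl, hm]; push_cast; ring),
    rpow_half h0 (t := a + b + 2) (by rw [hl, hm]; push_cast; ring)]
  simp only [← sqrt_zpow_sq h0 a, ← sqrt_zpow_sq h0 (a + b), ← sqrt_zpow_sq h0 (a - b)]
  simp only [zpow_neg, zpow_add₀ hh.ne', zpow_sub₀ hh.ne', zpow_ofNat]
  have hH : 0 < √q ^ a := zpow_pos hh a
  have hG : 0 < √q ^ b := zpow_pos hh b
  have hp : (1 : ℝ) + q ^ 2 ≠ 0 := by positivity
  generalize q⁻¹ - q = d at *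
  generalize betaCoeff q s n a ε = β
  generalize √q ^ a = H at *
  generalize √q ^ b = G at *
  generalize √q = k at *
  subst hq
  field_simp
  ring

end Comparison

end

noncomputable section

/-! Asymptotics of the matrix coefficients. -/

/-- Hölder continuity of the square root with exponent 1/2. It converts an error for α² into one for
α without a lower bound for α, and so includes s = 0. -/
theorem Real.abs_sqrt_sub_sqrt_le (x y : ℝ) : |√x - √y| ≤ √|x - y| := by
  have key : ∀ x y : ℝ, √x ≤ √y + √|x - y| := by
    intro x y
    rw [Real.sqrt_le_left (by positivity)]
    rcases le_total 0 y with hy | hy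
    · nlinarith [Real.sq_sqrt hy, Real.sq_sqrt (abs_nonneg (x - y)), le_abs_self (x - y),
        mul_nonneg (Real.sqrt_nonneg y) (Real.sqrt_nonneg |x - y|)]
    · rw [Real.sqrt_eq_zero_of_nonpos hy, zero_add, Real.sq_sqrt (abs_nonneg _)]
      linarith [le_abs_self (x - y)]
  rw [abs_le]
  have h1 := key x y
  have h2 := key y x
  rw [abs_sub_comm] at h2
  constructor <;> linarith

/-- Differentiability at 0 gives f(x) - f(0) = O(x) as x tends to 0. Along the sequence q^k, whose
terms are nonzero, an asymptotic bound is a bound for all k with a larger constant. -/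
theorem exists_abs_geometric_sub_le {q : ℝ} (h0 : 0 < q) (h1 : q < 1) {f : ℝ → ℝ}
    (hf : DifferentiableAt ℝ f 0) :
    ∃ K : ℝ, ∀ a : ℤ, 0 ≤ a → |f (q ^ a) - f 0| ≤ K * q ^ a := by
  have ht : Filter.Tendsto (fun k : ℕ => q ^ k) Filter.atTop (nhds 0) :=
    tendsto_pow_atTop_nhds_zero_of_lt_one h0.le h1
  have h := hf.isBigO_sub.comp_tendsto ht
  rw [Asymptotics.isBigO_nat_atTop_iff] at h
  · obtain ⟨C, hC⟩ := h
    refine ⟨C, fun a ha => ?_⟩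
    lift a to ℕ using ha
    have := hC a
    simpa [abs_of_pos h0] using this
  · intro k hk
    have : q ^ k - 0 = 0 := hk
    rw [sub_zero] at this
    exact absurd this (pow_pos h0 k).ne'

theorem exists_uniform_units {f : ℤ → ℤˣ → ℝ} {g : ℤ → ℝ} (hg : ∀ a, 0 ≤ g a)
    (h : ∀ ε, ∃ K : ℝ, ∀ a : ℤ, 0 ≤ a → f a ε ≤ K * g a) :
    ∃ K : ℝ, 0 ≤ K ∧ ∀ (a : ℤ) ε, 0 ≤ a → f a ε ≤ K * g a := by
  choose K hK using h
  refine ⟨|K 1| + |K (-1)|, by positivity, fun a ε ha => (hK ε a ha).trans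
    (mul_le_mul_of_nonneg_right ?_ (hg a))⟩
  rcases Int.units_eq_one_or ε with rfl | rfl
  · linarith [le_abs_self (K 1), abs_nonneg (K (-1))]
  · linarith [le_abs_self (K (-1)), abs_nonneg (K 1)]

section Asymptotics

variable {q s : ℝ}

theorem sqrt_lt_one (h1 : q < 1) : √q < 1 := by
  rw [Real.sqrt_lt' one_pos]
  simpa using h1

theorem zpow_le_sqrt_zpow (h0 : 0 < q) (h1 : q < 1) {a : ℤ} (ha : 0 ≤ a) : q ^ a ≤ √q ^ a := by
  rw [← sqrt_zpow_sq h0]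
  have h2 : √q ^ a ≤ 1 := zpow_le_one₀ (Real.sqrt_pos.2 h0) (sqrt_lt_one h1).le ha
  have h3 : 0 < √q ^ a := zpow_pos (Real.sqrt_pos.2 h0) a
  nlinarith

theorem exists_abs_betaCoeff_sub_le (h0 : 0 < q) (h1 : q < 1) (s : ℝ) (n : ℤ) :
    ∃ K : ℝ, 0 ≤ K ∧ ∀ (a : ℤ) ε, 0 ≤ a →
      |betaCoeff q s n a ε - q * (1 - s ^ 2)| ≤ K * √q ^ a := by
  refine exists_uniform_units (f := fun a ε => |betaCoeff q s n a ε - q * (1 - s ^ 2)|)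
    (fun a => (zpow_pos (Real.sqrt_pos.2 h0) a).le) fun ε => ?_
  have hd : DifferentiableAt ℝ (betaReduced q s (weightParam q n ε)) 0 := by
    unfold betaReduced
    refine DifferentiableAt.div (by fun_prop) (by fun_prop) (by norm_num)
  obtain ⟨K, hK⟩ := exists_abs_geometric_sub_le h0 h1 hd
  have e : betaReduced q s (weightParam q n ε) 0 = q * (1 - s ^ 2) := by simp [betaReduced]
  refine ⟨|K|, fun a ha => ?_⟩
  have := hK a ha
  rw [e] at this
  refine this.trans (mul_le_mul (le_abs_self K) (zpow_le_sqrt_zpow h0 h1 ha)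
    (zpow_pos h0 a).le (abs_nonneg K))

/-- The function α² of x is differentiable at 0 with value s², so its error is O(q^a); taking the
root leaves O(√q^a). This is why √q is the base of all decay estimates. -/
theorem exists_abs_alphaCoeff_sub_le (h0 : 0 < q) (h1 : q < 1) (hs : 0 ≤ s) (n : ℤ) :
    ∃ K : ℝ, 0 ≤ K ∧ ∀ (a : ℤ) ε, 0 ≤ a → |alphaCoeff q s n a ε - s| ≤ K * √q ^ a := by
  refine exists_uniform_units (f := fun a ε => |alphaCoeff q s n a ε - s|)
    (fun a => (zpow_pos (Real.sqrt_pos.2 h0) a).le) fun ε => ?_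
  have hd : DifferentiableAt ℝ (alphaSq q s (weightParam q n ε)) 0 := by
    unfold alphaSq alphaNum
    refine DifferentiableAt.div (by fun_prop) (by fun_prop) (by norm_num)
  obtain ⟨K, hK⟩ := exists_abs_geometric_sub_le h0 h1 hd
  have e : alphaSq q s (weightParam q n ε) 0 = s ^ 2 := by simp [alphaSq, alphaNum]
  refine ⟨√|K|, fun a ha => ?_⟩
  have h2 := hK a ha
  rw [e] at h2
  have h3 : 0 < √q ^ a := zpow_pos (Real.sqrt_pos.2 h0) a
  calc |alphaCoeff q s n a ε - s|
      = |√(alphaSq q s (weightParam q n ε) (q ^ a)) - √(s ^ 2)| := by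
        rw [Real.sqrt_sq hs]
        rfl
    _ ≤ √(|K| * (√q ^ a) ^ 2) := by
        refine (Real.abs_sqrt_sub_sqrt_le _ _).trans (Real.sqrt_le_sqrt (h2.trans ?_))
        rw [sqrt_zpow_sq h0]
        exact mul_le_mul_of_nonneg_right (le_abs_self K) (zpow_pos h0 a).le
    _ = √|K| * √q ^ a := by rw [Real.sqrt_mul (abs_nonneg K), Real.sqrt_sq h3.le]

theorem abs_le_of_abs_sub_le (h0 : 0 < q) (h1 : q < 1) {f : ℤ → ℤˣ → ℝ} {c K : ℝ} (hK : 0 ≤ K)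
    (h : ∀ (a : ℤ) ε, 0 ≤ a → |f a ε - c| ≤ K * √q ^ a) {a : ℤ} (ε : ℤˣ) (ha : 0 ≤ a) :
    |f a ε| ≤ K + |c| := by
  have h2 := h a ε ha
  have h3 : √q ^ a ≤ 1 := zpow_le_one₀ (Real.sqrt_pos.2 h0) (sqrt_lt_one h1).le ha
  have h4 := abs_sub_abs_le_abs_sub (f a ε) c
  nlinarith

theorem rootOneSub_nonneg (q : ℝ) (t : ℤ) : 0 ≤ rootOneSub q t := Real.sqrt_nonneg _

theorem rootOneSub_sq (h0 : 0 < q) (h1 : q < 1) {t : ℤ} (ht : 0 ≤ t) :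
    rootOneSub q t ^ 2 = 1 - q ^ t :=
  Real.sq_sqrt (sub_nonneg.2 (zpow_le_one₀ h0 h1.le ht))

theorem rootOneSub_zero (q : ℝ) : rootOneSub q 0 = 0 := by simp [rootOneSub]

theorem rootOneSub_le_one (h0 : 0 < q) (t : ℤ) : rootOneSub q t ≤ 1 := by
  refine Real.sqrt_le_iff.2 ⟨zero_le_one, ?_⟩
  linarith [zpow_pos h0 t]

theorem abs_rootOneSub_le (h0 : 0 < q) (t : ℤ) : |rootOneSub q t| ≤ 1 := by
  rw [abs_of_nonneg (rootOneSub_nonneg q t)]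
  exact rootOneSub_le_one h0 t

theorem abs_rootOneSub_sub_one_le (h0 : 0 < q) (h1 : q < 1) {t : ℤ} (ht : 0 ≤ t) :
    |rootOneSub q t - 1| ≤ q ^ t := by
  have h2 := rootOneSub_nonneg q t
  have h3 := rootOneSub_le_one h0 t
  have h4 := rootOneSub_sq h0 h1 ht
  rw [abs_le]
  constructor <;> nlinarith [zpow_pos h0 t]

theorem abs_rootOneSub_mul_sub_one_le (h0 : 0 < q) (h1 : q < 1) {t u : ℤ} (ht : 0 ≤ t)
    (hu : 0 ≤ u) : |rootOneSub q t * rootOneSub q u - 1| ≤ q ^ t + q ^ u := by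
  have h2 := abs_rootOneSub_sub_one_le h0 h1 ht
  have h3 := abs_rootOneSub_sub_one_le h0 h1 hu
  have h4 := abs_rootOneSub_le h0 t
  calc |rootOneSub q t * rootOneSub q u - 1|
      = |(rootOneSub q t - 1) + rootOneSub q t * (rootOneSub q u - 1)| := by ring_nf
    _ ≤ |rootOneSub q t - 1| + |rootOneSub q t| * |rootOneSub q u - 1| := by
        rw [← abs_mul]
        exact abs_add_le _ _
    _ ≤ q ^ t + 1 * q ^ u := by gcongr
    _ = _ := by ring

/-- Used with x a square root close to 1 and y a reduced coefficient close to its limit c. -/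
theorem abs_mul_sub_le {x y c : ℝ} : |x * y - c| ≤ |x - 1| * |y| + |y - c| := by
  rw [← abs_mul]
  refine le_of_eq_of_le ?_ (abs_add_le _ _)
  ring_nf

end Asymptotics

theorem IsShift.mem_oneSidedSpan_ofReal {h : ℝ} {n σ : ℤ} {T : Spinors n →L[ℂ] Spinors n}
    (h0 : 0 < h) (h1 : h < 1) (hσ : σ = 1 ∨ σ = -1) {p r : ℤ} {f : ℤ → ℤ → ℤˣ → ℝ}
    (hT : IsShift T p r 1 fun a b ε => (f a b ε : ℂ)) (φ : ℤ → ℝ) (c : ℝ) (K K' : ℝ)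
    (hφ : ∀ a b ε, SpinorLabel n a b → SpinorLabel n (a + p) (b + r) →
      |f a b ε - φ (a + σ * b)| ≤ K * h ^ a)
    (hc : ∀ t, 0 ≤ t → |φ t - c| ≤ K' * h ^ t) (hc' : c = 0 ∨ p = σ * r) :
    T ∈ oneSidedSpan h n σ := by
  refine hT.mem_oneSidedSpan h0 h1 hσ (fun t => (φ t : ℂ)) c K K' ?_ ?_ ?_
  · intro a b ε h2 h3
    rw [← Complex.ofReal_sub, Complex.norm_real]
    exact hφ a b ε h2 h3
  · intro t ht
    rw [← Complex.ofReal_sub, Complex.norm_real]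
    exact hc t ht
  · exact_mod_cast hc'

/-! ### The components of A and B depend asymptotically on l + m only. -/

section Membership

variable {q s : ℝ} {n : ℤ} {T : Spinors n →L[ℂ] Spinors n}

/-- Its weights tend to s, which may be nonzero. This is permitted since the move (2, 2) fixes a -
b. -/
theorem mem_oneSidedSpan_of_coeffBup (h0 : 0 < q) (h1 : q < 1) (hs : 0 ≤ s)
    (hT : IsShift T 2 2 1 fun a b ε => (coeffBup q s n a b ε : ℂ)) :
    T ∈ oneSidedSpan (√q) n 1 := by
  have hh0 := Real.sqrt_pos.2 h0
  have hh1 := sqrt_lt_one h1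
  obtain ⟨K, hK, hα⟩ := exists_abs_alphaCoeff_sub_le h0 h1 hs n
  refine hT.mem_oneSidedSpan_ofReal hh0 hh1 (Or.inl rfl)
    (fun t => rootOneSub q (t + 2) * rootOneSub q (t + 4) * s) s K (2 * s) ?_ ?_ (Or.inr (by simp))
  · intro a b ε h2 _
    have ha := h2.nonneg
    unfold coeffBup
    rw [one_mul, ← mul_sub, abs_mul, abs_mul]
    calc _ ≤ 1 * 1 * (K * √q ^ (a + 2)) := by
          gcongr
          · exact abs_rootOneSub_le h0 _
          · exact abs_rootOneSub_le h0 _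
          · exact hα _ _ (by omega)
      _ ≤ K * √q ^ a := by
          rw [one_mul, one_mul]
          exact mul_le_mul_of_nonneg_left
            (zpow_le_zpow_right_of_le_one₀ hh0 hh1.le (by omega)) hK
  · intro t ht
    have h3 : rootOneSub q (t + 2) * rootOneSub q (t + 4) * s - s =
      (rootOneSub q (t + 2) * rootOneSub q (t + 4) - 1) * s := by ring
    have h4 : ∀ k, 0 ≤ k → q ^ (t + k) ≤ √q ^ t := fun k hk =>
      (zpow_le_zpow_right_of_le_one₀ h0 h1.le (by omega)).trans (zpow_le_sqrt_zpow h0 h1 ht)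
    rw [h3, abs_mul, abs_of_nonneg hs]
    have h5 := abs_rootOneSub_mul_sub_one_le h0 h1 (by omega : 0 ≤ t + 2) (by omega : 0 ≤ t + 4)
    have h6 := h4 2 (by norm_num)
    have h7 := h4 4 (by norm_num)
    nlinarith

/-- Replacing √(1 - q^{a-b}) by 1 costs q^{a-b}, which is not small near b = a. The prefactor
√q^(a+b) compensates: the product is √q^(3a-b), at most √q^a because b ≤ a. -/
theorem mem_oneSidedSpan_of_coeffBmid (h0 : 0 < q) (h1 : q < 1)
    (hT : IsShift T 0 2 1 fun a b ε => (coeffBmid q s n a b ε : ℂ)) :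
    T ∈ oneSidedSpan (√q) n 1 := by
  have hh0 := Real.sqrt_pos.2 h0
  have hh1 := sqrt_lt_one h1
  obtain ⟨K, hK, hβ⟩ := exists_abs_betaCoeff_sub_le h0 h1 s n
  set c := q * (1 - s ^ 2) with hc
  refine hT.mem_oneSidedSpan_ofReal hh0 hh1 (Or.inl rfl)
    (fun t => -√q ^ t * rootOneSub q (t + 2) * c) 0 (K + |c| + K) |c| ?_ ?_ (Or.inl rfl)
  · intro a b ε h2 _
    have ha := h2.nonneg
    have hab := spinorLabel_iff.1 h2
    have h3 : coeffBmid q s n a b ε - -√q ^ (a + 1 * b) * rootOneSub q (a + 1 * b + 2) * c =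
        -√q ^ (a + b) * rootOneSub q (a + b + 2) *
          (rootOneSub q (a - b) * betaCoeff q s n a ε - c) := by
      unfold coeffBmid
      rw [one_mul]
      ring
    have h4 : |rootOneSub q (a - b) * betaCoeff q s n a ε - c| ≤
        q ^ (a - b) * (K + |c|) + K * √q ^ a :=
      abs_mul_sub_le.trans (add_le_add (mul_le_mul (abs_rootOneSub_sub_one_le h0 h1 (by omega))
        (abs_le_of_abs_sub_le h0 h1 hK hβ ε ha) (abs_nonneg _) (zpow_pos h0 _).le) (hβ a ε ha))
    have h5 : √q ^ (a + b) ≤ 1 := zpow_le_one₀ hh0 hh1.le (by omega)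
    have h6 : √q ^ (a + b) * q ^ (a - b) ≤ √q ^ a := by
      rw [← sqrt_zpow_sq h0, ← zpow_natCast, ← zpow_mul, ← zpow_add₀ hh0.ne']
      exact zpow_le_zpow_right_of_le_one₀ hh0 hh1.le (by push_cast; omega)
    have h7 := zpow_pos hh0 (a + b)
    have h8 := zpow_pos hh0 a
    have h9 := abs_nonneg c
    rw [h3, abs_mul, abs_mul, abs_neg, abs_of_pos h7]
    calc _ ≤ √q ^ (a + b) * 1 * (q ^ (a - b) * (K + |c|) + K * √q ^ a) := by
          gcongr
          exact abs_rootOneSub_le h0 _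
      _ = (√q ^ (a + b) * q ^ (a - b)) * (K + |c|) + √q ^ (a + b) * (K * √q ^ a) := by ring
      _ ≤ √q ^ a * (K + |c|) + 1 * (K * √q ^ a) := by gcongr
      _ = _ := by ring
  · intro t ht
    rw [sub_zero, abs_mul, abs_mul, abs_neg, abs_of_pos (zpow_pos hh0 t), mul_comm |c|]
    exact mul_le_mul_of_nonneg_right
      (mul_le_of_le_one_right (zpow_pos hh0 t).le (abs_rootOneSub_le h0 _)) (abs_nonneg c)

theorem mem_oneSidedSpan_of_coeffBdown (h0 : 0 < q) (h1 : q < 1) (hs : 0 ≤ s)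
    (hT : IsShift T (-2) 2 1 fun a b ε => (coeffBdown q s n a b ε : ℂ)) :
    T ∈ oneSidedSpan (√q) n 1 := by
  have hh0 := Real.sqrt_pos.2 h0
  have hh1 := sqrt_lt_one h1
  obtain ⟨K, hK, hα⟩ := exists_abs_alphaCoeff_sub_le h0 h1 hs n
  refine hT.mem_oneSidedSpan_ofReal hh0 hh1 (Or.inl rfl)
    (fun t => -q * q ^ t * s) 0 ((1 + q ^ (-2 : ℤ)) * (K + |s|) + K) s ?_ ?_ (Or.inl rfl)
  · intro a b ε h2 h2'
    have ha := h2.nonneg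
    have hab := spinorLabel_iff.1 h2
    have hab' := spinorLabel_iff.1 h2'
    have h3 : coeffBdown q s n a b ε - -q * q ^ (a + 1 * b) * s =
        -q * q ^ (a + b) *
          (rootOneSub q (a - b) * rootOneSub q (a - b - 2) * alphaCoeff q s n a ε - s) := by
      unfold coeffBdown
      rw [one_mul]
      ring
    have h4 : |rootOneSub q (a - b) * rootOneSub q (a - b - 2) * alphaCoeff q s n a ε - s| ≤
        (q ^ (a - b) + q ^ (a - b - 2)) * (K + |s|) + K * √q ^ a :=
      abs_mul_sub_le.trans (add_le_add
        (mul_le_mul (abs_rootOneSub_mul_sub_one_le h0 h1 (by omega) (by omega))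
        (abs_le_of_abs_sub_le h0 h1 hK hα ε ha) (abs_nonneg _) (by positivity)) (hα a ε ha))
    have h5 : q ^ (a + b) ≤ 1 := zpow_le_one₀ h0 h1.le (by omega)
    -- The dependence on b cancels: the left side is q^(2a) (1 + q⁻²).
    have h6 : q ^ (a + b) * (q ^ (a - b) + q ^ (a - b - 2)) ≤ √q ^ a * (1 + q ^ (-2 : ℤ)) := by
      have e : q ^ (a + b) * (q ^ (a - b) + q ^ (a - b - 2)) =
          q ^ (2 * a) * (1 + q ^ (-2 : ℤ)) := by
        rw [mul_add, mul_add, ← zpow_add₀ h0.ne', ← zpow_add₀ h0.ne', ← zpow_add₀ h0.ne', mul_one]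
        congr 2 <;> ring
      rw [e]
      gcongr
      exact (zpow_le_zpow_right_of_le_one₀ h0 h1.le (by omega)).trans (zpow_le_sqrt_zpow h0 h1 ha)
    have h7 := zpow_pos h0 (a + b)
    have h8 := zpow_pos hh0 a
    have h9 := abs_nonneg s
    rw [h3, abs_mul, abs_mul, abs_neg, abs_of_pos h7, abs_of_pos h0]
    calc _ ≤ 1 * q ^ (a + b) * ((q ^ (a - b) + q ^ (a - b - 2)) * (K + |s|) + K * √q ^ a) := by
          gcongr
      _ = (q ^ (a + b) * (q ^ (a - b) + q ^ (a - b - 2))) * (K + |s|) +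
          q ^ (a + b) * (K * √q ^ a) := by ring
      _ ≤ √q ^ a * (1 + q ^ (-2 : ℤ)) * (K + |s|) + 1 * (K * √q ^ a) := by gcongr
      _ = _ := by ring
  · intro t ht
    have h3 := zpow_le_sqrt_zpow h0 h1 ht
    have h4 := zpow_pos h0 t
    rw [sub_zero, abs_mul, abs_mul, abs_neg, abs_of_pos h4, abs_of_pos h0, abs_of_nonneg hs,
      mul_comm s]
    refine mul_le_mul_of_nonneg_right ?_ hs
    nlinarith

/-- The prefactor √q^(a+b) again absorbs the error made by replacing √(1 - q^{a-b+2}) by 1, and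
makes the limiting profile decay. -/
theorem mem_oneSidedSpan_of_coeffAup (h0 : 0 < q) (h1 : q < 1) (hs : 0 ≤ s)
    (hT : IsShift T 2 0 1 fun a b ε => (coeffAup q s n a b ε : ℂ)) :
    T ∈ oneSidedSpan (√q) n 1 := by
  have hh0 := Real.sqrt_pos.2 h0
  have hh1 := sqrt_lt_one h1
  obtain ⟨K, hK, hα⟩ := exists_abs_alphaCoeff_sub_le h0 h1 hs n
  refine hT.mem_oneSidedSpan_ofReal hh0 hh1 (Or.inl rfl)
    (fun t => -√q ^ t * rootOneSub q (t + 2) * s) 0 (K + |s| + K) s ?_ ?_ (Or.inl rfl)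
  · intro a b ε h2 _
    have ha := h2.nonneg
    have hab := spinorLabel_iff.1 h2
    have h3 : coeffAup q s n a b ε - -√q ^ (a + 1 * b) * rootOneSub q (a + 1 * b + 2) * s =
        -√q ^ (a + b) * rootOneSub q (a + b + 2) *
          (rootOneSub q (a - b + 2) * alphaCoeff q s n (a + 2) ε - s) := by
      unfold coeffAup
      rw [one_mul]
      ring
    have h4 : |rootOneSub q (a - b + 2) * alphaCoeff q s n (a + 2) ε - s| ≤
        q ^ (a - b + 2) * (K + |s|) + K * √q ^ (a + 2) :=
      abs_mul_sub_le.trans (add_le_add (mul_le_mul (abs_rootOneSub_sub_one_le h0 h1 (by omega))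
        (abs_le_of_abs_sub_le h0 h1 hK hα ε (by omega)) (abs_nonneg _) (zpow_pos h0 _).le)
        (hα (a + 2) ε (by omega)))
    have h5 : √q ^ (a + b) ≤ 1 := zpow_le_one₀ hh0 hh1.le (by omega)
    have h6 : √q ^ (a + b) * q ^ (a - b + 2) ≤ √q ^ a := by
      rw [← sqrt_zpow_sq h0, ← zpow_natCast, ← zpow_mul, ← zpow_add₀ hh0.ne']
      exact zpow_le_zpow_right_of_le_one₀ hh0 hh1.le (by push_cast; omega)
    have h6' : √q ^ (a + 2) ≤ √q ^ a := zpow_le_zpow_right_of_le_one₀ hh0 hh1.le (by omega)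
    have h7 := zpow_pos hh0 (a + b)
    have h8 := zpow_pos hh0 a
    have h9 := abs_nonneg s
    rw [h3, abs_mul, abs_mul, abs_neg, abs_of_pos h7]
    calc _ ≤ √q ^ (a + b) * 1 * (q ^ (a - b + 2) * (K + |s|) + K * √q ^ (a + 2)) := by
          gcongr
          exact abs_rootOneSub_le h0 _
      _ = (√q ^ (a + b) * q ^ (a - b + 2)) * (K + |s|) + √q ^ (a + b) * (K * √q ^ (a + 2)) := by
          ring
      _ ≤ √q ^ a * (K + |s|) + 1 * (K * √q ^ a) := by gcongr
      _ = _ := by ring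
  · intro t ht
    rw [sub_zero, abs_mul, abs_mul, abs_neg, abs_of_pos (zpow_pos hh0 t), mul_comm s,
      abs_of_nonneg hs]
    exact mul_le_mul_of_nonneg_right
      (mul_le_of_le_one_right (zpow_pos hh0 t).le (abs_rootOneSub_le h0 _)) hs

/-- Inserting the limit β = q(1 - s²) and dropping the term q²x² cancels the constant 1 - s² and
leaves the profile (1 - s²) q^(a+b). -/
theorem mem_oneSidedSpan_of_coeffAdiag (h0 : 0 < q) (h1 : q < 1)
    (hT : IsShift T 0 0 1 fun a b ε => (coeffAdiag q s n a b ε : ℂ)) :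
    T ∈ oneSidedSpan (√q) n 1 := by
  have hh0 := Real.sqrt_pos.2 h0
  have hh1 := sqrt_lt_one h1
  obtain ⟨K, hK, hβ⟩ := exists_abs_betaCoeff_sub_le h0 h1 s n
  set c := q * (1 - s ^ 2) with hc
  refine hT.mem_oneSidedSpan_ofReal hh0 hh1 (Or.inl rfl)
    (fun t => q ^ t * (1 - s ^ 2)) 0 ((3 * K + (K + |c|)) / q) |1 - s ^ 2| ?_ ?_ (Or.inl rfl)
  · intro a b ε h2 _
    have ha := h2.nonneg
    have hab := spinorLabel_iff.1 h2
    have hq : 0 < 1 + q ^ 2 := by positivity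
    have h3 : coeffAdiag q s n a b ε - q ^ (a + 1 * b) * (1 - s ^ 2) =
        -(((1 - (1 + q ^ 2) * q ^ (a + b)) * (betaCoeff q s n a ε - c) +
          q ^ 2 * (q ^ a) ^ 2 * betaCoeff q s n a ε) / q / (1 + q ^ 2)) := by
      unfold coeffAdiag
      rw [one_mul, hc]
      field_simp
      ring
    have h4 := hβ a ε ha
    have h5 := abs_le_of_abs_sub_le h0 h1 hK hβ ε ha
    have h6 : |1 - (1 + q ^ 2) * q ^ (a + b)| ≤ 3 := by
      have h7 : q ^ (a + b) ≤ 1 := zpow_le_one₀ h0 h1.le (by omega)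
      have h8 := zpow_pos h0 (a + b)
      have h9 : q ^ 2 ≤ 1 := by nlinarith
      rw [abs_le]
      constructor <;> nlinarith
    have h7 : q ^ 2 * (q ^ a) ^ 2 ≤ √q ^ a := by
      have h8 : q ^ a ≤ 1 := zpow_le_one₀ h0 h1.le ha
      have h9 := zpow_pos h0 a
      have h10 : q ^ 2 ≤ 1 := by nlinarith
      have h11 := zpow_le_sqrt_zpow h0 h1 ha
      nlinarith
    have h8 := zpow_pos hh0 a
    have h9 : |(1 - (1 + q ^ 2) * q ^ (a + b)) * (betaCoeff q s n a ε - c) +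
          q ^ 2 * (q ^ a) ^ 2 * betaCoeff q s n a ε| ≤ (3 * K + (K + |c|)) * √q ^ a :=
      calc _ ≤ 3 * (K * √q ^ a) + √q ^ a * (K + |c|) := by
            refine (abs_add_le _ _).trans ?_
            rw [abs_mul, abs_mul, abs_of_nonneg (by positivity : 0 ≤ q ^ 2 * (q ^ a) ^ 2)]
            gcongr
        _ = _ := by ring
    rw [h3, abs_neg, abs_div, abs_div, abs_of_pos h0, abs_of_pos hq, div_mul_eq_mul_div]
    refine (div_le_self (by positivity) (by nlinarith)).trans ?_
    gcongr
  · intro t ht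
    rw [sub_zero, abs_mul, abs_of_pos (zpow_pos h0 t), mul_comm |1 - s ^ 2|]
    exact mul_le_mul_of_nonneg_right (zpow_le_sqrt_zpow h0 h1 ht) (abs_nonneg _)

end Membership

/-! ### Uniform bounds for the weights. -/

section Boundedness

variable {q s : ℝ} {n : ℤ}

theorem exists_isShift_ofReal {n : ℤ} (p r : ℤ) (f : ℤ → ℤ → ℤˣ → ℝ)
    (hsupp : ∀ a b ε, SpinorLabel n a b → ¬ SpinorLabel n (a + p) (b + r) → f a b ε = 0)
    (hbdd : ∃ C : ℝ, ∀ a b ε, SpinorLabel n a b → |f a b ε| ≤ C) :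
    ∃ T : Spinors n →L[ℂ] Spinors n, IsShift T p r 1 fun a b ε => (f a b ε : ℂ) := by
  refine exists_isShift p r 1 _ (fun a b ε h h' => ?_) ?_
  · rw [hsupp a b ε h h', Complex.ofReal_zero]
  · obtain ⟨C, hC⟩ := hbdd
    exact ⟨C, fun a b ε h => by rw [Complex.norm_real]; exact hC a b ε h⟩

theorem zpow_add_le_one {h : ℝ} (h0 : 0 < h) (h1 : h < 1) {a b : ℤ} (hl : SpinorLabel n a b) :
    |h ^ (a + b)| ≤ 1 := by
  have := spinorLabel_iff.1 hl
  rw [abs_of_pos (zpow_pos h0 _)]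
  exact zpow_le_one₀ h0 h1.le (by omega)

theorem exists_abs_coeffBup_le (h0 : 0 < q) (h1 : q < 1) (hs : 0 ≤ s) :
    ∃ C : ℝ, ∀ a b ε, SpinorLabel n a b → |coeffBup q s n a b ε| ≤ C := by
  obtain ⟨K, hK, hα⟩ := exists_abs_alphaCoeff_sub_le h0 h1 hs n
  refine ⟨1 * 1 * (K + |s|), fun a b ε h => ?_⟩
  have ha := h.nonneg
  unfold coeffBup
  rw [abs_mul, abs_mul]
  gcongr
  · exact abs_rootOneSub_le h0 _
  · exact abs_rootOneSub_le h0 _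
  · exact abs_le_of_abs_sub_le h0 h1 hK hα ε (by omega)

theorem exists_abs_coeffBmid_le (h0 : 0 < q) (h1 : q < 1) :
    ∃ C : ℝ, ∀ a b ε, SpinorLabel n a b → |coeffBmid q s n a b ε| ≤ C := by
  obtain ⟨K, hK, hβ⟩ := exists_abs_betaCoeff_sub_le h0 h1 s n
  refine ⟨1 * 1 * 1 * (K + |q * (1 - s ^ 2)|), fun a b ε h => ?_⟩
  unfold coeffBmid
  rw [abs_mul, abs_mul, abs_mul, abs_neg]
  gcongr
  · exact zpow_add_le_one (Real.sqrt_pos.2 h0) (sqrt_lt_one h1) h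
  · exact abs_rootOneSub_le h0 _
  · exact abs_rootOneSub_le h0 _
  · exact abs_le_of_abs_sub_le h0 h1 hK hβ ε h.nonneg

theorem exists_abs_coeffBdown_le (h0 : 0 < q) (h1 : q < 1) (hs : 0 ≤ s) :
    ∃ C : ℝ, ∀ a b ε, SpinorLabel n a b → |coeffBdown q s n a b ε| ≤ C := by
  obtain ⟨K, hK, hα⟩ := exists_abs_alphaCoeff_sub_le h0 h1 hs n
  refine ⟨|q| * 1 * 1 * 1 * (K + |s|), fun a b ε h => ?_⟩
  unfold coeffBdown
  rw [abs_mul, abs_mul, abs_mul, abs_mul, abs_neg]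
  gcongr
  · exact zpow_add_le_one h0 h1 h
  · exact abs_rootOneSub_le h0 _
  · exact abs_rootOneSub_le h0 _
  · exact abs_le_of_abs_sub_le h0 h1 hK hα ε h.nonneg

theorem exists_abs_coeffAup_le (h0 : 0 < q) (h1 : q < 1) (hs : 0 ≤ s) :
    ∃ C : ℝ, ∀ a b ε, SpinorLabel n a b → |coeffAup q s n a b ε| ≤ C := by
  obtain ⟨K, hK, hα⟩ := exists_abs_alphaCoeff_sub_le h0 h1 hs n
  refine ⟨1 * 1 * 1 * (K + |s|), fun a b ε h => ?_⟩
  have ha := h.nonneg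
  unfold coeffAup
  rw [abs_mul, abs_mul, abs_mul, abs_neg]
  gcongr
  · exact zpow_add_le_one (Real.sqrt_pos.2 h0) (sqrt_lt_one h1) h
  · exact abs_rootOneSub_le h0 _
  · exact abs_rootOneSub_le h0 _
  · exact abs_le_of_abs_sub_le h0 h1 hK hα ε (by omega)

theorem exists_abs_coeffAdiag_le (h0 : 0 < q) (h1 : q < 1) :
    ∃ C : ℝ, ∀ a b ε, SpinorLabel n a b → |coeffAdiag q s n a b ε| ≤ C := by
  obtain ⟨K, hK, hβ⟩ := exists_abs_betaCoeff_sub_le h0 h1 s n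
  refine ⟨(|1 - s ^ 2| + (1 + (1 + q ^ 2) * 1 + q ^ 2 * 1 ^ 2) * (K + |q * (1 - s ^ 2)|) / q) /
    (1 + q ^ 2), fun a b ε h => ?_⟩
  have hq : 0 < 1 + q ^ 2 := by positivity
  unfold coeffAdiag
  rw [abs_div, abs_of_pos hq]
  gcongr
  refine (abs_sub _ _).trans ?_
  rw [abs_div, abs_mul, abs_of_pos h0]
  gcongr
  · refine (abs_add_le _ _).trans (add_le_add ((abs_sub _ _).trans ?_) ?_)
    · rw [abs_one, abs_mul, abs_of_pos hq]
      gcongr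
      exact zpow_add_le_one h0 h1 h
    · rw [abs_of_pos (mul_pos (pow_pos h0 2) (pow_pos (zpow_pos h0 a) 2))]
      have := zpow_pos h0 a
      gcongr
      exact zpow_le_one₀ h0 h1.le h.nonneg
  · exact abs_le_of_abs_sub_le h0 h1 hK hβ ε h.nonneg

end Boundedness

end

noncomputable section

/-! Identities between the matrix coefficients. -/

section Identities

variable {q s : ℝ} {n a b : ℤ} {ε : ℤˣ}

theorem betaCoeff_recursion (h0 : 0 < q) (h1 : q < 1) (s : ℝ) (n : ℤ) (ha : 0 < a) (ε : ℤˣ) :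
    (1 - q ^ 2) * (1 - s ^ 2) + q * betaCoeff q s n a ε * (1 - (q ^ a) ^ 2) =
      betaCoeff q s n (a + 2) ε / q * (1 - q ^ 8 * (q ^ a) ^ 2) := by
  have h2 := one_sub_zpow_sq_pos h0 h1 ha
  have h3 : ∀ k : ℕ, 1 - q ^ k * (q ^ a) ^ 2 ≠ 0 := by
    intro k
    have : q ^ k ≤ 1 := pow_le_one₀ h0.le h1.le
    nlinarith [sq_nonneg (q ^ a)]
  unfold betaCoeff
  rw [zpow_add₀ h0.ne', zpow_ofNat, mul_comm (q ^ a) (q ^ 2)]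
  exact betaReduced_recursion h0.ne' h2.ne' (h3 4) (h3 8)

/-- The inequality |n| ≤ a gives xv ≤ 1 and x/v ≤ 1, and a ≥ 1 gives x ≤ q, so all factors are
nonnegative. Hence squaring the root in `alphaCoeff` returns the rational expression. -/
theorem alphaSq_nonneg (h0 : 0 < q) (h1 : q < 1) (s : ℝ) (ha : 0 < a) (hn : |n| ≤ a) (ε : ℤˣ) :
    0 ≤ alphaSq q s (weightParam q n ε) (q ^ a) := by
  have hv := weightParam_pos h0 n ε
  have hx := zpow_pos h0 a
  have h2 := one_sub_zpow_sq_pos h0 h1 ha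
  have h3 : q ^ a * weightParam q n ε ≤ 1 := by
    rw [weightParam, ← zpow_add₀ h0.ne']
    exact zpow_le_one₀ h0 h1.le (by linarith [neg_abs_le_units_mul n ε])
  have h4 : q ^ a * (weightParam q n ε)⁻¹ ≤ 1 := by
    rw [weightParam, ← zpow_neg, ← zpow_add₀ h0.ne']
    exact zpow_le_one₀ h0 h1.le (by linarith [units_mul_le_abs n ε])
  have h5 : q ^ a ≤ q := by simpa using zpow_le_zpow_right_of_le_one₀ h0 h1.le (by omega : 1 ≤ a)
  have h6 : 0 ≤ 1 - (q ^ a) ^ 2 / q ^ 2 := by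
    rw [sub_nonneg, div_le_one (by positivity)]
    gcongr
  have h7 : 0 ≤ 1 - q ^ 2 * (q ^ a) ^ 2 := by nlinarith
  unfold alphaSq alphaNum
  refine div_nonneg (mul_nonneg (mul_nonneg (mul_nonneg (by linarith) (by linarith)) ?_) ?_) ?_ <;>
    positivity

theorem alphaCoeff_sq (h0 : 0 < q) (h1 : q < 1) (s : ℝ) (ha : 0 < a) (hn : |n| ≤ a) (ε : ℤˣ) :
    alphaCoeff q s n a ε ^ 2 = alphaSq q s (weightParam q n ε) (q ^ a) :=
  Real.sq_sqrt (alphaSq_nonneg h0 h1 s ha hn ε)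

/-- At l = |N| one has v = x or v = x⁻¹, and one of the first two factors vanishes. Thus the
convention α_{|M|} = 0 is built into the formula. -/
theorem alphaNum_abs (h0 : 0 < q) (s : ℝ) (n : ℤ) (ε : ℤˣ) :
    alphaNum s (weightParam q n ε) (q ^ |n|) = 0 := by
  have : (ε : ℤ) * n = |n| ∨ (ε : ℤ) * n = -|n| := by
    rcases Int.units_eq_one_or ε with rfl | rfl <;> rcases abs_choice n with h | h <;>
      simp [h]
  unfold alphaNum weightParam
  rcases this with h | h <;> rw [h]
  · rw [mul_inv_cancel₀ (zpow_pos h0 _).ne']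
    ring
  · rw [zpow_neg, mul_inv_cancel₀ (zpow_pos h0 _).ne']
    ring

theorem alphaCoeff_abs (h0 : 0 < q) (s : ℝ) (n : ℤ) (ε : ℤˣ) : alphaCoeff q s n |n| ε = 0 := by
  rw [alphaCoeff, alphaSq, alphaNum_abs h0, zero_div, Real.sqrt_zero]

/-- At a = |n| both sides vanish, including |n| = 1 where the factor 1 - x²/q² is zero; for larger a
this factor is positive and cancels. -/
theorem alphaCoeff_sq_mul (h0 : 0 < q) (h1 : q < 1) (s : ℝ) (hn0 : n ≠ 0) (hn : |n| ≤ a) (ε : ℤˣ) :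
    alphaCoeff q s n a ε ^ 2 * (1 - (q ^ a) ^ 2 / q ^ 2) =
      alphaNum s (weightParam q n ε) (q ^ a) /
        ((1 - (q ^ a) ^ 2) ^ 2 * (1 - q ^ 2 * (q ^ a) ^ 2)) := by
  rcases hn.eq_or_lt with rfl | h
  · rw [alphaCoeff_abs h0, alphaNum_abs h0]
    simp
  · have hn' := abs_pos.2 hn0
    have h5 : q ^ a < q := by
      simpa using zpow_lt_zpow_right_of_lt_one₀ h0 h1 (by omega : 1 < a)
    have h6 : 0 < 1 - (q ^ a) ^ 2 / q ^ 2 := by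
      have := zpow_pos h0 a
      rw [sub_pos, div_lt_one (by positivity)]
      gcongr
    rw [alphaCoeff_sq h0 h1 s (by omega) hn, alphaSq]
    generalize 1 - (q ^ a) ^ 2 / q ^ 2 = d at *
    field_simp

theorem alphaCoeff_add_two_sq_mul (h0 : 0 < q) (h1 : q < 1) (s : ℝ) (ha : 0 < a) (hn : |n| ≤ a)
    (ε : ℤˣ) : alphaCoeff q s n (a + 2) ε ^ 2 * (1 - q ^ 6 * (q ^ a) ^ 2) =
      alphaNum s (weightParam q n ε) (q ^ 2 * q ^ a) /
        ((1 - q ^ 4 * (q ^ a) ^ 2) ^ 2 * (1 - q ^ 2 * (q ^ a) ^ 2)) := by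
  have h2 := one_sub_zpow_sq_pos h0 h1 ha
  have h3 : ∀ k : ℕ, 1 - q ^ k * (q ^ a) ^ 2 ≠ 0 := by
    intro k
    have : q ^ k ≤ 1 := pow_le_one₀ h0.le h1.le
    nlinarith [sq_nonneg (q ^ a)]
  have h4 := h3 4
  have h6 := h3 6
  have h2' := h3 2
  rw [alphaCoeff_sq h0 h1 s (by omega) (by omega), alphaSq, zpow_add₀ h0.ne', zpow_ofNat,
    mul_comm (q ^ a)]
  have e1 : (q ^ 2 * q ^ a) ^ 2 / q ^ 2 = q ^ 2 * (q ^ a) ^ 2 := by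
    field_simp
  have e2 : q ^ 2 * (q ^ 2 * q ^ a) ^ 2 = q ^ 6 * (q ^ a) ^ 2 := by ring
  have e3 : (q ^ 2 * q ^ a) ^ 2 = q ^ 4 * (q ^ a) ^ 2 := by ring
  rw [e1, e2, e3]
  field_simp

theorem alphaCoeff_sq_sub (h0 : 0 < q) (h1 : q < 1) (s : ℝ) (hl : SpinorLabel n a b) (hn : n ≠ 0)
    (ε : ℤˣ) : q * (1 + q ^ 2) * (alphaCoeff q s n a ε ^ 2 * (1 - (q ^ a) ^ 2 / q ^ 2) -
        alphaCoeff q s n (a + 2) ε ^ 2 * (1 - q ^ 6 * (q ^ a) ^ 2)) =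
      (1 - q ^ 2) * betaCoeff q s n a ε *
        (1 - s ^ 2 - (1 + q ^ 2 * (q ^ a) ^ 2) * betaCoeff q s n a ε / q) := by
  have ha := hl.pos hn
  have h2 := one_sub_zpow_sq_pos h0 h1 ha
  have h3 : ∀ k : ℕ, 1 - q ^ k * (q ^ a) ^ 2 ≠ 0 := by
    intro k
    have : q ^ k ≤ 1 := pow_le_one₀ h0.le h1.le
    nlinarith [sq_nonneg (q ^ a)]
  exact alpha_beta_relation h0.ne' (weightParam_pos h0 n ε).ne' h2.ne' (h3 4) (h3 2) rfl
    (alphaCoeff_sq_mul h0 h1 s hn hl.1 ε) (alphaCoeff_add_two_sq_mul h0 h1 s ha hl.1 ε)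

theorem alphaCoeff_quadratic (h0 : 0 < q) (h1 : q < 1) (s : ℝ) (hl : SpinorLabel n a b)
    (hn : n ≠ 0) (ε : ℤˣ) :
    (1 + q ^ 2) ^ 2 * (alphaCoeff q s n a ε ^ 2 * (1 - (q ^ a) ^ 2 / q ^ 2) -
        (q ^ a) ^ 2 * betaCoeff q s n a ε ^ 2 -
        q ^ 2 * (q ^ a) ^ 2 * (alphaCoeff q s n (a + 2) ε ^ 2 * (1 - q ^ 6 * (q ^ a) ^ 2)) - s ^ 2)
      + (1 - s ^ 2 - (1 + q ^ 2 * (q ^ a) ^ 2) * betaCoeff q s n a ε / q) ^ 2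
      - (1 + q ^ 2) * (1 - s ^ 2) *
        (1 - s ^ 2 - (1 + q ^ 2 * (q ^ a) ^ 2) * betaCoeff q s n a ε / q) = 0 := by
  have ha := hl.pos hn
  have h2 := one_sub_zpow_sq_pos h0 h1 ha
  have h3 : ∀ k : ℕ, 1 - q ^ k * (q ^ a) ^ 2 ≠ 0 := by
    intro k
    have : q ^ k ≤ 1 := pow_le_one₀ h0.le h1.le
    nlinarith [sq_nonneg (q ^ a)]
  exact alpha_beta_quadratic h0.ne' (weightParam_pos h0 n ε).ne' h2.ne' (h3 4) (h3 2) rfl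
    (alphaCoeff_sq_mul h0 h1 s hn hl.1 ε) (alphaCoeff_add_two_sq_mul h0 h1 s ha hl.1 ε)

/-- The `_shift` lemmas write the exponents and root arguments as a + b or a - b plus a numeral.
Equal roots then become syntactically equal, and powers can be normalized by `sqrt_zpow_add`. -/
theorem coeffAup_shift (q s : ℝ) (n a b i j : ℤ) (ε : ℤˣ) :
    coeffAup q s n (a + i) (b + j) ε = -√q ^ (a + b + (i + j)) *
      rootOneSub q (a - b + (i - j + 2)) * rootOneSub q (a + b + (i + j + 2)) *
        alphaCoeff q s n (a + (i + 2)) ε := by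
  rw [coeffAup, show a + i + (b + j) = a + b + (i + j) by ring,
    show a + i - (b + j) + 2 = a - b + (i - j + 2) by ring,
    show a + b + (i + j) + 2 = a + b + (i + j + 2) by ring, add_assoc a i]

theorem coeffBup_shift (q s : ℝ) (n a b i j : ℤ) (ε : ℤˣ) :
    coeffBup q s n (a + i) (b + j) ε = rootOneSub q (a + b + (i + j + 2)) *
      rootOneSub q (a + b + (i + j + 4)) * alphaCoeff q s n (a + (i + 2)) ε := by
  rw [coeffBup, show a + i + (b + j) + 2 = a + b + (i + j + 2) by ring,
    show a + i + (b + j) + 4 = a + b + (i + j + 4) by ring, add_assoc a i]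

theorem coeffBmid_shift (q s : ℝ) (n a b i j : ℤ) (ε : ℤˣ) :
    coeffBmid q s n (a + i) (b + j) ε = -√q ^ (a + b + (i + j)) *
      rootOneSub q (a - b + (i - j)) * rootOneSub q (a + b + (i + j + 2)) *
        betaCoeff q s n (a + i) ε := by
  rw [coeffBmid, show a + i + (b + j) = a + b + (i + j) by ring,
    show a + i - (b + j) = a - b + (i - j) by ring,
    show a + b + (i + j) + 2 = a + b + (i + j + 2) by ring]

theorem coeffBdown_shift (h0 : 0 < q) (s : ℝ) (n a b i j : ℤ) (ε : ℤˣ) :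
    coeffBdown q s n (a + i) (b + j) ε = -q * (√q ^ (a + b + (i + j))) ^ 2 *
      rootOneSub q (a - b + (i - j)) * rootOneSub q (a - b + (i - j - 2)) *
        alphaCoeff q s n (a + i) ε := by
  rw [sqrt_zpow_sq h0]
  rw [coeffBdown, show a + i + (b + j) = a + b + (i + j) by ring,
    show a + i - (b + j) = a - b + (i - j) by ring,
    show a - b + (i - j) - 2 = a - b + (i - j - 2) by ring]

theorem coeffAdiag_shift (h0 : 0 < q) (s : ℝ) (n a b i j : ℤ) (ε : ℤˣ) :
    (1 + q ^ 2) * coeffAdiag q s n (a + i) (b + j) ε =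
      1 - s ^ 2 - (1 - (1 + q ^ 2) * (√q ^ (a + b + (i + j))) ^ 2 + q ^ 2 * (q ^ (a + i)) ^ 2) *
        (betaCoeff q s n (a + i) ε / q) := by
  have : 1 + q ^ 2 ≠ 0 := by positivity
  rw [sqrt_zpow_sq h0, show a + b + (i + j) = a + i + (b + j) by ring]
  unfold coeffAdiag
  field_simp

theorem rootOneSub_add_sq (h0 : 0 < q) (h1 : q < 1) {t : ℤ} (k : ℤ) (ht : 0 ≤ t + k) :
    rootOneSub q (t + k) ^ 2 = 1 - (√q ^ (t + k)) ^ 2 := by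
  rw [sqrt_zpow_sq h0, rootOneSub_sq h0 h1 ht]

theorem sqrt_zpow_add (h0 : 0 < q) (t i : ℤ) (k : ℕ) (j : ℤ) (hj : j = i + 2 * k) :
    √q ^ (t + j) = q ^ k * √q ^ (t + i) := by
  have hh := Real.sqrt_pos.2 h0
  rw [hj, ← add_assoc, zpow_add₀ hh.ne' (t + i), zpow_mul, zpow_ofNat, Real.sq_sqrt h0.le,
    zpow_natCast, mul_comm]

/-- x = q^a is expressed through √q^(a+b) and √q^(a-b). In these two variables, the roots and the
reduced coefficients, every relation is a polynomial identity. -/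
theorem zpow_eq_sqrt_mul (h0 : 0 < q) (a b i j k : ℤ) (h : 2 * i = j + k) :
    q ^ (a + i) = √q ^ (a + b + j) * √q ^ (a - b + k) := by
  have hh := Real.sqrt_pos.2 h0
  rw [← zpow_add₀ hh.ne', ← sqrt_zpow_sq h0, ← zpow_natCast, ← zpow_mul]
  congr 1
  push_cast
  linarith

theorem betaCoeff_recursion_shift (h0 : 0 < q) (h1 : q < 1) (s : ℝ) (n : ℤ) (i : ℤ)
    (ha : 0 < a + i) (ε : ℤˣ) :
    (1 - q ^ 2) * (1 - s ^ 2) + q * betaCoeff q s n (a + i) ε * (1 - (q ^ (a + i)) ^ 2) =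
      betaCoeff q s n (a + (i + 2)) ε / q * (1 - q ^ 8 * (q ^ (a + i)) ^ 2) := by
  rw [← add_assoc]
  exact betaCoeff_recursion h0 h1 s n ha ε

theorem zpow_sub_one_sq (h0 : 0 < q) (a : ℤ) : (q ^ a) ^ 2 / q ^ 2 = (q ^ (a + -1)) ^ 2 := by
  rw [← div_pow, zpow_add₀ h0.ne', zpow_neg_one, div_eq_mul_inv]

theorem alphaCoeff_sq_sub' (h0 : 0 < q) (h1 : q < 1) (s : ℝ) (hl : SpinorLabel n a b) (hn : n ≠ 0)
    (ε : ℤˣ) : (1 + q ^ 2) * (alphaCoeff q s n (a + 0) ε ^ 2 * (1 - (q ^ (a + -1)) ^ 2) -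
        alphaCoeff q s n (a + 2) ε ^ 2 * (1 - q ^ 6 * (q ^ (a + 0)) ^ 2)) =
      (1 - q ^ 2) * (betaCoeff q s n (a + 0) ε / q) *
        (1 - s ^ 2 - (1 + q ^ 2 * (q ^ (a + 0)) ^ 2) * (betaCoeff q s n (a + 0) ε / q)) := by
  have h := alphaCoeff_sq_sub h0 h1 s hl hn ε
  rw [zpow_sub_one_sq h0] at h
  simp only [add_zero]
  refine mul_left_cancel₀ h0.ne' ?_
  rw [← mul_assoc q, h]
  field_simp

theorem alphaCoeff_quadratic' (h0 : 0 < q) (h1 : q < 1) (s : ℝ) (hl : SpinorLabel n a b)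
    (hn : n ≠ 0) (ε : ℤˣ) :
    (1 + q ^ 2) ^ 2 * (alphaCoeff q s n (a + 0) ε ^ 2 * (1 - (q ^ (a + -1)) ^ 2) -
        (q ^ (a + 0)) ^ 2 * betaCoeff q s n (a + 0) ε ^ 2 -
        q ^ 2 * (q ^ (a + 0)) ^ 2 *
          (alphaCoeff q s n (a + 2) ε ^ 2 * (1 - q ^ 6 * (q ^ (a + 0)) ^ 2)) - s ^ 2)
      + (1 - s ^ 2 - (1 + q ^ 2 * (q ^ (a + 0)) ^ 2) * (betaCoeff q s n (a + 0) ε / q)) ^ 2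
      - (1 + q ^ 2) * (1 - s ^ 2) *
        (1 - s ^ 2 - (1 + q ^ 2 * (q ^ (a + 0)) ^ 2) * (betaCoeff q s n (a + 0) ε / q)) = 0 := by
  have h := alphaCoeff_quadratic h0 h1 s hl hn ε
  rw [zpow_sub_one_sq h0] at h
  simpa only [add_zero, mul_div_assoc] using h

/-- Writing β = qy turns the quotients β/q into polynomials, as `linear_combination` requires. -/
theorem exists_eq_mul (h0 : 0 < q) (x : ℝ) : ∃ y, x = q * y := ⟨x / q, by field_simp⟩

/-- For t ≥ 2 the square of the second root is 1 - q^{t-2}. At t = 0 this fails, since the root of a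
negative number is 0, but then the first factor vanishes. -/
theorem rootOneSub_mul_sq (h0 : 0 < q) (h1 : q < 1) {t : ℤ} (ht : 0 ≤ t) (h2 : 2 ∣ t) :
    rootOneSub q (t + 0) * rootOneSub q (t + -2) ^ 2 =
      rootOneSub q (t + 0) * (1 - (√q ^ (t + -2)) ^ 2) := by
  rcases ht.eq_or_lt with rfl | h
  · simp [rootOneSub_zero]
  · rw [rootOneSub_add_sq h0 h1 (-2) (by omega)]

/-! `A B = q² B A`. -/

theorem coeff_A_B_pos_four (h0 : 0 < q) :
    coeffAup q s n (a + 2) (b + 2) ε * coeffBup q s n (a + 0) (b + 0) ε =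
      q ^ 2 * (coeffBup q s n (a + 2) (b + 0) ε * coeffAup q s n (a + 0) (b + 0) ε) := by
  simp only [coeffAup_shift, coeffBup_shift, Int.reduceAdd, Int.reduceSub,
    sqrt_zpow_add h0 (a + b) 0 2 4 (by norm_num)]
  ring

/-- All terms share two roots and α_{l+1}. After squared roots are eliminated, what remains is the
difference of two diagonal weights of A, evaluated by the recursion for β. The other components
changing l by one step follow the same pattern. -/
theorem coeff_A_B_pos_two (h0 : 0 < q) (h1 : q < 1) (hn : n ≠ 0) (hl : SpinorLabel n a b) :
    coeffAup q s n (a + 0) (b + 2) ε * coeffBmid q s n (a + 0) (b + 0) ε +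
        coeffAdiag q s n (a + 2) (b + 2) ε * coeffBup q s n (a + 0) (b + 0) ε =
      q ^ 2 * (coeffBmid q s n (a + 2) (b + 0) ε * coeffAup q s n (a + 0) (b + 0) ε +
        coeffBup q s n (a + 0) (b + 0) ε * coeffAdiag q s n (a + 0) (b + 0) ε) := by
  have hab := spinorLabel_iff.1 hl
  have hp : 1 + q ^ 2 ≠ 0 := by positivity
  have e1 := coeffAdiag_shift h0 s n a b 2 2 ε
  have e2 := coeffAdiag_shift h0 s n a b 0 0 ε
  have hR := betaCoeff_recursion_shift (a := a) h0 h1 s n 0 (by have := hl.pos hn; omega) ε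
  have hV0 := rootOneSub_add_sq h0 h1 (t := a - b) 0 (by omega)
  have hV2 := rootOneSub_add_sq h0 h1 (t := a - b) 2 (by omega)
  simp only [coeffAup_shift, coeffBup_shift, coeffBmid_shift, coeffBdown_shift h0,
    Int.reduceAdd, Int.reduceSub, Int.reduceNeg,
    sqrt_zpow_add h0 (a + b) 0 1 2 (by norm_num),
    sqrt_zpow_add h0 (a + b) 0 2 4 (by norm_num),
    sqrt_zpow_add h0 (a - b) 0 1 2 (by norm_num),
    sqrt_zpow_add h0 (a - b) 0 2 4 (by norm_num),
    zpow_eq_sqrt_mul h0 a b 0 0 0 (by norm_num),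
    zpow_eq_sqrt_mul h0 a b 2 2 2 (by norm_num),
    zpow_eq_sqrt_mul h0 a b (-2) (-2) (-2) (by norm_num)]
    at ⊢ e1 e2 hR hV0 hV2
  obtain ⟨b0, hb0⟩ := exists_eq_mul h0 (betaCoeff q s n (a + 0) ε)
  obtain ⟨b2, hb2⟩ := exists_eq_mul h0 (betaCoeff q s n (a + 2) ε)
  obtain ⟨bm2, hbm2⟩ := exists_eq_mul h0 (betaCoeff q s n (a + -2) ε)
  simp only [hb0, hb2, hbm2, mul_div_cancel_left₀ _ h0.ne'] at ⊢ e1 e2 hR hV0 hV2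
  refine mul_left_cancel₀ hp ?_
  linear_combination rootOneSub q (a + b + 2) * rootOneSub q (a + b + 4) * alphaCoeff q s n (a + 2) ε *
    (e1 - q ^ 2 * e2 + (1 + q ^ 2) * (q * (√q ^ (a + b + 0)) ^ 2 * (q * b0) * hV0 -
      q ^ 3 * (√q ^ (a + b + 0)) ^ 2 * (q * b2) * hV2) + hR)

/-- The paths through l + 1 and l - 1 contribute a difference of squares of α, and
`alphaCoeff_sq_sub'` expresses it by β. -/
theorem coeff_A_B_zero (h0 : 0 < q) (h1 : q < 1) (hn : n ≠ 0) (hl : SpinorLabel n a b) :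
    coeffAup q s n (a + -2) (b + 2) ε * coeffBdown q s n (a + 0) (b + 0) ε +
        coeffAdiag q s n (a + 0) (b + 2) ε * coeffBmid q s n (a + 0) (b + 0) ε +
        coeffAup q s n (a + 0) (b + 2) ε * coeffBup q s n (a + 0) (b + 0) ε =
      q ^ 2 * (coeffBdown q s n (a + 2) (b + 0) ε * coeffAup q s n (a + 0) (b + 0) ε +
        coeffBmid q s n (a + 0) (b + 0) ε * coeffAdiag q s n (a + 0) (b + 0) ε +
        coeffBup q s n (a + -2) (b + 0) ε * coeffAup q s n (a + -2) (b + 0) ε) := by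
  have hab := spinorLabel_iff.1 hl
  have hp : 1 + q ^ 2 ≠ 0 := by positivity
  have e1 := coeffAdiag_shift h0 s n a b 0 2 ε
  have e2 := coeffAdiag_shift h0 s n a b 0 0 ε
  have hP := alphaCoeff_sq_sub' h0 h1 s hl hn ε
  have hU0 := rootOneSub_add_sq h0 h1 (t := a + b) 0 (by omega)
  have hU4 := rootOneSub_add_sq h0 h1 (t := a + b) 4 (by omega)
  have hV2 := rootOneSub_add_sq h0 h1 (t := a - b) 2 (by omega)
  have hV := rootOneSub_mul_sq h0 h1 (t := a - b) (by omega) (by omega)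
  simp only [coeffAup_shift, coeffBup_shift, coeffBmid_shift, coeffBdown_shift h0,
    Int.reduceAdd, Int.reduceSub, Int.reduceNeg,
    sqrt_zpow_add h0 (a + b) (-2) 1 0 (by norm_num),
    sqrt_zpow_add h0 (a + b) (-2) 2 2 (by norm_num),
    sqrt_zpow_add h0 (a + b) (-2) 3 4 (by norm_num),
    sqrt_zpow_add h0 (a - b) (-2) 1 0 (by norm_num),
    sqrt_zpow_add h0 (a - b) (-2) 2 2 (by norm_num),
    sqrt_zpow_add h0 (a - b) (-2) 3 4 (by norm_num),
    zpow_eq_sqrt_mul h0 a b 0 0 0 (by norm_num),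
    zpow_eq_sqrt_mul h0 a b 2 2 2 (by norm_num),
    zpow_eq_sqrt_mul h0 a b (-2) (-2) (-2) (by norm_num),
    zpow_eq_sqrt_mul h0 a b (-1) 0 (-2) (by norm_num)]
    at ⊢ e1 e2 hP hU0 hU4 hV2 hV
  obtain ⟨b0, hb0⟩ := exists_eq_mul h0 (betaCoeff q s n (a + 0) ε)
  obtain ⟨b2, hb2⟩ := exists_eq_mul h0 (betaCoeff q s n (a + 2) ε)
  obtain ⟨bm2, hbm2⟩ := exists_eq_mul h0 (betaCoeff q s n (a + -2) ε)
  simp only [hb0, hb2, hbm2, mul_div_cancel_left₀ _ h0.ne'] at ⊢ e1 e2 hP hU0 hU4 hV2 hV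
  refine mul_left_cancel₀ hp ?_
  linear_combination q * √q ^ (a + b + -2) * rootOneSub q (a - b + 0) * rootOneSub q (a + b + 2) *
    (-(q * b0) * e1 + q ^ 2 * (q * b0) * e2 + (1 + q ^ 2) * (q * alphaCoeff q s n (a + 0) ε ^ 2 * hU0 -
      q * alphaCoeff q s n (a + 2) ε ^ 2 * hU4 - q ^ 5 * (q * √q ^ (a + b + -2)) ^ 2 * alphaCoeff q s n (a + 2) ε ^ 2 * hV2) + q * hP) +
    (1 + q ^ 2) * (q * √q ^ (a + b + -2)) ^ 3 * q * rootOneSub q (a + b + 2) * alphaCoeff q s n (a + 0) ε ^ 2 * hV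

theorem coeff_A_B_neg_two (h0 : 0 < q) (h1 : q < 1) (hn : n ≠ 0) (hl : SpinorLabel n a b) :
    coeffAup q s n (a + -2) (b + 2) ε * coeffBmid q s n (a + 0) (b + 0) ε +
        coeffAdiag q s n (a + -2) (b + 2) ε * coeffBdown q s n (a + 0) (b + 0) ε =
      q ^ 2 * (coeffBmid q s n (a + -2) (b + 0) ε * coeffAup q s n (a + -2) (b + 0) ε +
        coeffBdown q s n (a + 0) (b + 0) ε * coeffAdiag q s n (a + 0) (b + 0) ε) := by
  have hab := spinorLabel_iff.1 hl
  have hp : 1 + q ^ 2 ≠ 0 := by positivity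
  -- At a = |n| every term contains α_{|N|} = 0. Otherwise a - 2 ≥ |n| > 0 by parity, and the
  -- recursion applies at a - 2.
  rcases hl.1.eq_or_lt with rfl | hlt
  · simp [coeffAup, coeffBdown, alphaCoeff_abs h0]
  have ha2 : 0 < a + -2 := by rcases abs_cases n with h | h <;> omega
  have e1 := coeffAdiag_shift h0 s n a b (-2) 2 ε
  have e2 := coeffAdiag_shift h0 s n a b 0 0 ε
  have hR := betaCoeff_recursion_shift (a := a) h0 h1 s n (-2) ha2 ε
  have hU0 := rootOneSub_add_sq h0 h1 (t := a + b) 0 (by omega)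
  have hU2 := rootOneSub_add_sq h0 h1 (t := a + b) 2 (by omega)
  simp only [coeffAup_shift, coeffBup_shift, coeffBmid_shift, coeffBdown_shift h0,
    Int.reduceAdd, Int.reduceSub, Int.reduceNeg,
    sqrt_zpow_add h0 (a + b) (-2) 1 0 (by norm_num),
    sqrt_zpow_add h0 (a + b) (-2) 2 2 (by norm_num),
    sqrt_zpow_add h0 (a + b) (-2) 3 4 (by norm_num),
    sqrt_zpow_add h0 (a - b) (-2) 1 0 (by norm_num),
    sqrt_zpow_add h0 (a - b) (-2) 2 2 (by norm_num),
    sqrt_zpow_add h0 (a - b) (-2) 3 4 (by norm_num),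
    zpow_eq_sqrt_mul h0 a b 0 0 0 (by norm_num),
    zpow_eq_sqrt_mul h0 a b 2 2 2 (by norm_num),
    zpow_eq_sqrt_mul h0 a b (-2) (-2) (-2) (by norm_num)]
    at ⊢ e1 e2 hR hU0 hU2
  obtain ⟨b0, hb0⟩ := exists_eq_mul h0 (betaCoeff q s n (a + 0) ε)
  obtain ⟨b2, hb2⟩ := exists_eq_mul h0 (betaCoeff q s n (a + 2) ε)
  obtain ⟨bm2, hbm2⟩ := exists_eq_mul h0 (betaCoeff q s n (a + -2) ε)
  simp only [hb0, hb2, hbm2, mul_div_cancel_left₀ _ h0.ne'] at ⊢ e1 e2 hR hU0 hU2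
  refine mul_left_cancel₀ hp ?_
  linear_combination (√q ^ (a + b + -2)) ^ 2 * rootOneSub q (a - b + 0) * rootOneSub q (a - b + -2) * alphaCoeff q s n (a + 0) ε * q ^ 2 *
    (-q * e1 + q ^ 3 * e2 + (1 + q ^ 2) * (q * b0 * hU2 - q * bm2 * hU0) - q * hR)

theorem coeff_A_B_neg_four (h0 : 0 < q) :
    coeffAup q s n (a + -4) (b + 2) ε * coeffBdown q s n (a + 0) (b + 0) ε =
      q ^ 2 * (coeffBdown q s n (a + -2) (b + 0) ε * coeffAup q s n (a + -2) (b + 0) ε) := by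
  simp only [coeffAup_shift, coeffBdown_shift h0, Int.reduceAdd, Int.reduceSub, Int.reduceNeg,
    sqrt_zpow_add h0 (a + b) (-2) 1 0 (by norm_num)]
  ring

/-! `B B^* + (A + s²) (A - 1) = 0`. -/

theorem coeff_B_Bs_pos_four (h0 : 0 < q) :
    coeffBup q s n (a + 2) (b + -2) ε * coeffBdown q s n (a + 2) (b + -2) ε +
      coeffAup q s n (a + 2) (b + 0) ε * coeffAup q s n (a + 0) (b + 0) ε = 0 := by
  simp only [coeffAup_shift, coeffBdown_shift h0, coeffBup_shift, Int.reduceAdd, Int.reduceSub,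
    Int.reduceNeg, sqrt_zpow_add h0 (a + b) 0 1 2 (by norm_num)]
  ring

theorem coeff_B_Bs_pos_two (h0 : 0 < q) (h1 : q < 1) (hn : n ≠ 0) (hl : SpinorLabel n a b) :
    coeffBup q s n (a + 0) (b + -2) ε * coeffBmid q s n (a + 0) (b + -2) ε +
        coeffBmid q s n (a + 2) (b + -2) ε * coeffBdown q s n (a + 2) (b + -2) ε +
        coeffAup q s n (a + 0) (b + 0) ε * coeffAdiag q s n (a + 0) (b + 0) ε +
        coeffAdiag q s n (a + 2) (b + 0) ε * coeffAup q s n (a + 0) (b + 0) ε +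
        (s ^ 2 - 1) * coeffAup q s n (a + 0) (b + 0) ε = 0 := by
  have hab := spinorLabel_iff.1 hl
  have hp : 1 + q ^ 2 ≠ 0 := by positivity
  have e1 := coeffAdiag_shift h0 s n a b 0 0 ε
  have e2 := coeffAdiag_shift h0 s n a b 2 0 ε
  have hR := betaCoeff_recursion_shift (a := a) h0 h1 s n 0 (by have := hl.pos hn; omega) ε
  have hU0 := rootOneSub_add_sq h0 h1 (t := a + b) 0 (by omega)
  have hV4 := rootOneSub_add_sq h0 h1 (t := a - b) 4 (by omega)
  simp only [coeffAup_shift, coeffBup_shift, coeffBmid_shift, coeffBdown_shift h0,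
    Int.reduceAdd, Int.reduceSub, Int.reduceNeg,
    sqrt_zpow_add h0 (a + b) (-2) 1 0 (by norm_num),
    sqrt_zpow_add h0 (a + b) (-2) 2 2 (by norm_num),
    sqrt_zpow_add h0 (a + b) (-2) 3 4 (by norm_num),
    sqrt_zpow_add h0 (a - b) 0 1 2 (by norm_num),
    sqrt_zpow_add h0 (a - b) 0 2 4 (by norm_num),
    zpow_eq_sqrt_mul h0 a b 0 0 0 (by norm_num),
    zpow_eq_sqrt_mul h0 a b 2 2 2 (by norm_num),
    zpow_eq_sqrt_mul h0 a b (-2) (-2) (-2) (by norm_num)]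
    at ⊢ e1 e2 hR hU0 hV4
  obtain ⟨b0, hb0⟩ := exists_eq_mul h0 (betaCoeff q s n (a + 0) ε)
  obtain ⟨b2, hb2⟩ := exists_eq_mul h0 (betaCoeff q s n (a + 2) ε)
  obtain ⟨bm2, hbm2⟩ := exists_eq_mul h0 (betaCoeff q s n (a + -2) ε)
  simp only [hb0, hb2, hbm2, mul_div_cancel_left₀ _ h0.ne'] at ⊢ e1 e2 hR hU0 hV4
  refine mul_left_cancel₀ hp ?_
  linear_combination -√q ^ (a + b + -2) * rootOneSub q (a - b + 2) * rootOneSub q (a + b + 2) * alphaCoeff q s n (a + 2) ε *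
    ((1 + q ^ 2) * (q * b0 * hU0 - q ^ 2 * (q * √q ^ (a + b + -2)) ^ 2 * (q * b2) * hV4) +
      q * e1 + q * e2 + q * hR)

/-- The part preserving l. Once the squared roots are removed, both relations between α² and β are
needed: the quadratic one and a multiple of `alphaCoeff_sq_sub'`. -/
theorem coeff_B_Bs_zero (h0 : 0 < q) (h1 : q < 1) (hn : n ≠ 0) (hl : SpinorLabel n a b) :
    coeffBup q s n (a + -2) (b + -2) ε ^ 2 +
        coeffBmid q s n (a + 0) (b + -2) ε ^ 2 +
        coeffBdown q s n (a + 2) (b + -2) ε ^ 2 +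
        coeffAup q s n (a + -2) (b + 0) ε ^ 2 +
        coeffAup q s n (a + 0) (b + 0) ε ^ 2 +
        coeffAdiag q s n (a + 0) (b + 0) ε ^ 2 +
        (s ^ 2 - 1) * coeffAdiag q s n (a + 0) (b + 0) ε - s ^ 2 = 0 := by
  have hab := spinorLabel_iff.1 hl
  have hp : 1 + q ^ 2 ≠ 0 := by positivity
  have e1 := coeffAdiag_shift h0 s n a b 0 0 ε
  have hP := alphaCoeff_sq_sub' h0 h1 s hl hn ε
  have hQ := alphaCoeff_quadratic' h0 h1 s hl hn ε
  have hU0 := rootOneSub_add_sq h0 h1 (t := a + b) 0 (by omega)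
  have hU2 := rootOneSub_add_sq h0 h1 (t := a + b) 2 (by omega)
  have hV0 := rootOneSub_add_sq h0 h1 (t := a - b) 0 (by omega)
  have hV2 := rootOneSub_add_sq h0 h1 (t := a - b) 2 (by omega)
  have hV4 := rootOneSub_add_sq h0 h1 (t := a - b) 4 (by omega)
  have hU := rootOneSub_mul_sq h0 h1 (t := a + b) (by omega) (by omega)
  simp only [coeffAup_shift, coeffBup_shift, coeffBmid_shift, coeffBdown_shift h0,
    Int.reduceAdd, Int.reduceSub, Int.reduceNeg,
    sqrt_zpow_add h0 (a + b) (-2) 1 0 (by norm_num),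
    sqrt_zpow_add h0 (a + b) (-2) 2 2 (by norm_num),
    sqrt_zpow_add h0 (a + b) (-2) 3 4 (by norm_num),
    sqrt_zpow_add h0 (a - b) 0 1 2 (by norm_num),
    sqrt_zpow_add h0 (a - b) 0 2 4 (by norm_num),
    zpow_eq_sqrt_mul h0 a b 0 0 0 (by norm_num),
    zpow_eq_sqrt_mul h0 a b 2 2 2 (by norm_num),
    zpow_eq_sqrt_mul h0 a b (-2) (-2) (-2) (by norm_num),
    zpow_eq_sqrt_mul h0 a b (-1) (-2) 0 (by norm_num)]
    at ⊢ e1 hP hQ hU0 hU2 hV0 hV2 hV4 hU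
  obtain ⟨b0, hb0⟩ := exists_eq_mul h0 (betaCoeff q s n (a + 0) ε)
  obtain ⟨b2, hb2⟩ := exists_eq_mul h0 (betaCoeff q s n (a + 2) ε)
  obtain ⟨bm2, hbm2⟩ := exists_eq_mul h0 (betaCoeff q s n (a + -2) ε)
  simp only [hb0, hb2, hbm2, mul_div_cancel_left₀ _ h0.ne'] at ⊢ e1 hP hQ hU0 hU2 hV0 hV2 hV4 hU
  -- The product form is valid also at a + b = 0, where the second root is 0 and does not square to
  -- 1 - q⁻².
  have hU' : rootOneSub q (a + b + 0) ^ 2 * rootOneSub q (a + b + -2) ^ 2 = rootOneSub q (a + b + 0) ^ 2 * (1 - (√q ^ (a + b + -2)) ^ 2) := by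
    linear_combination rootOneSub q (a + b + 0) * hU
  refine mul_left_cancel₀ (pow_ne_zero 2 hp) ?_
  linear_combination (1 + q ^ 2) ^ 2 * (alphaCoeff q s n (a + 0) ε ^ 2 * hU' + alphaCoeff q s n (a + 0) ε ^ 2 * (1 - (√q ^ (a + b + -2)) ^ 2) * hU0 +
      (√q ^ (a + b + -2)) ^ 2 * (q * b0) ^ 2 * (rootOneSub q (a - b + 2) ^ 2 * hU0 + (1 - (q * √q ^ (a + b + -2)) ^ 2) * hV2) +
      q ^ 2 * (q * √q ^ (a + b + -2)) ^ 4 * alphaCoeff q s n (a + 2) ε ^ 2 * (rootOneSub q (a - b + 2) ^ 2 * hV4 + (1 - q ^ 4 * (√q ^ (a - b + 0)) ^ 2) * hV2) +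
      (√q ^ (a + b + -2)) ^ 2 * alphaCoeff q s n (a + 0) ε ^ 2 * (rootOneSub q (a - b + 0) ^ 2 * hU0 + (1 - (q * √q ^ (a + b + -2)) ^ 2) * hV0) +
      (q * √q ^ (a + b + -2)) ^ 2 * alphaCoeff q s n (a + 2) ε ^ 2 * (rootOneSub q (a - b + 2) ^ 2 * hU2 + (1 - q ^ 4 * (√q ^ (a + b + -2)) ^ 2) * hV2)) +
    ((1 + q ^ 2) * coeffAdiag q s n (a + 0) (b + 0) ε + (1 - s ^ 2 - (1 - (1 + q ^ 2) * (q * √q ^ (a + b + -2)) ^ 2 +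
      q ^ 2 * (q * √q ^ (a + b + -2) * (√q ^ (a - b + 0))) ^ 2) * b0) + (s ^ 2 - 1) * (1 + q ^ 2)) * e1 + hQ -
    q ^ 2 * (√q ^ (a + b + -2)) ^ 2 * (1 + q ^ 2) * hP

/-! `B^* B + (q² A + s²) (q² A - 1) = 0`. -/

theorem coeff_Bs_B_pos_four (h0 : 0 < q) :
    coeffBdown q s n (a + 4) (b + 0) ε * coeffBup q s n (a + 0) (b + 0) ε +
      q ^ 4 * (coeffAup q s n (a + 2) (b + 0) ε * coeffAup q s n (a + 0) (b + 0) ε) = 0 := by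
  simp only [coeffAup_shift, coeffBdown_shift h0, coeffBup_shift, Int.reduceAdd, Int.reduceSub,
    Int.reduceNeg, sqrt_zpow_add h0 (a + b) 0 1 2 (by norm_num),
    sqrt_zpow_add h0 (a + b) 0 2 4 (by norm_num)]
  ring

theorem coeff_Bs_B_pos_two (h0 : 0 < q) (h1 : q < 1) (hn : n ≠ 0) (hl : SpinorLabel n a b) :
    coeffBmid q s n (a + 2) (b + 0) ε * coeffBup q s n (a + 0) (b + 0) ε +
        coeffBdown q s n (a + 2) (b + 0) ε * coeffBmid q s n (a + 0) (b + 0) ε +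
        q ^ 4 * (coeffAup q s n (a + 0) (b + 0) ε * coeffAdiag q s n (a + 0) (b + 0) ε +
        coeffAdiag q s n (a + 2) (b + 0) ε * coeffAup q s n (a + 0) (b + 0) ε) +
        q ^ 2 * (s ^ 2 - 1) * coeffAup q s n (a + 0) (b + 0) ε = 0 := by
  have hab := spinorLabel_iff.1 hl
  have hp : 1 + q ^ 2 ≠ 0 := by positivity
  have e1 := coeffAdiag_shift h0 s n a b 0 0 ε
  have e2 := coeffAdiag_shift h0 s n a b 2 0 ε
  have hR := betaCoeff_recursion_shift (a := a) h0 h1 s n 0 (by have := hl.pos hn; omega) ε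
  have hU4 := rootOneSub_add_sq h0 h1 (t := a + b) 4 (by omega)
  have hV0 := rootOneSub_add_sq h0 h1 (t := a - b) 0 (by omega)
  simp only [coeffAup_shift, coeffBup_shift, coeffBmid_shift, coeffBdown_shift h0,
    Int.reduceAdd, Int.reduceSub, Int.reduceNeg,
    sqrt_zpow_add h0 (a + b) 0 1 2 (by norm_num),
    sqrt_zpow_add h0 (a + b) 0 2 4 (by norm_num),
    sqrt_zpow_add h0 (a - b) 0 1 2 (by norm_num),
    sqrt_zpow_add h0 (a - b) 0 2 4 (by norm_num),
    zpow_eq_sqrt_mul h0 a b 0 0 0 (by norm_num),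
    zpow_eq_sqrt_mul h0 a b 2 2 2 (by norm_num),
    zpow_eq_sqrt_mul h0 a b (-2) (-2) (-2) (by norm_num)]
    at ⊢ e1 e2 hR hU4 hV0
  obtain ⟨b0, hb0⟩ := exists_eq_mul h0 (betaCoeff q s n (a + 0) ε)
  obtain ⟨b2, hb2⟩ := exists_eq_mul h0 (betaCoeff q s n (a + 2) ε)
  obtain ⟨bm2, hbm2⟩ := exists_eq_mul h0 (betaCoeff q s n (a + -2) ε)
  simp only [hb0, hb2, hbm2, mul_div_cancel_left₀ _ h0.ne'] at ⊢ e1 e2 hR hU4 hV0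
  refine mul_left_cancel₀ hp ?_
  linear_combination -√q ^ (a + b + 0) * rootOneSub q (a - b + 2) * rootOneSub q (a + b + 2) * alphaCoeff q s n (a + 2) ε *
    ((1 + q ^ 2) * (q * (q * b2) * hU4 - q ^ 3 * (√q ^ (a + b + 0)) ^ 2 * (q * b0) * hV0) +
      q ^ 4 * e1 + q ^ 4 * e2 - q ^ 2 * hR)

theorem coeff_Bs_B_zero (h0 : 0 < q) (h1 : q < 1) (hn : n ≠ 0) (hl : SpinorLabel n a b) :
    coeffBup q s n (a + 0) (b + 0) ε ^ 2 +
        coeffBmid q s n (a + 0) (b + 0) ε ^ 2 +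
        coeffBdown q s n (a + 0) (b + 0) ε ^ 2 +
        q ^ 4 * (coeffAup q s n (a + -2) (b + 0) ε ^ 2 +
        coeffAup q s n (a + 0) (b + 0) ε ^ 2 +
        coeffAdiag q s n (a + 0) (b + 0) ε ^ 2) +
        q ^ 2 * (s ^ 2 - 1) * coeffAdiag q s n (a + 0) (b + 0) ε - s ^ 2 = 0 := by
  have hab := spinorLabel_iff.1 hl
  have hp : 1 + q ^ 2 ≠ 0 := by positivity
  have e1 := coeffAdiag_shift h0 s n a b 0 0 ε
  have hP := alphaCoeff_sq_sub' h0 h1 s hl hn ε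
  have hQ := alphaCoeff_quadratic' h0 h1 s hl hn ε
  have hU0 := rootOneSub_add_sq h0 h1 (t := a + b) 0 (by omega)
  have hU2 := rootOneSub_add_sq h0 h1 (t := a + b) 2 (by omega)
  have hU4 := rootOneSub_add_sq h0 h1 (t := a + b) 4 (by omega)
  have hV0 := rootOneSub_add_sq h0 h1 (t := a - b) 0 (by omega)
  have hV2 := rootOneSub_add_sq h0 h1 (t := a - b) 2 (by omega)
  have hV := rootOneSub_mul_sq h0 h1 (t := a - b) (by omega) (by omega)
  simp only [coeffAup_shift, coeffBup_shift, coeffBmid_shift, coeffBdown_shift h0,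
    Int.reduceAdd, Int.reduceSub, Int.reduceNeg,
    sqrt_zpow_add h0 (a + b) (-2) 1 0 (by norm_num),
    sqrt_zpow_add h0 (a + b) (-2) 2 2 (by norm_num),
    sqrt_zpow_add h0 (a + b) (-2) 3 4 (by norm_num),
    sqrt_zpow_add h0 (a - b) (-2) 1 0 (by norm_num),
    sqrt_zpow_add h0 (a - b) (-2) 2 2 (by norm_num),
    sqrt_zpow_add h0 (a - b) (-2) 3 4 (by norm_num),
    zpow_eq_sqrt_mul h0 a b 0 0 0 (by norm_num),
    zpow_eq_sqrt_mul h0 a b 2 2 2 (by norm_num),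
    zpow_eq_sqrt_mul h0 a b (-2) (-2) (-2) (by norm_num),
    zpow_eq_sqrt_mul h0 a b (-1) 0 (-2) (by norm_num)]
    at ⊢ e1 hP hQ hU0 hU2 hU4 hV0 hV2 hV
  obtain ⟨b0, hb0⟩ := exists_eq_mul h0 (betaCoeff q s n (a + 0) ε)
  obtain ⟨b2, hb2⟩ := exists_eq_mul h0 (betaCoeff q s n (a + 2) ε)
  obtain ⟨bm2, hbm2⟩ := exists_eq_mul h0 (betaCoeff q s n (a + -2) ε)
  simp only [hb0, hb2, hbm2, mul_div_cancel_left₀ _ h0.ne'] at ⊢ e1 hP hQ hU0 hU2 hU4 hV0 hV2 hV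
  have hV' : rootOneSub q (a - b + 0) ^ 2 * rootOneSub q (a - b + -2) ^ 2 = rootOneSub q (a - b + 0) ^ 2 * (1 - (√q ^ (a - b + -2)) ^ 2) := by
    linear_combination rootOneSub q (a - b + 0) * hV
  refine mul_left_cancel₀ (pow_ne_zero 2 hp) ?_
  linear_combination (1 + q ^ 2) ^ 2 * (alphaCoeff q s n (a + 2) ε ^ 2 * (rootOneSub q (a + b + 2) ^ 2 * hU4 + (1 - (q ^ 3 * √q ^ (a + b + -2)) ^ 2) * hU2) +
      (q * √q ^ (a + b + -2)) ^ 2 * (q * b0) ^ 2 * (rootOneSub q (a - b + 0) ^ 2 * hU2 + (1 - q ^ 4 * (√q ^ (a + b + -2)) ^ 2) * hV0) +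
      q ^ 2 * (q * √q ^ (a + b + -2)) ^ 4 * alphaCoeff q s n (a + 0) ε ^ 2 * (hV' + (1 - (√q ^ (a - b + -2)) ^ 2) * hV0) +
      q ^ 4 * (√q ^ (a + b + -2)) ^ 2 * alphaCoeff q s n (a + 0) ε ^ 2 * (rootOneSub q (a - b + 0) ^ 2 * hU0 + (1 - (q * √q ^ (a + b + -2)) ^ 2) * hV0) +
      q ^ 4 * (q * √q ^ (a + b + -2)) ^ 2 * alphaCoeff q s n (a + 2) ε ^ 2 * (rootOneSub q (a - b + 2) ^ 2 * hU2 + (1 - q ^ 4 * (√q ^ (a + b + -2)) ^ 2) * hV2)) +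
    (q ^ 4 * ((1 + q ^ 2) * coeffAdiag q s n (a + 0) (b + 0) ε + (1 - s ^ 2 - (1 - (1 + q ^ 2) * (q * √q ^ (a + b + -2)) ^ 2 +
      q ^ 2 * (q * √q ^ (a + b + -2) * (q * (√q ^ (a - b + -2)))) ^ 2) * b0)) + q ^ 2 * (s ^ 2 - 1) * (1 + q ^ 2)) * e1 + hQ +
    (1 + q ^ 2) * (q ^ 2 * (q * √q ^ (a + b + -2)) ^ 2 - 1 - q ^ 2 * (q * √q ^ (a + b + -2) * (q * (√q ^ (a - b + -2)))) ^ 2) * hP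

end Identities

end

noncomputable section

/-! The representation of the coordinate algebra. -/

section ShiftArithmetic

variable {n : ℤ} {S T : Spinors n →L[ℂ] Spinors n} {p r p' r' P R : ℤ} {f g : ℤ → ℤ → ℤˣ → ℝ}

theorem IsShift.mul_ofReal (hS : IsShift S p r 1 fun a b ε => (f a b ε : ℂ))
    (hT : IsShift T p' r' 1 fun a b ε => (g a b ε : ℂ)) (hP : p' + p = P) (hR : r' + r = R) :
    IsShift (S * T) P R 1 fun a b ε => ((f (a + p') (b + r') ε * g a b ε : ℝ) : ℂ) := by
  refine ((hS.mul hT).cast hP hR rfl).congr fun a b ε _ => ?_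
  push_cast
  rw [mul_one]

theorem IsShift.add_ofReal (hS : IsShift S p r 1 fun a b ε => (f a b ε : ℂ))
    (hT : IsShift T p r 1 fun a b ε => (g a b ε : ℂ)) :
    IsShift (S + T) p r 1 fun a b ε => ((f a b ε + g a b ε : ℝ) : ℂ) :=
  (hS.add hT).congr fun a b ε _ => by push_cast; rfl

theorem IsShift.smul_ofReal (c : ℝ) (hS : IsShift S p r 1 fun a b ε => (f a b ε : ℂ)) :
    IsShift ((c : ℂ) • S) p r 1 fun a b ε => ((c * f a b ε : ℝ) : ℂ) :=
  (hS.smul c).congr fun a b ε _ => by push_cast; rfl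

theorem IsShift.one_ofReal :
    IsShift (1 : Spinors n →L[ℂ] Spinors n) 0 0 1 fun _ _ _ => ((1 : ℝ) : ℂ) :=
  IsShift.one.congr fun _ _ _ _ => by simp

theorem IsShift.eq_of_ofReal (hS : IsShift S p r 1 fun a b ε => (f a b ε : ℂ))
    (hT : IsShift T p r 1 fun a b ε => (g a b ε : ℂ))
    (h : ∀ a b ε, SpinorLabel n a b → f a b ε = g a b ε) : S = T :=
  hS.unique (hT.congr fun a b ε hl => by rw [h a b ε hl])

theorem IsShift.star_ofReal (hT : IsShift T p r 1 fun a b ε => (f a b ε : ℂ))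
    (h : ∀ a b ε, ¬ SpinorLabel n a b → SpinorLabel n (a + p) (b + r) → f a b ε = 0)
    (hp : -p = p') (hr : -r = r') :
    IsShift (star T) p' r' 1 fun a b ε => ((f (a + p') (b + r') ε : ℝ) : ℂ) := by
  subst hp hr
  refine (hT.adjoint fun a b ε h1 h2 => ?_).congr fun a b ε _ => ?_
  · rw [h a b ε h1 h2, Complex.ofReal_zero]
  · rw [Complex.conj_ofReal, mul_one, sub_eq_add_neg, sub_eq_add_neg]

end ShiftArithmetic

/-! ### Vanishing of the weights at the boundary of the label set. -/

section Supports

variable {q s : ℝ} {n a b : ℤ} {ε : ℤˣ}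

theorem coeffBmid_eq_zero (h : SpinorLabel n a b) (h' : ¬ SpinorLabel n (a + 0) (b + 2)) :
    coeffBmid q s n a b ε = 0 := by
  rw [spinorLabel_iff] at h h'
  have : a - b = 0 := by omega
  simp [coeffBmid, this, rootOneSub_zero]

theorem coeffBmid_eq_zero' (h : ¬ SpinorLabel n a b) (h' : SpinorLabel n (a + 0) (b + 2)) :
    coeffBmid q s n a b ε = 0 := by
  rw [spinorLabel_iff] at h h'
  have : a + b + 2 = 0 := by omega
  simp [coeffBmid, this, rootOneSub_zero]

theorem SpinorLabel.add_two (h : SpinorLabel n a b) {r : ℤ} (hr : r = 0 ∨ r = 2) :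
    SpinorLabel n (a + 2) (b + r) := by
  rw [spinorLabel_iff] at *
  omega

/-- A lowering step leaves the label set either at the bottom a = |n|, where α vanishes, or at the
edge b = a, b = a - 2, where one of the roots does. -/
theorem coeffBdown_eq_zero (h0 : 0 < q) (h : SpinorLabel n a b)
    (h' : ¬ SpinorLabel n (a + -2) (b + 2)) : coeffBdown q s n a b ε = 0 := by
  rw [spinorLabel_iff] at h h'
  by_cases hn : a = |n|
  · simp [coeffBdown, hn, alphaCoeff_abs h0]
  · have : a - b = 0 ∨ a - b - 2 = 0 := by
      rcases abs_cases n with h2 | h2 <;> omega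
    rcases this with h2 | h2 <;> simp [coeffBdown, h2, rootOneSub_zero]

theorem SpinorLabel.of_sub_two (h : SpinorLabel n (a + -2) (b + 2)) : SpinorLabel n a b := by
  rw [spinorLabel_iff] at *
  omega

/-- Entering an admissible label from outside happens at the bottom, where α vanishes, or at an
edge, where a root does. This is the condition under which the adjoint shift has the expected
weights. -/
theorem coeffAup_eq_zero' (h0 : 0 < q) (h : ¬ SpinorLabel n a b)
    (h' : SpinorLabel n (a + 2) (b + 0)) : coeffAup q s n a b ε = 0 := by
  rw [spinorLabel_iff] at h h'
  by_cases hn : a + 2 = |n|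
  · simp [coeffAup, hn, alphaCoeff_abs h0]
  · have : a - b + 2 = 0 ∨ a + b + 2 = 0 := by
      rcases abs_cases n with h2 | h2 <;> omega
    rcases this with h2 | h2 <;> simp [coeffAup, h2, rootOneSub_zero]

theorem coeffBup_eq_zero' (h0 : 0 < q) (h : ¬ SpinorLabel n a b)
    (h' : SpinorLabel n (a + 2) (b + 2)) : coeffBup q s n a b ε = 0 := by
  rw [spinorLabel_iff] at h h'
  by_cases hn : a + 2 = |n|
  · simp [coeffBup, hn, alphaCoeff_abs h0]
  · have : a + b + 2 = 0 ∨ a + b + 4 = 0 := by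
      rcases abs_cases n with h2 | h2 <;> omega
    rcases this with h2 | h2 <;> simp [coeffBup, h2, rootOneSub_zero]

end Supports

/-- The homogeneous parts of the generators `A` and `B`, as operators on spinors. -/
structure GeneratorShifts (q s : ℝ) (n : ℤ) where
  Aup : Spinors n →L[ℂ] Spinors n
  Adiag : Spinors n →L[ℂ] Spinors n
  Bup : Spinors n →L[ℂ] Spinors n
  Bmid : Spinors n →L[ℂ] Spinors n
  Bdown : Spinors n →L[ℂ] Spinors n
  isShift_Aup : IsShift Aup 2 0 1 fun a b ε => (coeffAup q s n a b ε : ℂ)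
  isShift_Adiag : IsShift Adiag 0 0 1 fun a b ε => (coeffAdiag q s n a b ε : ℂ)
  isShift_Bup : IsShift Bup 2 2 1 fun a b ε => (coeffBup q s n a b ε : ℂ)
  isShift_Bmid : IsShift Bmid 0 2 1 fun a b ε => (coeffBmid q s n a b ε : ℂ)
  isShift_Bdown : IsShift Bdown (-2) 2 1 fun a b ε => (coeffBdown q s n a b ε : ℂ)

theorem nonempty_generatorShifts {q s : ℝ} (h0 : 0 < q) (h1 : q < 1) (hs : 0 ≤ s) (n : ℤ) :
    Nonempty (GeneratorShifts q s n) := by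
  obtain ⟨Aup, h2⟩ := exists_isShift_ofReal (n := n) 2 0 (coeffAup q s n)
    (fun a b ε h h' => absurd (h.add_two (Or.inl rfl)) h') (exists_abs_coeffAup_le h0 h1 hs)
  obtain ⟨Adiag, h3⟩ := exists_isShift_ofReal (n := n) 0 0 (coeffAdiag q s n)
    (fun a b ε h h' => absurd (by simpa using h) h') (exists_abs_coeffAdiag_le h0 h1)
  obtain ⟨Bup, h4⟩ := exists_isShift_ofReal (n := n) 2 2 (coeffBup q s n)
    (fun a b ε h h' => absurd (h.add_two (Or.inr rfl)) h') (exists_abs_coeffBup_le h0 h1 hs)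
  obtain ⟨Bmid, h5⟩ := exists_isShift_ofReal (n := n) 0 2 (coeffBmid q s n)
    (fun a b ε h h' => coeffBmid_eq_zero h h') (exists_abs_coeffBmid_le h0 h1)
  obtain ⟨Bdown, h6⟩ := exists_isShift_ofReal (n := n) (-2) 2 (coeffBdown q s n)
    (fun a b ε h h' => coeffBdown_eq_zero h0 h h') (exists_abs_coeffBdown_le h0 h1 hs)
  exact ⟨⟨Aup, Adiag, Bup, Bmid, Bdown, h2, h3, h4, h5, h6⟩⟩

namespace GeneratorShifts

variable {q s : ℝ} {n : ℤ} (G : GeneratorShifts q s n)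

theorem isShift_star_Aup (h0 : 0 < q) : IsShift (star G.Aup) (-2) 0 1
    fun a b ε => (coeffAup q s n (a + -2) (b + 0) ε : ℂ) :=
  G.isShift_Aup.star_ofReal (fun _ _ _ => coeffAup_eq_zero' h0) rfl rfl

theorem star_Adiag : star G.Adiag = G.Adiag := by
  refine IsShift.unique (G.isShift_Adiag.star_ofReal (p' := 0) (r' := 0) ?_ rfl rfl) ?_
  · intro a b ε h h'
    exact absurd (by simpa using h') h
  · exact G.isShift_Adiag.congr fun a b ε _ => by simp

theorem isShift_star_Bup (h0 : 0 < q) : IsShift (star G.Bup) (-2) (-2) 1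
    fun a b ε => (coeffBup q s n (a + -2) (b + -2) ε : ℂ) :=
  G.isShift_Bup.star_ofReal (fun _ _ _ => coeffBup_eq_zero' h0) rfl rfl

theorem isShift_star_Bmid : IsShift (star G.Bmid) 0 (-2) 1
    fun a b ε => (coeffBmid q s n (a + 0) (b + -2) ε : ℂ) :=
  G.isShift_Bmid.star_ofReal (fun _ _ _ => coeffBmid_eq_zero') rfl rfl

theorem isShift_star_Bdown : IsShift (star G.Bdown) 2 (-2) 1
    fun a b ε => (coeffBdown q s n (a + 2) (b + -2) ε : ℂ) :=
  G.isShift_Bdown.star_ofReal (fun _ _ _ h h' => absurd h'.of_sub_two h) rfl rfl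

/-- The operator of the generator `A`. -/
def opA : Spinors n →L[ℂ] Spinors n := G.Aup + G.Adiag + star G.Aup

/-- The operator of the generator `B`. -/
def opB : Spinors n →L[ℂ] Spinors n := G.Bup + G.Bmid + G.Bdown

theorem star_opA : star G.opA = G.opA := by
  simp only [opA, star_add, star_star, star_Adiag]
  abel

/-- Both sides split by the change of l into five homogeneous parts. Each part is a single weighted
shift, so its equation is an identity of weights. -/
theorem opA_mul_opB (h0 : 0 < q) (h1 : q < 1) (hn : n ≠ 0) :
    G.opA * G.opB = ((q ^ 2 : ℝ) : ℂ) • (G.opB * G.opA) := by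
  have hA := G.isShift_Aup
  have hA0 := G.isShift_Adiag
  have hA' := G.isShift_star_Aup h0
  have hB := G.isShift_Bup
  have hB0 := G.isShift_Bmid
  have hB' := G.isShift_Bdown
  have e4 : G.Aup * G.Bup = ((q ^ 2 : ℝ) : ℂ) • (G.Bup * G.Aup) :=
    (hA.mul_ofReal hB (P := 4) (R := 2) rfl rfl).eq_of_ofReal
      ((hB.mul_ofReal hA rfl rfl).smul_ofReal _) fun a b ε _ => by
        simpa using coeff_A_B_pos_four (s := s) (n := n) (a := a) (b := b) (ε := ε) h0
  have e2 : G.Aup * G.Bmid + G.Adiag * G.Bup =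
      ((q ^ 2 : ℝ) : ℂ) • (G.Bmid * G.Aup + G.Bup * G.Adiag) :=
    ((hA.mul_ofReal hB0 (P := 2) (R := 2) rfl rfl).add_ofReal
      (hA0.mul_ofReal hB rfl rfl)).eq_of_ofReal
      (((hB0.mul_ofReal hA rfl rfl).add_ofReal (hB.mul_ofReal hA0 rfl rfl)).smul_ofReal _)
        fun a b ε h => by simpa using coeff_A_B_pos_two (s := s) (ε := ε) h0 h1 hn h
  have e0 : G.Aup * G.Bdown + G.Adiag * G.Bmid + star G.Aup * G.Bup =
      ((q ^ 2 : ℝ) : ℂ) • (G.Bdown * G.Aup + G.Bmid * G.Adiag + G.Bup * star G.Aup) :=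
    (((hA.mul_ofReal hB' (P := 0) (R := 2) rfl rfl).add_ofReal
      (hA0.mul_ofReal hB0 rfl rfl)).add_ofReal (hA'.mul_ofReal hB rfl rfl)).eq_of_ofReal
      ((((hB'.mul_ofReal hA rfl rfl).add_ofReal (hB0.mul_ofReal hA0 rfl rfl)).add_ofReal
        (hB.mul_ofReal hA' rfl rfl)).smul_ofReal _)
        fun a b ε h => by simpa using coeff_A_B_zero (s := s) (ε := ε) h0 h1 hn h
  have e2' : star G.Aup * G.Bmid + G.Adiag * G.Bdown =
      ((q ^ 2 : ℝ) : ℂ) • (G.Bmid * star G.Aup + G.Bdown * G.Adiag) :=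
    ((hA'.mul_ofReal hB0 (P := -2) (R := 2) rfl rfl).add_ofReal
      (hA0.mul_ofReal hB' rfl rfl)).eq_of_ofReal
      (((hB0.mul_ofReal hA' rfl rfl).add_ofReal (hB'.mul_ofReal hA0 rfl rfl)).smul_ofReal _)
        fun a b ε h => by simpa using coeff_A_B_neg_two (s := s) (ε := ε) h0 h1 hn h
  have e4' : star G.Aup * G.Bdown = ((q ^ 2 : ℝ) : ℂ) • (G.Bdown * star G.Aup) :=
    (hA'.mul_ofReal hB' (P := -4) (R := 2) rfl rfl).eq_of_ofReal
      ((hB'.mul_ofReal hA' rfl rfl).smul_ofReal _) fun a b ε _ => by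
        simpa [add_assoc] using coeff_A_B_neg_four (s := s) (n := n) (a := a) (b := b) (ε := ε) h0
  calc G.opA * G.opB = G.Aup * G.Bup + (G.Aup * G.Bmid + G.Adiag * G.Bup) +
        (G.Aup * G.Bdown + G.Adiag * G.Bmid + star G.Aup * G.Bup) +
        (star G.Aup * G.Bmid + G.Adiag * G.Bdown) + star G.Aup * G.Bdown := by
        simp only [opA, opB, mul_add, add_mul]
        abel
    _ = _ := by
        rw [e4, e2, e0, e2', e4']
        simp only [opA, opB, mul_add, add_mul, smul_add]
        abel

theorem star_opB_mul_opA (h0 : 0 < q) (h1 : q < 1) (hn : n ≠ 0) :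
    star G.opB * G.opA = ((q ^ 2 : ℝ) : ℂ) • (G.opA * star G.opB) := by
  have h := congrArg star (G.opA_mul_opB h0 h1 hn)
  simpa [star_opA, star_smul] using h

/-- The two sphere relations are self-adjoint: the parts lowering l are adjoints of those raising
it, so only the parts of degree 0, 2 and 4 have to be computed. -/
theorem add_star_eq_zero {X0 X2 X4 : Spinors n →L[ℂ] Spinors n} (h0 : X0 = 0) (h2 : X2 = 0)
    (h4 : X4 = 0) : X4 + X2 + X0 + star X2 + star X4 = 0 := by
  simp [h0, h2, h4]

theorem opB_mul_star_opB (h0 : 0 < q) (h1 : q < 1) (hn : n ≠ 0) :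
    G.opB * star G.opB + (G.opA + ((s ^ 2 : ℝ) : ℂ) • 1) * (G.opA - 1) = 0 := by
  have hA := G.isShift_Aup
  have hA0 := G.isShift_Adiag
  have hA' := G.isShift_star_Aup h0
  have hB := G.isShift_Bup
  have hB0 := G.isShift_Bmid
  have hB' := G.isShift_Bdown
  have hBs := G.isShift_star_Bup h0
  have hB0s := G.isShift_star_Bmid
  have hBs' := G.isShift_star_Bdown
  have hz : ∀ p r, IsShift (0 : Spinors n →L[ℂ] Spinors n) p r 1 fun _ _ _ => ((0 : ℝ) : ℂ) :=
    fun p r => (IsShift.zero p r 1).congr fun _ _ _ _ => by simp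
  have e4 : G.Bup * star G.Bdown + G.Aup * G.Aup = 0 :=
    ((hB.mul_ofReal hBs' (P := 4) (R := 0) rfl rfl).add_ofReal
      (hA.mul_ofReal hA rfl rfl)).eq_of_ofReal (hz 4 0) fun a b ε _ => by
        simpa using coeff_B_Bs_pos_four (s := s) (n := n) (a := a) (b := b) (ε := ε) h0
  have e2 : G.Bup * star G.Bmid + G.Bmid * star G.Bdown + G.Aup * G.Adiag + G.Adiag * G.Aup +
      ((s ^ 2 - 1 : ℝ) : ℂ) • G.Aup = 0 :=
    (((((hB.mul_ofReal hB0s (P := 2) (R := 0) rfl rfl).add_ofReal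
      (hB0.mul_ofReal hBs' rfl rfl)).add_ofReal (hA.mul_ofReal hA0 rfl rfl)).add_ofReal
      (hA0.mul_ofReal hA rfl rfl)).add_ofReal (hA.smul_ofReal _)).eq_of_ofReal (hz 2 0)
      fun a b ε h => by simpa using coeff_B_Bs_pos_two (s := s) (ε := ε) h0 h1 hn h
  have e0 : G.Bup * star G.Bup + G.Bmid * star G.Bmid + G.Bdown * star G.Bdown +
      G.Aup * star G.Aup + star G.Aup * G.Aup + G.Adiag * G.Adiag +
      ((s ^ 2 - 1 : ℝ) : ℂ) • G.Adiag + ((-s ^ 2 : ℝ) : ℂ) • 1 = 0 :=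
    ((((((((hB.mul_ofReal hBs (P := 0) (R := 0) rfl rfl).add_ofReal
      (hB0.mul_ofReal hB0s rfl rfl)).add_ofReal (hB'.mul_ofReal hBs' rfl rfl)).add_ofReal
      (hA.mul_ofReal hA' rfl rfl)).add_ofReal (hA'.mul_ofReal hA rfl rfl)).add_ofReal
      (hA0.mul_ofReal hA0 rfl rfl)).add_ofReal (hA0.smul_ofReal _)).add_ofReal
      (IsShift.one_ofReal.smul_ofReal _)).eq_of_ofReal (hz 0 0)
      fun a b ε h => by
        have := coeff_B_Bs_zero (s := s) (ε := ε) h0 h1 hn h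
        simp only [add_zero] at this
        simp only [add_zero, neg_add_cancel_right, add_neg_cancel_right]
        linear_combination this
  refine Eq.trans ?_ (add_star_eq_zero e0 e2 e4)
  have hc : ((s ^ 2 - 1 : ℝ) : ℂ) = ((s ^ 2 : ℝ) : ℂ) - 1 := by push_cast; rfl
  have hc' : ((-s ^ 2 : ℝ) : ℂ) = -((s ^ 2 : ℝ) : ℂ) := by push_cast; rfl
  rw [hc, hc']
  simp only [opA, opB, mul_add, add_mul, mul_sub, smul_mul_assoc, one_mul, mul_one, star_add,
    star_mul, star_star, star_smul, star_Adiag, RCLike.star_def, map_sub, map_one,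
    Complex.conj_ofReal]
  module

theorem star_opB_mul_opB (h0 : 0 < q) (h1 : q < 1) (hn : n ≠ 0) :
    star G.opB * G.opB + (((q ^ 2 : ℝ) : ℂ) • G.opA + ((s ^ 2 : ℝ) : ℂ) • 1) *
      (((q ^ 2 : ℝ) : ℂ) • G.opA - 1) = 0 := by
  have hA := G.isShift_Aup
  have hA0 := G.isShift_Adiag
  have hA' := G.isShift_star_Aup h0
  have hB := G.isShift_Bup
  have hB0 := G.isShift_Bmid
  have hB' := G.isShift_Bdown
  have hBs := G.isShift_star_Bup h0
  have hB0s := G.isShift_star_Bmid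
  have hBs' := G.isShift_star_Bdown
  have hz : ∀ p r, IsShift (0 : Spinors n →L[ℂ] Spinors n) p r 1 fun _ _ _ => ((0 : ℝ) : ℂ) :=
    fun p r => (IsShift.zero p r 1).congr fun _ _ _ _ => by simp
  have e4 : star G.Bdown * G.Bup + ((q ^ 4 : ℝ) : ℂ) • (G.Aup * G.Aup) = 0 :=
    ((hBs'.mul_ofReal hB (P := 4) (R := 0) rfl rfl).add_ofReal
      ((hA.mul_ofReal hA rfl rfl).smul_ofReal _)).eq_of_ofReal (hz 4 0) fun a b ε _ => by
        simpa [add_assoc] using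
          coeff_Bs_B_pos_four (s := s) (n := n) (a := a) (b := b) (ε := ε) h0
  have e2 : star G.Bmid * G.Bup + star G.Bdown * G.Bmid +
      ((q ^ 4 : ℝ) : ℂ) • (G.Aup * G.Adiag + G.Adiag * G.Aup) +
      ((q ^ 2 * (s ^ 2 - 1) : ℝ) : ℂ) • G.Aup = 0 :=
    ((((hB0s.mul_ofReal hB (P := 2) (R := 0) rfl rfl).add_ofReal
      (hBs'.mul_ofReal hB0 rfl rfl)).add_ofReal (((hA.mul_ofReal hA0 rfl rfl).add_ofReal
      (hA0.mul_ofReal hA rfl rfl)).smul_ofReal _)).add_ofReal (hA.smul_ofReal _)).eq_of_ofReal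
      (hz 2 0) fun a b ε h => by
        simpa using coeff_Bs_B_pos_two (s := s) (ε := ε) h0 h1 hn h
  have e0 : star G.Bup * G.Bup + star G.Bmid * G.Bmid + star G.Bdown * G.Bdown +
      ((q ^ 4 : ℝ) : ℂ) • (G.Aup * star G.Aup + star G.Aup * G.Aup + G.Adiag * G.Adiag) +
      ((q ^ 2 * (s ^ 2 - 1) : ℝ) : ℂ) • G.Adiag + ((-s ^ 2 : ℝ) : ℂ) • 1 = 0 :=
    ((((((hBs.mul_ofReal hB (P := 0) (R := 0) rfl rfl).add_ofReal
      (hB0s.mul_ofReal hB0 rfl rfl)).add_ofReal (hBs'.mul_ofReal hB' rfl rfl)).add_ofReal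
      ((((hA.mul_ofReal hA' rfl rfl).add_ofReal (hA'.mul_ofReal hA rfl rfl)).add_ofReal
      (hA0.mul_ofReal hA0 rfl rfl)).smul_ofReal _)).add_ofReal (hA0.smul_ofReal _)).add_ofReal
      (IsShift.one_ofReal.smul_ofReal _)).eq_of_ofReal (hz 0 0)
      fun a b ε h => by
        have := coeff_Bs_B_zero (s := s) (ε := ε) h0 h1 hn h
        simp only [add_zero] at this
        simp only [add_zero, neg_add_cancel_right, add_neg_cancel_right]
        linear_combination this
  refine Eq.trans ?_ (add_star_eq_zero e0 e2 e4)
  have hc : ((q ^ 2 * (s ^ 2 - 1) : ℝ) : ℂ) =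
      ((q ^ 2 : ℝ) : ℂ) * (((s ^ 2 : ℝ) : ℂ) - 1) := by push_cast; rfl
  have hc' : ((-s ^ 2 : ℝ) : ℂ) = -((s ^ 2 : ℝ) : ℂ) := by push_cast; rfl
  have hc4 : ((q ^ 4 : ℝ) : ℂ) = ((q ^ 2 : ℝ) : ℂ) * ((q ^ 2 : ℝ) : ℂ) := by push_cast; ring
  rw [hc, hc', hc4]
  simp only [opA, opB, mul_add, add_mul, mul_sub, smul_mul_assoc, mul_smul_comm, one_mul, mul_one,
    star_add, star_mul, star_star, star_smul, star_Adiag, RCLike.star_def, map_sub, map_one,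
    map_mul, Complex.conj_ofReal, smul_add]
  module

end GeneratorShifts

end

noncomputable section

/-! ### Existence and uniqueness of the representation. -/

section Representation

variable {q : Set.Ioo (0 : ℝ) 1} {s : ℝ} {n : ℤ} (G : GeneratorShifts q s n)

theorem PodlesAlg.star_Bs (q : Set.Ioo (0 : ℝ) 1) (s : ℝ) :
    star (PodlesAlg.Bs q s) = PodlesAlg.B q s := by
  rw [← PodlesAlg.star_B, star_star]

theorem qC_sq : qC q ^ 2 = (((q : ℝ) ^ 2 : ℝ) : ℂ) := by
  unfold qC
  push_cast
  rfl

/-- The representation defined by the homogeneous parts of the generators. -/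
def GeneratorShifts.algRep (hn : n ≠ 0) : PodlesAlg q s →ₐ[ℂ] (Spinors n →L[ℂ] Spinors n) :=
  PodlesAlg.lift q s (fun x => match x with
    | .A => G.opA
    | .B => G.opB
    | .Bs => star G.opB)
    (by rw [qC_sq]; exact G.opA_mul_opB q.2.1 q.2.2 hn)
    (by rw [qC_sq]; exact G.star_opB_mul_opA q.2.1 q.2.2 hn)
    (by rw [← Complex.ofReal_pow]; exact G.opB_mul_star_opB q.2.1 q.2.2 hn)
    (by rw [← Complex.ofReal_pow, qC_sq]; exact G.star_opB_mul_opB q.2.1 q.2.2 hn)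

theorem GeneratorShifts.algRep_gen (hn : n ≠ 0) (x : PodlesGen) :
    G.algRep hn (PodlesAlg.gen q s x) = match x with
    | .A => G.opA
    | .B => G.opB
    | .Bs => star G.opB := PodlesAlg.lift_gen q s _ _ _ _ _ x

/-- The `*`-representation defined by the homogeneous parts of the generators. -/
def GeneratorShifts.rep (hn : n ≠ 0) : PodlesAlg q s →⋆ₐ[ℂ] (Spinors n →L[ℂ] Spinors n) :=
  { G.algRep hn with
    map_star' := fun x => by
      change G.algRep hn (star x) = star (G.algRep hn x)
      induction x using PodlesAlg.induction with
      | h0 c =>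
        rw [← algebraMap_star_comm, AlgHom.commutes, AlgHom.commutes, algebraMap_star_comm]
      | h1 x =>
        cases x
        · rw [PodlesAlg.star_A, G.algRep_gen hn, G.star_opA]
        · rw [PodlesAlg.star_B, G.algRep_gen hn, G.algRep_gen hn]
        · rw [PodlesAlg.star_Bs, G.algRep_gen hn, G.algRep_gen hn, star_star]
      | hmul a b ha hb => rw [star_mul, map_mul, map_mul, star_mul, ha, hb]
      | hadd a b ha hb => rw [star_add, map_add, map_add, star_add, ha, hb] }

theorem GeneratorShifts.rep_A (hn : n ≠ 0) : G.rep hn (PodlesAlg.A q s) = G.opA :=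
  G.algRep_gen hn .A

theorem GeneratorShifts.rep_B (hn : n ≠ 0) : G.rep hn (PodlesAlg.B q s) = G.opB :=
  G.algRep_gen hn .B

theorem GeneratorShifts.opB_ket {a b : ℤ} (ε : ℤˣ) (h : SpinorLabel n a b) :
    G.opB (ket n a b ε) = (coeffBup q s n a b ε : ℂ) • ket n (a + 2) (b + 2) ε +
      (coeffBmid q s n a b ε : ℂ) • ket n a (b + 2) ε +
      (coeffBdown q s n a b ε : ℂ) • ket n (a - 2) (b + 2) ε := by
  rw [opB, add_apply, add_apply, G.isShift_Bup.apply_ket ε h,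
    G.isShift_Bmid.apply_ket ε h, G.isShift_Bdown.apply_ket ε h, mul_one, add_zero, sub_eq_add_neg]

theorem GeneratorShifts.opA_ket {a b : ℤ} (ε : ℤˣ) (h : SpinorLabel n a b) :
    G.opA (ket n a b ε) = (coeffAup q s n a b ε : ℂ) • ket n (a + 2) b ε +
      (coeffAdiag q s n a b ε : ℂ) • ket n a b ε +
      (coeffAup q s n (a - 2) b ε : ℂ) • ket n (a - 2) b ε := by
  rw [opA, add_apply, add_apply, G.isShift_Aup.apply_ket ε h,
    G.isShift_Adiag.apply_ket ε h, (G.isShift_star_Aup q.2.1).apply_ket ε h, mul_one, add_zero,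
    add_zero, sub_eq_add_neg]

variable (q) in
theorem sqrt_q_mul_qNum_two_pos : 0 < √((q : ℝ) * qNum q 2) := by
  rw [q_mul_qNum_two q.2.1 q.2.2]
  exact Real.sqrt_pos.2 (by positivity)

theorem x1_ket_eq {a b : ℤ} (ε : ℤˣ) (hn : n ≠ 0) (h : SpinorLabel n a b) {l m N : ℝ}
    (hl : l = (a : ℝ) / 2) (hm : m = (b : ℝ) / 2) (hN : N = ((ε : ℤ) : ℝ) * ((n : ℝ) / 2)) :
    (coeffBplus q s N l m : ℂ) • ket n (a + 2) (b + 2) ε +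
      (coeffBzero q s N l m : ℂ) • ket n a (b + 2) ε +
      (coeffBminus q s N l m : ℂ) • ket n (a - 2) (b + 2) ε =
    ((√((q : ℝ) * qNum q 2) : ℝ) : ℂ) • G.opB (ket n a b ε) := by
  rw [G.opB_ket ε h, coeffBplus_eq q.2.1 q.2.2 hn h hl hm hN,
    coeffBzero_eq q.2.1 q.2.2 hn h hl hm hN, coeffBminus_eq q.2.1 q.2.2 hn h hl hm hN]
  simp only [Complex.ofReal_mul, smul_add, smul_smul]

theorem x0_ket_eq {a b : ℤ} (ε : ℤˣ) (hn : n ≠ 0) (h : SpinorLabel n a b) {l m N : ℝ}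
    (hl : l = (a : ℝ) / 2) (hm : m = (b : ℝ) / 2) (hN : N = ((ε : ℤ) : ℝ) * ((n : ℝ) / 2)) :
    (coeffAplus q s N l m : ℂ) • ket n (a + 2) b ε +
      (coeffAzero q s N l m : ℂ) • ket n a b ε +
      (coeffAplus q s N (l - 1) m : ℂ) • ket n (a - 2) b ε =
    -(((q : ℝ) * qNum q 2 : ℝ) : ℂ) • G.opA (ket n a b ε) +
      ((1 - s ^ 2 : ℝ) : ℂ) • ket n a b ε := by
  have hab := spinorLabel_iff.1 h
  rw [G.opA_ket ε h, coeffAplus_eq q.2.1 q.2.2 hn (by omega) (by omega) hl hm hN,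
    coeffAzero_eq q.2.1 q.2.2 hn h hl hm hN,
    coeffAplus_eq q.2.1 q.2.2 hn (a := a - 2) (by omega) (by omega)
      (by rw [hl]; push_cast; ring) hm hN]
  simp only [Complex.ofReal_mul, Complex.ofReal_add, Complex.ofReal_neg]
  module

theorem GeneratorShifts.isSpinorRep (hn : n ≠ 0) : IsSpinorRep q s n (G.rep hn) := by
  intro a b ε h l m N hl hm hN
  rw [x1_ket_eq G ε hn h hl hm hN, x0_ket_eq G ε hn h hl hm hN, PodlesAlg.x1, PodlesAlg.x0,
    map_add, map_smul, map_smul, map_smul, map_one, G.rep_A, G.rep_B]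
  exact ⟨rfl, rfl⟩

variable {π : PodlesAlg q s →⋆ₐ[ℂ] (Spinors n →L[ℂ] Spinors n)}

/-- The scalar relating x₁ and B is nonzero, so the prescribed values on basis vectors determine the
bounded operator. -/
theorem IsSpinorRep.map_B (hπ : IsSpinorRep q s n π) (hn : n ≠ 0) :
    π (PodlesAlg.B q s) = G.opB := by
  refine clm_ext_ket fun a b ε h => ?_
  have h1 := (hπ a b ε h _ _ _ rfl rfl rfl).1
  rw [x1_ket_eq G ε hn h rfl rfl rfl, PodlesAlg.x1, map_smul, smul_apply] at h1
  exact smul_right_injective _ (Complex.ofReal_ne_zero.2 (sqrt_q_mul_qNum_two_pos q).ne') h1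

theorem IsSpinorRep.map_A (hπ : IsSpinorRep q s n π) (hn : n ≠ 0) :
    π (PodlesAlg.A q s) = G.opA := by
  refine clm_ext_ket fun a b ε h => ?_
  have h1 := (hπ a b ε h _ _ _ rfl rfl rfl).2
  rw [x0_ket_eq G ε hn h rfl rfl rfl, PodlesAlg.x0, map_add, map_smul, map_smul, map_one,
    add_apply, smul_apply, smul_apply] at h1
  have h2 := add_right_cancel h1
  have h3 : (-(((q : ℝ) * qNum q 2 : ℝ) : ℂ)) ≠ 0 := by
    rw [q_mul_qNum_two q.2.1 q.2.2, neg_ne_zero, Complex.ofReal_ne_zero]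
    positivity
  exact smul_right_injective _ h3 h2

theorem IsSpinorRep.map_Bs (hπ : IsSpinorRep q s n π) (hn : n ≠ 0) :
    π (PodlesAlg.Bs q s) = star G.opB := by
  rw [← PodlesAlg.star_B, map_star, hπ.map_B G hn]

theorem IsSpinorRep.eq_rep (hπ : IsSpinorRep q s n π) (hn : n ≠ 0) : π = G.rep hn := by
  have h : π.toAlgHom = (G.rep hn).toAlgHom := by
    refine PodlesAlg.algHom_ext q s fun x => ?_
    have hG := G.isSpinorRep hn
    cases x
    · exact (hπ.map_A G hn).trans (hG.map_A G hn).symm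
    · exact (hπ.map_B G hn).trans (hG.map_B G hn).symm
    · exact (hπ.map_Bs G hn).trans (hG.map_Bs G hn).symm
  ext1 x
  exact DFunLike.congr_fun h x

theorem existsUnique_isSpinorRep (q : Set.Ioo (0 : ℝ) 1) (hs : 0 ≤ s) (hn : n ≠ 0) :
    ∃! π : PodlesAlg q s →⋆ₐ[ℂ] (Spinors n →L[ℂ] Spinors n), IsSpinorRep q s n π := by
  obtain ⟨G⟩ := nonempty_generatorShifts q.2.1 q.2.2 hs n
  exact ⟨G.rep hn, G.isSpinorRep hn, fun π hπ => hπ.eq_rep G hn⟩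

/-- The image of the representation is generated by three explicit operators, so statements about
the abstract algebra reduce to them. -/
theorem IsSpinorRep.induction (hπ : IsSpinorRep q s n π) (hn : n ≠ 0)
    {p : (Spinors n →L[ℂ] Spinors n) → Prop} (hone : p 1) (hA : p G.opA) (hB : p G.opB)
    (hBs : p (star G.opB)) (hmul : ∀ S T, p S → p T → p (S * T))
    (hadd : ∀ S T, p S → p T → p (S + T)) (hsmul : ∀ (c : ℂ) T, p T → p (c • T))
    (x : PodlesAlg q s) : p (π x) := by
  induction x using PodlesAlg.induction with
  | h0 c =>
    rw [AlgHomClass.commutes, Algebra.algebraMap_eq_smul_one]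
    exact hsmul c 1 hone
  | h1 x =>
    cases x
    · rw [hπ.map_A G hn]; exact hA
    · rw [hπ.map_B G hn]; exact hB
    · rw [hπ.map_Bs G hn]; exact hBs
  | hmul a b ha hb => rw [map_mul]; exact hmul _ _ ha hb
  | hadd a b ha hb => rw [map_add]; exact hadd _ _ ha hb

variable (s)

theorem GeneratorShifts.opA_mem_oneSidedSpan (hs : 0 ≤ s) (G : GeneratorShifts q s n) :
    G.opA ∈ oneSidedSpan (√q) n 1 := by
  have h := mem_oneSidedSpan_of_coeffAup q.2.1 q.2.2 hs G.isShift_Aup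
  exact add_mem (add_mem h (mem_oneSidedSpan_of_coeffAdiag q.2.1 q.2.2 G.isShift_Adiag))
    (star_mem_oneSidedSpan (Real.sqrt_pos.2 q.2.1) h)

theorem GeneratorShifts.opB_mem_oneSidedSpan (hs : 0 ≤ s) (G : GeneratorShifts q s n) :
    G.opB ∈ oneSidedSpan (√q) n 1 :=
  add_mem (add_mem (mem_oneSidedSpan_of_coeffBup q.2.1 q.2.2 hs G.isShift_Bup)
    (mem_oneSidedSpan_of_coeffBmid q.2.1 q.2.2 G.isShift_Bmid))
    (mem_oneSidedSpan_of_coeffBdown q.2.1 q.2.2 hs G.isShift_Bdown)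

end Representation

end

noncomputable section

/-! Commutators modulo smoothing operators. -/

/-- The operators `S` and `T` commute up to sums of weighted shifts with rapidly decaying weights. -/
def CommutesModRapid {n : ℤ} (S T : Spinors n →L[ℂ] Spinors n) : Prop :=
  S * T - T * S ∈ rapidSpan n

namespace CommutesModRapid

variable {n : ℤ} {S S' T T' : Spinors n →L[ℂ] Spinors n}

theorem symm (h : CommutesModRapid S T) : CommutesModRapid T S := by
  have := neg_mem h
  rwa [neg_sub] at this

theorem one_right (S : Spinors n →L[ℂ] Spinors n) : CommutesModRapid S 1 := by
  simp [CommutesModRapid]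

theorem zero_right (S : Spinors n →L[ℂ] Spinors n) : CommutesModRapid S 0 := by
  simp [CommutesModRapid]

theorem add_right (h : CommutesModRapid S T) (h' : CommutesModRapid S T') :
    CommutesModRapid S (T + T') := by
  have := add_mem h h'
  unfold CommutesModRapid
  convert this using 1
  noncomm_ring

theorem smul_right (c : ℂ) (h : CommutesModRapid S T) : CommutesModRapid S (c • T) := by
  have := Submodule.smul_mem _ c h
  unfold CommutesModRapid
  rwa [mul_smul_comm, smul_mul_assoc, ← smul_sub]

/-- Leibniz rule for [S, TT']. The rapidly decaying operators form an ideal only within the finite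
sums of shifts, which is why `T` and `T'` must lie there. -/
theorem mul_right (h : CommutesModRapid S T) (h' : CommutesModRapid S T') (hT : T ∈ shiftSpan n)
    (hT' : T' ∈ shiftSpan n) : CommutesModRapid S (T * T') := by
  have := add_mem (mul_mem_rapidSpan_left h hT') (mul_mem_rapidSpan_right hT h')
  unfold CommutesModRapid
  convert this using 1
  noncomm_ring

theorem of_mem_rapidSpan (hS : S ∈ shiftSpan n) (hT : T ∈ rapidSpan n) : CommutesModRapid S T :=
  commutator_mem_rapidSpan_left hS hT

end CommutesModRapid

section DiracCommutator

variable {n : ℤ} {h : ℝ} {σ : ℤ} {T : Spinors n →L[ℂ] Spinors n}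

/-- `[D, T] = F [|D|, T] + [F, T] |D|`. -/
theorem exists_dirac_commutator (hT : T ∈ oneSidedSpan h n σ) :
    ∃ C ∈ oneSidedSpan h n σ, ∃ R ∈ rapidSpan n,
      IsCommutator (dirac n) T (signOperator n * C + R) := by
  obtain ⟨C, hC, h1⟩ := exists_commutator_of_mem_oneSidedSpan hT
  -- [F, T] is smoothing, so the unbounded factor |D| on its right still yields a smoothing
  -- operator.
  obtain ⟨R, hR, h2⟩ := exists_mul_absDirac_of_mem_rapidSpan
    (signOperator_commutator_mem_rapidSpan hT)
  refine ⟨C, hC, R, hR, fun x => ?_⟩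
  obtain ⟨h3, h4⟩ := h1 x
  refine ⟨h3, ?_⟩
  have h5 := h2 x
  change signOperator n (absDirac n ⟨T x, h3⟩) - T (signOperator n (absDirac n x)) =
    signOperator n (C x) + R x
  rw [← h4, ← h5, map_sub]
  simp only [sub_apply, mul_apply_eq_comp]
  abel

end DiracCommutator

/-! ### Commutators with the conjugated algebra. -/

section RealStructure

variable {q : Set.Ioo (0 : ℝ) 1} {s : ℝ} {n : ℤ}
  {π : PodlesAlg q s →⋆ₐ[ℂ] (Spinors n →L[ℂ] Spinors n)}

theorem IsSpinorRep.mem_shiftSpan (hπ : IsSpinorRep q s n π) (hs : 0 ≤ s) (hn : n ≠ 0)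
    (a : PodlesAlg q s) : π a ∈ shiftSpan n := by
  obtain ⟨G⟩ := nonempty_generatorShifts q.2.1 q.2.2 hs n
  have hB := oneSidedSpan_le_shiftSpan (G.opB_mem_oneSidedSpan s hs)
  exact hπ.induction G hn one_mem_shiftSpan
    (oneSidedSpan_le_shiftSpan (G.opA_mem_oneSidedSpan s hs)) hB (star_mem_shiftSpan hB)
    (fun _ _ => mul_mem_shiftSpan) (fun _ _ => add_mem) (fun c _ => Submodule.smul_mem _ c) a

/-- Conjugation by J is multiplicative, so it suffices to test against the conjugated generators,
which lie in the class σ = -1. -/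
theorem IsSpinorRep.commutesModRapid_conjBy (hπ : IsSpinorRep q s n π) (hs : 0 ≤ s) (hn : n ≠ 0)
    {S : Spinors n →L[ℂ] Spinors n}
    (hS : ∀ T ∈ oneSidedSpan (√q) n (-1), CommutesModRapid S T) (b : PodlesAlg q s) :
    CommutesModRapid S (conjBy (realStructure n) (π b)) := by
  obtain ⟨G⟩ := nonempty_generatorShifts q.2.1 q.2.2 hs n
  have hB := G.opB_mem_oneSidedSpan s hs
  have key : π b ∈ shiftSpan n ∧ CommutesModRapid S (conjBy (realStructure n) (π b)) := by
    have hgen : ∀ T ∈ oneSidedSpan (√q) n 1,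
        T ∈ shiftSpan n ∧ CommutesModRapid S (conjBy (realStructure n) T) := fun T hT =>
      ⟨oneSidedSpan_le_shiftSpan hT, hS _ (conjBy_mem_oneSidedSpan hT)⟩
    refine hπ.induction G hn (p := fun T => T ∈ shiftSpan n ∧
      CommutesModRapid S (conjBy (realStructure n) T)) ?_ (hgen _ (G.opA_mem_oneSidedSpan s hs))
      (hgen _ hB) (hgen _ (star_mem_oneSidedSpan (Real.sqrt_pos.2 q.2.1) hB)) ?_ ?_ ?_ b
    · rw [conjBy_one]
      exact ⟨one_mem_shiftSpan, CommutesModRapid.one_right S⟩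
    · rintro T T' ⟨h1, h2⟩ ⟨h3, h4⟩
      rw [conjBy_mul]
      exact ⟨mul_mem_shiftSpan h1 h3,
        h2.mul_right h4 (conjBy_mem_shiftSpan h1) (conjBy_mem_shiftSpan h3)⟩
    · rintro T T' ⟨h1, h2⟩ ⟨h3, h4⟩
      rw [conjBy_add]
      exact ⟨add_mem h1 h3, h2.add_right h4⟩
    · rintro c T ⟨h1, h2⟩
      rw [conjBy_smul]
      exact ⟨Submodule.smul_mem _ c h1, h2.smul_right _⟩
  exact key.2

/-- The property proved by induction also records that the operator and its commutator with D are
finite sums of shifts. Without this the Leibniz rule would not preserve commutation modulo smoothing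
operators. -/
theorem IsSpinorRep.exists_commutator_commutesModRapid (hπ : IsSpinorRep q s n π) (hs : 0 ≤ s)
    (hn : n ≠ 0) (a : PodlesAlg q s) :
    (∀ b, CommutesModRapid (π a) (conjBy (realStructure n) (π b))) ∧
    ∃ C : Spinors n →L[ℂ] Spinors n, IsCommutator (dirac n) (π a) C ∧
      ∀ b, CommutesModRapid C (conjBy (realStructure n) (π b)) := by
  have h0 := Real.sqrt_pos.2 q.2.1
  have h1 := sqrt_lt_one q.2.2
  obtain ⟨G⟩ := nonempty_generatorShifts q.2.1 q.2.2 hs n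
  have hB := G.opB_mem_oneSidedSpan s hs
  let p : (Spinors n →L[ℂ] Spinors n) → Prop := fun T => T ∈ shiftSpan n ∧
    (∀ b, CommutesModRapid T (conjBy (realStructure n) (π b))) ∧
    ∃ C ∈ shiftSpan n, IsCommutator (dirac n) T C ∧
      ∀ b, CommutesModRapid C (conjBy (realStructure n) (π b))
  have hgen : ∀ T ∈ oneSidedSpan (√q) n 1, p T := by
    intro T hT
    obtain ⟨C, hC, R, hR, h2⟩ := exists_dirac_commutator hT
    refine ⟨oneSidedSpan_le_shiftSpan hT, hπ.commutesModRapid_conjBy hs hn fun Y hY =>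
      oneSidedSpan_commutator_mem_rapidSpan h0 h1 hT hY, _, add_mem (mul_mem_shiftSpan
        signOperator_mem_shiftSpan (oneSidedSpan_le_shiftSpan hC)) (rapidSpan_le_shiftSpan hR),
      h2, hπ.commutesModRapid_conjBy hs hn fun Y hY => ?_⟩
    have hY' := oneSidedSpan_le_shiftSpan hY
    have hC' := oneSidedSpan_le_shiftSpan hC
    -- For a generator the commutator with D is FC + R: here F commutes with `Y` modulo smoothing
    -- operators, `C` lies in the class opposite to that of `Y`, and `R` is smoothing.
    have h3 : CommutesModRapid Y (signOperator n) :=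
      CommutesModRapid.symm (signOperator_commutator_mem_rapidSpan hY)
    have h4 : CommutesModRapid Y C :=
      CommutesModRapid.symm (oneSidedSpan_commutator_mem_rapidSpan h0 h1 hC hY)
    exact ((h3.mul_right h4 signOperator_mem_shiftSpan hC').add_right
      (CommutesModRapid.of_mem_rapidSpan hY' hR)).symm
  have hY : ∀ b, conjBy (realStructure n) (π b) ∈ shiftSpan n := fun b =>
    conjBy_mem_shiftSpan (hπ.mem_shiftSpan hs hn b)
  have key : p (π a) := by
    refine hπ.induction G hn ?_ (hgen _ (G.opA_mem_oneSidedSpan s hs)) (hgen _ hB)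
      (hgen _ (star_mem_oneSidedSpan h0 hB)) ?_ ?_ ?_ a
    · exact ⟨one_mem_shiftSpan, fun b => (CommutesModRapid.one_right _).symm, 0, zero_mem _,
        IsCommutator.one, fun b => (CommutesModRapid.zero_right _).symm⟩
    · rintro T T' ⟨h2, h3, C, h4, h5, h6⟩ ⟨h2', h3', C', h4', h5', h6'⟩
      refine ⟨mul_mem_shiftSpan h2 h2', fun b => ((h3 b).symm.mul_right (h3' b).symm h2 h2').symm,
        _, add_mem (mul_mem_shiftSpan h4 h2') (mul_mem_shiftSpan h2 h4'), h5.mul h5', fun b => ?_⟩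
      exact (((h6 b).symm.mul_right (h3' b).symm h4 h2').add_right
        ((h3 b).symm.mul_right (h6' b).symm h2 h4')).symm
    · rintro T T' ⟨h2, h3, C, h4, h5, h6⟩ ⟨h2', h3', C', h4', h5', h6'⟩
      exact ⟨add_mem h2 h2', fun b => ((h3 b).symm.add_right (h3' b).symm).symm, _,
        add_mem h4 h4', h5.add h5', fun b => ((h6 b).symm.add_right (h6' b).symm).symm⟩
    · rintro c T ⟨h2, h3, C, h4, h5, h6⟩
      exact ⟨Submodule.smul_mem _ c h2, fun b => ((h3 b).symm.smul_right c).symm, _,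
        Submodule.smul_mem _ c h4, h5.smul c, fun b => ((h6 b).symm.smul_right c).symm⟩
  exact ⟨key.2.1, key.2.2.imp fun C h => h.2⟩

end RealStructure

end

noncomputable section

/-! Self-adjointness of diagonal operators and of the Dirac operator. -/

section SelfAdjoint
set_option linter.unusedSectionVars false

variable {H : Type*} [NormedAddCommGroup H] [InnerProductSpace ℂ H] [CompleteSpace H]

/-- Symmetry gives P ≤ P*. The condition `hm` says that the domain of P* is contained in that of P,
which gives equality. -/
theorem LinearPMap.isSelfAdjoint_of_isFormalAdjoint (P : H →ₗ.[ℂ] H)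
    (hd : Dense (P.domain : Set H)) (hs : P.IsFormalAdjoint P)
    (hm : ∀ y u : H, (∀ x : P.domain, inner ℂ (P x) y = inner ℂ (x : H) u) → y ∈ P.domain) :
    IsSelfAdjoint P := by
  rw [LinearPMap.isSelfAdjoint_def]
  refine (LinearPMap.eq_of_le_of_domain_eq (hs.le_adjoint hd) ?_).symm
  refine le_antisymm (hs.le_adjoint hd).1 fun y hy => hm y (P.adjoint ⟨y, hy⟩) fun x => ?_
  have h := LinearPMap.adjoint_isFormalAdjoint hd ⟨y, hy⟩ x
  rw [← inner_conj_symm, ← inner_conj_symm (x : H), h]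

end SelfAdjoint

/-! ### Diagonal operators on their maximal domain. -/

section Diagonal

variable {ι : Type*} {w : ι → ℝ}

theorem diagonalOperator_eq_of_apply {x y : lp (fun _ : ι => ℂ) 2}
    (h : ∀ i, y i = (w i : ℂ) * x i) :
    ∃ hx : x ∈ (diagonalOperator w).domain, diagonalOperator w ⟨x, hx⟩ = y := by
  have hx : x ∈ (diagonalOperator w).domain := by
    change Memℓp (fun i => (w i : ℂ) * x i) 2
    rw [← funext h]
    exact lp.memℓp y
  exact ⟨hx, by ext i; exact (h i).symm⟩

theorem diagonalOperator_apply (x : (diagonalOperator w).domain) (i : ι) :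
    diagonalOperator w x i = (w i : ℂ) * (x : lp (fun _ : ι => ℂ) 2) i := rfl

theorem diagonalOperator_isFormalAdjoint (w : ι → ℝ) :
    (diagonalOperator w).IsFormalAdjoint (diagonalOperator w) := by
  intro x y
  rw [lp.inner_eq_tsum, lp.inner_eq_tsum]
  refine tsum_congr fun i => ?_
  rw [diagonalOperator_apply, diagonalOperator_apply]
  simp
  ring

theorem diagonalOperator_nonneg (hw : ∀ i, 0 ≤ w i) (x : (diagonalOperator w).domain) :
    0 ≤ (inner ℂ (x : lp (fun _ : ι => ℂ) 2) (diagonalOperator w x)).re := by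
  rw [← RCLike.re_eq_complex_re, lp.inner_eq_tsum, RCLike.re_tsum _ (lp.summable_inner _ _)]
  refine tsum_nonneg fun i => ?_
  rw [diagonalOperator_apply]
  have e : inner ℂ ((x : lp (fun _ : ι => ℂ) 2) i) ((w i : ℂ) * (x : lp (fun _ : ι => ℂ) 2) i) =
      ((w i * Complex.normSq ((x : lp (fun _ : ι => ℂ) 2) i) : ℝ) : ℂ) := by
    rw [RCLike.inner_apply]
    push_cast
    rw [← Complex.mul_conj]
    ring
  rw [e, RCLike.re_eq_complex_re, Complex.ofReal_re]
  exact mul_nonneg (hw i) (Complex.normSq_nonneg _)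

theorem diagonalOperator_eq_zero (hw : ∀ i, 0 < w i) (x : (diagonalOperator w).domain)
    (h : diagonalOperator w x = 0) : x = 0 := by
  ext i
  have e := diagonalOperator_apply x i
  rw [h] at e
  have := (hw i).ne'
  simpa [this] using e.symm

variable {n : ℤ}

theorem finiteSpinors_le_diagonalOperator_domain (w : SpinorIdx n → ℝ) :
    finiteSpinors n ≤ (diagonalOperator w).domain := by
  intro x hx
  refine finiteSpinors_induction (p := fun x => x ∈ (diagonalOperator w).domain) ?_ ?_ ?_ ?_ hx
  · intro a b ε h
    refine (diagonalOperator_eq_of_apply (y := (w ⟨(a, b, ε), h⟩ : ℂ) • ket n a b ε) ?_).1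
    intro i
    rw [lp.coeFn_smul, Pi.smul_apply, smul_eq_mul]
    by_cases hi : i.1 = (a, b, ε)
    · rw [show i = ⟨(a, b, ε), h⟩ from Subtype.ext hi]
    · rw [ket_apply_ne hi, mul_zero, mul_zero]
  · exact Submodule.zero_mem _
  · exact fun x y => Submodule.add_mem _
  · exact fun c x => Submodule.smul_mem _ c

theorem diagonalOperator_spinorBasis (w : SpinorIdx n → ℝ) (i : SpinorIdx n) :
    ∃ h : spinorBasis i ∈ (diagonalOperator w).domain,
      diagonalOperator w ⟨spinorBasis i, h⟩ = (w i : ℂ) • spinorBasis i := by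
  refine diagonalOperator_eq_of_apply fun j => ?_
  rw [lp.coeFn_smul, Pi.smul_apply, smul_eq_mul]
  by_cases h : j = i
  · rw [h]
  · rw [spinorBasis_ne h, mul_zero, mul_zero]

theorem inner_spinorBasis_left (i : SpinorIdx n) (x : Spinors n) :
    inner ℂ (spinorBasis i) x = x i := by
  rw [spinorBasis_eq_ket, inner_ket_left, coord_idx]

theorem dense_diagonalOperator_domain (w : SpinorIdx n → ℝ) :
    Dense ((diagonalOperator w).domain : Set (Spinors n)) :=
  (dense_finiteSpinors n).mono (finiteSpinors_le_diagonalOperator_domain w)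

/-- Testing the adjoint relation on basis vectors gives u_i = w_i y_i, so the rescaled coordinates
of y are square summable and y lies in the maximal domain. -/
theorem isSelfAdjoint_diagonalOperator (w : SpinorIdx n → ℝ) :
    IsSelfAdjoint (diagonalOperator w) := by
  refine LinearPMap.isSelfAdjoint_of_isFormalAdjoint _ (dense_diagonalOperator_domain w)
    (diagonalOperator_isFormalAdjoint w) fun y u h => ?_
  refine (diagonalOperator_eq_of_apply (y := u) fun i => ?_).1
  obtain ⟨hi, e⟩ := diagonalOperator_spinorBasis w i
  have := h ⟨_, hi⟩
  rw [e, inner_smul_left, inner_spinorBasis_left, inner_spinorBasis_left] at this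
  simpa using this.symm

/-- The finite sums of basis vectors form a core of every diagonal operator. -/
theorem hasCore_diagonalOperator (w : SpinorIdx n → ℝ) :
    (diagonalOperator w).HasCore (finiteSpinors n) := by
  classical
  refine ⟨finiteSpinors_le_diagonalOperator_domain w, ?_⟩
  have hc := (isSelfAdjoint_diagonalOperator w).isClosed
  have hle : (diagonalOperator w).domRestrict (finiteSpinors n) ≤ diagonalOperator w :=
    LinearPMap.domRestrict_le
  have hcl := hc.isClosable.leIsClosable hle
  refine LinearPMap.eq_of_eq_graph ?_
  rw [← hcl.graph_closure_eq_closure_graph]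
  refine le_antisymm ?_ ?_
  · refine (Submodule.topologicalClosure_mono (LinearPMap.le_graph_of_le hle)).trans ?_
    exact le_of_eq hc.submodule_topologicalClosure_eq
  · intro p hp
    obtain ⟨x, hx1, hx2⟩ := LinearPMap.mem_graph_iff _ |>.1 hp
    -- The partial sums of the basis expansions of x and of its image converge simultaneously, so
    -- the point of the graph is a limit of points over finite sums.
    have h1 := lp.hasSum_single (p := 2) (by norm_num) (x : Spinors n)
    have h2 := lp.hasSum_single (p := 2) (by norm_num) (diagonalOperator w x)
    have h3 := h1.prodMk h2
    have e : p = ((x : Spinors n), diagonalOperator w x) := Prod.ext hx1.symm hx2.symm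
    rw [e]
    refine mem_closure_of_tendsto h3 (Filter.Eventually.of_forall fun s => ?_)
    refine Submodule.sum_mem _ fun i _ => ?_
    have e1 : ∀ (z : Spinors n) (j : SpinorIdx n), lp.single 2 j (z j) = z j • spinorBasis j := by
      intro z j
      ext k
      rw [lp.coeFn_smul, Pi.smul_apply, smul_eq_mul]
      by_cases hk : k = j
      · rw [hk, lp.single_apply_self, spinorBasis_self, mul_one]
      · rw [lp.single_apply_ne _ _ _ hk, spinorBasis_ne hk, mul_zero]
    rw [e1, e1, diagonalOperator_apply]
    have hb : spinorBasis i ∈ finiteSpinors n := by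
      rw [spinorBasis_eq_ket]
      exact ket_mem_finiteSpinors _ _ _
    obtain ⟨hi, hei⟩ := diagonalOperator_spinorBasis w i
    have hmem : (spinorBasis i, (w i : ℂ) • spinorBasis i) ∈
        ((diagonalOperator w).domRestrict (finiteSpinors n)).graph := by
      rw [LinearPMap.mem_graph_iff]
      refine ⟨⟨spinorBasis i, hb, hi⟩, rfl, ?_⟩
      rw [← hei]
      rfl
    have := Submodule.smul_mem _ ((x : Spinors n) i) hmem
    rwa [Prod.smul_mk, smul_smul, mul_comm ((x : Spinors n) i)] at this

end Diagonal

/-! The absolute value and the compact resolvent of the Dirac operator. -/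

section Dirac

variable {n : ℤ}

theorem levelOf_pos {a b : ℤ} (h : SpinorLabel n a b) : 0 < levelOf n a := by
  have h1 : |(n : ℝ)| ≤ a := by exact_mod_cast h.1
  rw [levelOf, abs_div, abs_two]
  linarith

theorem SpinorIdx.level_pos (i : SpinorIdx n) : 0 < i.level := levelOf_pos i.2

theorem signOperator_signOperator (x : Spinors n) : signOperator n (signOperator n x) = x :=
  ext_coord fun a b ε _ => by rw [coord_signOperator, coord_signOperator, neg_neg]

theorem norm_signOperator (x : Spinors n) : ‖signOperator n x‖ = ‖x‖ :=
  (monomialIsometry (RingHom.id ℂ) SpinorIdx.flipSign (fun _ => 1) (fun _ => norm_one)).norm_map x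

theorem inner_signOperator (x y : Spinors n) :
    inner ℂ (signOperator n x) y = inner ℂ x (signOperator n y) := by
  conv_lhs => rw [← signOperator_signOperator y]
  exact (monomialIsometry (RingHom.id ℂ) SpinorIdx.flipSign (fun _ => 1)
    (fun _ => norm_one)).inner_map_map x (signOperator n y)

theorem dirac_apply (x : (dirac n).domain) : dirac n x = signOperator n (absDirac n x) := rfl

theorem coord_dirac (x : (dirac n).domain) (a b : ℤ) (ε : ℤˣ) :
    coord (dirac n x) a b ε = (levelOf n a : ℂ) * coord (x : Spinors n) a b (-ε) :=
  (coord_signOperator _ _ _ _).trans (coord_absDirac _ _ _ _)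

theorem dirac_eq_of_coord {x y : Spinors n} (h : ∀ a b ε, SpinorLabel n a b →
    coord y a b ε = (levelOf n a : ℂ) * coord x a b (-ε)) :
    ∃ hx : x ∈ (dirac n).domain, dirac n ⟨x, hx⟩ = y := by
  obtain ⟨hx, e⟩ := absDirac_eq_of_coord (x := x) (y := signOperator n y) (n := n)
    fun a b ε hl => by rw [coord_signOperator, h _ _ _ hl, neg_neg]
  exact ⟨hx, (congrArg _ e).trans (signOperator_signOperator y)⟩

theorem signOperator_mem_domain (x : (absDirac n).domain) :
    ∃ h : signOperator n x ∈ (absDirac n).domain,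
      absDirac n ⟨signOperator n x, h⟩ = signOperator n (absDirac n x) := by
  refine absDirac_eq_of_coord fun a b ε _ => ?_
  rw [coord_signOperator, coord_signOperator, coord_absDirac]

theorem isModulusOf_absDirac_dirac (n : ℤ) : IsModulusOf (absDirac n) (dirac n) where
  selfAdjoint := isSelfAdjoint_diagonalOperator _
  nonneg := diagonalOperator_nonneg fun i => i.level_pos.le
  domain_eq := rfl
  norm_eq x hP _ := (norm_signOperator (absDirac n ⟨x, hP⟩)).symm

theorem isSelfAdjoint_dirac (n : ℤ) : IsSelfAdjoint (dirac n) := by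
  refine LinearPMap.isSelfAdjoint_of_isFormalAdjoint _ (dense_diagonalOperator_domain _)
    (fun x y => ?_) fun y u h => ?_
  · obtain ⟨hy, e⟩ := signOperator_mem_domain y
    rw [dirac_apply, dirac_apply, inner_signOperator, ← e]
    exact diagonalOperator_isFormalAdjoint _ x ⟨_, hy⟩
  -- The test vectors are F e_i rather than e_i, since D F e_i = |D| e_i is again a multiple of e_i.
  · refine (diagonalOperator_eq_of_apply (y := signOperator n u) fun i => ?_).1
    obtain ⟨hi, e⟩ := diagonalOperator_spinorBasis SpinorIdx.level i
    obtain ⟨hi', e'⟩ := signOperator_mem_domain ⟨_, hi⟩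
    have h1 := h ⟨_, hi'⟩
    have e2 : dirac n ⟨_, hi'⟩ = (i.level : ℂ) • spinorBasis i :=
      (congrArg _ e').trans ((signOperator_signOperator _).trans e)
    rw [e2, inner_signOperator, inner_smul_left, inner_spinorBasis_left,
      inner_spinorBasis_left] at h1
    simpa using h1.symm

/-- A diagonal operator vanishing outside finitely many basis vectors is compact. -/
theorem isCompactOperator_of_support_finite (T : Spinors n →L[ℂ] Spinors n)
    (S : Finset (SpinorIdx n)) (h : ∀ x, ∀ i ∉ S, T x i = 0) : IsCompactOperator T := by
  classical
  let W : Submodule ℂ (Spinors n) := Submodule.span ℂ (S.image spinorBasis : Set (Spinors n))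
  have hW : FiniteDimensional ℂ W := FiniteDimensional.span_finset ℂ _
  have hT : ∀ x, T x ∈ W := by
    intro x
    have e : T x = ∑ i ∈ S, T x i • spinorBasis i := by
      ext j
      rw [lp.coeFn_sum, Finset.sum_apply]
      simp only [lp.coeFn_smul, Pi.smul_apply, smul_eq_mul]
      by_cases hj : j ∈ S
      · rw [Finset.sum_eq_single j, spinorBasis_self, mul_one]
        · intro i _ hi
          rw [spinorBasis_ne hi.symm, mul_zero]
        · exact fun h => absurd hj h
      · rw [h x j hj, Finset.sum_eq_zero]
        intro i hi
        rw [spinorBasis_ne, mul_zero]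
        rintro rfl
        exact hj hi
    rw [e]
    exact Submodule.sum_mem _ fun i hi => Submodule.smul_mem _ _
      (Submodule.subset_span (by exact_mod_cast Finset.mem_image_of_mem _ hi))
  have hid : IsCompactOperator (id : W → W) :=
    (isCompactOperator_id_iff_finiteDimensional (𝕜 := ℂ)).2 hW
  exact (hid.comp_clm (T.codRestrict W hT)).clm_comp W.subtypeL

/-- Coordinatewise the operator is dominated by C times the sign operator, which is isometric. -/
theorem IsShift.norm_le {T : Spinors n →L[ℂ] Spinors n} {f : ℤ → ℤ → ℤˣ → ℂ}
    (hT : IsShift T 0 0 (-1) f) {C : ℝ} (hC : 0 ≤ C)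
    (h : ∀ a b ε, SpinorLabel n a b → ‖f a b ε‖ ≤ C) : ‖T‖ ≤ C := by
  refine T.opNorm_le_bound hC fun x => ?_
  have h1 : ‖T x‖ ≤ ‖(C : ℂ) • signOperator n x‖ := by
    refine lp.norm_mono (by norm_num) fun i => ?_
    have e := hT x i.1.1 i.1.2.1 (-i.1.2.2)
    rw [add_zero, add_zero, mul_neg, mul_one, neg_neg, coord_idx] at e
    rw [e, lp.coeFn_smul, Pi.smul_apply, norm_smul, norm_mul, ← coord_idx, coord_signOperator,
      Complex.norm_real, Real.norm_of_nonneg hC]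
    exact mul_le_mul_of_nonneg_right (h _ _ _ i.2) (norm_nonneg _)
  rwa [norm_smul, norm_signOperator, Complex.norm_real, Real.norm_of_nonneg hC] at h1

theorem finite_setOf_level_le (n c : ℤ) : {i : SpinorIdx n | i.1.1 ≤ c}.Finite := by
  have h : (Set.Icc 0 c ×ˢ (Set.Icc (-c) c ×ˢ (Set.univ : Set ℤˣ))).Finite :=
    (Set.finite_Icc _ _).prod ((Set.finite_Icc _ _).prod Set.finite_univ)
  refine (h.preimage Subtype.val_injective.injOn).subset fun i (hi : i.1.1 ≤ c) => ?_
  have h1 := i.2.nonneg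
  have h2 := abs_le.1 i.2.2.2.1
  exact ⟨⟨h1, hi⟩, ⟨by linarith [h2.1], by linarith [h2.2]⟩, trivial⟩

/-- All eigenvalues of |D| are at least 1, so D is invertible and z = 0 may be used. The inverse is
a shift with weights 1/(l - |N| + 1), a norm limit of finite-rank truncations. -/
theorem hasCompactResolvent_dirac (n : ℤ) : HasCompactResolvent (dirac n) := by
  have hl : ∀ {a b : ℤ}, SpinorLabel n a b → ‖(((levelOf n a)⁻¹ : ℝ) : ℂ)‖ ≤ 1 := by
    intro a b h
    have h1 : |(n : ℝ)| ≤ a := by exact_mod_cast h.1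
    have h2 : 1 ≤ levelOf n a := by
      rw [levelOf, abs_div, abs_two]
      linarith
    rw [Complex.norm_real, Real.norm_of_nonneg (inv_nonneg.2 (levelOf_pos h).le)]
    exact inv_le_one_of_one_le₀ h2
  obtain ⟨R, hR⟩ := exists_isShift (n := n) 0 0 (-1) (fun a _ _ => (((levelOf n a)⁻¹ : ℝ) : ℂ))
    (fun a b ε h h' => absurd (by simpa using h) h') ⟨1, fun a b ε h => hl h⟩
  have hcoord : ∀ x a b ε, coord (R x) a b ε = (((levelOf n a)⁻¹ : ℝ) : ℂ) * coord x a b (-ε) := by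
    intro x a b ε
    have := hR x a b (-ε)
    rwa [add_zero, add_zero, mul_neg, mul_one, neg_neg] at this
  refine ⟨0, R, ?_, ?_, ?_⟩
  -- The truncation keeps a ≤ |n| + 2k, that is l - |N| ≤ k; the discarded weights are at most 1/(k
  -- + 1).
  · have hk : ∀ k : ℕ, ∃ T : Spinors n →L[ℂ] Spinors n, IsShift T 0 0 (-1)
        (fun a _ _ => if a ≤ |n| + 2 * k then (((levelOf n a)⁻¹ : ℝ) : ℂ) else 0) := by
      intro k
      refine exists_isShift 0 0 (-1) _ (fun a b ε h h' => absurd (by simpa using h) h')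
        ⟨1, fun a b ε h => ?_⟩
      split_ifs
      · exact hl h
      · simp
    choose T hT using hk
    refine isCompactOperator_of_tendsto (l := Filter.atTop) (F := T) ?_
      (Filter.Eventually.of_forall fun k => ?_)
    · rw [tendsto_iff_norm_sub_tendsto_zero]
      refine squeeze_zero (fun _ => norm_nonneg _) (fun k => ?_)
        tendsto_one_div_add_atTop_nhds_zero_nat
      refine ((hT k).sub hR).norm_le (by positivity) fun a b ε h => ?_
      split_ifs with hak
      · simpa using by positivity
      · have h3 : (|(n : ℝ)| + 2 * k) ≤ a := by
          push Not at hak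
          exact_mod_cast hak.le
        rw [zero_sub, norm_neg, Complex.norm_real,
          Real.norm_of_nonneg (inv_nonneg.2 (levelOf_pos h).le), one_div]
        refine inv_anti₀ (by positivity) ?_
        rw [levelOf, abs_div, abs_two]
        linarith
    · refine isCompactOperator_of_support_finite (T k)
        (finite_setOf_level_le n (|n| + 2 * k)).toFinset fun x i hi => ?_
      rw [Set.Finite.mem_toFinset] at hi
      have := hT k x i.1.1 i.1.2.1 (-i.1.2.2)
      rw [add_zero, add_zero, mul_neg, mul_one, neg_neg, coord_idx] at this
      exact this.trans ((congrArg (· * _) (if_neg hi)).trans (zero_mul _))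
  · intro y
    obtain ⟨h, e⟩ := dirac_eq_of_coord (x := R y) (y := y) (n := n) (by
      intro a b ε hl
      have := (levelOf_pos hl).ne'
      rw [hcoord, ← mul_assoc, ← Complex.ofReal_mul, mul_inv_cancel₀ this,
        Complex.ofReal_one, one_mul, neg_neg])
    exact ⟨h, by rw [zero_smul, sub_zero, e]⟩
  · intro x
    refine ext_coord fun a b ε hl => ?_
    have := (levelOf_pos hl).ne'
    rw [zero_smul, sub_zero, hcoord, coord_dirac, neg_neg,
      ← mul_assoc, ← Complex.ofReal_mul, inv_mul_cancel₀ this, Complex.ofReal_one, one_mul]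

/-! The grading and the real structure. -/

theorem grading_mul_grading (n : ℤ) : grading n * grading n = 1 := by
  ext1 x
  refine ext_coord fun a b ε _ => ?_
  rw [mul_apply_eq_comp, coord_grading, coord_grading, ← mul_assoc]
  rcases Int.units_eq_one_or ε with h | h <;> simp [h]

theorem isSelfAdjoint_grading (n : ℤ) : IsSelfAdjoint (grading n) := by
  have h := (isShift_grading (n := n)).adjoint fun a b ε h1 h2 => absurd (by simpa using h2) h1
  refine IsShift.unique ((h.cast neg_zero neg_zero rfl).congr fun a b ε _ => ?_) isShift_grading
  simp

theorem grading_dirac (x : (dirac n).domain) : ∃ h : grading n x ∈ (dirac n).domain,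
    grading n (dirac n x) + dirac n ⟨grading n x, h⟩ = 0 := by
  obtain ⟨h, e⟩ := dirac_eq_of_coord (x := grading n x) (y := -grading n (dirac n x))
    (n := n) (fun a b ε _ => by
      rw [← neg_one_smul ℂ, coord_smul, coord_grading, coord_grading, coord_dirac]
      push_cast
      ring)
  exact ⟨h, by rw [e, add_neg_cancel]⟩

theorem realStructure_grading (x : Spinors n) :
    realStructure n (grading n x) = -grading n (realStructure n x) := by
  refine ext_coord fun a b ε _ => ?_
  rw [← neg_one_smul ℂ, coord_smul, coord_grading, coord_realStructure, coord_realStructure,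
    coord_grading]
  push_cast
  simp
  ring

theorem realStructure_dirac (x : (dirac n).domain) :
    ∃ h : realStructure n x ∈ (dirac n).domain,
      realStructure n (dirac n x) = dirac n ⟨realStructure n x, h⟩ := by
  obtain ⟨h, e⟩ := dirac_eq_of_coord (x := realStructure n x)
    (y := realStructure n (dirac n x)) (n := n) (fun a b ε _ => by
      rw [coord_realStructure, coord_realStructure, coord_dirac, map_mul, Complex.conj_ofReal]
      ring)
  exact ⟨h, e.symm⟩

theorem realStructure_mem_dirac_domain_iff (x : Spinors n) :
    realStructure n x ∈ (dirac n).domain ↔ x ∈ (dirac n).domain := by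
  refine ⟨fun h => ?_, fun h => (realStructure_dirac ⟨x, h⟩).1⟩
  obtain ⟨h', -⟩ := realStructure_dirac ⟨_, h⟩
  have := Submodule.smul_mem _ ((-1 : ℂ) ^ n) h'
  rw [realStructure_realStructure, smul_smul, neg_one_zpow_mul_self, one_smul] at this
  exact this

end Dirac

end

noncomputable section

/-! The action of `U_q(su(2))` on finite sums of basis vectors. -/

section SpinorAction

variable {n : ℤ}

/-- The basis vectors as elements of the space of finite sums. -/
def finKet (n a b : ℤ) (ε : ℤˣ) : finiteSpinors n := ⟨ket n a b ε, ket_mem_finiteSpinors a b ε⟩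

theorem finKet_eq_zero {a b : ℤ} (ε : ℤˣ) (h : ¬ SpinorLabel n a b) : finKet n a b ε = 0 :=
  Subtype.ext (ket_eq_zero ε h)

theorem finKet_induction {p : finiteSpinors n → Prop}
    (hket : ∀ a b ε, SpinorLabel n a b → p (finKet n a b ε)) (hzero : p 0)
    (hadd : ∀ x y, p x → p y → p (x + y)) (hsmul : ∀ (c : ℂ) x, p x → p (c • x))
    (v : finiteSpinors n) : p v := by
  obtain ⟨h, e⟩ := finiteSpinors_induction (p := fun x => ∃ h : x ∈ finiteSpinors n, p ⟨x, h⟩)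
    (fun a b ε h => ⟨_, hket a b ε h⟩) ⟨_, hzero⟩
    (fun x y ⟨_, h1⟩ ⟨_, h2⟩ => ⟨_, hadd _ _ h1 h2⟩) (fun c x ⟨_, h⟩ => ⟨_, hsmul c _ h⟩) v.2
  exact e

theorem finKet_ext {V : Type*} [AddCommGroup V] [Module ℂ V] {σ : ℂ →+* ℂ}
    {S T : finiteSpinors n →ₛₗ[σ] V}
    (h : ∀ a b ε, SpinorLabel n a b → S (finKet n a b ε) = T (finKet n a b ε)) : S = T := by
  ext v
  refine finKet_induction (p := fun v => S v = T v) h ?_ ?_ ?_ v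
  · simp
  · intro x y hx hy
    rw [map_add, map_add, hx, hy]
  · intro c x hx
    rw [map_smulₛₗ, map_smulₛₗ, hx]

theorem formalInclusion_formalKet (a b : ℤ) (ε : ℤˣ) :
    formalInclusion n (formalKet n a b ε) = ket n a b ε := by
  by_cases h : SpinorLabel n a b
  · rw [formalKet, dif_pos h, ket, dif_pos h]
    exact (Finsupp.linearCombination_single ℂ _ _).trans (one_smul ℂ _)
  · rw [ket_eq_zero _ h, formalKet_eq_zero _ h, map_zero]

variable {q : Set.Ioo (0 : ℝ) 1}

/-- The identification of formal sums with finite sums of basis vectors. -/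
def formalEquiv (n : ℤ) : (SpinorIdx n →₀ ℂ) ≃ₗ[ℂ] finiteSpinors n :=
  LinearEquiv.ofInjective (formalInclusion n) (formalInclusion_injective n)

theorem spinorAction_formalEquiv (h : Uq q) (x : SpinorIdx n →₀ ℂ) :
    spinorAction q n h (formalEquiv n x) = formalEquiv n (formalAction q n h x) := by
  change formalEquiv n (formalAction q n h ((formalEquiv n).symm (formalEquiv n x))) = _
  rw [LinearEquiv.symm_apply_apply]

theorem finKet_eq_formalEquiv (a b : ℤ) (ε : ℤˣ) :
    finKet n a b ε = formalEquiv n (formalKet n a b ε) :=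
  Subtype.ext (formalInclusion_formalKet a b ε).symm

theorem mem_finiteSpinors_of_finKet {σ : ℂ →+* ℂ} (S : finiteSpinors n →ₛₗ[σ] Spinors n)
    (h : ∀ a b ε, SpinorLabel n a b → S (finKet n a b ε) ∈ finiteSpinors n)
    (v : finiteSpinors n) : S v ∈ finiteSpinors n := by
  refine finKet_induction (p := fun v : finiteSpinors n => S v ∈ finiteSpinors n) h ?_ ?_ ?_ v
  · simp
  · intro x y hx hy
    rw [map_add]
    exact Submodule.add_mem _ hx hy
  · intro c x hx
    rw [map_smulₛₗ]
    exact Submodule.smul_mem _ _ hx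

theorem SpinorLabel.of_add_two {a b : ℤ} (h : SpinorLabel n a (b + 2)) (hb : b + 2 ≠ -a) :
    SpinorLabel n a b := by
  simpa using h.down hb

theorem spinorAction_K (a b : ℤ) (ε : ℤˣ) :
    spinorAction q n (Uq.K q) (finKet n a b ε) = ((√(q : ℝ) ^ b : ℝ) : ℂ) • finKet n a b ε := by
  rw [finKet_eq_formalEquiv, spinorAction_formalEquiv, ← map_smul]
  congr 1
  rw [formalAction, Uq.lift_gen]
  exact (formalK_formalKet _ n a b 1 ε).trans (by rw [rpow_half q.2.1 (t := b) (by ring)])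

theorem spinorAction_Kinv (a b : ℤ) (ε : ℤˣ) :
    spinorAction q n (Uq.Kinv q) (finKet n a b ε) =
      ((√(q : ℝ) ^ (-b) : ℝ) : ℂ) • finKet n a b ε := by
  rw [finKet_eq_formalEquiv, spinorAction_formalEquiv, ← map_smul]
  congr 1
  rw [formalAction, Uq.lift_gen]
  exact (formalK_formalKet _ n a b (-1) ε).trans
    (by rw [rpow_half q.2.1 (t := -b) (by push_cast; ring)])

/-- The formula needs no admissibility: if (a, b) is not a label but (a, b + 2) is, then b + 2 = -a
and the ladder coefficient vanishes. -/
theorem spinorAction_E (a b : ℤ) (ε : ℤˣ) :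
    spinorAction q n (Uq.E q) (finKet n a b ε) =
      (ladderCoeff q a b : ℂ) • finKet n a (b + 2) ε := by
  by_cases h : SpinorLabel n a b
  · rw [finKet_eq_formalEquiv, finKet_eq_formalEquiv, spinorAction_formalEquiv, ← map_smul]
    congr 1
    rw [formalAction, Uq.lift_gen]
    exact formalE_formalKet q ε h
  · rw [finKet_eq_zero ε h, map_zero]
    by_cases h' : SpinorLabel n a (b + 2)
    · by_cases hb : b + 2 = -a
      · have e := ladderCoeff_symm (q : ℝ) a b
        rw [hb, neg_neg, ladderCoeff_self] at e
        rw [← e, Complex.ofReal_zero, zero_smul]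
      · exact absurd (h'.of_add_two hb) h
    · rw [finKet_eq_zero ε h', smul_zero]

theorem spinorAction_F (a b : ℤ) (ε : ℤˣ) :
    spinorAction q n (Uq.F q) (finKet n a b ε) =
      (ladderCoeff q a (-b) : ℂ) • finKet n a (b - 2) ε := by
  by_cases h : SpinorLabel n a b
  · rw [finKet_eq_formalEquiv, finKet_eq_formalEquiv, spinorAction_formalEquiv, ← map_smul]
    congr 1
    rw [formalAction, Uq.lift_gen]
    exact formalF_formalKet q ε h
  · rw [finKet_eq_zero ε h, map_zero]
    by_cases h' : SpinorLabel n a (b - 2)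
    · by_cases hb : b - 2 = a
      · have e := ladderCoeff_symm (q : ℝ) a (b - 2)
        rw [sub_add_cancel, hb, ladderCoeff_self] at e
        rw [e, Complex.ofReal_zero, zero_smul]
      · exact absurd (by simpa using h'.up hb) h
    · rw [finKet_eq_zero ε h', smul_zero]

theorem Uq.star_F : star (Uq.F q) = Uq.E q := by rw [← Uq.star_E, star_star]

theorem Uq.star_Kinv : star (Uq.Kinv q) = Uq.Kinv q := by simp [Uq.star_def, Uq.starHom]

theorem inner_spinorAction_E (v w : finiteSpinors n) :
    inner ℂ (spinorAction q n (Uq.E q) v : Spinors n) (w : Spinors n) =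
      inner ℂ (v : Spinors n) (spinorAction q n (Uq.F q) w : Spinors n) := by
  refine finKet_induction (p := fun v : finiteSpinors n =>
    inner ℂ (spinorAction q n (Uq.E q) v : Spinors n) (w : Spinors n) =
      inner ℂ (v : Spinors n) (spinorAction q n (Uq.F q) w : Spinors n)) ?_ ?_ ?_ ?_ v
  · intro a b ε hl
    refine finKet_induction (p := fun w : finiteSpinors n =>
      inner ℂ (spinorAction q n (Uq.E q) (finKet n a b ε) : Spinors n) (w : Spinors n) =
        inner ℂ (finKet n a b ε : Spinors n) (spinorAction q n (Uq.F q) w : Spinors n))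
      ?_ ?_ ?_ ?_ w
    · intro a' b' ε' hl'
      rw [spinorAction_E, spinorAction_F, Submodule.coe_smul, Submodule.coe_smul, inner_smul_left,
        inner_smul_right, Complex.conj_ofReal]
      simp only [finKet, inner_ket_left]
      by_cases e : (a, b + 2, ε) = (a', b', ε')
      · obtain ⟨rfl, rfl, rfl⟩ : a = a' ∧ b + 2 = b' ∧ ε = ε' := by simpa using e
        rw [ladderCoeff_symm, add_sub_cancel_right, coord_ket_self _ hl, coord_ket_self _ hl']
      · rw [coord_ket_ne e, coord_ket_ne, mul_zero, mul_zero]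
        intro e'
        apply e
        obtain ⟨rfl, h, rfl⟩ : a = a' ∧ b = b' - 2 ∧ ε = ε' := by simpa using e'
        rw [h, sub_add_cancel]
    · simp
    · intro x y hx hy
      simp only [map_add, Submodule.coe_add, inner_add_right, hx, hy]
    · intro c x hx
      simp only [map_smul, Submodule.coe_smul, inner_smul_right, hx]
  · simp
  · intro x y hx hy
    simp only [map_add, Submodule.coe_add, inner_add_left, hx, hy]
  · intro c x hx
    simp only [map_smul, Submodule.coe_smul, inner_smul_left, hx]

theorem inner_diagonal_finKet {X : Module.End ℂ (finiteSpinors n)} {w : ℤ → ℝ}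
    (hX : ∀ a b ε, X (finKet n a b ε) = (w b : ℂ) • finKet n a b ε) (v u : finiteSpinors n) :
    inner ℂ (X v : Spinors n) (u : Spinors n) = inner ℂ (v : Spinors n) (X u : Spinors n) := by
  refine finKet_induction (p := fun v : finiteSpinors n =>
    inner ℂ (X v : Spinors n) (u : Spinors n) = inner ℂ (v : Spinors n) (X u : Spinors n))
    ?_ ?_ ?_ ?_ v
  · intro a b ε hl
    refine finKet_induction (p := fun u : finiteSpinors n =>
      inner ℂ (X (finKet n a b ε) : Spinors n) (u : Spinors n) =
        inner ℂ (finKet n a b ε : Spinors n) (X u : Spinors n)) ?_ ?_ ?_ ?_ u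
    · intro a' b' ε' hl'
      rw [hX, hX, Submodule.coe_smul, Submodule.coe_smul, inner_smul_left,
        inner_smul_right, Complex.conj_ofReal]
      simp only [finKet, inner_ket_left]
      by_cases e : (a, b, ε) = (a', b', ε')
      · obtain ⟨rfl, rfl, rfl⟩ : a = a' ∧ b = b' ∧ ε = ε' := by simpa using e
        rfl
      · rw [coord_ket_ne e, mul_zero, mul_zero]
    · simp
    · intro x y hx hy
      simp only [map_add, Submodule.coe_add, inner_add_right, hx, hy]
    · intro c x hx
      simp only [map_smul, Submodule.coe_smul, inner_smul_right, hx]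
  · simp
  · intro x y hx hy
    simp only [map_add, Submodule.coe_add, inner_add_left, hx, hy]
  · intro c x hx
    simp only [map_smul, Submodule.coe_smul, inner_smul_left, hx]

theorem inner_spinorAction (h : Uq q) (v w : finiteSpinors n) :
    inner ℂ (spinorAction q n h v : Spinors n) (w : Spinors n) =
      inner ℂ (v : Spinors n) (spinorAction q n (star h) w : Spinors n) := by
  induction h using Uq.induction generalizing v w with
  | h0 c =>
    rw [← algebraMap_star_comm, AlgHom.commutes, AlgHom.commutes, Module.algebraMap_end_apply,
      Module.algebraMap_end_apply, Submodule.coe_smul, Submodule.coe_smul, inner_smul_left,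
      inner_smul_right]
    rfl
  | h1 x =>
    cases x with
    | K => rw [Uq.star_K]; exact inner_diagonal_finKet (w := fun b => √(q : ℝ) ^ b) spinorAction_K v w
    | Kinv =>
      rw [Uq.star_Kinv]
      exact inner_diagonal_finKet (w := fun b => √(q : ℝ) ^ (-b)) spinorAction_Kinv v w
    | E => rw [Uq.star_E]; exact inner_spinorAction_E v w
    | F =>
      rw [Uq.star_F, ← inner_conj_symm, ← inner_spinorAction_E, inner_conj_symm]
  | hmul x y hx hy =>
    rw [star_mul, map_mul, map_mul, Module.End.mul_apply, Module.End.mul_apply, hx, hy]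
  | hadd x y hx hy =>
    rw [star_add, map_add, map_add, LinearMap.add_apply, LinearMap.add_apply, Submodule.coe_add,
      Submodule.coe_add, inner_add_left, inner_add_right, hx, hy]

theorem commute_spinorAction {X : Module.End ℂ (finiteSpinors n)}
    (hX : ∀ x, Commute X (spinorAction q n (Uq.gen q x))) (h : Uq q) :
    Commute X (spinorAction q n h) := by
  induction h using Uq.induction with
  | h0 c => rw [AlgHom.commutes]; exact Algebra.commute_algebraMap_right c X
  | h1 x => exact hX x
  | hmul x y hx hy => rw [map_mul]; exact hx.mul_right hy
  | hadd x y hx hy => rw [map_add]; exact hx.add_right hy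

/-- Operators `|l, m; ε⟩ ↦ c_{l, ε} |l, m; ± ε⟩` commute with the action of `U_q(su(2))`. -/
theorem commute_spinorAction_of_finKet {X : Module.End ℂ (finiteSpinors n)} {c : ℤ → ℤˣ → ℂ}
    {η : ℤˣ} (hX : ∀ a b ε, X (finKet n a b ε) = c a ε • finKet n a b (ε * η)) (h : Uq q) :
    Commute X (spinorAction q n h) := by
  refine commute_spinorAction (fun x => ?_) h
  refine finKet_ext fun a b ε _ => ?_
  cases x <;> simp only [Module.End.mul_apply, hX, spinorAction_K, spinorAction_Kinv,
    spinorAction_E, spinorAction_F, map_smul, smul_smul, mul_comm]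

theorem dirac_finKet (a b : ℤ) (ε : ℤˣ) (h : (finKet n a b ε : Spinors n) ∈ (dirac n).domain) :
    dirac n ⟨finKet n a b ε, h⟩ = (levelOf n a : ℂ) • (finKet n a b (-ε) : Spinors n) :=
  dirac_ket n a b ε

theorem finiteSpinors_le_dirac_domain : finiteSpinors n ≤ (dirac n).domain :=
  finiteSpinors_le_diagonalOperator_domain _

/-- The Dirac operator restricted to finite sums of basis vectors. -/
def diracRestrict (n : ℤ) : finiteSpinors n →ₗ[ℂ] Spinors n :=
  (dirac n).toFun ∘ₗ Submodule.inclusion finiteSpinors_le_dirac_domain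

theorem diracRestrict_finKet (a b : ℤ) (ε : ℤˣ) :
    diracRestrict n (finKet n a b ε) = (levelOf n a : ℂ) • (finKet n a b (-ε) : Spinors n) :=
  dirac_finKet a b ε (finiteSpinors_le_dirac_domain (finKet n a b ε).2)

theorem dirac_mem_finiteSpinors (v : finiteSpinors n) : diracRestrict n v ∈ finiteSpinors n :=
  mem_finiteSpinors_of_finKet _ (fun a b ε _ => by
    rw [diracRestrict_finKet]
    exact Submodule.smul_mem _ _ (finKet n a b (-ε)).2) v

/-- The Dirac operator on finite sums of basis vectors. -/
def finDirac (n : ℤ) : Module.End ℂ (finiteSpinors n) :=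
  (diracRestrict n).codRestrict _ dirac_mem_finiteSpinors

theorem commute_finDirac (h : Uq q) : Commute (finDirac n) (spinorAction q n h) :=
  commute_spinorAction_of_finKet (c := fun a _ => (levelOf n a : ℂ)) (η := -1)
    (fun a b ε => Subtype.ext (by
      rw [mul_neg, mul_one]
      exact diracRestrict_finKet a b ε)) h

theorem grading_mem_finiteSpinors (v : finiteSpinors n) :
    grading n (v : Spinors n) ∈ finiteSpinors n :=
  mem_finiteSpinors_of_finKet ((grading n).toLinearMap ∘ₗ (finiteSpinors n).subtype)
    (fun a b ε _ => by
      refine (grading_ket n a b ε).symm ▸ ?_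
      exact Submodule.smul_mem _ _ (ket_mem_finiteSpinors _ _ _)) v

/-- The grading on finite sums of basis vectors. -/
def finGrading (n : ℤ) : Module.End ℂ (finiteSpinors n) :=
  ((grading n).toLinearMap ∘ₗ (finiteSpinors n).subtype).codRestrict _ grading_mem_finiteSpinors

theorem commute_finGrading (h : Uq q) : Commute (finGrading n) (spinorAction q n h) :=
  commute_spinorAction_of_finKet (c := fun _ ε => -((ε : ℤ) : ℂ)) (η := 1)
    (fun a b ε => Subtype.ext (by
      rw [mul_one]
      exact grading_ket n a b ε)) h

/-! The antilinear operator `T`. -/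

/-- The weights `q^{m + N}`. -/
def modularWeight (q : ℝ) {n : ℤ} (i : SpinorIdx n) : ℝ := q ^ ((i.1.2.1 + n) / 2)

/-- The operator `J P`, where `P` is diagonal with the eigenvalues `q^{m + N}`. -/
def antilinearJP (q : ℝ) (n : ℤ) : finiteSpinors n →ₗ⋆[ℂ] Spinors n where
  toFun v := realStructure n (diagonalOperator (modularWeight q)
    ⟨v, finiteSpinors_le_diagonalOperator_domain _ v.2⟩)
  map_add' x y := by
    rw [← map_add, ← LinearPMap.map_add]
    rfl
  map_smul' c x := by
    rw [← map_smulₛₗ, ← LinearPMap.map_smul]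
    rfl

theorem antilinearJP_finKet (a b : ℤ) (ε : ℤˣ) : antilinearJP q n (finKet n a b ε) =
    (-qC q) ^ ((b + n) / 2) • ket n a (-b) (-ε) := by
  by_cases h : SpinorLabel n a b
  · obtain ⟨h1, e⟩ := diagonalOperator_spinorBasis (n := n) (modularWeight q) ⟨(a, b, ε), h⟩
    have e1 : (finKet n a b ε : Spinors n) = spinorBasis ⟨(a, b, ε), h⟩ :=
      (spinorBasis_eq_ket (n := n) ⟨(a, b, ε), h⟩).symm
    have e2 : antilinearJP q n (finKet n a b ε) =
        realStructure n ((modularWeight q (n := n) ⟨(a, b, ε), h⟩ : ℂ) • ket n a b ε) := by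
      rw [← spinorBasis_eq_ket (n := n) ⟨(a, b, ε), h⟩, ← e]
      simp only [← e1]
      rfl
    rw [e2, map_smulₛₗ, realStructure_ket, smul_smul, Complex.conj_ofReal,
      ← neg_one_mul (qC q), mul_zpow, mul_comm, qC, ← Complex.ofReal_zpow]
    rfl
  · rw [finKet_eq_zero ε h, map_zero, ket_eq_zero, smul_zero]
    exact fun h' => h (by simpa using h'.neg)

theorem antilinearJP_mem (v : finiteSpinors n) : antilinearJP q n v ∈ finiteSpinors n :=
  mem_finiteSpinors_of_finKet _ (fun a b ε _ => by
    rw [antilinearJP_finKet]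
    exact Submodule.smul_mem _ _ (ket_mem_finiteSpinors _ _ _)) v

/-- The operator `T |l, m; ± N⟩ = (-q)^{m + N} |l, -m; ∓ N⟩`. -/
def modularT (q : Set.Ioo (0 : ℝ) 1) (n : ℤ) : finiteSpinors n →ₗ⋆[ℂ] finiteSpinors n :=
  (antilinearJP q n).codRestrict _ antilinearJP_mem

theorem modularT_finKet (a b : ℤ) (ε : ℤˣ) : modularT q n (finKet n a b ε) =
    (-qC q) ^ ((b + n) / 2) • finKet n a (-b) (-ε) :=
  Subtype.ext (antilinearJP_finKet a b ε)

/-- By construction T = JP on finite sums, with P diagonal and positive; finite sums form a core for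
P, so this is the polar decomposition of the closure of T. -/
theorem isAntiunitaryPart_modularT :
    IsAntiunitaryPart (finiteSpinors n) (modularT q n) (realStructure n) := by
  have hw : ∀ i : SpinorIdx n, 0 < modularWeight q i := fun i => zpow_pos q.2.1 _
  exact ⟨diagonalOperator (modularWeight q), isSelfAdjoint_diagonalOperator _,
    diagonalOperator_nonneg fun i => (hw i).le, diagonalOperator_eq_zero hw,
    hasCore_diagonalOperator _, fun v hv => rfl⟩

theorem Uq.antipode_gen (x : UqGen) : HopfAlgebraStruct.antipode ℂ (Uq.gen q x) =
    (match x with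
      | .K => Uq.Kinv q
      | .Kinv => Uq.K q
      | .E => -qC q • Uq.E q
      | .F => -(qC q)⁻¹ • Uq.F q) := by
  change Uq.antipodeLin q _ = _
  cases x <;> simp [Uq.antipodeLin, Uq.antipodeHom]

/-- Since h ↦ S(h)^* is multiplicative and antilinear, generators suffice. Raising m by 1 multiplies
(-q)^{m+N} by -q and lowers -m by 1, which is the action of S(E)^* = -qF; lowering m gives the case
of F, and K is clear. -/
theorem isEquivariantAntilinear_modularT :
    IsEquivariantAntilinear (finiteSpinors n) (spinorAction q n) (modularT q n) := by
  have hq : -qC q ≠ 0 := neg_ne_zero.2 (qC_ne_zero q)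
  have hqc : starRingEnd ℂ (qC q) = qC q := Complex.conj_ofReal _
  intro h
  induction h using Uq.induction with
  | h0 c =>
    intro v
    have e : HopfAlgebraStruct.antipode ℂ (algebraMap ℂ (Uq q) c) = algebraMap ℂ (Uq q) c :=
      Uq.antipodeLin_algebraMap q c
    rw [e, ← algebraMap_star_comm, AlgHom.commutes, AlgHom.commutes, Module.algebraMap_end_apply,
      Module.algebraMap_end_apply, map_smulₛₗ]
    rfl
  | h1 x =>
    intro v
    refine finKet_induction (p := fun v => modularT q n (spinorAction q n (Uq.gen q x) v) =
      spinorAction q n (star (HopfAlgebraStruct.antipode ℂ (Uq.gen q x))) (modularT q n v))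
      (fun a b ε hl => ?_) (by simp) ?_ ?_ v
    · rw [Uq.antipode_gen]
      cases x with
      | K =>
        simp only [Uq.star_Kinv, spinorAction_K, map_smulₛₗ, modularT_finKet, spinorAction_Kinv,
          smul_smul, Complex.conj_ofReal, RingHom.id_apply, neg_neg, mul_comm]
      | Kinv =>
        simp only [Uq.star_K, spinorAction_Kinv, map_smulₛₗ, modularT_finKet, spinorAction_K,
          smul_smul, Complex.conj_ofReal, RingHom.id_apply, mul_comm]
      | E =>
        have e : (b + 2 + n) / 2 = (b + n) / 2 + 1 := by omega
        simp only [star_smul, Uq.star_E, spinorAction_E, map_smulₛₗ, modularT_finKet,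
          spinorAction_F, smul_smul, Complex.conj_ofReal, RingHom.id_apply, neg_neg, e,
          zpow_add_one₀ hq, map_smul, LinearMap.smul_apply, star_neg, neg_add, ← sub_eq_add_neg,
          Complex.star_def, hqc]
        congr 1
        ring
      | F =>
        have e : (b - 2 + n) / 2 = (b + n) / 2 - 1 := by omega
        have e' : -(b - 2) = -b + 2 := by ring
        simp only [star_smul, Uq.star_F, spinorAction_F, map_smulₛₗ, modularT_finKet,
          spinorAction_E, smul_smul, Complex.conj_ofReal, RingHom.id_apply, neg_neg, e, e',
          zpow_sub_one₀ hq, map_smul, LinearMap.smul_apply, star_neg, star_inv₀,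
          Complex.star_def, hqc]
        congr 1
        rw [inv_neg]
        ring
    · intro x y hx hy
      simp only [map_add, hx, hy]
    · intro c x hx
      simp only [map_smul, map_smulₛₗ, hx]
  | hmul x y hx hy =>
    intro v
    have e : HopfAlgebraStruct.antipode ℂ (x * y) =
        HopfAlgebraStruct.antipode ℂ y * HopfAlgebraStruct.antipode ℂ x :=
      Uq.antipodeLin_mul q x y
    rw [e, star_mul, map_mul, map_mul, Module.End.mul_apply, Module.End.mul_apply, hx, hy]
  | hadd x y hx hy =>
    intro v
    rw [map_add, map_add, star_add, map_add, LinearMap.add_apply, LinearMap.add_apply, map_add,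
      hx, hy]

end SpinorAction

end

noncomputable section

/-! Identities between the matrix coefficients and the ladder coefficients. -/

section LadderIdentities

variable {q s : ℝ} {n a b : ℤ} {ε : ℤˣ}

/-- It suffices that one of the two arguments is nonnegative, because b ↦ -b - 2 exchanges them and
fixes the coefficient. -/
theorem ladderCoeff_eq (h0 : 0 < q) (h1 : q < 1) (h : 0 ≤ a - b ∨ 0 ≤ a + b + 2) :
    ladderCoeff q a b = √q ^ (-(a + 1)) / (q⁻¹ - q) *
      (rootOneSub q (a - b) * rootOneSub q (a + b + 2)) := by
  have key : ∀ {b : ℤ}, 0 ≤ a - b → ladderCoeff q a b = √q ^ (-(a + 1)) / (q⁻¹ - q) *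
      (rootOneSub q (a - b) * rootOneSub q (a + b + 2)) := fun {b} h =>
    sqrt_qNum_mul h0 h1 (t := a - b) (u := a + b + 2) (by push_cast; ring) (by push_cast; ring) h
      (by ring)
  rcases h with h | h
  · exact key h
  · rw [← ladderCoeff_symm, key (by linarith), mul_comm (rootOneSub _ _)]
    congr 3 <;> ring

/-- The common scale of the ladder coefficients for the spins near `l`. -/
def ladderScale (q : ℝ) (a : ℤ) : ℝ := √q ^ (-(a + 3)) / (q⁻¹ - q)

/-- The spins l + 1, l and l - 1 correspond to i = 2, 0, -2 and k = 0, 1, 2. Their ladder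
coefficients get a common scale and then differ only by powers of q and roots. -/
theorem ladderCoeff_shift (h0 : 0 < q) (h1 : q < 1) (a b i j : ℤ) (k : ℕ) (hk : i + 2 * k = 2)
    (h : 0 ≤ a - b + (i - j) ∨ 0 ≤ a + b + (i + j + 2)) :
    ladderCoeff q (a + i) (b + j) = ladderScale q a * q ^ k *
      (rootOneSub q (a - b + (i - j)) * rootOneSub q (a + b + (i + j + 2))) := by
  rw [ladderCoeff_eq h0 h1 (by convert h using 2 <;> ring), ladderScale]
  have e : √q ^ (-(a + i + 1)) = √q ^ (-(a + 3)) * q ^ k := by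
    rw [show -(a + i + 1) = -(a + 3) + 2 * k by linarith,
      sqrt_zpow_add h0 (-(a + 3)) 0 k (2 * k) (by ring), add_zero, mul_comm]
  rw [e, show a + i - (b + j) = a - b + (i - j) by ring,
    show a + i + (b + j) + 2 = a + b + (i + j + 2) by ring]
  ring

/-- The factor q^{m - 1/2} of the terms containing K is brought to the scale of the ladder
coefficients, using (1 - q²)/(q⁻¹ - q) = q. -/
theorem sqrt_zpow_eq_ladderScale (h0 : 0 < q) (h1 : q < 1) (a b : ℤ) :
    √q ^ (b - 1) = ladderScale q a * (1 - q ^ 2) * √q ^ (a + b + 0) := by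
  have hd : (1 - q ^ 2) ≠ 0 := by nlinarith
  have hg := (Real.sqrt_pos.2 h0).ne'
  have e1 : √q ^ (b - 1) = q * (√q ^ (-(a + 3)) * √q ^ (a + b + 0)) := by
    rw [← zpow_add₀ hg, show b - 1 = -(a + 3) + (a + b + 0) + 2 by ring,
      sqrt_zpow_add h0 _ 0 1 2 (by norm_num), pow_one, add_zero]
  rw [e1, ladderScale]
  field_simp

/-- The `ladder_E_A` identities are the matrix entries of EA = -q^{-1/2}BK + AE. Those named
`ladder_E_B` belong to qEB = BE, those named `ladder_F_B` to the relation between F and B. -/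
theorem ladder_E_A_up (h0 : 0 < q) (h1 : q < 1) (hl : SpinorLabel n a b) :
    coeffAup q s n (a + 0) (b + 0) ε * ladderCoeff q (a + 2) (b + 0) -
        ladderCoeff q (a + 0) (b + 0) * coeffAup q s n (a + 0) (b + 2) ε =
      -(√q ^ (b - 1) * coeffBup q s n (a + 0) (b + 0) ε) := by
  have hab := spinorLabel_iff.1 hl
  have hV0 := rootOneSub_add_sq h0 h1 (t := a - b) 0 (by omega)
  have hV2 := rootOneSub_add_sq h0 h1 (t := a - b) 2 (by omega)
  rw [sqrt_zpow_eq_ladderScale h0 h1 a b, ladderCoeff_shift h0 h1 a b 2 0 0 (by norm_num) (by omega),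
    ladderCoeff_shift h0 h1 a b 0 0 1 (by norm_num) (by omega)]
  simp only [coeffAup_shift, coeffBup_shift, Int.reduceAdd, Int.reduceSub,
    sqrt_zpow_add h0 (a + b) 0 1 2 (by norm_num),
    sqrt_zpow_add h0 (a - b) 0 1 2 (by norm_num)] at ⊢ hV0 hV2
  linear_combination (-ladderScale q a * √q ^ (a + b + 0) * rootOneSub q (a + b + 2) *
    rootOneSub q (a + b + 4) * alphaCoeff q s n (a + 2) ε) * (hV2 - q ^ 2 * hV0)

theorem ladder_E_A_mid (h0 : 0 < q) (h1 : q < 1) (hl : SpinorLabel n a b) :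
    coeffAdiag q s n (a + 0) (b + 0) ε * ladderCoeff q (a + 0) (b + 0) -
        ladderCoeff q (a + 0) (b + 0) * coeffAdiag q s n (a + 0) (b + 2) ε =
      -(√q ^ (b - 1) * coeffBmid q s n (a + 0) (b + 0) ε) := by
  have hab := spinorLabel_iff.1 hl
  have hp : 1 + q ^ 2 ≠ 0 := by positivity
  have e1 := coeffAdiag_shift h0 s n a b 0 2 ε
  have e2 := coeffAdiag_shift h0 s n a b 0 0 ε
  rw [sqrt_zpow_eq_ladderScale h0 h1 a b,
    ladderCoeff_shift h0 h1 a b 0 0 1 (by norm_num) (by omega)]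
  simp only [coeffBmid_shift, Int.reduceAdd, Int.reduceSub,
    sqrt_zpow_add h0 (a + b) 0 1 2 (by norm_num)] at ⊢ e1 e2
  obtain ⟨b0, hb0⟩ := exists_eq_mul h0 (betaCoeff q s n (a + 0) ε)
  simp only [hb0, mul_div_cancel_left₀ _ h0.ne'] at ⊢ e1 e2
  refine mul_left_cancel₀ hp ?_
  linear_combination (ladderScale q a * q * rootOneSub q (a - b + 0) *
    rootOneSub q (a + b + 2)) * (e2 - e1)

theorem ladder_E_A_down (h0 : 0 < q) (h1 : q < 1) (hl : SpinorLabel n a b) :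
    coeffAup q s n (a + -2) (b + 0) ε * ladderCoeff q (a + -2) (b + 0) -
        ladderCoeff q (a + 0) (b + 0) * coeffAup q s n (a + -2) (b + 2) ε =
      -(√q ^ (b - 1) * coeffBdown q s n (a + 0) (b + 0) ε) := by
  have hab := spinorLabel_iff.1 hl
  have hU0 := rootOneSub_add_sq h0 h1 (t := a + b) 0 (by omega)
  have hU2 := rootOneSub_add_sq h0 h1 (t := a + b) 2 (by omega)
  rw [sqrt_zpow_eq_ladderScale h0 h1 a b,
    ladderCoeff_shift h0 h1 a b (-2) 0 2 (by norm_num) (by omega),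
    ladderCoeff_shift h0 h1 a b 0 0 1 (by norm_num) (by omega)]
  simp only [coeffAup_shift, coeffBdown_shift h0, Int.reduceAdd, Int.reduceSub, Int.reduceNeg,
    sqrt_zpow_add h0 (a + b) (-2) 1 0 (by norm_num),
    sqrt_zpow_add h0 (a + b) (-2) 2 2 (by norm_num)] at ⊢ hU0 hU2
  linear_combination (-ladderScale q a * q ^ 2 * √q ^ (a + b + -2) * rootOneSub q (a - b + 0) *
    rootOneSub q (a - b + -2) * alphaCoeff q s n (a + 0) ε) * (hU0 - hU2)

theorem ladder_E_B_up (h0 : 0 < q) (h1 : q < 1) (hl : SpinorLabel n a b) :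
    q * (coeffBup q s n (a + 0) (b + 0) ε * ladderCoeff q (a + 2) (b + 2)) =
      ladderCoeff q (a + 0) (b + 0) * coeffBup q s n (a + 0) (b + 2) ε := by
  have hab := spinorLabel_iff.1 hl
  rw [ladderCoeff_shift h0 h1 a b 2 2 0 (by norm_num) (by omega),
    ladderCoeff_shift h0 h1 a b 0 0 1 (by norm_num) (by omega)]
  simp only [coeffBup_shift, Int.reduceAdd, Int.reduceSub]
  ring

theorem ladder_E_B_mid (h0 : 0 < q) (h1 : q < 1) (hl : SpinorLabel n a b) :
    q * (coeffBmid q s n (a + 0) (b + 0) ε * ladderCoeff q (a + 0) (b + 2)) =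
      ladderCoeff q (a + 0) (b + 0) * coeffBmid q s n (a + 0) (b + 2) ε := by
  have hab := spinorLabel_iff.1 hl
  rw [ladderCoeff_shift h0 h1 a b 0 2 1 (by norm_num) (by omega),
    ladderCoeff_shift h0 h1 a b 0 0 1 (by norm_num) (by omega)]
  simp only [coeffBmid_shift, Int.reduceAdd, Int.reduceSub, Int.reduceNeg,
    sqrt_zpow_add h0 (a + b) 0 1 2 (by norm_num)]
  ring

theorem ladder_E_B_down (h0 : 0 < q) (h1 : q < 1) (hl : SpinorLabel n a b) :
    q * (coeffBdown q s n (a + 0) (b + 0) ε * ladderCoeff q (a + -2) (b + 2)) =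
      ladderCoeff q (a + 0) (b + 0) * coeffBdown q s n (a + 0) (b + 2) ε := by
  have hab := spinorLabel_iff.1 hl
  rw [ladderCoeff_shift h0 h1 a b (-2) 2 2 (by norm_num) (by omega),
    ladderCoeff_shift h0 h1 a b 0 0 1 (by norm_num) (by omega)]
  simp only [coeffBdown_shift h0, Int.reduceAdd, Int.reduceSub, Int.reduceNeg,
    sqrt_zpow_add h0 (a + b) 0 1 2 (by norm_num)]
  ring

theorem ladder_F_B_up (h0 : 0 < q) (h1 : q < 1) (hl : SpinorLabel n a b) :
    q * (coeffBup q s n (a + 0) (b + 0) ε * ladderCoeff q (a + 2) (b + 0)) -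
        ladderCoeff q (a + 0) (b + -2) * coeffBup q s n (a + 0) (b + -2) ε =
      -(q * √q ^ (b - 1) * ((1 + q ^ 2) * coeffAup q s n (a + 0) (b + 0) ε)) := by
  have hab := spinorLabel_iff.1 hl
  have hU0 := rootOneSub_add_sq h0 h1 (t := a + b) 0 (by omega)
  have hU4 := rootOneSub_add_sq h0 h1 (t := a + b) 4 (by omega)
  rw [sqrt_zpow_eq_ladderScale h0 h1 a b,
    ladderCoeff_shift h0 h1 a b 2 0 0 (by norm_num) (by omega),
    ladderCoeff_shift h0 h1 a b 0 (-2) 1 (by norm_num) (by omega)]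
  simp only [coeffAup_shift, coeffBup_shift, Int.reduceAdd, Int.reduceSub, Int.reduceNeg,
    sqrt_zpow_add h0 (a + b) 0 2 4 (by norm_num)] at ⊢ hU0 hU4
  linear_combination (ladderScale q a * q * rootOneSub q (a - b + 2) *
    rootOneSub q (a + b + 2) * alphaCoeff q s n (a + 2) ε) * (hU4 - hU0)

theorem ladder_F_B_mid (h0 : 0 < q) (h1 : q < 1) (hl : SpinorLabel n a b) :
    q * (coeffBmid q s n (a + 0) (b + 0) ε * ladderCoeff q (a + 0) (b + 0)) -
        ladderCoeff q (a + 0) (b + -2) * coeffBmid q s n (a + 0) (b + -2) ε =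
      -(q * √q ^ (b - 1) * ((1 + q ^ 2) * coeffAdiag q s n (a + 0) (b + 0) ε - (1 - s ^ 2))) := by
  have hab := spinorLabel_iff.1 hl
  have e2 := coeffAdiag_shift h0 s n a b 0 0 ε
  have hU0 := rootOneSub_add_sq h0 h1 (t := a + b) 0 (by omega)
  have hU2 := rootOneSub_add_sq h0 h1 (t := a + b) 2 (by omega)
  have hV0 := rootOneSub_add_sq h0 h1 (t := a - b) 0 (by omega)
  have hV2 := rootOneSub_add_sq h0 h1 (t := a - b) 2 (by omega)
  rw [sqrt_zpow_eq_ladderScale h0 h1 a b,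
    ladderCoeff_shift h0 h1 a b 0 0 1 (by norm_num) (by omega),
    ladderCoeff_shift h0 h1 a b 0 (-2) 1 (by norm_num) (by omega)]
  simp only [coeffBmid_shift, Int.reduceAdd, Int.reduceSub, Int.reduceNeg,
    sqrt_zpow_add h0 (a + b) (-2) 1 0 (by norm_num),
    sqrt_zpow_add h0 (a + b) (-2) 2 2 (by norm_num),
    sqrt_zpow_add h0 (a - b) 0 1 2 (by norm_num),
    zpow_eq_sqrt_mul h0 a b 0 0 0 (by norm_num)] at ⊢ e2 hU0 hU2 hV0 hV2
  rw [e2]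
  obtain ⟨b0, hb0⟩ := exists_eq_mul h0 (betaCoeff q s n (a + 0) ε)
  simp only [hb0, mul_div_cancel_left₀ _ h0.ne']
  linear_combination (ladderScale q a * q ^ 2 * √q ^ (a + b + -2) * b0) *
    (-(q ^ 2) * (rootOneSub q (a + b + 2) ^ 2 * hV0 + (1 - (√q ^ (a - b + 0)) ^ 2) * hU2) +
      (rootOneSub q (a + b + 0) ^ 2 * hV2 + (1 - (q * √q ^ (a - b + 0)) ^ 2) * hU0))

theorem ladder_F_B_down (h0 : 0 < q) (h1 : q < 1) (hl : SpinorLabel n a b) :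
    q * (coeffBdown q s n (a + 0) (b + 0) ε * ladderCoeff q (a + -2) (b + 0)) -
        ladderCoeff q (a + 0) (b + -2) * coeffBdown q s n (a + 0) (b + -2) ε =
      -(q * √q ^ (b - 1) * ((1 + q ^ 2) * coeffAup q s n (a + -2) (b + 0) ε)) := by
  have hab := spinorLabel_iff.1 hl
  have hV := rootOneSub_mul_sq h0 h1 (t := a - b) (by omega) (by omega)
  have hV2 := rootOneSub_add_sq h0 h1 (t := a - b) 2 (by omega)
  rw [sqrt_zpow_eq_ladderScale h0 h1 a b,
    ladderCoeff_shift h0 h1 a b (-2) 0 2 (by norm_num) (by omega),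
    ladderCoeff_shift h0 h1 a b 0 (-2) 1 (by norm_num) (by omega)]
  simp only [coeffAup_shift, coeffBdown_shift h0, Int.reduceAdd, Int.reduceSub, Int.reduceNeg,
    sqrt_zpow_add h0 (a + b) (-2) 1 0 (by norm_num),
    sqrt_zpow_add h0 (a - b) (-2) 2 2 (by norm_num)] at ⊢ hV hV2
  linear_combination (ladderScale q a * q ^ 2 * (√q ^ (a + b + -2)) ^ 2 * rootOneSub q (a + b + 0) *
    alphaCoeff q s n (a + 0) ε) * (rootOneSub q (a - b + 0) * hV2 - q ^ 4 * hV)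

end LadderIdentities

end

noncomputable section

/-! Smash product relations. -/

section Smash

variable {U A R : Type*} [Ring U] [HopfAlgebra ℂ U] [Ring A] [Algebra ℂ A] [Ring R] [Algebra ℂ R]

/-- The linear map `h₁ ⊗ h₂ ↦ f (h₁ ▷ a) ρ(h₂)`. -/
def smashMap (act : U →ₐ[ℂ] Module.End ℂ A) (ρ : U →ₐ[ℂ] R) (f : A →ₐ[ℂ] R) (a : A) :
    U ⊗[ℂ] U →ₗ[ℂ] R :=
  LinearMap.mul' ℂ R ∘ₗ TensorProduct.map (f.toLinearMap ∘ₗ actOn act a) ρ.toLinearMap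

variable {act : U →ₐ[ℂ] Module.End ℂ A} {ρ : U →ₐ[ℂ] R} {f : A →ₐ[ℂ] R}

@[simp] theorem smashMap_tmul (a : A) (x y : U) :
    smashMap act ρ f a (x ⊗ₜ y) = f (act x a) * ρ y := rfl

theorem smashMap_act_mul (a : A) (x y : U) (t : U ⊗[ℂ] U) :
    smashMap act ρ f (act x a) t * ρ y = smashMap act ρ f a (t * x ⊗ₜ y) := by
  induction t with
  | zero => simp
  | add t t' h h' => rw [map_add, add_mul, h, h', add_mul, map_add]
  | tmul x' y' => simp [mul_assoc]

/-- The relation passes to products in `U` because the coproduct is multiplicative: moving `y` and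
then `x` past `f a` applies the two coproducts in succession. -/
theorem smash_mul {x y : U}
    (hx : ∀ a, ρ x * f a = smashMap act ρ f a (Coalgebra.comul (R := ℂ) x))
    (hy : ∀ a, ρ y * f a = smashMap act ρ f a (Coalgebra.comul (R := ℂ) y)) (a : A) :
    ρ (x * y) * f a = smashMap act ρ f a (Coalgebra.comul (R := ℂ) (x * y)) := by
  have key : ∀ t, ρ x * smashMap act ρ f a t =
      smashMap act ρ f a (Coalgebra.comul (R := ℂ) x * t) := by
    intro t
    induction t with
    | zero => simp
    | add t t' h h' => rw [map_add, mul_add, h, h', mul_add, map_add]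
    | tmul x' y' => rw [smashMap_tmul, ← mul_assoc, hx, smashMap_act_mul]
  rw [map_mul, mul_assoc, hy, key, Bialgebra.comul_mul]

end Smash

/-! ### Reduction of the crossed product relations to generators; the module algebra laws. -/

section PodlesSmash

variable {q : Set.Ioo (0 : ℝ) 1} {s : ℝ} {R : Type*} [Ring R] [Algebra ℂ R]

/-- The relations `h a = (h₁ ▷ a) h₂` follow from the case of the generators `h = K, E, F`. -/
theorem smash_of_gen {A : Type*} [Ring A] [Algebra ℂ A] {act : Uq q →ₐ[ℂ] Module.End ℂ A}
    {ρ : Uq q →ₐ[ℂ] R} {f : A →ₐ[ℂ] R}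
    (hK : ∀ a, ρ (Uq.K q) * f a = f (act (Uq.K q) a) * ρ (Uq.K q))
    (hE : ∀ a, ρ (Uq.E q) * f a =
      f (act (Uq.E q) a) * ρ (Uq.K q) + f (act (Uq.Kinv q) a) * ρ (Uq.E q))
    (hF : ∀ a, ρ (Uq.F q) * f a =
      f (act (Uq.F q) a) * ρ (Uq.K q) + f (act (Uq.Kinv q) a) * ρ (Uq.F q))
    (h : Uq q) (a : A) :
    ρ h * f a = smashMap act ρ f a (Coalgebra.comul (R := ℂ) h) := by
  induction h using Uq.induction generalizing a with
  | h0 c =>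
    rw [Bialgebra.comul_algebraMap, Algebra.TensorProduct.algebraMap_apply, smashMap_tmul]
    simp [Algebra.algebraMap_eq_smul_one]
  | h1 x =>
    cases x with
    | K => simp [Uq.comul_gen, Uq.comulHom, hK]
    | Kinv =>
      -- The case of K⁻¹ follows by applying the relation for K to K⁻¹ ▷ a and multiplying by ρ(K⁻¹)
      -- on both sides.
      have e1 : act (Uq.K q) (act (Uq.Kinv q) a) = a := by
        rw [← Module.End.mul_apply, ← map_mul, Uq.K_mul_Kinv, map_one, Module.End.one_apply]
      have e2 := hK (act (Uq.Kinv q) a)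
      rw [e1] at e2
      have e3 : ρ (Uq.Kinv q) * ρ (Uq.K q) = 1 := by rw [← map_mul, Uq.Kinv_mul_K, map_one]
      have e4 : ρ (Uq.K q) * ρ (Uq.Kinv q) = 1 := by rw [← map_mul, Uq.K_mul_Kinv, map_one]
      have e5 : ρ (Uq.Kinv q) * f a = f (act (Uq.Kinv q) a) * ρ (Uq.Kinv q) := by
        rw [← mul_one (f a), ← e4, ← mul_assoc (f a), ← e2, ← mul_assoc, ← mul_assoc, e3, one_mul]
      simp [Uq.comul_gen, Uq.comulHom, e5]
    | E => simp [Uq.comul_gen, Uq.comulHom, hE]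
    | F => simp [Uq.comul_gen, Uq.comulHom, hF]
  | hmul x y hx hy => exact smash_mul hx hy a
  | hadd x y hx hy => rw [map_add, add_mul, hx, hy, map_add, map_add]

theorem PodlesAlg.act_K (a : PodlesAlg q s) : act q s (Uq.K q) a = actK q s a := by
  simp [act]

theorem PodlesAlg.act_Kinv (a : PodlesAlg q s) : act q s (Uq.Kinv q) a = actKinv q s a := by
  simp [act]

theorem PodlesAlg.act_E (a : PodlesAlg q s) : act q s (Uq.E q) a = actE q s a := by
  simp [act]

theorem PodlesAlg.act_F (a : PodlesAlg q s) : act q s (Uq.F q) a = actF q s a := by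
  simp [act]

open PodlesAlg in
-- For fixed K, E or F the relation also passes to products in the coordinate algebra, by the
-- twisted Leibniz rules. So only pairs of generators remain.
theorem podles_smash {ρ : Uq q →ₐ[ℂ] R} {f : PodlesAlg q s →ₐ[ℂ] R}
    (hK : ∀ x, ρ (Uq.K q) * f (gen q s x) = f (actK q s (gen q s x)) * ρ (Uq.K q))
    (hE : ∀ x, ρ (Uq.E q) * f (gen q s x) =
      f (genE q s x) * ρ (Uq.K q) + f (actKinv q s (gen q s x)) * ρ (Uq.E q))
    (hF : ∀ x, ρ (Uq.F q) * f (gen q s x) =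
      f (genF q s x) * ρ (Uq.K q) + f (actKinv q s (gen q s x)) * ρ (Uq.F q))
    (h : Uq q) (a : PodlesAlg q s) :
    ρ h * f a = smashMap (act q s) ρ f a (Coalgebra.comul (R := ℂ) h) := by
  -- The case of K comes first: in the Leibniz step for E and F, a factor ρ(K) has to be moved past
  -- the second algebra element.
  have hK' : ∀ a, ρ (Uq.K q) * f a = f (actK q s a) * ρ (Uq.K q) := by
    intro a
    induction a using PodlesAlg.induction with
    | h0 c => simp [Algebra.commutes]
    | h1 x => exact hK x
    | hmul a b ha hb => rw [map_mul, ← mul_assoc, ha, mul_assoc, hb, map_mul, map_mul, mul_assoc]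
    | hadd a b ha hb => simp only [map_add, mul_add, add_mul, ha, hb]
  refine smash_of_gen ?_ ?_ ?_ h a
  · intro a
    rw [act_K, hK']
  · intro a
    rw [act_E, act_Kinv]
    induction a using PodlesAlg.induction with
    | h0 c => simp [Algebra.commutes, actE_algebraMap]
    | h1 x => rw [actE_gen, hE]
    | hmul a b ha hb =>
      rw [map_mul, ← mul_assoc, ha, add_mul, mul_assoc, hK', mul_assoc _ (ρ (Uq.E q)), hb, actE_mul]
      simp only [map_add, map_mul, add_mul, mul_add, mul_assoc]
      abel
    | hadd a b ha hb =>
      simp only [map_add, mul_add, add_mul, ha, hb]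
      abel
  · intro a
    rw [act_F, act_Kinv]
    induction a using PodlesAlg.induction with
    | h0 c => simp [Algebra.commutes, actF_algebraMap]
    | h1 x => rw [actF_gen, hF]
    | hmul a b ha hb =>
      rw [map_mul, ← mul_assoc, ha, add_mul, mul_assoc, hK', mul_assoc _ (ρ (Uq.F q)), hb, actF_mul]
      simp only [map_add, map_mul, add_mul, mul_add, mul_assoc]
      abel
    | hadd a b ha hb =>
      simp only [map_add, mul_add, add_mul, ha, hb]
      abel

open PodlesAlg in
-- The module algebra law is itself a crossed product relation, with `act` as the representation of
-- `U` and left multiplication as that of the algebra.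
theorem act_mul_smash (h : Uq q) (a : PodlesAlg q s) :
    act q s h * Algebra.lmul ℂ (PodlesAlg q s) a =
      smashMap (act q s) (act q s) (Algebra.lmul ℂ (PodlesAlg q s)) a
        (Coalgebra.comul (R := ℂ) h) := by
  refine smash_of_gen ?_ ?_ ?_ h a
  · intro a
    ext b
    simp [act_K]
  · intro a
    ext b
    simp [act_K, act_E, act_Kinv, actE_mul, add_comm]
  · intro a
    ext b
    simp [act_K, act_F, act_Kinv, actF_mul, add_comm]

open PodlesAlg in
theorem actK_star (a : PodlesAlg q s) : actK q s (star a) = star (actKinv q s a) := by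
  have hqc : starRingEnd ℂ (qC q) = qC q := Complex.conj_ofReal _
  induction a using PodlesAlg.induction with
  | h0 c => rw [← algebraMap_star_comm]; simp [← algebraMap_star_comm]
  | h1 x => cases x <;> simp [star_A, star_B, star_Bs, actK, actKinv, scale, hqc]
  | hmul a b ha hb => simp [ha, hb]
  | hadd a b ha hb => simp [ha, hb]

open PodlesAlg in
theorem actKinv_star (a : PodlesAlg q s) : actKinv q s (star a) = star (actK q s a) := by
  have h := actK_star (actK q s a)
  rw [actKinv_actK] at h
  rw [← h, actKinv_actK]

open PodlesAlg in
theorem actE_star (a : PodlesAlg q s) : actE q s (star a) = -qC q • star (actF q s a) := by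
  have hhc : starRingEnd ℂ (qh q) = qh q := Complex.conj_ofReal _
  have hsc : starRingEnd ℂ (s : ℂ) = s := Complex.conj_ofReal _
  have hq := qC_ne_zero q
  have h0 := qh_ne_zero q
  induction a using PodlesAlg.induction with
  | h0 c => rw [← algebraMap_star_comm]; simp [actE_algebraMap, actF_algebraMap]
  | h1 x =>
    cases x <;> simp [star_A, star_B, star_Bs, actE_gen, actF_gen, genE, genF, hhc, hsc,
      smul_smul, ← qh_sq]
    all_goals match_scalars <;> field_simp
  | hmul a b ha hb =>
    rw [star_mul, actE_mul, actF_mul, ha, hb, actK_star, actKinv_star, star_add, star_mul, star_mul]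
    simp only [smul_mul_assoc, mul_smul_comm, smul_add]
    abel
  | hadd a b ha hb => simp [ha, hb]

open PodlesAlg in
theorem actF_star (a : PodlesAlg q s) : actF q s (star a) = -(qC q)⁻¹ • star (actE q s a) := by
  have hqc : starRingEnd ℂ (qC q) = qC q := Complex.conj_ofReal _
  have h := actE_star (star a)
  have hq := qC_ne_zero q
  rw [star_star] at h
  rw [h, star_smul, star_star, smul_smul, Complex.star_def, map_neg, hqc, neg_mul_neg,
    inv_mul_cancel₀ hq, one_smul]

open PodlesAlg in
theorem isModuleStarAlgebra_act : IsModuleStarAlgebra (act q s) where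
  act_mul h a b := by
    have e := LinearMap.congr_fun (act_mul_smash h a) b
    refine e.trans ?_
    generalize Coalgebra.comul (R := ℂ) h = t
    induction t with
    | zero => simp
    | add t t' h h' => rw [map_add, LinearMap.add_apply, h, h', map_add, map_add]
    | tmul x y => rfl
  act_one h := by
    induction h using Uq.induction with
    | h0 c => simp [Algebra.algebraMap_eq_smul_one]
    | h1 x =>
      cases x <;> simp [act, Uq.counit_gen, Uq.counitHom, actE_one, actF_one]
    | hmul x y hx hy =>
      rw [map_mul, Module.End.mul_apply, hy, map_smul, hx, smul_smul, Bialgebra.counit_mul,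
        mul_comm]
    | hadd x y hx hy => rw [map_add, LinearMap.add_apply, hx, hy, map_add, add_smul]
  act_star h := by
    have hqc : starRingEnd ℂ (qC q) = qC q := Complex.conj_ofReal _
    induction h using Uq.induction with
    | h0 c =>
      intro a
      have e : HopfAlgebraStruct.antipode ℂ (algebraMap ℂ (Uq q) c) = algebraMap ℂ (Uq q) c :=
        Uq.antipodeLin_algebraMap q c
      rw [e, ← algebraMap_star_comm, AlgHom.commutes, AlgHom.commutes, Module.algebraMap_end_apply,
        Module.algebraMap_end_apply, star_smul, star_star]
    | h1 x =>
      intro a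
      rw [Uq.antipode_gen]
      cases x with
      | K => simp only [Uq.star_Kinv, act_K, act_Kinv, actK_star]
      | Kinv => simp only [Uq.star_K, act_K, act_Kinv, actKinv_star]
      | E =>
        simp only [star_smul, Uq.star_E, act_E, map_smul, LinearMap.smul_apply, act_F, actE_star,
          star_star]
      | F =>
        simp only [star_smul, Uq.star_F, act_F, map_smul, LinearMap.smul_apply, act_E, actF_star,
          star_star]
    | hmul x y hx hy =>
      intro a
      have e : HopfAlgebraStruct.antipode ℂ (x * y) =
          HopfAlgebraStruct.antipode ℂ y * HopfAlgebraStruct.antipode ℂ x :=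
        Uq.antipodeLin_mul q x y
      rw [e, star_mul, map_mul, map_mul, Module.End.mul_apply, Module.End.mul_apply, hy, hx]
    | hadd x y hx hy =>
      intro a
      rw [map_add, map_add, star_add, map_add, LinearMap.add_apply, LinearMap.add_apply, star_add,
        hx, hy]

end PodlesSmash

end

noncomputable section

/-! The crossed product representation on finite sums of basis vectors. -/

section Restrict
set_option linter.unusedSectionVars false

variable {H : Type*} [NormedAddCommGroup H] [InnerProductSpace ℂ H] [CompleteSpace H]
  {U A : Type*} [Ring U] [HopfAlgebra ℂ U] [StarRing U] [Ring A] [Algebra ℂ A] [StarRing A]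
  {M : Submodule ℂ H}

/-- The restriction of a representation to an invariant subspace. -/
def restrictRep (π : A →⋆ₐ[ℂ] (H →L[ℂ] H)) (hπ : ∀ (a : A) (v : M), π a v ∈ M) :
    A →ₐ[ℂ] Module.End ℂ M where
  toFun a := (π a).toLinearMap.restrict fun v hv => hπ a ⟨v, hv⟩
  map_one' := by ext v; simp
  map_mul' a b := by ext v; simp
  map_zero' := by ext v; simp
  map_add' a b := by ext v; simp
  commutes' c := by ext v; simp [Algebra.algebraMap_eq_smul_one]

variable {π : A →⋆ₐ[ℂ] (H →L[ℂ] H)} (hπ : ∀ (a : A) (v : M), π a v ∈ M)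

theorem coe_restrictRep_apply (a : A) (v : M) : (restrictRep π hπ a v : H) = π a v := rfl

theorem crossedMap_eq_smashMap (act : U →ₐ[ℂ] Module.End ℂ A) (ρ : U →ₐ[ℂ] Module.End ℂ M)
    (a : A) (v : M) (t : U ⊗[ℂ] U) :
    crossedMap act M ρ π a v t = (smashMap act ρ (restrictRep π hπ) a t v : H) := by
  induction t with
  | zero => simp
  | add t t' h h' => rw [map_add, map_add, LinearMap.add_apply, Submodule.coe_add, h, h']
  | tmul x y => rfl

/-- The endomorphisms `X` and `Y` of `M` are formally adjoint. -/
def FormallyAdjoint (X Y : Module.End ℂ M) : Prop :=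
  ∀ v w : M, inner ℂ (X v : H) (w : H) = inner ℂ (v : H) (Y w : H)

theorem formallyAdjoint_restrictRep (a : A) :
    FormallyAdjoint (restrictRep π hπ a) (restrictRep π hπ (star a)) := by
  intro v w
  rw [coe_restrictRep_apply, coe_restrictRep_apply, map_star,
    ContinuousLinearMap.star_eq_adjoint, ContinuousLinearMap.adjoint_inner_right]

namespace FormallyAdjoint

variable {X Y X' Y' : Module.End ℂ M}

theorem mul (h : FormallyAdjoint X Y) (h' : FormallyAdjoint X' Y') :
    FormallyAdjoint (X * X') (Y' * Y) := fun v w => by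
  rw [Module.End.mul_apply, Module.End.mul_apply, h, h']

theorem add (h : FormallyAdjoint X Y) (h' : FormallyAdjoint X' Y') :
    FormallyAdjoint (X + X') (Y + Y') := fun v w => by
  rw [LinearMap.add_apply, LinearMap.add_apply, Submodule.coe_add, Submodule.coe_add,
    inner_add_left, inner_add_right, h, h']

theorem smul {c : ℂ} (hc : starRingEnd ℂ c = c) (h : FormallyAdjoint X Y) :
    FormallyAdjoint (c • X) (c • Y) := fun v w => by
  rw [LinearMap.smul_apply, LinearMap.smul_apply, Submodule.coe_smul, Submodule.coe_smul,
    inner_smul_left, inner_smul_right, h, hc]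

/-- Positivity of the inner product makes the formal adjoint on M unique. Hence an operator relation
can be turned into its adjoint relation, although M is not complete. -/
theorem unique (h : FormallyAdjoint X Y) (h' : FormallyAdjoint X Y') : Y = Y' := by
  ext w
  have key : inner ℂ ((Y w - Y' w : M) : H) ((Y w - Y' w : M) : H) = 0 := by
    conv_lhs => rw [Submodule.coe_sub _ (Y w) (Y' w), inner_sub_right]
    rw [← Submodule.coe_sub, ← h, ← h', sub_self]
  have e := inner_self_eq_zero.1 key
  rwa [Submodule.coe_sub, sub_eq_zero] at e

end FormallyAdjoint

end Restrict

/-! ### The generators of both algebras on finite sums. -/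

section SpinorCrossed

variable {n : ℤ} {q : Set.Ioo (0 : ℝ) 1} {s : ℝ} {G : GeneratorShifts q s n}
  {π : PodlesAlg q s →⋆ₐ[ℂ] (Spinors n →L[ℂ] Spinors n)}

/-- Weighted shifts preserve the space of finite sums of basis vectors. -/
theorem IsShift.apply_mem_finiteSpinors {T : Spinors n →L[ℂ] Spinors n} {p r : ℤ} {η : ℤˣ}
    {f : ℤ → ℤ → ℤˣ → ℂ} (hT : IsShift T p r η f) {v : Spinors n} (hv : v ∈ finiteSpinors n) :
    T v ∈ finiteSpinors n :=
  mem_finiteSpinors_of_finKet (T.toLinearMap ∘ₗ (finiteSpinors n).subtype)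
    (fun a b ε h => by
      refine (hT.apply_ket ε h).symm ▸ ?_
      exact Submodule.smul_mem _ _ (ket_mem_finiteSpinors _ _ _)) ⟨v, hv⟩

theorem IsSpinorRep.apply_mem_finiteSpinors (hπ : IsSpinorRep q s n π) (hs : 0 ≤ s) (hn : n ≠ 0)
    (a : PodlesAlg q s) (v : finiteSpinors n) : π a v ∈ finiteSpinors n := by
  obtain ⟨G⟩ := nonempty_generatorShifts q.2.1 q.2.2 hs n
  refine hπ.induction G hn
    (p := fun S => ∀ v ∈ finiteSpinors n, S v ∈ finiteSpinors n) ?_ ?_ ?_ ?_ ?_ ?_ ?_ a v v.2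
  · exact fun v hv => hv
  · intro v hv
    exact add_mem (add_mem (G.isShift_Aup.apply_mem_finiteSpinors hv)
      (G.isShift_Adiag.apply_mem_finiteSpinors hv))
      ((G.isShift_star_Aup q.2.1).apply_mem_finiteSpinors hv)
  · intro v hv
    exact add_mem (add_mem (G.isShift_Bup.apply_mem_finiteSpinors hv)
      (G.isShift_Bmid.apply_mem_finiteSpinors hv)) (G.isShift_Bdown.apply_mem_finiteSpinors hv)
  · intro v hv
    rw [GeneratorShifts.opB, star_add, star_add]
    exact add_mem (add_mem ((G.isShift_star_Bup q.2.1).apply_mem_finiteSpinors hv)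
      (G.isShift_star_Bmid.apply_mem_finiteSpinors hv))
      (G.isShift_star_Bdown.apply_mem_finiteSpinors hv)
  · exact fun S T hS hT v hv => hS _ (hT v hv)
  · exact fun S T hS hT v hv => add_mem (hS v hv) (hT v hv)
  · exact fun c T hT v hv => Submodule.smul_mem _ c (hT v hv)

/-- All components of the generators are shifts with η = 1; they preserve ε and therefore commute
with the grading. -/
theorem IsSpinorRep.mul_grading (hπ : IsSpinorRep q s n π) (hs : 0 ≤ s) (hn : n ≠ 0)
    (a : PodlesAlg q s) : π a * grading n = grading n * π a := by
  obtain ⟨G⟩ := nonempty_generatorShifts q.2.1 q.2.2 hs n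
  have key : ∀ {T : Spinors n →L[ℂ] Spinors n} {p r : ℤ} {f : ℤ → ℤ → ℤˣ → ℂ},
      IsShift T p r 1 f → T * grading n = grading n * T := by
    intro T p r f hT
    ext1 x
    refine ext_coord fun a b ε _ => ?_
    have h1 := hT (grading n x) (a - p) (b - r) ε
    have h2 := hT x (a - p) (b - r) ε
    rw [sub_add_cancel, sub_add_cancel, mul_one] at h1 h2
    rw [mul_apply_eq_comp, mul_apply_eq_comp, h1, coord_grading, coord_grading, h2]
    ring
  refine hπ.induction G hn (p := fun S => S * grading n = grading n * S) ?_ ?_ ?_ ?_ ?_ ?_ ?_ a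
  · rw [one_mul, mul_one]
  · simp only [GeneratorShifts.opA, add_mul, mul_add, key G.isShift_Aup, key G.isShift_Adiag,
      key (G.isShift_star_Aup q.2.1)]
  · simp only [GeneratorShifts.opB, add_mul, mul_add, key G.isShift_Bup, key G.isShift_Bmid,
      key G.isShift_Bdown]
  · simp only [GeneratorShifts.opB, star_add, add_mul, mul_add, key (G.isShift_star_Bup q.2.1),
      key G.isShift_star_Bmid, key G.isShift_star_Bdown]
  · intro S T hS hT
    rw [mul_assoc, hT, ← mul_assoc, hS, mul_assoc]
  · intro S T hS hT
    rw [add_mul, mul_add, hS, hT]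
  · intro c T hT
    rw [smul_mul_assoc, mul_smul_comm, hT]

variable (hπ : IsSpinorRep q s n π) (hs : 0 ≤ s) (hn : n ≠ 0)

/-- The representation of the coordinate algebra on finite sums of basis vectors. -/
def IsSpinorRep.finRep : PodlesAlg q s →ₐ[ℂ] Module.End ℂ (finiteSpinors n) :=
  restrictRep π (hπ.apply_mem_finiteSpinors hs hn)

theorem IsSpinorRep.finRep_A {a b : ℤ} (ε : ℤˣ) (h : SpinorLabel n a b) :
    hπ.finRep hs hn (PodlesAlg.A q s) (finKet n a b ε) =
      (coeffAup q s n a b ε : ℂ) • finKet n (a + 2) b ε +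
      (coeffAdiag q s n a b ε : ℂ) • finKet n a b ε +
      (coeffAup q s n (a - 2) b ε : ℂ) • finKet n (a - 2) b ε := by
  obtain ⟨G⟩ := nonempty_generatorShifts q.2.1 q.2.2 hs n
  refine Subtype.ext ?_
  refine Eq.trans ?_ (G.opA_ket ε h)
  rw [← hπ.map_A G hn]
  rfl

theorem IsSpinorRep.finRep_B {a b : ℤ} (ε : ℤˣ) (h : SpinorLabel n a b) :
    hπ.finRep hs hn (PodlesAlg.B q s) (finKet n a b ε) =
      (coeffBup q s n a b ε : ℂ) • finKet n (a + 2) (b + 2) ε +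
      (coeffBmid q s n a b ε : ℂ) • finKet n a (b + 2) ε +
      (coeffBdown q s n a b ε : ℂ) • finKet n (a - 2) (b + 2) ε := by
  obtain ⟨G⟩ := nonempty_generatorShifts q.2.1 q.2.2 hs n
  refine Subtype.ext ?_
  refine Eq.trans ?_ (G.opB_ket ε h)
  rw [← hπ.map_B G hn]
  rfl

/-- The formulas for A and B are available only on admissible labels. When E leads out of the label
set its coefficient vanishes and the substitution is harmless. -/
theorem ladderCoeff_smul_congr_up {a b : ℤ} (h : SpinorLabel n a b) {x y : finiteSpinors n}
    (hxy : SpinorLabel n a (b + 2) → x = y) :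
    (ladderCoeff q a b : ℂ) • x = (ladderCoeff q a b : ℂ) • y := by
  by_cases hb : b = a
  · rw [hb, ladderCoeff_self, Complex.ofReal_zero, zero_smul, zero_smul]
  · rw [hxy (h.up hb)]

theorem ladderCoeff_smul_congr_down {a b : ℤ} (h : SpinorLabel n a b) {x y : finiteSpinors n}
    (hxy : SpinorLabel n a (b - 2) → x = y) :
    (ladderCoeff q a (-b) : ℂ) • x = (ladderCoeff q a (-b) : ℂ) • y := by
  by_cases hb : b = -a
  · rw [hb, neg_neg, ladderCoeff_self, Complex.ofReal_zero, zero_smul, zero_smul]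
  · rw [hxy (h.down hb)]

theorem inv_qh_mul_sqrt_zpow (b : ℤ) :
    (PodlesAlg.qh q)⁻¹ * ((√(q : ℝ) ^ b : ℝ) : ℂ) = ((√(q : ℝ) ^ (b - 1) : ℝ) : ℂ) := by
  rw [PodlesAlg.qh, zpow_sub_one₀ (Real.sqrt_pos.2 q.2.1).ne', mul_comm]
  push_cast
  rfl

theorem IsSpinorRep.spinorAction_E_mul_A :
    spinorAction q n (Uq.E q) * hπ.finRep hs hn (PodlesAlg.A q s) =
      -(PodlesAlg.qh q)⁻¹ • (hπ.finRep hs hn (PodlesAlg.B q s) * spinorAction q n (Uq.K q)) +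
        hπ.finRep hs hn (PodlesAlg.A q s) * spinorAction q n (Uq.E q) := by
  refine finKet_ext fun a b ε h => ?_
  have h1 := ladder_E_A_up (s := s) (ε := ε) q.2.1 q.2.2 h
  have h2 := ladder_E_A_mid (s := s) (ε := ε) q.2.1 q.2.2 h
  have h3 := ladder_E_A_down (s := s) (ε := ε) q.2.1 q.2.2 h
  simp only [add_zero, ← sub_eq_add_neg] at h1 h2 h3
  apply_fun ((↑) : ℝ → ℂ) at h1 h2 h3
  rw [LinearMap.add_apply, LinearMap.smul_apply, Module.End.mul_apply, Module.End.mul_apply,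
    Module.End.mul_apply, hπ.finRep_A hs hn ε h, spinorAction_K, spinorAction_E, map_smul,
    map_smul, ladderCoeff_smul_congr_up h fun h' => hπ.finRep_A hs hn ε h',
    hπ.finRep_B hs hn ε h, smul_smul, neg_mul, inv_qh_mul_sqrt_zpow]
  simp only [map_add, map_smul, spinorAction_E, Complex.ofReal_mul, Complex.ofReal_sub,
    Complex.ofReal_neg] at h1 h2 h3 ⊢
  linear_combination (norm := module) h1 • finKet n (a + 2) (b + 2) ε + h2 • finKet n a (b + 2) ε +
    h3 • finKet n (a - 2) (b + 2) ε

theorem IsSpinorRep.spinorAction_E_mul_B :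
    qC q • (spinorAction q n (Uq.E q) * hπ.finRep hs hn (PodlesAlg.B q s)) =
      hπ.finRep hs hn (PodlesAlg.B q s) * spinorAction q n (Uq.E q) := by
  refine finKet_ext fun a b ε h => ?_
  have h1 := ladder_E_B_up (s := s) (ε := ε) q.2.1 q.2.2 h
  have h2 := ladder_E_B_mid (s := s) (ε := ε) q.2.1 q.2.2 h
  have h3 := ladder_E_B_down (s := s) (ε := ε) q.2.1 q.2.2 h
  simp only [add_zero, ← sub_eq_add_neg] at h1 h2 h3
  apply_fun ((↑) : ℝ → ℂ) at h1 h2 h3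
  rw [LinearMap.smul_apply, Module.End.mul_apply, Module.End.mul_apply,
    hπ.finRep_B hs hn ε h, spinorAction_E, map_smul,
    ladderCoeff_smul_congr_up h fun h' => hπ.finRep_B hs hn ε h', qC]
  simp only [map_add, map_smul, spinorAction_E, Complex.ofReal_mul] at h1 h2 h3 ⊢
  linear_combination (norm := module) h1 • finKet n (a + 2) (b + 2 + 2) ε +
    h2 • finKet n a (b + 2 + 2) ε + h3 • finKet n (a - 2) (b + 2 + 2) ε

theorem IsSpinorRep.spinorAction_F_mul_B :
    qC q • (spinorAction q n (Uq.F q) * hπ.finRep hs hn (PodlesAlg.B q s)) =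
      -(qC q * (PodlesAlg.qh q)⁻¹) • ((1 + qC q ^ 2) •
          (hπ.finRep hs hn (PodlesAlg.A q s) * spinorAction q n (Uq.K q)) +
        -(1 - (s : ℂ) ^ 2) • spinorAction q n (Uq.K q)) +
      hπ.finRep hs hn (PodlesAlg.B q s) * spinorAction q n (Uq.F q) := by
  refine finKet_ext fun a b ε h => ?_
  have h1 := ladder_F_B_up (s := s) (ε := ε) q.2.1 q.2.2 h
  have h2 := ladder_F_B_mid (s := s) (ε := ε) q.2.1 q.2.2 h
  have h3 := ladder_F_B_down (s := s) (ε := ε) q.2.1 q.2.2 h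
  have hg := inv_qh_mul_sqrt_zpow (q := q) b
  have e1 : b - 2 + 2 = b := by ring
  have e2 : b + 2 - 2 = b := by ring
  have e3 : ladderCoeff q a (-b) = ladderCoeff q a (b - 2) := by
    rw [← ladderCoeff_symm q a (b - 2), e1]
  simp only [add_zero, ← sub_eq_add_neg] at h1 h2 h3
  apply_fun ((↑) : ℝ → ℂ) at h1 h2 h3
  simp only [LinearMap.add_apply, LinearMap.smul_apply, Module.End.mul_apply]
  rw [hπ.finRep_B hs hn ε h, spinorAction_F, map_smul,
    ladderCoeff_smul_congr_down h fun h' => hπ.finRep_B hs hn ε h', e3, spinorAction_K, map_smul,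
    hπ.finRep_A hs hn ε h, e1]
  simp only [map_add, map_smul, spinorAction_F, ladderCoeff_symm, e2, Complex.ofReal_mul,
    Complex.ofReal_sub, Complex.ofReal_add, Complex.ofReal_pow, Complex.ofReal_one,
    Complex.ofReal_neg, ← hg] at h1 h2 h3 ⊢
  rw [qC]
  linear_combination (norm := module) h1 • finKet n (a + 2) b ε + h2 • finKet n a b ε +
    h3 • finKet n (a - 2) b ε

theorem IsSpinorRep.spinorAction_K_mul_A :
    spinorAction q n (Uq.K q) * hπ.finRep hs hn (PodlesAlg.A q s) =
      hπ.finRep hs hn (PodlesAlg.A q s) * spinorAction q n (Uq.K q) := by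
  refine finKet_ext fun a b ε h => ?_
  rw [Module.End.mul_apply, Module.End.mul_apply, spinorAction_K, map_smul,
    hπ.finRep_A hs hn ε h]
  simp only [map_add, map_smul, spinorAction_K]
  module

theorem IsSpinorRep.spinorAction_K_mul_B :
    spinorAction q n (Uq.K q) * hπ.finRep hs hn (PodlesAlg.B q s) =
      qC q • (hπ.finRep hs hn (PodlesAlg.B q s) * spinorAction q n (Uq.K q)) := by
  refine finKet_ext fun a b ε h => ?_
  have e : √(q : ℝ) ^ (b + 2) = q * √(q : ℝ) ^ b := by
    rw [sqrt_zpow_add q.2.1 b 0 1 2 (by norm_num), pow_one, add_zero]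
  rw [LinearMap.smul_apply, Module.End.mul_apply, Module.End.mul_apply, spinorAction_K, map_smul,
    hπ.finRep_B hs hn ε h, qC]
  simp only [map_add, map_smul, spinorAction_K, e, Complex.ofReal_mul]
  module

theorem formallyAdjoint_spinorAction (h : Uq q) :
    FormallyAdjoint (spinorAction q n h) (spinorAction q n (star h)) :=
  fun v w => inner_spinorAction h v w

/-- The representations of the coordinate algebra and of `U_q(su(2))` on finite sums of basis
vectors form a representation of the crossed product. -/
theorem IsSpinorRep.spinorAction_mul_finRep (h : Uq q) (a : PodlesAlg q s) :
    spinorAction q n h * hπ.finRep hs hn a =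
      smashMap (PodlesAlg.act q s) (spinorAction q n) (hπ.finRep hs hn) a
        (Coalgebra.comul (R := ℂ) h) := by
  have hqc : starRingEnd ℂ (qC q) = qC q := Complex.conj_ofReal _
  have hhc : starRingEnd ℂ (PodlesAlg.qh q) = PodlesAlg.qh q := Complex.conj_ofReal _
  have hsc : starRingEnd ℂ (s : ℂ) = s := Complex.conj_ofReal _
  have hq := qC_ne_zero q
  have h0 := PodlesAlg.qh_ne_zero q
  have hA := formallyAdjoint_restrictRep (hπ.apply_mem_finiteSpinors hs hn) (PodlesAlg.A q s)
  have hB := formallyAdjoint_restrictRep (hπ.apply_mem_finiteSpinors hs hn) (PodlesAlg.B q s)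
  have hK := formallyAdjoint_spinorAction (n := n) (Uq.K q)
  have hE := formallyAdjoint_spinorAction (n := n) (Uq.E q)
  have hF := formallyAdjoint_spinorAction (n := n) (Uq.F q)
  rw [PodlesAlg.star_A] at hA
  rw [PodlesAlg.star_B] at hB
  rw [Uq.star_K] at hK
  rw [Uq.star_E] at hE
  rw [Uq.star_F] at hF
  have eKA := hπ.spinorAction_K_mul_A hs hn
  have eKB := hπ.spinorAction_K_mul_B hs hn
  have eEA := hπ.spinorAction_E_mul_A hs hn
  have eEB := hπ.spinorAction_E_mul_B hs hn
  have eFB := hπ.spinorAction_F_mul_B hs hn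
  -- Adjoints of the verified relations: KB gives K with B^*, EB gives F with B^*, EA gives F with
  -- A, and FB gives E with B^*. All scalars involved are real.
  have eKBs := (hK.mul hB).unique (eKB ▸ (hB.mul hK).smul hqc)
  have eFBs := ((hE.mul hB).smul hqc).unique (eEB ▸ hB.mul hE)
  have eFA := (hE.mul hA).unique (eEA ▸ (((hB.mul hK).smul
    (c := -(PodlesAlg.qh q)⁻¹) (by simp [hhc])).add (hA.mul hE)))
  have eEBs := ((hF.mul hB).smul hqc).unique (eFB ▸ (((((hA.mul hK).smul
    (c := 1 + qC q ^ 2) (by simp [hqc])).add (hK.smul (c := -(1 - (s : ℂ) ^ 2))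
    (by simp [hsc]))).smul (c := -(qC q * (PodlesAlg.qh q)⁻¹)) (by simp [hhc, hqc])).add
    (hB.mul hF)))
  change hπ.finRep hs hn (PodlesAlg.Bs q s) * _ =
    _ • (_ * hπ.finRep hs hn (PodlesAlg.Bs q s)) at eKBs
  change _ • (hπ.finRep hs hn (PodlesAlg.Bs q s) * _) =
    _ * hπ.finRep hs hn (PodlesAlg.Bs q s) at eFBs
  change hπ.finRep hs hn (PodlesAlg.A q s) * _ =
    _ • (_ * hπ.finRep hs hn (PodlesAlg.Bs q s)) + _ * hπ.finRep hs hn (PodlesAlg.A q s) at eFA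
  change _ • (hπ.finRep hs hn (PodlesAlg.Bs q s) * _) =
    _ • (_ • (_ * hπ.finRep hs hn (PodlesAlg.A q s)) + _) +
      _ * hπ.finRep hs hn (PodlesAlg.Bs q s) at eEBs
  refine podles_smash ?_ ?_ ?_ h a
  · intro x
    cases x with
    | A => simpa [PodlesAlg.actK, PodlesAlg.scale] using eKA
    | B => simpa [PodlesAlg.actK, PodlesAlg.scale] using eKB
    | Bs => simp [PodlesAlg.actK, PodlesAlg.scale, eKBs, smul_smul, hq]
  · intro x
    cases x with
    | A =>
      simp only [PodlesAlg.actKinv, PodlesAlg.scale, PodlesAlg.genE, PodlesAlg.lift_gen, map_smul,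
        smul_mul_assoc, eEA]
    | B => simp [PodlesAlg.actKinv, PodlesAlg.scale, PodlesAlg.genE, ← eEB, smul_smul, hq]
    | Bs =>
      have e : PodlesAlg.qh q = qC q * (PodlesAlg.qh q)⁻¹ := by
        rw [← PodlesAlg.qh_sq]
        field_simp
      rw [eKA, ← e] at eEBs
      simp only [PodlesAlg.actKinv, PodlesAlg.scale, PodlesAlg.genE, PodlesAlg.lift_gen, inv_inv,
        map_sub, map_smul, map_one, sub_mul, smul_mul_assoc, one_mul, eEBs]
      module
  · intro x
    cases x with
    | A =>
      have e : ((PodlesAlg.qh q) ^ 3)⁻¹ * qC q = (PodlesAlg.qh q)⁻¹ := by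
        rw [← PodlesAlg.qh_sq]
        field_simp
      simp only [PodlesAlg.actKinv, PodlesAlg.scale, PodlesAlg.genF, PodlesAlg.lift_gen,
        map_smul, smul_mul_assoc, eFA, eKBs, smul_smul, e]
      module
    | B =>
      refine smul_right_injective _ hq ?_
      simp only [PodlesAlg.actKinv, PodlesAlg.scale, PodlesAlg.genF, PodlesAlg.lift_gen, eFB,
        map_add, map_smul, map_one, add_mul, smul_mul_assoc, one_mul, smul_add, smul_smul,
        mul_inv_cancel₀ hq, one_smul]
      module
    | Bs => simp [PodlesAlg.actKinv, PodlesAlg.scale, PodlesAlg.genF, ← eFBs]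

end SpinorCrossed

end

noncomputable section

/-! The equivariant spectral triple and its weak real structure. -/

section MainResults

variable {n : ℤ} {q : Set.Ioo (0 : ℝ) 1} {s : ℝ}
  {π : PodlesAlg q s →⋆ₐ[ℂ] (Spinors n →L[ℂ] Spinors n)}

theorem IsSpinorRep.isEvenEquivariantSpectralTriple (hπ : IsSpinorRep q s n π) (hs : 0 ≤ s)
    (hn : n ≠ 0) : IsEvenEquivariantSpectralTriple (PodlesAlg.act q s) (finiteSpinors n)
      (spinorAction q n) π (dirac n) (grading n) where
  moduleStarAlgebra := isModuleStarAlgebra_act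
  dense := dense_finiteSpinors n
  star_rep := inner_spinorAction
  invariant := hπ.apply_mem_finiteSpinors hs hn
  crossed h a v := by
    rw [crossedMap_eq_smashMap (hπ.apply_mem_finiteSpinors hs hn)]
    exact congrArg Subtype.val
      (LinearMap.congr_fun (hπ.spinorAction_mul_finRep hs hn h a) v)
  selfAdjoint := isSelfAdjoint_dirac n
  compactResolvent := hasCompactResolvent_dirac n
  le_domain := finiteSpinors_le_dirac_domain
  commutator a := (hπ.exists_commutator_commutesModRapid hs hn a).2.imp fun _ h => h.1
  D_invariant := dirac_mem_finiteSpinors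
  D_equivariant h v := congrArg Subtype.val (LinearMap.congr_fun (commute_finDirac h) v)
  γ_selfAdjoint := isSelfAdjoint_grading n
  γ_sq := grading_mul_grading n
  γ_odd := grading_dirac
  γ_even := hπ.mul_grading hs hn
  γ_invariant := grading_mem_finiteSpinors
  γ_equivariant h v :=
    (congrArg Subtype.val (LinearMap.congr_fun (commute_finGrading h) v)).symm

theorem IsSpinorRep.commutator_mem_OPNegInfty (hπ : IsSpinorRep q s n π) (hs : 0 ≤ s)
    (hn : n ≠ 0) (a b : PodlesAlg q s) :
    π a * conjBy (realStructure n) (π b) - conjBy (realStructure n) (π b) * π a ∈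
      OPNegInfty (absDirac n) :=
  rapidSpan_subset_OPNegInfty ((hπ.exists_commutator_commutesModRapid hs hn a).1 b)

theorem IsSpinorRep.exists_commutator_dirac (hπ : IsSpinorRep q s n π) (hs : 0 ≤ s)
    (hn : n ≠ 0) (a : PodlesAlg q s) :
    ∃ C : Spinors n →L[ℂ] Spinors n, IsCommutator (dirac n) (π a) C ∧ ∀ b : PodlesAlg q s,
      C * conjBy (realStructure n) (π b) - conjBy (realStructure n) (π b) * C ∈
        OPNegInfty (absDirac n) :=
  (hπ.exists_commutator_commutesModRapid hs hn a).2.imp fun _ h =>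
    ⟨h.1, fun b => rapidSpan_subset_OPNegInfty (h.2 b)⟩

theorem IsSpinorRep.isWeakEquivariantRealStructure (hπ : IsSpinorRep q s n π) (hs : 0 ≤ s)
    (hn : n ≠ 0) {k : ZMod 8} (hk : KOSigns k ((-1 : ℂ) ^ n) 1 (-1)) :
    IsWeakEquivariantRealStructure (finiteSpinors n) (spinorAction q n) π
      (dirac n) (absDirac n) (grading n) (realStructure n) k where
  modulus := isModulusOf_absDirac_dirac n
  signs := ⟨_, _, _, hk, realStructure_realStructure,
    fun x => (realStructure_dirac x).imp fun _ h => by rw [h, one_smul],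
    fun x => by rw [realStructure_grading, neg_one_smul]⟩
  commutant := hπ.commutator_mem_OPNegInfty hs hn
  firstOrder := hπ.exists_commutator_dirac hs hn
  equivariant := ⟨modularT q n, isEquivariantAntilinear_modularT, isAntiunitaryPart_modularT⟩

end MainResults

end

theorem mainTheorem4 (q : Set.Ioo (0 : ℝ) 1) (s : ℝ) (hs : s ∈ Set.Icc (0 : ℝ) 1)
    (n : ℤ) (hn : n ≠ 0) :
    (∃! π : PodlesAlg q s →⋆ₐ[ℂ] (Spinors n →L[ℂ] Spinors n), IsSpinorRep q s n π) ∧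
    ∀ π : PodlesAlg q s →⋆ₐ[ℂ] (Spinors n →L[ℂ] Spinors n), IsSpinorRep q s n π →
      IsEvenEquivariantSpectralTriple (PodlesAlg.act q s) (finiteSpinors n) (spinorAction q n) π
        (dirac n) (grading n) ∧
      IsModulusOf (absDirac n) (dirac n) ∧
      (∃ T : finiteSpinors n →ₗ⋆[ℂ] finiteSpinors n,
        (∀ (a b : ℤ) (ε : ℤˣ) (v : finiteSpinors n), SpinorLabel n a b →
          (v : Spinors n) = ket n a b ε →
          (T v : Spinors n) = (-qC q) ^ ((b + n) / 2) • ket n a (-b) (-ε)) ∧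
        IsEquivariantAntilinear (finiteSpinors n) (spinorAction q n) T ∧
        IsAntiunitaryPart (finiteSpinors n) T (realStructure n)) ∧
      (∀ v : Spinors n, realStructure n (realStructure n v) = (-1 : ℂ) ^ n • v) ∧
      (∀ v : Spinors n, realStructure n (grading n v) = -grading n (realStructure n v)) ∧
      (∀ x : Spinors n, realStructure n x ∈ (dirac n).domain ↔ x ∈ (dirac n).domain) ∧
      (∀ (x : Spinors n) (hx : x ∈ (dirac n).domain) (hJx : realStructure n x ∈ (dirac n).domain),
        realStructure n (dirac n ⟨x, hx⟩) = dirac n ⟨realStructure n x, hJx⟩) ∧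
      (∀ a b : PodlesAlg q s,
        π a * conjBy (realStructure n) (π (star b)) - conjBy (realStructure n) (π (star b)) * π a ∈
          OPNegInfty (absDirac n)) ∧
      (∀ a : PodlesAlg q s, ∃ C : Spinors n →L[ℂ] Spinors n, IsCommutator (dirac n) (π a) C ∧
        ∀ b : PodlesAlg q s,
          C * conjBy (realStructure n) (π (star b)) - conjBy (realStructure n) (π (star b)) * C ∈
            OPNegInfty (absDirac n)) ∧
      (Odd n → IsWeakEquivariantRealStructure (finiteSpinors n) (spinorAction q n) π
        (dirac n) (absDirac n) (grading n) (realStructure n) 2) ∧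
      (Even n → IsWeakEquivariantRealStructure (finiteSpinors n) (spinorAction q n) π
        (dirac n) (absDirac n) (grading n) (realStructure n) 6) := by
  refine ⟨existsUnique_isSpinorRep q hs.1 hn, fun π hπ =>
    ⟨hπ.isEvenEquivariantSpectralTriple hs.1 hn, isModulusOf_absDirac_dirac n,
      ⟨modularT q n, fun a b ε v _ hv => ?_, isEquivariantAntilinear_modularT,
        isAntiunitaryPart_modularT⟩, realStructure_realStructure, realStructure_grading,
      realStructure_mem_dirac_domain_iff, fun x hx hJx => (realStructure_dirac ⟨x, hx⟩).2,
      fun a b => hπ.commutator_mem_OPNegInfty hs.1 hn a (star b),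
      fun a => (hπ.exists_commutator_dirac hs.1 hn a).imp fun _ h => ⟨h.1, fun b => h.2 (star b)⟩,
      fun h => hπ.isWeakEquivariantRealStructure hs.1 hn ?_,
      fun h => hπ.isWeakEquivariantRealStructure hs.1 hn ?_⟩⟩
  · have e : v = finKet n a b ε := Subtype.ext hv
    rw [e, modularT_finKet]
    rfl
  · rw [h.neg_one_zpow]
    exact Or.inr (Or.inl ⟨rfl, rfl, rfl, rfl⟩)
  · rw [h.neg_one_zpow]
    exact Or.inr (Or.inr (Or.inr ⟨rfl, rfl, rfl, rfl⟩))
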